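/- Let $k$ be a field of characteristic $p>0$ and let $\Lambda=k[x]/x^2$. Let $\mathrm{K^b_p}\Lambda$ be the homotopy category of bounded complexes of finitely generated projective $\Lambda$-modules, and let $\mathrm A=\mathrm{K^b_p}\Lambda/[1]$ be its orbit category: it has the same objects, $\mathrm A(X,Y)_n=\mathrm{Hom}(X,Y[n])$, and $g\circ f=g[n]f$ for $f$ of degree $n$. Let $Z^*$ be its graded center, i.e. $Z^n$ is the space of families $(\eta_X\in \mathrm A(X,X)_n)_X$ with $f\eta_X=(-1)^{nj}\eta_Yf$ for all $f\in\mathrm A(X,Y)_j$. Let $\mathrm A_{\mathrm A}=\bigoplus_X\mathrm A(X,X)/[\mathrm A,\mathrm A]$ be its graded abelianization, where $[\mathrm A,\mathrm A]$ is spanned by the elements $gf-(-1)^{ij}fg$ with $f\in\mathrm A(X,Y)_i$, $g\in \mathrm A(Y,X)_j$. Let $T_r\subseteq\mathrm A_{\mathrm A}$ be the (graded) kernel of the $r$-th iterate of the map induced on homogeneous elements by $\sum_X f_X\mapsto\sum_X f_X^p$. For $r\ge 0$, $s\in\mathbb Z$ let $K_{r,s}$ be the graded ideal of $Z^*$ whose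 degree $t$ part consists of the elements of $Z^t$ annihilating (on both sides) the degree $s-t$ part of $T_r$, and put $K_r=\bigcap_{s\in\mathbb Z} K_{r,s}$, $R_s=\bigcap_{r\ge0}K_{r,s}$, $R=\bigcap_{r\ge 0}K_r$. Let $\mathrm{HH}^n(\Lambda)=\mathrm{Hom}(\Lambda,\Lambda[n])$, $n\ge 0$ (morphisms in the derived category of $\Lambda$-bimodules), let $\chi:\mathrm{HH}^*(\Lambda)\to Z^*$, $\chi(f)_X=\mathrm{Id}_X\otimes^L_\Lambda f$, be the characteristic homomorphism, and put $\mathrm{HK}_{r,s}=\chi^{-1}(K_{r,s})$, $\mathrm{HK}_r=\chi^{-1}(K_r)$, $\mathrm{HR}_s=\chi^{-1}(R_s)$, $\mathrm{HR}=\chi^{-1}(R)$. For $m\le n$ let $\Lambda^{[m,n]}$ be the complex with $\Lambda$ in the degrees $m,\dots,n$, zero in all other degrees, and all differentials between the degrees $m,\dots,n$ equal to multiplication by $x$; let $x_n:\Lambda^{[m,n]}\to\Lambda^{[m,n]}$ be multiplication by $x$ in degree $n$ and zero in all other degrees. Let $\tilde Z^0\subseteq Z^0$ be the subspace of all $\eta$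 such that $\eta_{\Lambda^{[m,n]}}$ is a scalar multiple of the class of $x_n$ for all $m\le n$. Let $\langle x\rangle$ be the line $kx$ in $\mathrm{HH}^0(\Lambda)=\Lambda$. Then for every $r>0$ the following holds. (1) If $\mathrm{char}\,k\ne2$, then $$(K_{r,s})_t=\begin{cases}0,& t<0,\ s\in\mathbb Z,\\ Z^t,& s>0,\ t\ge0,\\ Z^t,& s-t\text{ odd},\ s\le0,\ t\ge0,\\ \tilde Z^0,& s-t\text{ even},\ s\le0,\ t=0,\\ 0,& s-t\text{ even},\ s\le 0,\ t>0.\end{cases}$$ If $\mathrm{char}\,k=2$, then $$(K_{r,s})_t=\begin{cases}0,& t<0,\ s\in\mathbb Z,\\ Z^t,& s>0,\ t\ge0,\\ \tilde Z^0,& s\le0,\ t=0,\\ 0,& s\le 0,\ t>0.\end{cases}$$ (2) In every characteristic $p>0$, $R=K_r=\tilde Z^0$ (concentrated in degree $0$), and $R_s=K_{r,s}$ for all $s\in\mathbb Z$. (3) If $\mathrm{char}\,k\ne2$, then $\mathrm{HK}_{r,s}=\langle x\rangle\oplus\bigoplus_{l\ge0}\mathrm{HH}^{2l+1}(\Lambda)$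 if $s\le0$ is even, and $\mathrm{HK}_{r,s}=\mathrm{HH}^*(\Lambda)$ if $s\le 0$ is odd or $s>0$. Moreover, $\mathrm{HK}_r=\langle x\rangle\oplus\bigoplus_{l\ge0}\mathrm{HH}^{2l+1}(\Lambda)$. (4) If $\mathrm{char}\,k=2$, then for $s\le 0$ the ideal $\mathrm{HK}_{r,s}$ is the ideal generated by $x\in\mathrm{HH}^0(\Lambda)$, namely $\bigoplus_{t\ge0}x\cdot\mathrm{HH}^t(\Lambda)$, and $\mathrm{HK}_{r,s}=\mathrm{HH}^*(\Lambda)$ for $s>0$. Moreover, $\mathrm{HK}_r$ is the ideal generated by $x\in\mathrm{HH}^0(\Lambda)$, namely $\bigoplus_{t\ge0}x\cdot\mathrm{HH}^t(\Lambda)$. (5) In every characteristic $p>0$, $\mathrm{HR}=\mathrm{HK}_r$, and $\mathrm{HR}_s=\mathrm{HK}_{r,s}$ for all $s\in\mathbb Z$. -/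

import Mathlib

open CategoryTheory
open scoped TensorProduct

universe u

noncomputable section

namespace KulshammerIdeals

/-! ### Graded center, graded abelianization and Külshammer ideals of an orbit category

Let `C` be a category with a shift by `ℤ` and `obj : ι → C` a family of objects.  The orbit category
`A/Σ` of the full subcategory `A` on this family has the elements of `ι` as objects,
`ShiftedHom (obj x) (obj y) n = Hom (obj x, (obj y)⟦n⟧)` as the degree `n` part of the morphisms from
`x` to `y`, and `ShiftedHom.comp` as composition: `f.comp g` is `g ∘ f = Σⁿ(g) f`, for `f` of degree
`n`.  All graded spaces are given by the families of their homogeneous components.  As morphism spaces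
are closed under scalars, subspaces spanned by (or defined through) all morphisms are the same as the
corresponding additive subgroups, and we speak of the latter. -/

section Orbit

variable {C : Type*} [Category C] [Preadditive C] [HasShift C ℤ]

/-- The `m`-th power `f ∘ ⋯ ∘ f` of an endomorphism of degree `n` in the orbit category. -/
def shiftedPow {X : C} {n : ℤ} (f : ShiftedHom X X n) : (m : ℕ) → ShiftedHom X X (m * n)
  | 0 => ShiftedHom.mk₀ _ (by simp) (𝟙 X)
  | m + 1 => f.comp (shiftedPow f m) (by push_cast; ring)

lemma shiftedPow_zero {X : C} {n : ℤ} (m : ℕ) [NeZero m] :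
    shiftedPow (0 : ShiftedHom X X n) m = 0 := by
  cases m with
  | zero => exact absurd rfl (NeZero.ne 0)
  | succ m => rw [shiftedPow, ShiftedHom.zero_comp]

variable [∀ n : ℤ, (shiftFunctor C n).Additive] {ι : Type*} (obj : ι → C)

/-- The `n`-th component of the center of `A/Σ`: families `(η_x)` of degree `n` endomorphisms with
`f η_x = (-1)^{nj} η_y f` for every `f : x ⟶ y` of degree `j`. -/
def gradedCenter (n : ℤ) : AddSubgroup (∀ x, ShiftedHom (obj x) (obj x) n) where
  carrier := {η | ∀ (x y : ι) (j : ℤ) (f : ShiftedHom (obj x) (obj y) j),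
    (η x).comp f (add_comm j n) = (n * j).negOnePow • f.comp (η y) rfl}
  zero_mem' := fun x y j f => by
    simp only [Pi.zero_apply, ShiftedHom.zero_comp, ShiftedHom.comp_zero, smul_zero]
  add_mem' := fun {a b} ha hb x y j f => by
    simp only [Pi.add_apply, ShiftedHom.add_comp, ShiftedHom.comp_add, smul_add, ha x y j f,
      hb x y j f]
  neg_mem' := fun {a} ha x y j f => by
    simp only [Pi.neg_apply, ShiftedHom.neg_comp, ShiftedHom.comp_neg, smul_neg, ha x y j f]

/-- The degree `n` part of `⊕_x (A/Σ)(x, x)`. -/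
abbrev EndSum (n : ℤ) : Type _ := Π₀ x, ShiftedHom (obj x) (obj x) n

open Classical in
/-- The degree `n` part of `[A/Σ, A/Σ]`, spanned by the elements `g f - (-1)^{ij} f g` for
`f : x ⟶ y` of degree `i` and `g : y ⟶ x` of degree `j`, `i + j = n`.  The degree `n` part of
the graded abelianization of `A/Σ` is the quotient of `EndSum obj n` by this subgroup. -/
def commutators (n : ℤ) : AddSubgroup (EndSum obj n) :=
  AddSubgroup.closure {w | ∃ (x y : ι) (i j : ℤ) (hij : i + j = n)
    (f : ShiftedHom (obj x) (obj y) i) (g : ShiftedHom (obj y) (obj x) j),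
    w = DFinsupp.single x (f.comp g ((add_comm j i).trans hij)) -
      (i * j).negOnePow • DFinsupp.single y (g.comp f hij)}

/-- The map `∑ f_x ↦ ∑ f_x ^ m` on the degree `n` part of `⊕_x (A/Σ)(x, x)`.  For `m = p ^ r` it is
the `r`-th iterate of `∑ f_x ↦ ∑ f_x ^ p`. -/
def powMap (n : ℤ) (m : ℕ) [NeZero m] (w : EndSum obj n) : EndSum obj (m * n) :=
  w.mapRange (fun _ f => shiftedPow f m) (fun _ => shiftedPow_zero m)

/-- The product `η w` of `η` of degree `n` with `w` of degree `s - n`. -/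
def leftAct (s n : ℤ) (η : ∀ x, ShiftedHom (obj x) (obj x) n) (w : EndSum obj (s - n)) :
    EndSum obj s :=
  w.mapRange (fun x f => f.comp (η x) (by ring)) (fun _ => ShiftedHom.zero_comp _ _ _ _)

/-- The product `w η` of `w` of degree `s - n` with `η` of degree `n`. -/
def rightAct (s n : ℤ) (η : ∀ x, ShiftedHom (obj x) (obj x) n) (w : EndSum obj (s - n)) :
    EndSum obj s :=
  w.mapRange (fun x f => (η x).comp f (by ring)) (fun _ => ShiftedHom.comp_zero _ _ _)

variable (p : ℕ) [NeZero p]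

/-- `w` represents an element of `T_r`, the kernel of the `r`-th iterate of the `p`-th power map
on the graded abelianization. -/
def IsInT (r : ℕ) {n : ℤ} (w : EndSum obj n) : Prop :=
  powMap obj n (p ^ r) w ∈ commutators obj _

/-- The degree `n` part of the Külshammer ideal `K_{r,s}`: the elements of degree `n` of the graded
center that annihilate, on both sides, the degree `s - n` part of `T_r`. -/
def kulshammer (r : ℕ) (s n : ℤ) : AddSubgroup (∀ x, ShiftedHom (obj x) (obj x) n) where
  carrier := {η | η ∈ gradedCenter obj n ∧ ∀ w : EndSum obj (s - n), IsInT obj p r w →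
    leftAct obj s n η w ∈ commutators obj s ∧ rightAct obj s n η w ∈ commutators obj s}
  zero_mem' := ⟨zero_mem _, fun w _ => by
    have h₁ : leftAct obj s n 0 w = 0 := by ext x; simp [leftAct]
    have h₂ : rightAct obj s n 0 w = 0 := by ext x; simp [rightAct]
    rw [h₁, h₂]
    exact ⟨zero_mem _, zero_mem _⟩⟩
  add_mem' := fun {a b} ha hb => ⟨add_mem ha.1 hb.1, fun w hw => by
    have h₁ : leftAct obj s n (a + b) w = leftAct obj s n a w + leftAct obj s n b w := by
      ext x; simp [leftAct]
    have h₂ : rightAct obj s n (a + b) w = rightAct obj s n a w + rightAct obj s n b w := by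
      ext x; simp [rightAct]
    rw [h₁, h₂]
    exact ⟨add_mem (ha.2 w hw).1 (hb.2 w hw).1, add_mem (ha.2 w hw).2 (hb.2 w hw).2⟩⟩
  neg_mem' := fun {a} ha => ⟨neg_mem ha.1, fun w hw => by
    have h₁ : leftAct obj s n (-a) w = -leftAct obj s n a w := by ext x; simp [leftAct]
    have h₂ : rightAct obj s n (-a) w = -rightAct obj s n a w := by ext x; simp [rightAct]
    rw [h₁, h₂]
    exact ⟨neg_mem (ha.2 w hw).1, neg_mem (ha.2 w hw).2⟩⟩

/-- The degree `n` part of `K_r = ⋂_s K_{r,s}`. -/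
def kulshammerInf (r : ℕ) (n : ℤ) : AddSubgroup (∀ x, ShiftedHom (obj x) (obj x) n) :=
  ⨅ s : ℤ, kulshammer obj p r s n

/-- The degree `n` part of the Reynolds ideal `R_s = ⋂_{r ≥ 0} K_{r,s}`. -/
def reynolds (s n : ℤ) : AddSubgroup (∀ x, ShiftedHom (obj x) (obj x) n) :=
  ⨅ r : ℕ, kulshammer obj p r s n

/-- The degree `n` part of the Reynolds ideal `R = ⋂_{r ≥ 0} K_r`. -/
def reynoldsInf (n : ℤ) : AddSubgroup (∀ x, ShiftedHom (obj x) (obj x) n) :=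
  ⨅ r : ℕ, kulshammerInf obj p r n

end Orbit

/-! ### The category of perfect complexes -/

section Perfect

variable (A : Type u) [CommRing A]

/-- The objects of `K^b_p A`: bounded complexes of finitely generated projective `A`-modules. -/
structure PerfectComplex where
  /-- the underlying complex -/
  cx : CochainComplex (ModuleCat.{u} A) ℤ
  finite : ∀ i, Module.Finite A (cx.X i)
  projective : ∀ i, Module.Projective A (cx.X i)
  bounded : ∃ a b : ℤ, ∀ i, (i < a ∨ b < i) → Limits.IsZero (cx.X i)

/-- The homotopy category of complexes of `A`-modules. -/
abbrev HoCat : Type _ := HomotopyCategory (ModuleCat.{u} A) (ComplexShape.up ℤ)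

/-- The functor from complexes of `A`-modules to the homotopy category. -/
abbrev toHo : CochainComplex (ModuleCat.{u} A) ℤ ⥤ HoCat A :=
  HomotopyCategory.quotient (ModuleCat.{u} A) (ComplexShape.up ℤ)

/-- `K^b_p A`, as a family of objects in the homotopy category. -/
def perf (X : PerfectComplex A) : HoCat A := (toHo A).obj X.cx

end Perfect

/-! ### Bimodules over a commutative algebra, Hochschild cohomology and the characteristic map -/

section Unit

open HomologicalComplex

variable {C D : Type*} [Category C] [Category D] [Preadditive C] [Preadditive D]
  [Limits.HasZeroObject D] (F : C ⥤ D ⥤ C) [F.Additive] [∀ X, (F.obj X).Additive]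
  [∀ (K₁ : CochainComplex C ℤ) (K₂ : CochainComplex D ℤ), CochainComplex.HasMapBifunctor K₁ K₂ F]
  (Y : D) (e : F.flip.obj Y ⟶ 𝟭 C)

/-- For a biadditive functor `F` and natural maps `F(M, Y) ⟶ M`, the induced chain map from the total
complex of `F(X, Y[0])` to `X`. -/
def unitComplex (X : CochainComplex C ℤ) :
    mapBifunctor X ((single D (ComplexShape.up ℤ) 0).obj Y) F (ComplexShape.up ℤ) ⟶ X where
  f j := mapBifunctorDesc (fun p q h =>
    if hq : q = 0 then
      (F.obj (X.X p)).map (singleObjXIsoOfEq (ComplexShape.up ℤ) 0 Y q hq).hom ≫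
        e.app (X.X p) ≫ (X.XIsoOfEq (show p = j by subst hq; simpa using h)).hom
    else 0)
  comm' i j hij := by
    have hij' : i + 1 = j := hij
    subst hij'
    apply mapBifunctor.hom_ext
    intro p q h
    have hpq : p + q = i := h
    subst hpq
    have hd : mapBifunctor.d₂ X ((single D (ComplexShape.up ℤ) 0).obj Y) F (ComplexShape.up ℤ)
        p q (p + q + 1) = 0 := by
      rw [mapBifunctor.d₂_eq _ _ _ _ p (show (ComplexShape.up ℤ).Rel q (q + 1) from rfl) _
        (show p + (q + 1) = _ by ring)]
      simp
    simp only [mapBifunctor.d_eq, Preadditive.add_comp,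
      Preadditive.comp_add, mapBifunctor.ι_D₁_assoc, mapBifunctor.ι_D₂_assoc, hd,
      Limits.zero_comp, add_zero, ι_mapBifunctorDesc_assoc]
    rw [mapBifunctor.d₁_eq _ _ _ _ (show (ComplexShape.up ℤ).Rel p (p + 1) from rfl) q _
      (show p + 1 + q = _ by ring)]
    by_cases hq : q = 0
    · subst hq
      have hn := e.naturality (X.d p (p + 1))
      dsimp at hn
      have hm := (F.map (X.d p (p + 1))).naturality
        (singleObjXIsoOfEq (ComplexShape.up ℤ) 0 Y 0 rfl).hom
      simp only [↓reduceDIte, Category.assoc, XIsoOfEq_hom_comp_d, ComplexShape.ε₁_def,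
        one_smul, ι_mapBifunctorDesc]
      rw [← reassoc_of% hm, reassoc_of% hn]
      simp
    · simp [hq]

end Unit

section Hochschild

variable (k : Type u) [Field k] (A : Type u) [CommRing A] [Algebra k A]

/- An `A`-bimodule (with `k` acting centrally) is a module over `A ⊗[k] A`; the left action is through
`inLeft`, the right action through `inRight`. -/

/-- `a ↦ a ⊗ 1`. -/
def inLeft : A →+* A ⊗[k] A := (Algebra.TensorProduct.includeLeft : A →ₐ[k] A ⊗[k] A).toRingHom

/-- `a ↦ 1 ⊗ a`. -/
def inRight : A →+* A ⊗[k] A := (Algebra.TensorProduct.includeRight : A →ₐ[k] A ⊗[k] A).toRingHom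

/-- `a ⊗ b ↦ a b`. -/
def mulHom : A ⊗[k] A →+* A := (Algebra.TensorProduct.lmul' k : A ⊗[k] A →ₐ[k] A).toRingHom

lemma mulHom_inLeft : (mulHom k A).comp (inLeft k A) = RingHom.id A := by
  ext a; simp [mulHom, inLeft]

lemma mulHom_inRight : (mulHom k A).comp (inRight k A) = RingHom.id A := by
  ext a; simp [mulHom, inRight]

/-- The functor `(M, N) ↦ M ⊗_A N` of an `A`-module `M` and an `A`-bimodule `N`, where the tensor
product is over the left action on `N` and the result is a module through the right action on `N`.
It is obtained as `(M ⊗ₖ A) ⊗_{A ⊗ₖ A} N`, with `M ⊗ₖ A` the extension of scalars of `M`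
along `inLeft`. -/
def tensorBimod : ModuleCat.{u} A ⥤ ModuleCat.{u} (A ⊗[k] A) ⥤ ModuleCat.{u} A :=
  ModuleCat.extendScalars (inLeft k A) ⋙
    MonoidalCategory.curriedTensor (ModuleCat.{u} (A ⊗[k] A)) ⋙
    (Functor.whiskeringRight _ _ _).obj (ModuleCat.restrictScalars (inRight k A))

instance : (ModuleCat.extendScalars.{u, u, u} (inLeft k A)).Additive :=
  (ModuleCat.extendRestrictScalarsAdj.{u, u, u} (inLeft k A)).left_adjoint_additive

instance : (tensorBimod k A).Additive where
  map_add {M N f g} := by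
    apply NatTrans.ext
    funext X
    change (ModuleCat.restrictScalars (inRight k A)).map (MonoidalCategory.whiskerRight
        ((ModuleCat.extendScalars (inLeft k A)).map (f + g)) X) =
      (ModuleCat.restrictScalars (inRight k A)).map (MonoidalCategory.whiskerRight
        ((ModuleCat.extendScalars (inLeft k A)).map f) X) +
      (ModuleCat.restrictScalars (inRight k A)).map (MonoidalCategory.whiskerRight
        ((ModuleCat.extendScalars (inLeft k A)).map g) X)
    rw [Functor.map_add, MonoidalPreadditive.add_whiskerRight, Functor.map_add]

instance (M : ModuleCat.{u} A) : ((tensorBimod k A).obj M).Additive := by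
  unfold tensorBimod
  dsimp
  infer_instance

/-- `A` as a bimodule over itself. -/
def regBimod : ModuleCat.{u} (A ⊗[k] A) :=
  (ModuleCat.restrictScalars (mulHom k A)).obj (ModuleCat.of A A)

/-- Multiplication by `a`, as a bimodule endomorphism of `A`. -/
def mulReg (a : A) : regBimod k A ⟶ regBimod k A :=
  (ModuleCat.restrictScalars (mulHom k A)).map (ModuleCat.ofHom (LinearMap.lsmul A A a))

/-- `M ⊗ₖ A ⟶ M`, `s ⊗ m ↦ (mulHom s) m`. -/
def unitAuxLeft : ModuleCat.extendScalars (inLeft k A) ⟶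
    ModuleCat.restrictScalars.{u} (mulHom k A) where
  app M := ((ModuleCat.extendRestrictScalarsAdj (inLeft k A)).homEquiv _ _).symm
    ((ModuleCat.restrictScalarsId' _ (mulHom_inLeft k A)).inv.app M ≫
      (ModuleCat.restrictScalarsComp' _ _ _ rfl).hom.app M)
  naturality M N f := by
    rw [← Adjunction.homEquiv_naturality_left_symm, ← Adjunction.homEquiv_naturality_right_symm]
    rfl

/-- `M ⊗_{A ⊗ₖ A} A ⟶ M`, `m ⊗ a ↦ a m`. -/
def unitAuxRight : ModuleCat.restrictScalars (mulHom k A) ⋙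
    MonoidalCategory.tensorRight (regBimod k A) ⟶ ModuleCat.restrictScalars (mulHom k A) where
  app M := ModuleCat.MonoidalCategory.tensorLift
    (fun y a => (show A from a) • (show M from y))
    (fun y y' a => smul_add (show A from a) (show M from y) (show M from y'))
    (fun s y a => smul_comm (show A from a) (mulHom k A s) (show M from y))
    (fun y a a' => add_smul (show A from a) (show A from a') (show M from y))
    (fun s y a => mul_smul (mulHom k A s) (show A from a) (show M from y))
  naturality M N f := by
    apply ModuleCat.MonoidalCategory.tensor_ext
    intro y a
    exact (map_smul f.hom (show A from a) (show M from y)).symm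

/-- The canonical identification `M ⊗_A A ⟶ M`, natural in `M`. -/
def unitBimod : (tensorBimod k A).flip.obj (regBimod k A) ⟶ 𝟭 _ :=
  Functor.whiskerRight (unitAuxLeft k A)
      (MonoidalCategory.tensorRight (regBimod k A) ⋙ ModuleCat.restrictScalars (inRight k A)) ≫
    Functor.whiskerRight (unitAuxRight k A) (ModuleCat.restrictScalars (inRight k A)) ≫
    (ModuleCat.restrictScalarsComp' (inRight k A) (mulHom k A) _ rfl).inv ≫
    (ModuleCat.restrictScalarsId' _ (mulHom_inRight k A)).hom

/-- The element `(s ⊗ m) ⊗ a` of `M ⊗_A A`. -/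
def tensorElement (M : ModuleCat.{u} A) (s : A ⊗[k] A) (m : M) (a : A) :
    ((tensorBimod k A).obj M).obj (regBimod k A) :=
  letI : Module A (A ⊗[k] A) := Module.compHom _ (inLeft k A)
  (show (ModuleCat.extendScalars (inLeft k A)).obj M from s ⊗ₜ[A] m) ⊗ₜ[A ⊗[k] A]
    (show regBimod k A from a)

lemma unitBimod_tensorElement (M : ModuleCat.{u} A) (s : A ⊗[k] A) (m : M) (a : A) :
    (unitBimod k A).app M (tensorElement k A M s m a) = (a * mulHom k A s) • m := by
  rw [mul_smul]; rfl

/-- A choice of the derived category of bimodules. -/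
instance : HasDerivedCategory (ModuleCat.{u} (A ⊗[k] A)) := HasDerivedCategory.standard _

/-- The bimodule `A` as a complex concentrated in degree `0`. -/
abbrev regComplex : CochainComplex (ModuleCat.{u} (A ⊗[k] A)) ℤ :=
  (HomologicalComplex.single _ (ComplexShape.up ℤ) 0).obj (regBimod k A)

/-- Hochschild cohomology: `HHⁿ(A) = Hom(A, A[n])` in the derived category of `A`-bimodules. -/
abbrev HH (n : ℕ) : Type _ :=
  ShiftedHom (DerivedCategory.Q.obj (regComplex k A)) (DerivedCategory.Q.obj (regComplex k A)) (n : ℤ)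

/-- The product `a b` in Hochschild cohomology, i.e. the composition of `b` followed by `a`. -/
def hhMul {l m n : ℕ} (h : l + m = n) (a : HH k A l) (b : HH k A m) : HH k A n :=
  ShiftedHom.comp b a (by exact_mod_cast h)

/-- The element of `HH⁰(A)` given by an element of (the center of) the commutative algebra `A`. -/
def hhZero (a : A) : HH k A 0 :=
  ShiftedHom.mk₀ _ (by simp)
    (DerivedCategory.Q.map ((HomologicalComplex.single _ (ComplexShape.up ℤ) 0).map (mulReg k A a)))

/-- A family of subgroups of the `HHⁿ(A)` which is a two-sided graded ideal of `HH^*(A)`. -/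
structure IsHHIdeal (I : ∀ n, AddSubgroup (HH k A n)) : Prop where
  mul_left : ∀ {l m n : ℕ} (h : l + m = n) (a : HH k A l) (b : HH k A m), b ∈ I m →
    hhMul k A h a b ∈ I n
  mul_right : ∀ {l m n : ℕ} (h : l + m = n) (a : HH k A l) (b : HH k A m), a ∈ I l →
    hhMul k A h a b ∈ I n

/-- The degree `n` part of the two-sided graded ideal of `HH^*(A)` generated by the element `x`
of degree `m`. -/
def hhSpan {m : ℕ} (x : HH k A m) (n : ℕ) : Set (HH k A n) :=
  {f | ∀ I : ∀ n, AddSubgroup (HH k A n), IsHHIdeal k A I → x ∈ I m → f ∈ I n}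

/-- The functor `N ↦ X ⊗_A N` from complexes of bimodules to the homotopy category. -/
abbrev tensorHo (X : CochainComplex (ModuleCat.{u} A) ℤ) :
    CochainComplex (ModuleCat.{u} (A ⊗[k] A)) ℤ ⥤ HoCat A :=
  (tensorBimod k A).map₂CochainComplex.obj X ⋙ toHo A

/-- The canonical identification `X ⊗_A A ⟶ X`. -/
def unitHo (X : CochainComplex (ModuleCat.{u} A) ℤ) :
    (tensorHo k A X).obj (regComplex k A) ⟶ (toHo A).obj X :=
  (toHo A).map (unitComplex (tensorBimod k A) (regBimod k A) (unitBimod k A) X)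

/-- `φ` is the value `χ(f)_X : X ≅ X ⊗_A^L A ⟶ X ⊗_A^L A[n] ≅ X[n]` of the characteristic homomorphism:
if `s : P ⟶ A` is a K-projective resolution of the bimodule `A` and `f` is represented by the chain
map `g : P ⟶ A[n]`, then the composite `X ⊗_A P ⟶ X ⊗_A A ≅ X ⟶ X[n]` of `X ⊗ s` and `φ` is
`X ⊗ g : X ⊗_A P ⟶ X ⊗_A A[n] ≅ X[n]`. -/
def IsCharValue {n : ℕ} (f : HH k A n) (X : PerfectComplex A)
    (φ : ShiftedHom (perf A X) (perf A X) (n : ℤ)) : Prop :=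
  ∃ (P : CochainComplex (ModuleCat.{u} (A ⊗[k] A)) ℤ) (s : P ⟶ regComplex k A)
    (g : ShiftedHom P (regComplex k A) (n : ℤ)),
    P.IsKProjective ∧ QuasiIso s ∧
    DerivedCategory.Q.map s ≫ f = g.map DerivedCategory.Q ∧
    ((tensorHo k A X.cx).map s ≫ unitHo k A X.cx) ≫ φ =
      g.map (tensorHo k A X.cx) ≫ (unitHo k A X.cx)⟦(n : ℤ)⟧'

/-- The preimage, in degree `n`, of a subspace of the graded center under the characteristic
homomorphism `χ : HH^*(A) ⟶ Z^*(K^b_p A)`. -/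
def charPreimage {n : ℕ} (I : AddSubgroup (∀ X, ShiftedHom (perf A X) (perf A X) (n : ℤ))) :
    Set (HH k A n) :=
  {f | ∃ η ∈ I, ∀ X, IsCharValue k A f X (η X)}

variable (p : ℕ) [NeZero p]

/-- The degree `n` part of the higher Külshammer ideal `HK_{r,s}(A)`. -/
def HK (r : ℕ) (s : ℤ) (n : ℕ) : Set (HH k A n) := charPreimage k A (kulshammer (perf A) p r s n)

/-- The degree `n` part of the higher Külshammer ideal `HK_r(A)`. -/
def HKInf (r : ℕ) (n : ℕ) : Set (HH k A n) := charPreimage k A (kulshammerInf (perf A) p r n)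

/-- The degree `n` part of the higher Reynolds ideal `HR_s(A)`. -/
def HR (s : ℤ) (n : ℕ) : Set (HH k A n) := charPreimage k A (reynolds (perf A) p s n)

/-- The degree `n` part of the higher Reynolds ideal `HR(A)`. -/
def HRInf (n : ℕ) : Set (HH k A n) := charPreimage k A (reynoldsInf (perf A) p n)

end Hochschild

/-! ### The algebra `k[x]/x²` -/

section DualNumber

variable (k : Type u) [Field k]

/-- The algebra `Λ = k[x]/x²`, with `x = DualNumber.eps`. -/
abbrev Lam : Type u := DualNumber k

/-- The dual numbers are `k[x]/x²`. -/
lemma lam_equiv : ∃ e : (Polynomial k ⧸ Ideal.span {(Polynomial.X ^ 2 : Polynomial k)}) ≃ₐ[k] Lam k,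
    e (Ideal.Quotient.mk _ Polynomial.X) = DualNumber.eps := by
  let π := Ideal.Quotient.mkₐ k (Ideal.span {(Polynomial.X ^ 2 : Polynomial k)})
  have hX : π Polynomial.X * π Polynomial.X = 0 := by
    rw [← map_mul, ← pow_two]
    exact Ideal.Quotient.eq_zero_iff_mem.2 (Ideal.subset_span rfl)
  let f : (Polynomial k ⧸ Ideal.span {(Polynomial.X ^ 2 : Polynomial k)}) →ₐ[k] Lam k :=
    Ideal.Quotient.liftₐ _ (Polynomial.aeval DualNumber.eps) (fun a ha => by
      obtain ⟨b, rfl⟩ := Ideal.mem_span_singleton.1 ha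
      simp [pow_two])
  let g : Lam k →ₐ[k] (Polynomial k ⧸ Ideal.span {(Polynomial.X ^ 2 : Polynomial k)}) :=
    DualNumber.lift ⟨(Algebra.ofId _ _, π Polynomial.X), hX, fun _ => Algebra.commutes _ _⟩
  have hf : f (π Polynomial.X) = DualNumber.eps := by
    change Polynomial.aeval DualNumber.eps Polynomial.X = _
    simp
  have hg : g DualNumber.eps = π Polynomial.X := by simp [g]
  refine ⟨AlgEquiv.ofAlgHom f g ?_ ?_, hf⟩
  · apply DualNumber.algHom_ext
    simp [hg, hf]
  · apply Ideal.Quotient.algHom_ext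
    apply Polynomial.algHom_ext
    change g (f (π Polynomial.X)) = π Polynomial.X
    rw [hf, hg]

/-- The `i`-th term of `Λ^{[m,n]}`, as a submodule of `Λ`: it is `Λ` for `m ≤ i ≤ n` and `0`
otherwise. -/
def intervalTerm (m n i : ℤ) : Submodule (Lam k) (Lam k) := if m ≤ i ∧ i ≤ n then ⊤ else ⊥

/-- Multiplication by `x` from the `i`-th to the `j`-th term of `Λ^{[m,n]}` (zero, if
one of these terms is zero). -/
def mulX (m n i j : ℤ) : intervalTerm k m n i →ₗ[Lam k] intervalTerm k m n j :=
  if h : m ≤ j ∧ j ≤ n then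
    LinearMap.codRestrict _ ((DualNumber.eps : Lam k) • (intervalTerm k m n i).subtype)
      (fun _ => by simp [intervalTerm, h])
  else 0

lemma mulX_coe (m n i j : ℤ) (v : intervalTerm k m n i) :
    (mulX k m n i j v : Lam k) = if m ≤ j ∧ j ≤ n then DualNumber.eps * (v : Lam k) else 0 := by
  by_cases h : m ≤ j ∧ j ≤ n
  · rw [mulX, dif_pos h, if_pos h]; rfl
  · rw [mulX, dif_neg h, if_neg h]; rfl

lemma mulX_mulX (m n i j l : ℤ) : mulX k m n j l ∘ₗ mulX k m n i j = 0 := by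
  ext1 v
  apply Subtype.ext
  rw [LinearMap.comp_apply, mulX_coe, mulX_coe]
  split_ifs <;> simp [← mul_assoc]

lemma intervalTerm_cases (m n i : ℤ) :
    Nonempty (intervalTerm k m n i ≃ₗ[Lam k] Lam k) ∨ Subsingleton (intervalTerm k m n i) := by
  by_cases h : m ≤ i ∧ i ≤ n
  · rw [intervalTerm, if_pos h]
    exact Or.inl ⟨Submodule.topEquiv⟩
  · rw [intervalTerm, if_neg h]
    exact Or.inr inferInstance

/-- The complex `Λ^{[m,n]} = ⋯ → 0 → Λ → Λ → ⋯ → Λ → 0 → ⋯`, with `Λ` in the degrees of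
`[m, n]` and all differentials between these degrees being multiplication by `x`. -/
def interval (m n : ℤ) : CochainComplex (ModuleCat.{u} (Lam k)) ℤ where
  X i := ModuleCat.of (Lam k) (intervalTerm k m n i)
  d i j := if i + 1 = j then ModuleCat.ofHom (mulX k m n i j) else 0
  shape i j h := if_neg h
  d_comp_d' i j l hij hjl := by
    have hij' : i + 1 = j := hij
    have hjl' : j + 1 = l := hjl
    rw [if_pos hij', if_pos hjl', ← ModuleCat.ofHom_comp, mulX_mulX]
    rfl

/-- `Λ^{[m,n]}` as an object of `K^b_p Λ`. -/
def intervalPerf (m n : ℤ) : PerfectComplex (Lam k) where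
  cx := interval k m n
  finite i := by
    change Module.Finite (Lam k) (intervalTerm k m n i)
    obtain ⟨⟨e⟩⟩ | h := intervalTerm_cases k m n i
    · exact Module.Finite.equiv e.symm
    · infer_instance
  projective i := by
    change Module.Projective (Lam k) (intervalTerm k m n i)
    obtain ⟨⟨e⟩⟩ | h := intervalTerm_cases k m n i
    · exact Module.Projective.of_equiv e.symm
    · infer_instance
  bounded := ⟨m, n, fun i hi => by
    have h : intervalTerm k m n i = ⊥ := if_neg (by omega)
    have h' : Subsingleton (intervalTerm k m n i) := by rw [h]; infer_instance
    exact ModuleCat.isZero_of_iff_subsingleton.2 h'⟩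

/-- Multiplication by `c x` on the `i`-th term of `Λ^{[m,n]}` if `i = n`, and zero otherwise. -/
def xTerm (m n i : ℤ) (c : k) : intervalTerm k m n i →ₗ[Lam k] intervalTerm k m n i :=
  (if i = n then c • (DualNumber.eps : Lam k) else 0) • LinearMap.id

lemma xTerm_coe (m n i : ℤ) (c : k) (v : intervalTerm k m n i) :
    (xTerm k m n i c v : Lam k) =
      (if i = n then c • (DualNumber.eps : Lam k) else 0) * (v : Lam k) := rfl

lemma xTerm_add (m n i : ℤ) (c d : k) :
    xTerm k m n i (c + d) = xTerm k m n i c + xTerm k m n i d := by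
  ext1 v
  apply Subtype.ext
  rw [LinearMap.add_apply, Submodule.coe_add, xTerm_coe, xTerm_coe, xTerm_coe]
  split_ifs <;> simp [add_smul, add_mul]

/-- The chain map `c x_n : Λ^{[m,n]} ⟶ Λ^{[m,n]}`: multiplication by `c x` in degree `n`, and zero in
all other degrees. -/
def xEnd (m n : ℤ) (c : k) : interval k m n ⟶ interval k m n where
  f i := ModuleCat.ofHom (xTerm k m n i c)
  comm' i j hij := by
    have hij' : i + 1 = j := hij
    subst hij'
    simp only [interval, if_true, ← ModuleCat.ofHom_comp]
    congr 1
    ext1 v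
    apply Subtype.ext
    rw [LinearMap.comp_apply, LinearMap.comp_apply, mulX_coe, xTerm_coe, xTerm_coe, mulX_coe]
    split_ifs <;> first | omega | simp [← mul_assoc]

lemma xEnd_add (m n : ℤ) (c d : k) : xEnd k m n (c + d) = xEnd k m n c + xEnd k m n d := by
  ext i : 1
  change ModuleCat.ofHom _ = ModuleCat.ofHom _ + ModuleCat.ofHom _
  rw [xTerm_add, ModuleCat.ofHom_add]
  rfl

/-- The class of `c x_n`, as an endomorphism of `Λ^{[m,n]}` of degree `0`. -/
def xClass (m n : ℤ) (c : k) :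
    ShiftedHom (perf (Lam k) (intervalPerf k m n)) (perf (Lam k) (intervalPerf k m n)) (0 : ℤ) :=
  ShiftedHom.mk₀ 0 rfl
    ((toHo (Lam k)).map (X := (intervalPerf k m n).cx) (Y := (intervalPerf k m n).cx) (xEnd k m n c))

lemma xClass_add (m n : ℤ) (c d : k) : xClass k m n (c + d) = xClass k m n c + xClass k m n d := by
  have h : (toHo (Lam k)).map (xEnd k m n (c + d)) =
      (toHo (Lam k)).map (xEnd k m n c) + (toHo (Lam k)).map (xEnd k m n d) := by
    rw [xEnd_add, Functor.map_add]
  exact (congrArg (ShiftedHom.mk₀ (0 : ℤ) rfl) h).trans (ShiftedHom.mk₀_add _ _ _ _)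

lemma xClass_zero (m n : ℤ) : xClass k m n 0 = 0 := by
  have h := xClass_add k m n 0 0
  rwa [add_zero, left_eq_add] at h

lemma xClass_neg (m n : ℤ) (c : k) : xClass k m n (-c) = -xClass k m n c := by
  rw [eq_neg_iff_add_eq_zero, ← xClass_add, neg_add_cancel, xClass_zero]

/-- The subspace `Z̃⁰` of the elements `η` of degree `0` of the graded center of `K^b_p Λ` such that,
for all `m ≤ n`, `η` acts on `Λ^{[m,n]}` by a scalar multiple of `x_n`. -/
def tildeZ : AddSubgroup (∀ X, ShiftedHom (perf (Lam k) X) (perf (Lam k) X) (0 : ℤ)) where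
  carrier := {η | η ∈ gradedCenter (perf (Lam k)) 0 ∧
    ∀ m n : ℤ, m ≤ n → ∃ c : k, η (intervalPerf k m n) = xClass k m n c}
  zero_mem' := ⟨zero_mem _, fun m n _ => ⟨0, (xClass_zero k m n).symm⟩⟩
  add_mem' := fun {a b} ha hb => ⟨add_mem ha.1 hb.1, fun m n h => by
    obtain ⟨c, hc⟩ := ha.2 m n h
    obtain ⟨d, hd⟩ := hb.2 m n h
    exact ⟨c + d, by rw [xClass_add, ← hc, ← hd]; rfl⟩⟩
  neg_mem' := fun {a} ha => ⟨neg_mem ha.1, fun m n h => by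
    obtain ⟨c, hc⟩ := ha.2 m n h
    exact ⟨-c, by rw [xClass_neg, ← hc]; rfl⟩⟩

/-- The line `⟨x⟩` in `HH⁰(Λ) = Λ`. -/
def hhLineX : Set (HH k (Lam k) 0) := {f | ∃ c : k, f = hhZero k (Lam k) (c • DualNumber.eps)}

/-- The subspace `x · HHˡ(Λ)` of `HHˡ(Λ)`. -/
def hhLineXMul (l : ℕ) : Set (HH k (Lam k) l) :=
  {f | ∃ b : HH k (Lam k) l, f = hhMul k (Lam k) (zero_add l) (hhZero k (Lam k) DualNumber.eps) b}

end DualNumber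

end KulshammerIdeals

end

open KulshammerIdeals

noncomputable section

namespace KulshammerIdeals

set_option linter.unusedSectionVars false

/-! ### Orbit categories: reduction to a family of building blocks -/

section Orbit

variable {C : Type*} [Category C] [Preadditive C] [HasShift C ℤ]

/-! Everything is computed on the complexes Λ^{[m,n]}. By `exists_decomposition` every object is a
sum of them in the homotopy category: contractible summands are removed until the differential has
the form x·D, and then a longest string of iterates of D, starting in the lowest degree, spans a
retract Λ^{[m,n]}. The graded center and the graded abelianization only see these blocks: a central
family is determined by the blocks and extends from them (`center_eq_zero`, `exists_center`), an
endomorphism is modulo commutators the sum of its diagonal entries, and a trace given on the blocks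
extends to all objects (`BlockTrace`).

A map of degree t between blocks is a family of elements of Λ. Its constant terms (the leading
coefficients) are homotopy invariant and form a geometric sequence of ratio (-1)^t; homotopies only
change the coefficients of x (`homotopy_iff`). So an endomorphism of a block is given by one leading
coefficient if t > 0, by a multiple of x in the top degree if t < 0, and by both if t = 0. It
follows that the center vanishes for t < 0, and for odd t if 2 is invertible, and that all
endomorphisms are sums of commutators for t > 0, and for odd t if 2 is invertible. If t ≤ 0 and
(-1)^t = 1 in k, the alternating sum of the coefficients of x is a trace (`altBlockTrace`).

Let r > 0, s ≤ 0 and (-1)^s = 1. The multiple of x in the top degree, taken as a map of degree s -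
t, has square zero, so it represents an element of T_r. Its product with a central η of degree t is
x times the leading coefficient of η, which the alternating trace detects. Hence elements of K_{r,s}
have no leading coefficients (`scal_eq_zero_of_mem_kulshammer`): they vanish for t > 0 and lie in
Z̃⁰ for t = 0. Conversely Z̃⁰ annihilates T_r (`tildeZ_le_kulshammer`). For s < 0 this is x² = 0.
For s = 0, an element of Z̃⁰ acts modulo commutators through the signed sums of leading coefficients
over blocks of equal length; these sums vanish on T_r because tr(M^{p^r}) = tr(M)^{p^r}
(`trace_pow_char_pow`). The answer is the same for all r > 0, and K_{0,s} is the whole center, which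
gives the Reynolds ideals.

In Hochschild cohomology, the periodic bimodule resolution represents a class of degree l by some a
in Λ with constant term a₀ such that (-1)^l a₀ = a₀. An explicit homotopy shows that χ takes it to
multiplication by (-1)^l a on Λ^{[m,n]} (`charEquation_interval`). A zigzag argument shows that a₀
can be recovered from any value of χ on Λ^{[0,l]} (`fst_eq_zero_of_homotopy`). Hence the preimages
of 0 for l > 0 and of Z̃⁰ for l = 0 consist of the classes with a₀ = 0 (`hhNilpotent`). If 2 is
invertible, these are all classes for odd l and only 0 for even l > 0, because 2x is a coboundary
there; in characteristic 2 they are the multiples of x. -/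

lemma smul_comp_units {X Y Z : C} {a b c : ℤ} (u : ℤˣ) (f : ShiftedHom X Y a)
    (g : ShiftedHom Y Z b) (h : b + a = c) : (u • f).comp g h = u • f.comp g h := by
  obtain rfl | rfl := Int.units_eq_one_or u <;> simp

variable [∀ n : ℤ, (shiftFunctor C n).Additive]

lemma comp_smul_units {X Y Z : C} {a b c : ℤ} (u : ℤˣ) (f : ShiftedHom X Y a)
    (g : ShiftedHom Y Z b) (h : b + a = c) : f.comp (u • g) h = u • f.comp g h := by
  obtain rfl | rfl := Int.units_eq_one_or u <;> simp

lemma comp_sum' {X Y Z : C} {a b c : ℤ} {σ : Type*} (s : Finset σ) (f : ShiftedHom X Y a)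
    (g : σ → ShiftedHom Y Z b) (h : b + a = c) :
    f.comp (∑ i ∈ s, g i) h = ∑ i ∈ s, f.comp (g i) h :=
  map_sum (AddMonoidHom.mk' (fun g => f.comp g h) fun _ _ => ShiftedHom.comp_add _ _ _ _) g s

lemma sum_comp' {X Y Z : C} {a b c : ℤ} {σ : Type*} (s : Finset σ) (f : σ → ShiftedHom X Y a)
    (g : ShiftedHom Y Z b) (h : b + a = c) :
    (∑ i ∈ s, f i).comp g h = ∑ i ∈ s, (f i).comp g h :=
  map_sum (AddMonoidHom.mk' (fun f => ShiftedHom.comp f g h) fun _ _ => ShiftedHom.add_comp _ _ _ _)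
    f s

variable {ι κ : Type*} (obj : ι → C) (e : κ → ι)

/-- The identity of `obj x` as a sum of morphisms of degree `0` which factor through objects of the
family `obj ∘ e`. -/
structure Decomposition (x : ι) where
  /-- the number of summands -/
  size : ℕ
  /-- the object through which a summand factors -/
  idx : Fin size → κ
  /-- the morphism from the object -/
  inj : ∀ a, ShiftedHom (obj (e (idx a))) (obj x) (0 : ℤ)
  /-- the morphism to the object -/
  proj : ∀ a, ShiftedHom (obj x) (obj (e (idx a))) (0 : ℤ)
  sum_eq : ∑ a, (proj a).comp (inj a) (zero_add 0) = ShiftedHom.mk₀ 0 rfl (𝟙 (obj x))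

variable {obj e}

namespace Decomposition

/-- The entries of a morphism with respect to two decompositions. -/
def entry {x y : ι} (d : Decomposition obj e x) (d' : Decomposition obj e y) {n : ℤ}
    (f : ShiftedHom (obj x) (obj y) n) (a : Fin d.size) (b : Fin d'.size) :
    ShiftedHom (obj (e (d.idx a))) (obj (e (d'.idx b))) n :=
  (d.inj a).comp (f.comp (d'.proj b) (zero_add n)) (add_zero n)

lemma sum_proj_inj_comp {x : ι} (d : Decomposition obj e x) {Y : C} {n : ℤ}
    (f : ShiftedHom (obj x) Y n) :
    ∑ a, (d.proj a).comp ((d.inj a).comp f (add_zero n)) (add_zero n) = f := by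
  have h := congrArg (fun z => ShiftedHom.comp z f (add_zero n)) d.sum_eq
  simp only [ShiftedHom.mk₀_id_comp] at h
  rw [sum_comp'] at h
  refine Eq.trans (Finset.sum_congr rfl fun a _ => ?_) h
  rw [ShiftedHom.comp_assoc _ _ _ (zero_add 0) (add_zero n) (by simp)]

lemma sum_comp_proj_inj {x : ι} (d : Decomposition obj e x) {Y : C} {n : ℤ}
    (f : ShiftedHom Y (obj x) n) :
    ∑ a, (f.comp (d.proj a) (zero_add n)).comp (d.inj a) (zero_add n) = f := by
  have h := congrArg (fun z => f.comp z (zero_add n)) d.sum_eq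
  simp only [ShiftedHom.comp_mk₀_id] at h
  rw [comp_sum'] at h
  refine Eq.trans (Finset.sum_congr rfl fun a _ => ?_) h
  rw [ShiftedHom.comp_assoc _ _ _ (zero_add n) (zero_add 0) (by simp)]

/-- Entries multiply like matrices, because the identity of the middle object is the sum of the
composites of `proj` and `inj`. -/
lemma entry_comp {x y z : ι} (d : Decomposition obj e x) (d' : Decomposition obj e y)
    (d'' : Decomposition obj e z) {m n l : ℤ} (f : ShiftedHom (obj x) (obj y) m)
    (g : ShiftedHom (obj y) (obj z) n) (h : n + m = l) (a : Fin d.size) (c : Fin d''.size) :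
    d.entry d'' (f.comp g h) a c = ∑ b, (d.entry d' f a b).comp (d'.entry d'' g b c) h := by
  have h1 : ∀ b, (d.entry d' f a b).comp (d'.entry d'' g b c) h =
      (d.inj a).comp (((f.comp (d'.proj b) (zero_add m)).comp (d'.inj b) (zero_add m)).comp
        (g.comp (d''.proj c) (zero_add n)) h) (add_zero l) := by
    intro b
    rw [entry, entry, ShiftedHom.comp_assoc (d.inj a) _ _ (add_zero m) (h) (by omega),
      ShiftedHom.comp_assoc _ (d'.inj b) _ (zero_add m) (add_zero n) (by omega)]
  simp only [h1]
  rw [← comp_sum', ← sum_comp', d'.sum_comp_proj_inj, entry,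
    ShiftedHom.comp_assoc f g _ h (zero_add n) (by omega)]

end Decomposition

/-! ### Endomorphisms modulo commutators reduce to diagonal entries. -/

section Commutators

open Classical in
lemma commutator_mem {x y : ι} {i j n : ℤ} (hij : i + j = n) (f : ShiftedHom (obj x) (obj y) i)
    (g : ShiftedHom (obj y) (obj x) j) :
    (DFinsupp.single x (f.comp g ((add_comm j i).trans hij)) -
      (i * j).negOnePow • DFinsupp.single y (g.comp f hij) : EndSum obj n) ∈ commutators obj n :=
  AddSubgroup.subset_closure ⟨x, y, i, j, hij, f, g, rfl⟩

open Classical in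
-- Write f as the sum of (f followed by `proj`) followed by `inj`, and turn each product around. As
-- `inj` has degree 0, no sign appears.
lemma Decomposition.single_sub_mem {x : ι} (d : Decomposition obj e x) {n : ℤ}
    (f : ShiftedHom (obj x) (obj x) n) :
    (DFinsupp.single x f - ∑ a, DFinsupp.single (e (d.idx a)) (d.entry d f a a) : EndSum obj n) ∈
      commutators obj n := by
  have h : (DFinsupp.single x f : EndSum obj n) = ∑ a, DFinsupp.single x
      ((f.comp (d.proj a) (zero_add n)).comp (d.inj a) (zero_add n)) := by
    conv_lhs => rw [← d.sum_comp_proj_inj f]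
    exact map_sum (DFinsupp.singleAddHom (fun x => ShiftedHom (obj x) (obj x) n) x) _ _
  rw [h, ← Finset.sum_sub_distrib]
  refine sum_mem fun a _ => ?_
  have := commutator_mem (add_zero n) (f.comp (d.proj a) (zero_add n)) (d.inj a)
  simpa [Decomposition.entry] using this

open Classical in
/-- A subgroup of `⊕ End` is everything once it contains the commutators and the endomorphisms of
the building blocks. -/
lemma endSum_mem_of_blocks (hD : ∀ x, Nonempty (Decomposition obj e x)) {n : ℤ}
    (S : AddSubgroup (EndSum obj n)) (hS : commutators obj n ≤ S)
    (h : ∀ j (f : ShiftedHom (obj (e j)) (obj (e j)) n), DFinsupp.single (e j) f ∈ S)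
    (w : EndSum obj n) : w ∈ S := by
  induction w using DFinsupp.induction with
  | h0 => exact zero_mem _
  | ha x f w _ _ ih =>
    refine add_mem ?_ ih
    obtain ⟨d⟩ := hD x
    have := S.add_mem (hS (d.single_sub_mem f)) (sum_mem (t := Finset.univ) fun a _ => h (d.idx a) (d.entry d f a a))
    rwa [sub_add_cancel] at this

lemma commutators_eq_top (hD : ∀ x, Nonempty (Decomposition obj e x)) {n : ℤ}
    (h : ∀ j (f : ShiftedHom (obj (e j)) (obj (e j)) n), by
      classical exact DFinsupp.single (e j) f ∈ commutators obj n) : commutators obj n = ⊤ :=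
  eq_top_iff.2 fun w _ => endSum_mem_of_blocks hD _ le_rfl h w

end Commutators

/-! ### The graded center: action on commutators, restriction to and extension from the blocks. -/

section Center

lemma leftAct_single [DecidableEq ι] {s n : ℤ} (η : ∀ x, ShiftedHom (obj x) (obj x) n) (x : ι)
    (f : ShiftedHom (obj x) (obj x) (s - n)) :
    leftAct obj s n η (DFinsupp.single x f) = DFinsupp.single x (f.comp (η x) (by ring)) :=
  DFinsupp.mapRange_single

/-- `leftAct` as an additive map. -/
def leftActHom (s n : ℤ) (η : ∀ x, ShiftedHom (obj x) (obj x) n) :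
    EndSum obj (s - n) →+ EndSum obj s where
  toFun := leftAct obj s n η
  map_zero' := by ext x; simp [leftAct]
  map_add' a b := by ext x; simp [leftAct]

lemma rightAct_eq {s n : ℤ} {η : ∀ x, ShiftedHom (obj x) (obj x) n} (hη : η ∈ gradedCenter obj n)
    (w : EndSum obj (s - n)) :
    rightAct obj s n η w = (n * (s - n)).negOnePow • leftAct obj s n η w := by
  ext x
  simp only [rightAct, leftAct, DFinsupp.mapRange_apply]
  change (η x).comp (w x) _ = (n * (s - n)).negOnePow • (w x).comp (η x) _
  have h := hη x x (s - n) (w x)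
  -- The target degrees are replaced by variables, so that the equalities of degrees can be
  -- eliminated by substitution.
  have key : ∀ (m : ℤ) (hm : s - n + n = m),
      (η x).comp (w x) hm = (n * (s - n)).negOnePow • (w x).comp (η x) ((add_comm _ _).trans hm) := by
    rintro _ rfl
    have := hη x x (s - n) (w x)
    have key2 : ∀ (q : ℤ) (hq : n + (s - n) = q), (η x).comp (w x) ((add_comm _ _).trans hq) =
      (n * (s - n)).negOnePow • (w x).comp (η x) hq := by
      rintro _ rfl
      exact this
    exact key2 _ (add_comm _ _)
  exact key s (by ring)

lemma units_smul_mem {M : Type*} [AddCommGroup M] {S : AddSubgroup M} (u : ℤˣ) {w : M}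
    (h : w ∈ S) : u • w ∈ S := by
  obtain rfl | rfl := Int.units_eq_one_or u
  · simpa using h
  · simpa using h

/-- Right multiplication by central elements may be disregarded in the definition of the
Külshammer ideals. -/
lemma mem_kulshammer_iff (p : ℕ) [NeZero p] (r : ℕ) {s n : ℤ}
    {η : ∀ x, ShiftedHom (obj x) (obj x) n} :
    η ∈ kulshammer obj p r s n ↔ η ∈ gradedCenter obj n ∧
      ∀ w : EndSum obj (s - n), IsInT obj p r w → leftAct obj s n η w ∈ commutators obj s :=
  ⟨fun h => ⟨h.1, fun w hw => (h.2 w hw).1⟩, fun h => ⟨h.1, fun w hw => ⟨h.2 w hw, by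
    rw [rightAct_eq h.1]
    exact units_smul_mem _ (h.2 w hw)⟩⟩⟩

/-- The defining relation of the center, with the degree of the composites left free. -/
lemma comp_center_comm {n : ℤ} {η : ∀ x, ShiftedHom (obj x) (obj x) n}
    (hη : η ∈ gradedCenter obj n) {x y : ι} {j q : ℤ} (f : ShiftedHom (obj x) (obj y) j)
    (hq : n + j = q) : (η x).comp f ((add_comm _ _).trans hq) =
      (n * j).negOnePow • f.comp (η y) hq := by
  subst hq
  exact hη x y j f

open Classical in
/-- The commutators form an ideal under the action of the graded center. -/
lemma leftAct_mem_commutators {s n : ℤ} {η : ∀ x, ShiftedHom (obj x) (obj x) n}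
    (hη : η ∈ gradedCenter obj n) {w : EndSum obj (s - n)} (hw : w ∈ commutators obj (s - n)) :
    leftAct obj s n η w ∈ commutators obj s := by
  suffices h : commutators obj (s - n) ≤ (commutators obj s).comap (leftActHom s n η) from h hw
  refine (AddSubgroup.closure_le _).2 ?_
  rintro _ ⟨x, y, i, j, hij, f, g, rfl⟩
  change leftActHom s n η _ ∈ commutators obj s
  rw [map_sub]
  have h1 : ∀ (u : ℤˣ) (w : EndSum obj (s - n)),
      leftActHom s n η (u • w) = u • leftActHom s n η w := by
    intro u w
    obtain rfl | rfl := Int.units_eq_one_or u <;> simp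
  rw [h1]
  change leftAct obj s n η _ - (i * j).negOnePow • leftAct obj s n η _ ∈ commutators obj s
  rw [leftAct_single, leftAct_single]
  -- Multiplying the commutator of f and g by η gives the commutator of f with η g, of degree n + j.
  -- Moving η past f costs (-1)^{ni}, which is the difference between the signs for ij and for i(n +
  -- j).
  have h2 := commutator_mem (show i + (n + j) = s by omega) f (g.comp (η x) rfl)
  convert! h2 using 2
  · rw [ShiftedHom.comp_assoc _ _ _ _ rfl (by omega)]
  · have h3 : (g.comp f hij).comp (η y) (by omega : n + (s - n) = s) =
        (n * i).negOnePow • (g.comp (η x) rfl).comp f (by omega : i + (n + j) = s) := by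
      rw [ShiftedHom.comp_assoc _ _ _ hij rfl (by omega),
        ShiftedHom.comp_assoc g (η x) f rfl (add_comm i n) (by omega),
        comp_center_comm hη f rfl, comp_smul_units, smul_smul, ← Int.negOnePow_add, ← two_mul,
        Int.negOnePow_even _ (even_two_mul _), one_smul]
    rw [h3]
    have h4 : ∀ (u : ℤˣ) (f : ShiftedHom (obj y) (obj y) s),
        (DFinsupp.single y (u • f) : EndSum obj s) = u • DFinsupp.single y f := by
      intro u f
      obtain rfl | rfl := Int.units_eq_one_or u <;> simp
    rw [h4, smul_smul, ← Int.negOnePow_add]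
    congr 2
    ring

/-- A central element is determined by its values on the building blocks. -/
lemma center_eq_zero (hD : ∀ x, Nonempty (Decomposition obj e x)) {n : ℤ}
    {η : ∀ x, ShiftedHom (obj x) (obj x) n} (hη : η ∈ gradedCenter obj n)
    (h : ∀ j, η (e j) = 0) : η = 0 := by
  funext x
  obtain ⟨d⟩ := hD x
  rw [← d.sum_comp_proj_inj (η x), Pi.zero_apply]
  refine Finset.sum_eq_zero fun a _ => ?_
  rw [comp_center_comm hη (d.proj a) (add_zero n), h, ShiftedHom.comp_zero, smul_zero,
    ShiftedHom.zero_comp]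

/-- A central family on the building blocks extends to all objects. -/
lemma exists_center (hD : ∀ x, Nonempty (Decomposition obj e x)) {n : ℤ}
    (θ : ∀ j, ShiftedHom (obj (e j)) (obj (e j)) n)
    (hθ : θ ∈ gradedCenter (fun j => obj (e j)) n) :
    ∃ η ∈ gradedCenter obj n, (∀ j, η (e j) = θ j) ∧ ∀ x (d : Decomposition obj e x),
      η x = ∑ a, (d.proj a).comp ((θ (d.idx a)).comp (d.inj a) (zero_add n)) (add_zero n) := by
  have d := fun x => (hD x).some
  -- Centrality is proved for arbitrary decompositions of source and target. Applied to the identity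
  -- it shows that the extension does not depend on the decomposition, which is why it agrees with θ
  -- on the blocks.
  have key : ∀ (x y : ι) (dx : Decomposition obj e x) (dy : Decomposition obj e y) (j q : ℤ)
      (f : ShiftedHom (obj x) (obj y) j) (hq : n + j = q),
      ShiftedHom.comp (∑ a, (dx.proj a).comp ((θ (dx.idx a)).comp (dx.inj a) (zero_add n))
        (add_zero n)) f ((add_comm j n).trans hq) = (n * j).negOnePow •
      f.comp (∑ a, (dy.proj a).comp ((θ (dy.idx a)).comp (dy.inj a) (zero_add n)) (add_zero n))
        hq := by
    intro x y dx dy j q f hq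
    have h1 : ∀ a b, (θ (dx.idx a)).comp (dx.entry dy f a b) ((add_comm j n).trans hq) =
        (n * j).negOnePow • (dx.entry dy f a b).comp (θ (dy.idx b)) hq :=
      fun a b => comp_center_comm (obj := fun j => obj (e j)) hθ (dx.entry dy f a b) hq
    -- Both sides are expanded into double sums over the entries of f; centrality of θ then applies
    -- to each term.
    have hL : ShiftedHom.comp (∑ a, (dx.proj a).comp ((θ (dx.idx a)).comp (dx.inj a) (zero_add n))
        (add_zero n)) f ((add_comm j n).trans hq) = ∑ a, ∑ b, (dx.proj a).comp
          (((θ (dx.idx a)).comp (dx.entry dy f a b) ((add_comm j n).trans hq)).comp (dy.inj b)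
            (zero_add q)) (add_zero q) := by
      rw [sum_comp']
      refine Finset.sum_congr rfl fun a _ => ?_
      rw [← comp_sum', ShiftedHom.comp_assoc (dx.proj a) _ f (add_zero n)
        ((add_comm j n).trans hq) (by omega)]
      congr 1
      rw [ShiftedHom.comp_assoc (θ _) _ f (zero_add n) (add_zero j) (by omega)]
      conv_lhs => rw [← dy.sum_comp_proj_inj f]
      rw [comp_sum', comp_sum']
      refine Finset.sum_congr rfl fun b _ => ?_
      rw [Decomposition.entry, ← ShiftedHom.comp_assoc (dx.inj a) _ _ (add_zero j) (zero_add j)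
        (by omega), ShiftedHom.comp_assoc (θ _) _ (dy.inj b) ((add_comm j n).trans hq)
        (zero_add j) (by omega)]
    have hR : f.comp (∑ a, (dy.proj a).comp ((θ (dy.idx a)).comp (dy.inj a) (zero_add n))
        (add_zero n)) hq = ∑ a, ∑ b, (dx.proj a).comp
          (((dx.entry dy f a b).comp (θ (dy.idx b)) hq).comp (dy.inj b)
            (zero_add q)) (add_zero q) := by
      rw [comp_sum', Finset.sum_comm]
      refine Finset.sum_congr rfl fun b _ => ?_
      rw [← ShiftedHom.comp_assoc f (dy.proj b) _ (zero_add j) (add_zero n) (by omega)]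
      conv_lhs => rw [← dx.sum_proj_inj_comp (f.comp (dy.proj b) (zero_add j))]
      rw [sum_comp']
      refine Finset.sum_congr rfl fun a _ => ?_
      rw [Decomposition.entry, ShiftedHom.comp_assoc (dx.proj a) _ _ (add_zero j) hq (by omega),
        ShiftedHom.comp_assoc _ (θ _) (dy.inj b) hq (zero_add n) (by omega)]
    rw [hL, hR, Finset.smul_sum]
    refine Finset.sum_congr rfl fun a _ => ?_
    rw [Finset.smul_sum]
    refine Finset.sum_congr rfl fun b _ => ?_
    rw [h1, smul_comp_units, comp_smul_units]
  have indep : ∀ (x : ι) (dx dx' : Decomposition obj e x),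
      ∑ a, (dx.proj a).comp ((θ (dx.idx a)).comp (dx.inj a) (zero_add n)) (add_zero n) =
      ∑ a, (dx'.proj a).comp ((θ (dx'.idx a)).comp (dx'.inj a) (zero_add n)) (add_zero n) := by
    intro x dx dx'
    have h := key x x dx dx' 0 n (ShiftedHom.mk₀ 0 rfl (𝟙 _)) (add_zero n)
    rw [ShiftedHom.comp_mk₀_id, ShiftedHom.mk₀_id_comp] at h
    simpa using h
  refine ⟨fun x => ∑ a, ((d x).proj a).comp ((θ ((d x).idx a)).comp ((d x).inj a) (zero_add n))
    (add_zero n), ?_, ?_, ?_⟩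
  · intro x y j f
    exact key x y (d x) (d y) j _ f rfl
  · intro j
    let d0 : Decomposition obj e (e j) :=
      { size := 1, idx := fun _ => j
        inj := fun _ => ShiftedHom.mk₀ 0 rfl (𝟙 _)
        proj := fun _ => ShiftedHom.mk₀ 0 rfl (𝟙 _)
        sum_eq := by simp }
    refine (indep _ _ d0).trans ?_
    simp [d0]
  · intro x dx
    exact indep _ _ _

end Center

/-! ### Extending traces from the blocks to all objects. -/

section Trace

/-- A trace of degree `n` on the building blocks. -/
structure BlockTrace (obj : ι → C) (e : κ → ι) (n : ℤ) (M : Type*) [AddCommGroup M] where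
  /-- the value on an endomorphism -/
  toFun : ∀ j, ShiftedHom (obj (e j)) (obj (e j)) n →+ M
  comm : ∀ (j l : κ) (a b : ℤ) (hab : a + b = n) (f : ShiftedHom (obj (e j)) (obj (e l)) a)
    (g : ShiftedHom (obj (e l)) (obj (e j)) b),
    toFun j (f.comp g ((add_comm b a).trans hab)) = (a * b).negOnePow • toFun l (g.comp f hab)

variable {M : Type*} [AddCommGroup M] {n : ℤ} (φ : BlockTrace obj e n M)

namespace BlockTrace

/-- The trace of an endomorphism of an object with a given decomposition. -/
def onObj {x : ι} (d : Decomposition obj e x) : ShiftedHom (obj x) (obj x) n →+ M where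
  toFun f := ∑ a, φ.toFun (d.idx a) (d.entry d f a a)
  map_zero' := Finset.sum_eq_zero fun a _ => by simp [Decomposition.entry]
  map_add' f g := by simp [Decomposition.entry, Finset.sum_add_distrib]

/-- As for the trace of a product of matrices: both sides become the same double sum over pairs of
entries, and the block trace exchanges the two factors. -/
lemma onObj_comm {x y : ι} (dx : Decomposition obj e x) (dy : Decomposition obj e y) (a b : ℤ)
    (hab : a + b = n) (f : ShiftedHom (obj x) (obj y) a) (g : ShiftedHom (obj y) (obj x) b) :
    φ.onObj dx (f.comp g ((add_comm b a).trans hab)) =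
      (a * b).negOnePow • φ.onObj dy (g.comp f hab) := by
  change ∑ a', φ.toFun (dx.idx a') (dx.entry dx _ a' a') =
    (a * b).negOnePow • ∑ b', φ.toFun (dy.idx b') (dy.entry dy _ b' b')
  simp only [dx.entry_comp dy dx, dy.entry_comp dx dy, map_sum, Finset.smul_sum]
  rw [Finset.sum_comm]
  refine Finset.sum_congr rfl fun b' _ => Finset.sum_congr rfl fun a' _ => ?_
  exact φ.comm _ _ _ _ _ _ _

variable (hD : ∀ x, Nonempty (Decomposition obj e x))

open Classical in
/-- The trace on `⊕ End`. -/
def total : EndSum obj n →+ M := DFinsupp.liftAddHom fun x => φ.onObj (hD x).some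

open Classical in
-- Independence of the decomposition: this is the trace property for the identity and f, with one
-- decomposition used at the source and the other at the target.
lemma total_single_eq {x : ι} (d : Decomposition obj e x) (f : ShiftedHom (obj x) (obj x) n) :
    φ.total hD (DFinsupp.single x f) = φ.onObj d f := by
  rw [total, DFinsupp.liftAddHom_apply_single]
  have h := φ.onObj_comm (hD x).some d 0 n (zero_add n) (ShiftedHom.mk₀ 0 rfl (𝟙 _)) f
  simpa using h

open Classical in
lemma total_block (j : κ) (f : ShiftedHom (obj (e j)) (obj (e j)) n) :
    φ.total hD (DFinsupp.single (e j) f) = φ.toFun j f := by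
  let d0 : Decomposition obj e (e j) :=
    { size := 1, idx := fun _ => j
      inj := fun _ => ShiftedHom.mk₀ 0 rfl (𝟙 _)
      proj := fun _ => ShiftedHom.mk₀ 0 rfl (𝟙 _)
      sum_eq := by simp }
  rw [φ.total_single_eq hD d0]
  simp [onObj, d0, Decomposition.entry]

lemma total_commutator {w : EndSum obj n} (hw : w ∈ commutators obj n) : φ.total hD w = 0 := by
  classical
  suffices h : commutators obj n ≤ (φ.total hD).ker from h hw
  refine (AddSubgroup.closure_le _).2 ?_
  rintro _ ⟨x, y, i, j, hij, f, g, rfl⟩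
  change φ.total hD _ = 0
  obtain ⟨dx⟩ := hD x
  obtain ⟨dy⟩ := hD y
  have h1 : ∀ (u : ℤˣ) (w : EndSum obj n), φ.total hD (u • w) = u • φ.total hD w := by
    intro u w
    obtain rfl | rfl := Int.units_eq_one_or u <;> simp
  rw [map_sub, h1]
  erw [φ.total_single_eq hD dx, φ.total_single_eq hD dy]
  rw [φ.onObj_comm dx dy i j hij f g, sub_self]

end BlockTrace

end Trace

end Orbit

/-! ### Morphisms of degree `t` in the homotopy category -/

section HoCat

variable {A : Type u} [CommRing A] {X Y Z : CochainComplex (ModuleCat.{u} A) ℤ} {t : ℤ}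

/-- The class in the homotopy category of a chain map of degree `t`. -/
abbrev hoClass (f : ShiftedHom X Y t) : ShiftedHom ((toHo A).obj X) ((toHo A).obj Y) t :=
  ShiftedHom.map f (toHo A)

lemma hoClass_surjective (φ : ShiftedHom ((toHo A).obj X) ((toHo A).obj Y) t) :
    ∃ f : ShiftedHom X Y t, hoClass f = φ := by
  obtain ⟨f, hf⟩ := (toHo A).map_surjective (φ ≫ ((toHo A).commShiftIso t).inv.app Y)
  exact ⟨f, by simp [hoClass, ShiftedHom.map, hf]⟩

lemma hoClass_eq_zero_iff (f : ShiftedHom X Y t) :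
    hoClass f = 0 ↔ Nonempty (Homotopy f 0) := by
  have h : hoClass f = 0 ↔ (toHo A).map f = 0 := by
    constructor
    · intro h
      have := congrArg (· ≫ ((toHo A).commShiftIso t).inv.app Y) h
      simpa [hoClass, ShiftedHom.map] using this
    · intro h
      simp [hoClass, ShiftedHom.map, h]
  rw [h]
  constructor
  · intro h
    exact ⟨HomotopyCategory.homotopyOfEq _ _ (by simpa using h)⟩
  · rintro ⟨h⟩
    simpa using HomotopyCategory.eq_of_homotopy _ _ h

end HoCat

/-! ### Chain maps and homotopies between interval complexes, by coefficients. -/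

section Interval

variable (k : Type u) [Field k] (m n m' n' : ℤ) {m₁ n₁ m₂ n₂ m₃ n₃ : ℤ}

variable {k}

/-- A morphism between terms of interval complexes, as a linear map. -/
def termHom {i j : ℤ} (φ : (interval k m₁ n₁).X i ⟶ (interval k m₂ n₂).X j) :
    intervalTerm k m₁ n₁ i →ₗ[Lam k] intervalTerm k m₂ n₂ j := φ.hom

/-- The element of `Λ` through which a morphism between terms of interval complexes multiplies. -/
def coef {i j : ℤ} (φ : (interval k m₁ n₁).X i ⟶ (interval k m₂ n₂).X j) : Lam k :=
  if h : m₁ ≤ i ∧ i ≤ n₁ then (termHom φ ⟨1, by simp [intervalTerm, h]⟩ : Lam k) else 0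

/-- Multiplication by an element of `Λ` between terms of interval complexes. -/
def mulTerm (m₁ n₁ m₂ n₂ i j : ℤ) (c : Lam k) :
    intervalTerm k m₁ n₁ i →ₗ[Lam k] intervalTerm k m₂ n₂ j :=
  if h : m₂ ≤ j ∧ j ≤ n₂ then
    LinearMap.codRestrict _ (c • (intervalTerm k m₁ n₁ i).subtype)
      (fun _ => by simp [intervalTerm, h])
  else 0

/-- The morphism between terms of interval complexes given by multiplication by an element. -/
def ofCoef {m₁ n₁ m₂ n₂ : ℤ} {i j : ℤ} (c : Lam k) :
    (interval k m₁ n₁).X i ⟶ (interval k m₂ n₂).X j :=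
  ModuleCat.ofHom (mulTerm m₁ n₁ m₂ n₂ i j c)

lemma intervalTerm_eq_zero {m n i : ℤ} (h : ¬(m ≤ i ∧ i ≤ n)) (v : intervalTerm k m n i) :
    (v : Lam k) = 0 := by
  have e : intervalTerm k m n i = ⊥ := if_neg h
  exact (Submodule.mem_bot _).1 (e.le v.2)

lemma coef_mul {i j : ℤ} (φ : (interval k m₁ n₁).X i ⟶ (interval k m₂ n₂).X j)
    (v : intervalTerm k m₁ n₁ i) : (termHom φ v : Lam k) = coef φ * (v : Lam k) := by
  by_cases h : m₁ ≤ i ∧ i ≤ n₁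
  · have hv : v = (v : Lam k) • (⟨1, by simp [intervalTerm, h]⟩ : intervalTerm k m₁ n₁ i) := by
      ext1; simp
    rw [coef, dif_pos h]
    conv_lhs => rw [hv, map_smul]
    exact mul_comm _ _
  · have hv : v = 0 := Subtype.ext (intervalTerm_eq_zero h v)
    rw [hv]
    simp

lemma ofCoef_apply {i j : ℤ} (c : Lam k) (v : intervalTerm k m₁ n₁ i) :
    (termHom (ofCoef c : (interval k m₁ n₁).X i ⟶ (interval k m₂ n₂).X j) v : Lam k) =
      if m₂ ≤ j ∧ j ≤ n₂ then c * v else 0 := by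
  change (mulTerm m₁ n₁ m₂ n₂ i j c v : Lam k) = _
  by_cases h : m₂ ≤ j ∧ j ≤ n₂
  · rw [if_pos h, mulTerm, dif_pos h]; rfl
  · rw [if_neg h, mulTerm, dif_neg h]; rfl

lemma coef_eq_zero {i j : ℤ} (φ : (interval k m₁ n₁).X i ⟶ (interval k m₂ n₂).X j)
    (h : ¬(m₁ ≤ i ∧ i ≤ n₁ ∧ m₂ ≤ j ∧ j ≤ n₂)) : coef φ = 0 := by
  rw [coef]
  split_ifs with h'
  · exact intervalTerm_eq_zero (fun h2 => h ⟨h'.1, h'.2, h2⟩) _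
  · rfl

lemma coef_ext {i j : ℤ} {φ ψ : (interval k m₁ n₁).X i ⟶ (interval k m₂ n₂).X j}
    (h : coef φ = coef ψ) : φ = ψ := by
  apply ModuleCat.hom_ext
  apply LinearMap.ext
  intro (v : intervalTerm k m₁ n₁ i)
  apply Subtype.ext
  exact (coef_mul φ v).trans ((congrArg (· * (v : Lam k)) h).trans (coef_mul ψ v).symm)

lemma coef_ofCoef {i j : ℤ} (c : Lam k) :
    coef (ofCoef c : (interval k m₁ n₁).X i ⟶ (interval k m₂ n₂).X j) =
      if m₁ ≤ i ∧ i ≤ n₁ ∧ m₂ ≤ j ∧ j ≤ n₂ then c else 0 := by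
  rw [coef]
  split_ifs with h h' h'
  · rw [ofCoef_apply, if_pos h'.2.2]; simp
  · rw [ofCoef_apply, if_neg fun h2 => h' ⟨h.1, h.2, h2⟩]
  · exact absurd ⟨h'.1, h'.2.1⟩ h
  · rfl

@[simp]
lemma coef_zero {i j : ℤ} : coef (0 : (interval k m₁ n₁).X i ⟶ (interval k m₂ n₂).X j) = 0 := by
  rw [coef]; split_ifs <;> rfl

@[simp]
lemma coef_add {i j : ℤ} (φ ψ : (interval k m₁ n₁).X i ⟶ (interval k m₂ n₂).X j) :
    coef (φ + ψ) = coef φ + coef ψ := by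
  simp only [coef]; split_ifs
  · rfl
  · simp

@[simp]
lemma coef_neg {i j : ℤ} (φ : (interval k m₁ n₁).X i ⟶ (interval k m₂ n₂).X j) :
    coef (-φ) = -coef φ := by
  rw [eq_neg_iff_add_eq_zero, ← coef_add, neg_add_cancel, coef_zero]

lemma coef_units_smul {i j : ℤ} (t : ℤ)
    (φ : (interval k m₁ n₁).X i ⟶ (interval k m₂ n₂).X j) :
    coef (t.negOnePow • φ) = (-1 : k) ^ t • coef φ := by
  obtain h | h := Int.even_or_odd t
  · rw [Int.negOnePow_even _ h, h.neg_one_zpow]; simp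
  · rw [Int.negOnePow_odd _ h, h.neg_one_zpow]; simp

lemma coef_comp {i j l : ℤ} (φ : (interval k m₁ n₁).X i ⟶ (interval k m₂ n₂).X j)
    (ψ : (interval k m₂ n₂).X j ⟶ (interval k m₃ n₃).X l) :
    coef (φ ≫ ψ) = coef ψ * coef φ := by
  by_cases h : m₁ ≤ i ∧ i ≤ n₁
  · conv_lhs => rw [coef, dif_pos h]
    conv_rhs => rw [show coef φ = _ from dif_pos h]
    exact coef_mul ψ (termHom φ _)
  · rw [coef_eq_zero _ (by tauto), coef_eq_zero φ (by tauto), mul_zero]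

lemma coef_d (i j : ℤ) : coef ((interval k m n).d i j) =
    if i + 1 = j ∧ m ≤ i ∧ j ≤ n then (DualNumber.eps : Lam k) else 0 := by
  by_cases hij : i + 1 = j
  · have hd : (interval k m n).d i j = ModuleCat.ofHom (mulX k m n i j) := if_pos hij
    by_cases h : m ≤ i ∧ j ≤ n
    · have ht : termHom ((interval k m n).d i j) = mulX k m n i j := by
        change ((interval k m n).d i j).hom = _
        rw [hd]
        rfl
      rw [if_pos ⟨hij, h⟩, coef, dif_pos (by omega), ht, mulX_coe, if_pos (by omega)]
      simp
    · rw [if_neg (by tauto), coef_eq_zero _ (by omega)]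
  · rw [if_neg (by tauto), HomologicalComplex.shape _ _ _ hij, coef_zero]

lemma coef_id (i : ℤ) : coef (𝟙 ((interval k m n).X i)) = if m ≤ i ∧ i ≤ n then 1 else 0 := by
  rw [coef]; split_ifs <;> rfl

@[simp]
lemma coef_comp_XIsoOfEq {i j l : ℤ} (φ : (interval k m₁ n₁).X i ⟶ (interval k m₂ n₂).X j)
    (h : j = l) : coef (φ ≫ ((interval k m₂ n₂).XIsoOfEq h).hom) = coef φ := by
  subst h
  simp [HomologicalComplex.XIsoOfEq]

variable (k) in
/-- Families of coefficients which define a chain map of degree `t` between interval complexes. -/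
def cocycles (m n m' n' t : ℤ) : AddSubgroup (ℤ → Lam k) where
  -- Only constant terms are constrained, since the differentials multiply by x. The relation is
  -- meant also where one of the two coefficients is forced to vanish by the first condition; it
  -- then says that the other has no constant term. For i < m or i + t + 1 > n' the square gives no
  -- condition.
  carrier := {c | (∀ i, ¬(m ≤ i ∧ i ≤ n ∧ m' ≤ i + t ∧ i + t ≤ n') → c i = 0) ∧
    ∀ i, m ≤ i → i + t + 1 ≤ n' → (c (i + 1)).fst = (-1 : k) ^ t * (c i).fst}
  zero_mem' := ⟨fun _ _ => rfl, fun _ _ _ => by simp⟩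
  add_mem' := fun {a b} ha hb => ⟨fun i hi => by simp [ha.1 i hi, hb.1 i hi], fun i h h' => by
    simp [ha.2 i h h', hb.2 i h h', mul_add]⟩
  neg_mem' := fun {a} ha => ⟨fun i hi => by simp [ha.1 i hi], fun i h h' => by
    simp [ha.2 i h h']⟩

variable {m n m' n'} {t : ℤ}

lemma mul_eps (a : Lam k) : a * DualNumber.eps = a.fst • DualNumber.eps := by
  ext <;> simp

/-- The component of a chain map of degree `t`. -/
def comp' (f : ShiftedHom (interval k m n) (interval k m' n') t) (i : ℤ) :
    (interval k m n).X i ⟶ (interval k m' n').X (i + t) := f.f i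

/-- The coefficients of a chain map of degree `t`. -/
def coefAt (f : ShiftedHom (interval k m n) (interval k m' n') t) (i : ℤ) : Lam k :=
  coef (comp' f i)

lemma coefAt_comm (f : ShiftedHom (interval k m n) (interval k m' n') t) (i : ℤ) :
    (-1 : k) ^ t • (if m' ≤ i + t ∧ i + t + 1 ≤ n' then DualNumber.eps else 0) * coefAt f i =
      coefAt f (i + 1) * (if m ≤ i ∧ i + 1 ≤ n then DualNumber.eps else 0) := by
  have h : comp' f i ≫ (t.negOnePow • (interval k m' n').d (i + t) (i + 1 + t)) =
      (interval k m n).d i (i + 1) ≫ comp' f (i + 1) := f.comm i (i + 1)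
  have h2 := congrArg coef h
  rw [coef_comp, coef_comp, coef_units_smul, coef_d, coef_d] at h2
  have e1 : (i + t + 1 = i + 1 + t ∧ m' ≤ i + t ∧ i + 1 + t ≤ n') ↔
      (m' ≤ i + t ∧ i + t + 1 ≤ n') := by omega
  simp only [e1, true_and] at h2
  exact h2

/-- The chain map with given coefficients. -/
def chainOf (c : cocycles k m n m' n' t) : ShiftedHom (interval k m n) (interval k m' n') t where
  f i := ofCoef (j := i + t) (c.1 i)
  comm' i j hij := by
    have hij' : i + 1 = j := hij
    subst hij'
    apply coef_ext (j := i + 1 + t)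
    change coef (ofCoef (j := i + t) (c.1 i) ≫ (t.negOnePow • (interval k m' n').d (i + t) (i + 1 + t)))
      = coef ((interval k m n).d i (i + 1) ≫ ofCoef (j := i + 1 + t) (c.1 (i + 1)))
    rw [coef_comp, coef_units_smul, coef_comp, coef_d, coef_d, coef_ofCoef, coef_ofCoef,
      smul_mul_assoc]
    have hc : ∀ i, (if m ≤ i ∧ i ≤ n ∧ m' ≤ i + t ∧ i + t ≤ n' then c.1 i else 0) = c.1 i := by
      intro i
      split_ifs with h
      · rfl
      · exact (c.2.1 i h).symm
    rw [hc, hc]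
    have h0 := c.2.1 i
    have h0' := c.2.1 (i + 1)
    have h1 := c.2.2 i
    split_ifs with h2 h3 h3
    · rw [mul_comm, mul_eps, mul_eps, h1 h3.2.1 (by omega), smul_smul]
    · rw [mul_comm, mul_eps, smul_smul]
      by_cases h4 : m ≤ i
      · rw [← h1 h4 (by omega), h0' (by omega)]; simp
      · rw [h0 (by omega)]; simp
    · rw [mul_eps]
      by_cases h4 : i + t + 1 ≤ n'
      · rw [h1 h3.2.1 h4, h0 (by omega)]; simp
      · rw [h0' (by omega)]; simp
    · simp

lemma coefAt_chainOf (c : cocycles k m n m' n' t) (i : ℤ) : coefAt (chainOf c) i = c.1 i := by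
  change coef (ofCoef (j := i + t) (c.1 i)) = _
  rw [coef_ofCoef]
  split_ifs with h
  · rfl
  · exact (c.2.1 i h).symm

lemma chain_ext {f g : ShiftedHom (interval k m n) (interval k m' n') t}
    (h : ∀ i, coefAt f i = coefAt g i) : f = g := by
  apply HomologicalComplex.hom_ext
  intro i
  exact coef_ext (h i)

lemma coefAt_mem (f : ShiftedHom (interval k m n) (interval k m' n') t) :
    coefAt f ∈ cocycles k m n m' n' t := by
  refine ⟨fun i hi => coef_eq_zero _ hi, fun i h h' => ?_⟩
  have h0 : ∀ i, ¬(m ≤ i ∧ i ≤ n ∧ m' ≤ i + t ∧ i + t ≤ n') → coefAt f i = 0 :=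
    fun i hi => coef_eq_zero _ hi
  have h3 := congrArg TrivSqZeroExt.snd (coefAt_comm f i)
  have h1 := h0 i
  have h2 := h0 (i + 1)
  split_ifs at h3 with h4 h5 h5
  · simpa using h3.symm
  · rw [h2 (by omega)]
    simpa using h3.symm
  · rw [h1 (by omega)]
    simpa using h3.symm
  · by_cases h6 : i ≤ n ∧ m' ≤ i + t
    · exact absurd ⟨h6.2, h'⟩ h4
    · rw [h1 (by omega), h2 (by omega)]
      simp

lemma chainOf_coefAt (f : ShiftedHom (interval k m n) (interval k m' n') t) :
    chainOf ⟨coefAt f, coefAt_mem f⟩ = f := chain_ext fun i => coefAt_chainOf _ i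

/-- A null-homotopic map, in terms of coefficients. -/
lemma homotopy_iff (f : ShiftedHom (interval k m n) (interval k m' n') t) :
    Nonempty (Homotopy f 0) ↔ (∀ i, (coefAt f i).fst = 0) ∧ ∃ h : ℤ → k,
      (∀ i, ¬(m ≤ i ∧ i ≤ n ∧ m' ≤ i + t - 1 ∧ i + t - 1 ≤ n') → h i = 0) ∧
      ∀ i, m ≤ i → i ≤ n → m' ≤ i + t → i + t ≤ n' →
        (coefAt f i).snd = h (i + 1) + (-1) ^ t * h i := by
  constructor
  · rintro ⟨H⟩
    let H' : ∀ i, (interval k m n).X i ⟶ (interval k m' n').X (i - 1 + t) := fun i => H.hom i (i - 1)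
    -- Both terms of a null-homotopic map contain a factor x. So it has no constant terms, and only
    -- the constant terms of the homotopy matter.
    have key : ∀ i, coefAt f i =
        (if m' ≤ i - 1 + t ∧ i + t ≤ n' then (-1 : k) ^ t • DualNumber.eps * coef (H' i) else 0) +
        (if m ≤ i ∧ i + 1 ≤ n then coef (H' (i + 1)) * DualNumber.eps else 0) := by
      intro i
      have h1 : comp' f i = (interval k m n).d i (i + 1) ≫ H' (i + 1) ≫
            ((interval k m' n').XIsoOfEq (by ring)).hom +
          H' i ≫ (t.negOnePow • (interval k m' n').d (i - 1 + t) (i + t)) := by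
        have := H.comm i
        rw [dNext_eq _ (show (ComplexShape.up ℤ).Rel i (i + 1) by simp),
          prevD_eq _ (show (ComplexShape.up ℤ).Rel (i - 1) i by simp)] at this
        have h3 : H' (i + 1) ≫ ((interval k m' n').XIsoOfEq (by ring)).hom = H.hom (i + 1) i := by
          have h4 : ∀ (j a b : ℤ) (h : a = b), H.hom j a ≫
              (((interval k m' n')⟦t⟧).XIsoOfEq h).hom = H.hom j b := by
            rintro j a _ rfl
            exact Category.comp_id _
          exact h4 (i + 1) (i + 1 - 1) i (by ring)
        rw [h3]
        refine this.trans ?_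
        rw [HomologicalComplex.zero_f, add_zero]
        rfl
      rw [coefAt, h1, coef_add, coef_comp, coef_comp_XIsoOfEq, coef_comp, coef_units_smul, coef_d,
        coef_d, add_comm]
      congr 1
      · split_ifs <;> first | omega | simp
      · split_ifs <;> first | omega | simp
    have hs : ∀ i, ¬(m ≤ i ∧ i ≤ n ∧ m' ≤ i + t - 1 ∧ i + t - 1 ≤ n') → coef (H' i) = 0 :=
      fun i hi => coef_eq_zero _ (by omega)
    refine ⟨fun i => ?_, fun i => (coef (H' i)).fst, fun i hi => congrArg TrivSqZeroExt.fst (hs i hi),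
      fun i h1 h2 h3 h4 => ?_⟩
    · rw [key]
      split_ifs <;> simp
    · rw [key, add_comm]
      have h5 := hs i
      have h6 := hs (i + 1)
      change _ = (coef (H' (i + 1))).fst + (-1) ^ t * (coef (H' i)).fst
      split_ifs with h7 h8 h8
      · simp
      · rw [h5 (by omega)]; simp
      · rw [h6 (by omega)]; simp
      · rw [h5 (by omega), h6 (by omega)]; simp
  · rintro ⟨h1, h, h2, h3⟩
    -- The coefficients of x of a homotopy have no effect, so they are chosen to be zero.
    let H' : ∀ i j, (interval k m n).X i ⟶ (interval k m' n').X (j + t) :=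
      fun i j => if j + 1 = i then ofCoef (TrivSqZeroExt.inl (h i)) else 0
    have hH : ∀ i, coef (H' i (i - 1)) = TrivSqZeroExt.inl (h i) := by
      intro i
      have : H' i (i - 1) = ofCoef (TrivSqZeroExt.inl (h i)) := if_pos (by ring)
      rw [this, coef_ofCoef]
      split_ifs with h4
      · rfl
      · rw [h2 i (by omega)]; rfl
    have hH' : ∀ i, coef (H' (i + 1) i) = TrivSqZeroExt.inl (h (i + 1)) := by
      intro i
      have : H' (i + 1) i = ofCoef (TrivSqZeroExt.inl (h (i + 1))) := if_pos rfl
      rw [this, coef_ofCoef]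
      split_ifs with h4
      · rfl
      · rw [h2 (i + 1) (by omega)]; rfl
    let H'' : ∀ i j, (interval k m n).X i ⟶ ((interval k m' n')⟦t⟧).X j := H'
    refine ⟨{ hom := H'', zero := fun i j hij => if_neg hij, comm := fun i => ?_ }⟩
    rw [dNext_eq _ (show (ComplexShape.up ℤ).Rel i (i + 1) by simp),
      prevD_eq _ (show (ComplexShape.up ℤ).Rel (i - 1) i by simp), HomologicalComplex.zero_f,
      add_zero]
    have h4 : comp' f i = (interval k m n).d i (i + 1) ≫ H' (i + 1) i +
        H' i (i - 1) ≫ (t.negOnePow • (interval k m' n').d (i - 1 + t) (i + t)) := by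
      apply coef_ext
      rw [coef_add, coef_comp, coef_comp, coef_units_smul, coef_d, coef_d, hH, hH']
      change coefAt f i = _
      by_cases h5 : m ≤ i ∧ i ≤ n ∧ m' ≤ i + t ∧ i + t ≤ n'
      · have h6 : coefAt f i = TrivSqZeroExt.inr (h (i + 1) + (-1) ^ t * h i) := by
          ext
          · exact h1 i
          · exact h3 i h5.1 h5.2.1 h5.2.2.1 h5.2.2.2
        rw [h6]
        have h7 := h2 i
        have h8 := h2 (i + 1)
        split_ifs with h9 h10 h10
        · ext <;> simp
        · rw [h7 (by omega)]; ext <;> simp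
        · rw [h8 (by omega)]; ext <;> simp
        · rw [h8 (by omega), h7 (by omega)]; ext <;> simp
      · rw [(coefAt_mem f).1 i h5]
        have h7 := h2 i
        have h8 := h2 (i + 1)
        split_ifs with h9 h10 h10
        · omega
        · rw [h8 (by omega)]; simp
        · rw [h7 (by omega)]; simp
        · simp
    exact h4

lemma coefAt_comp {t' t'' : ℤ} (f : ShiftedHom (interval k m₁ n₁) (interval k m₂ n₂) t)
    (g : ShiftedHom (interval k m₂ n₂) (interval k m₃ n₃) t') (h : t' + t = t'') (i : ℤ) :
    coefAt (f.comp g h) i = coefAt g (i + t) * coefAt f i := by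
  have h1 : comp' (f.comp g h) i = (comp' f i ≫ comp' g (i + t)) ≫
      ((interval k m₃ n₃).XIsoOfEq (by omega)).hom := by
    change (f ≫ g⟦t⟧' ≫ _).f i = _
    rw [HomologicalComplex.comp_f, HomologicalComplex.comp_f,
      CochainComplex.shiftFunctorAdd'_inv_app_f']
    rw [Category.assoc]
    rfl
  rw [coefAt, h1, coef_comp_XIsoOfEq, coef_comp]
  rfl

lemma coefAt_add (f g : ShiftedHom (interval k m n) (interval k m' n') t) (i : ℤ) :
    coefAt (f + g) i = coefAt f i + coefAt g i := coef_add (comp' f i) (comp' g i)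

lemma coefAt_mk₀ (f : interval k m n ⟶ interval k m' n') (i : ℤ) :
    coefAt (ShiftedHom.mk₀ (0 : ℤ) rfl f) i = coef (f.f i) := by
  have h1 : comp' (ShiftedHom.mk₀ (0 : ℤ) rfl f) i =
      f.f i ≫ ((interval k m' n').XIsoOfEq (add_zero i).symm).hom := by
    change (f ≫ _).f i = _
    rw [HomologicalComplex.comp_f, shiftFunctorZero', Iso.trans_inv, NatTrans.comp_app,
      HomologicalComplex.comp_f]
    simp only [eqToIso_refl, Iso.refl_inv, NatTrans.id_app, HomologicalComplex.id_f]
    rw [CochainComplex.shiftFunctorZero_inv_app_f]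
    erw [Category.comp_id]
    rfl
  rw [coefAt, h1, coef_comp_XIsoOfEq]

/-! ### The orbit category of the interval complexes -/

/-- The morphism in the orbit category with given coefficients. -/
def cls (c : cocycles k m n m' n' t) :
    ShiftedHom (perf (Lam k) (intervalPerf k m n)) (perf (Lam k) (intervalPerf k m' n')) t :=
  hoClass (X := interval k m n) (Y := interval k m' n') (chainOf c)

lemma cls_surjective (φ : ShiftedHom (perf (Lam k) (intervalPerf k m n))
    (perf (Lam k) (intervalPerf k m' n')) t) : ∃ c, cls c = φ := by
  obtain ⟨f, hf⟩ := hoClass_surjective (X := interval k m n) (Y := interval k m' n') φ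
  exact ⟨_, (congrArg hoClass (chainOf_coefAt f)).trans hf⟩

lemma cls_add (c d : cocycles k m n m' n' t) : cls (c + d) = cls c + cls d := by
  have : chainOf (c + d) = chainOf c + chainOf d := chain_ext fun i => by
    rw [coefAt_add, coefAt_chainOf, coefAt_chainOf, coefAt_chainOf]; rfl
  exact (congrArg hoClass this).trans (ShiftedHom.map_add _ _ _)

lemma cls_eq_zero_iff (c : cocycles k m n m' n' t) :
    cls c = 0 ↔ (∀ i, (c.1 i).fst = 0) ∧ ∃ h : ℤ → k,
      (∀ i, ¬(m ≤ i ∧ i ≤ n ∧ m' ≤ i + t - 1 ∧ i + t - 1 ≤ n') → h i = 0) ∧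
      ∀ i, m ≤ i → i ≤ n → m' ≤ i + t → i + t ≤ n' →
        (c.1 i).snd = h (i + 1) + (-1) ^ t * h i := by
  have h := (hoClass_eq_zero_iff (chainOf c)).trans (homotopy_iff (chainOf c))
  simp only [coefAt_chainOf] at h
  exact h

lemma cocycles_comp {t' t'' : ℤ} (c : cocycles k m₁ n₁ m₂ n₂ t) (d : cocycles k m₂ n₂ m₃ n₃ t')
    (h : t' + t = t'') : (fun i => d.1 (i + t) * c.1 i) ∈ cocycles k m₁ n₁ m₃ n₃ t'' := by
  have h1 := coefAt_mem ((chainOf c).comp (chainOf d) h)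
  have h2 : coefAt ((chainOf c).comp (chainOf d) h) = fun i => d.1 (i + t) * c.1 i := by
    funext i
    rw [coefAt_comp, coefAt_chainOf, coefAt_chainOf]
  rwa [h2] at h1

lemma cls_comp {t' t'' : ℤ} (c : cocycles k m₁ n₁ m₂ n₂ t) (d : cocycles k m₂ n₂ m₃ n₃ t')
    (h : t' + t = t'') : (cls c).comp (cls d) h = cls ⟨_, cocycles_comp c d h⟩ := by
  have h1 : chainOf ⟨_, cocycles_comp c d h⟩ = (chainOf c).comp (chainOf d) h :=
    chain_ext fun i => by rw [coefAt_comp, coefAt_chainOf, coefAt_chainOf, coefAt_chainOf]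
  exact ((congrArg hoClass h1).trans (ShiftedHom.map_comp _ _ _ _)).symm

lemma x_mem_cocycles (m n : ℤ) (c : k) :
    (fun i => if m ≤ i ∧ i = n then c • DualNumber.eps else 0) ∈ cocycles k m n m n 0 := by
  refine ⟨fun i hi => if_neg (by omega), fun i h h' => ?_⟩
  simp only
  split_ifs <;> simp

lemma cls_x (m n : ℤ) (c : k) : cls ⟨_, x_mem_cocycles m n c⟩ = xClass k m n c := by
  have h1 : chainOf ⟨_, x_mem_cocycles m n c⟩ = ShiftedHom.mk₀ (0 : ℤ) rfl (xEnd k m n c) :=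
    chain_ext fun i => by
      rw [coefAt_chainOf, coefAt_mk₀]
      have ht : termHom ((xEnd k m n c).f i) = xTerm k m n i c := rfl
      rw [coef]
      split_ifs with h
      · rw [ht, xTerm_coe]
        have : (m ≤ i ∧ i = n) ↔ i = n := by omega
        simp [this]
      · exact if_neg (by omega)
  exact (congrArg hoClass h1).trans (ShiftedHom.map_mk₀ _ _ _ _)

end Interval

/-! ### Perfect complexes over the dual numbers are sums of interval complexes -/

section Decompose

variable {k : Type u} [Field k]

/-- An element of a free module over the dual numbers is divisible by `x` or takes the value `1`
under some linear form. -/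
lemma exists_dual_eq_one_or {M : Type*} [AddCommGroup M] [Module (Lam k) M]
    [Module.Free (Lam k) M] (w : M) :
    (∃ φ : M →ₗ[Lam k] Lam k, φ w = 1) ∨ ∃ w' : M, w = (DualNumber.eps : Lam k) • w' := by
  let b := Module.Free.chooseBasis (Lam k) M
  by_cases h : ∀ i, (b.repr w i).fst = 0
  · right
    refine ⟨b.repr.symm ((b.repr w).mapRange (fun c => TrivSqZeroExt.inl c.snd) (by simp)), ?_⟩
    apply b.repr.injective
    ext i
    · simp [h i]
    · simp
      rfl
  · left
    push Not at h
    obtain ⟨i, hi⟩ := h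
    have hu : IsUnit (b.repr w i) := by
      rw [TrivSqZeroExt.isUnit_iff_isUnit_fst]
      exact isUnit_iff_ne_zero.2 hi
    obtain ⟨c, hc⟩ := hu.exists_left_inv
    exact ⟨c • b.coord i, by simpa using hc⟩

instance : IsLocalRing (Lam k) := inferInstance

lemma free_of_projective {M : Type u} [AddCommGroup M] [Module (Lam k) M] [Module.Finite (Lam k) M]
    [Module.Projective (Lam k) M] : Module.Free (Lam k) M := by
  have : Module.FinitePresentation (Lam k) M := Module.finitePresentation_of_projective _ _
  exact Module.free_of_flat_of_isLocalRing

/-- A proper retract has smaller rank. -/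
lemma finrank_lt_of_retract {M N : Type u} [AddCommGroup M] [Module (Lam k) M]
    [Module.Finite (Lam k) M] [Module.Projective (Lam k) M] [AddCommGroup N] [Module (Lam k) N]
    (j : N →ₗ[Lam k] M) (q : M →ₗ[Lam k] N) (h : q ∘ₗ j = LinearMap.id) :
    Module.finrank (Lam k) N ≤ Module.finrank (Lam k) M ∧
      (j ∘ₗ q ≠ LinearMap.id → Module.finrank (Lam k) N < Module.finrank (Lam k) M) := by
  have hq : Function.Surjective q := fun x => ⟨j x, LinearMap.congr_fun h x⟩
  have hj : Function.Injective j := fun x y hxy => by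
    have := congrArg q hxy
    rwa [← LinearMap.comp_apply, ← LinearMap.comp_apply, h] at this
  have : Module.Projective (Lam k) N := Module.Projective.of_split j q h
  have : Module.Finite (Lam k) N := Module.Finite.of_surjective q hq
  have : Module.Free (Lam k) N := free_of_projective
  have : Module.Free (Lam k) M := free_of_projective
  have h1 := LinearMap.finrank_le_finrank_of_injective hj
  refine ⟨h1, fun hne => lt_of_le_of_ne h1 fun heq => hne ?_⟩
  -- If the ranks agree, e ∘ q is a surjective endomorphism of a finite module, hence injective. So
  -- q is injective, and q (j (q x)) = q x gives j ∘ q = id.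
  let e := LinearEquiv.ofFinrankEq N M heq
  have h2 : Function.Injective (e.toLinearMap ∘ₗ q) :=
    OrzechProperty.injective_of_surjective_endomorphism _ (e.surjective.comp hq)
  have h3 : Function.Injective q := fun x y hxy => h2 (by simp [hxy])
  ext x
  apply h3
  exact LinearMap.congr_fun h (q x)

/-- Adds one interval to the decomposition of Y, transported along q and j. The identity is required
only in the homotopy category, and p and i may be zero; in this way contractible summands disappear.
-/
lemma homotopic_sum {X : PerfectComplex (Lam k)} {Y : PerfectComplex (Lam k)} {m n : ℤ}
    (d : Decomposition (perf (Lam k)) (fun I : ℤ × ℤ => intervalPerf k I.1 I.2) Y)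
    (q : X.cx ⟶ Y.cx) (j : Y.cx ⟶ X.cx) (p : X.cx ⟶ interval k m n) (i : interval k m n ⟶ X.cx)
    (h : (toHo (Lam k)).map (q ≫ j) + (toHo (Lam k)).map (p ≫ i) = 𝟙 _) :
    Nonempty (Decomposition (perf (Lam k)) (fun I : ℤ × ℤ => intervalPerf k I.1 I.2) X) := by
  let q' : ShiftedHom (perf (Lam k) X) (perf (Lam k) Y) (0 : ℤ) :=
    ShiftedHom.mk₀ (0 : ℤ) rfl ((toHo (Lam k)).map q)
  let j' : ShiftedHom (perf (Lam k) Y) (perf (Lam k) X) (0 : ℤ) :=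
    ShiftedHom.mk₀ (0 : ℤ) rfl ((toHo (Lam k)).map j)
  let p' : ShiftedHom (perf (Lam k) X) (perf (Lam k) (intervalPerf k m n)) (0 : ℤ) :=
    ShiftedHom.mk₀ (0 : ℤ) rfl ((toHo (Lam k)).map p)
  let i' : ShiftedHom (perf (Lam k) (intervalPerf k m n)) (perf (Lam k) X) (0 : ℤ) :=
    ShiftedHom.mk₀ (0 : ℤ) rfl ((toHo (Lam k)).map i)
  have h' : q'.comp j' (zero_add 0) + p'.comp i' (zero_add 0) =
      ShiftedHom.mk₀ (0 : ℤ) rfl (𝟙 (perf (Lam k) X)) := by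
    have e1 : q'.comp j' (zero_add 0) = ShiftedHom.mk₀ (0 : ℤ) rfl
      ((toHo (Lam k)).map (q ≫ j)) := by
        rw [Functor.map_comp]; exact ShiftedHom.mk₀_comp_mk₀ _ _ _ _ _
    have e2 : p'.comp i' (zero_add 0) = ShiftedHom.mk₀ (0 : ℤ) rfl
      ((toHo (Lam k)).map (p ≫ i)) := by
        rw [Functor.map_comp]; exact ShiftedHom.mk₀_comp_mk₀ _ _ _ _ _
    rw [e1, e2]
    exact (ShiftedHom.mk₀_add _ _ _ _).symm.trans (congrArg (ShiftedHom.mk₀ (0 : ℤ) rfl) h)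
  refine ⟨{
    size := d.size + 1
    idx := Fin.cons (m, n) d.idx
    inj := fun a => Fin.cases (motive := fun a => ShiftedHom (perf (Lam k)
      (intervalPerf k (Fin.cons (α := fun _ => ℤ × ℤ) (m, n) d.idx a).1 (Fin.cons (α := fun _ => ℤ × ℤ) (m, n) d.idx a).2))
      (perf (Lam k) X) (0 : ℤ)) i' (fun a => (d.inj a).comp j' (zero_add 0)) a
    proj := fun a => Fin.cases (motive := fun a => ShiftedHom (perf (Lam k) X) (perf (Lam k)
      (intervalPerf k (Fin.cons (α := fun _ => ℤ × ℤ) (m, n) d.idx a).1 (Fin.cons (α := fun _ => ℤ × ℤ) (m, n) d.idx a).2))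
      (0 : ℤ)) p' (fun a => q'.comp (d.proj a) (zero_add 0)) a
    sum_eq := ?_ }⟩
  rw [Fin.sum_univ_succ, ← h', add_comm]
  congr 1
  conv_rhs => rw [← d.sum_proj_inj_comp j', comp_sum']
  refine Finset.sum_congr rfl fun a _ => ?_
  exact ShiftedHom.comp_assoc q' (d.proj a) _ (zero_add 0) (zero_add 0) (by simp)

/-- Splitting off the image of an idempotent endomorphism. -/
lemma exists_complement (X : PerfectComplex (Lam k)) (ε : X.cx ⟶ X.cx) (hε : ε ≫ ε = ε) :
    ∃ (Y : PerfectComplex (Lam k)) (q : X.cx ⟶ Y.cx) (j : Y.cx ⟶ X.cx), q ≫ j + ε = 𝟙 _ ∧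
      (∀ i, Limits.IsZero (X.cx.X i) → Limits.IsZero (Y.cx.X i)) ∧
      (∀ i, Module.finrank (Lam k) (Y.cx.X i) ≤ Module.finrank (Lam k) (X.cx.X i)) ∧
      ∀ i, ε.f i ≠ 0 →
        Module.finrank (Lam k) (Y.cx.X i) < Module.finrank (Lam k) (X.cx.X i) := by
  -- The complement is the image of the idempotent 1 - ε; its terms are retracts of those of X, so
  -- they are again finite and projective.
  have hε' : (𝟙 X.cx - ε) ≫ (𝟙 X.cx - ε) = 𝟙 X.cx - ε := by
    simp [hε]
  obtain ⟨Y, j, q, hjq, hqj⟩ := IsIdempotentComplete.idempotents_split X.cx (𝟙 X.cx - ε) hε'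
  have hi : ∀ i, (q.f i).hom ∘ₗ (j.f i).hom = LinearMap.id := by
    intro i
    have := congrArg (fun f : Y ⟶ Y => (HomologicalComplex.Hom.f f i).hom) hjq
    simpa using this
  have hfin := X.finite
  have hproj := X.projective
  have hz : ∀ i, Limits.IsZero (X.cx.X i) → Limits.IsZero (Y.X i) := by
    intro i h
    rw [ModuleCat.isZero_iff_subsingleton] at h ⊢
    have hj : Function.Injective (j.f i).hom := fun x y hxy => by
      have := congrArg (q.f i).hom hxy
      rwa [← LinearMap.comp_apply, ← LinearMap.comp_apply, hi] at this
    exact hj.subsingleton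
  let Y' : PerfectComplex (Lam k) :=
    { cx := Y
      finite := fun i => Module.Finite.of_surjective (q.f i).hom
        fun x => ⟨(j.f i).hom x, LinearMap.congr_fun (hi i) x⟩
      projective := fun i => Module.Projective.of_split (j.f i).hom (q.f i).hom (hi i)
      bounded := by
        obtain ⟨a, b, h⟩ := X.bounded
        exact ⟨a, b, fun i h' => hz i (h i h')⟩ }
  refine ⟨Y', q, j, by rw [hqj]; simp, hz, fun i => (finrank_lt_of_retract _ _ (hi i)).1,
    fun i h => (finrank_lt_of_retract _ _ (hi i)).2 fun h' => h ?_⟩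
  have h1 : q.f i ≫ j.f i + ε.f i = 𝟙 _ := by
    have := congrArg (fun f : X.cx ⟶ X.cx => HomologicalComplex.Hom.f f i)
      (show q ≫ j + ε = 𝟙 _ by rw [hqj]; simp)
    simpa using this
  have h2 : q.f i ≫ j.f i = 𝟙 _ := by
    apply ModuleCat.hom_ext
    simpa using h'
  rw [h2] at h1
  simpa using h1

/-- A complex whose differential does not vanish modulo `x` has a contractible summand. -/
lemma exists_contractible {K : CochainComplex (ModuleCat.{u} (Lam k)) ℤ} {i : ℤ} (v : K.X i)
    (φ : K.X (i + 1) →ₗ[Lam k] Lam k) (h : φ (K.d i (i + 1) v) = 1) :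
    ∃ ε : K ⟶ K, ε ≫ ε = ε ∧ (toHo (Lam k)).map ε = 0 ∧ ε.f (i + 1) ≠ 0 := by
  -- As φ(dv) = 1, the map w ↦ φ(w) v satisfies h₀ d h₀ = h₀. So the null-homotopic map d h₀ + h₀ d
  -- is idempotent; its image is spanned by v and dv.
  let h0 : K.X (i + 1) ⟶ K.X i := ModuleCat.ofHom (φ.smulRight v)
  have hh0 : h0 ≫ K.d i (i + 1) ≫ h0 = h0 := by
    ext w
    simp [h0, h]
  let H : ∀ a b, K.X a ⟶ K.X b := fun a b =>
    if h : a = i + 1 ∧ b = i then (K.XIsoOfEq h.1).hom ≫ h0 ≫ (K.XIsoOfEq h.2.symm).hom else 0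
  have H0 : H (i + 1) i = h0 := by simp [H, HomologicalComplex.XIsoOfEq]
  have H1 : ∀ a b, ¬(a = i + 1 ∧ b = i) → H a b = 0 := fun a b h => dif_neg h
  have HdH : ∀ a, H a (a - 1) ≫ K.d (a - 1) a ≫ H a (a - 1) = H a (a - 1) := by
    have : ∀ a b, b + 1 = a → H a b ≫ K.d b a ≫ H a b = H a b := by
      rintro a b rfl
      by_cases hb : b = i
      · subst hb
        rw [H0, hh0]
      · rw [H1 _ _ (by omega)]; simp
    exact fun a => this a (a - 1) (by ring)
  have HH : ∀ a b c, H a b ≫ H b c = 0 := by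
    intro a b c
    by_cases hb : b = i
    · rw [H1 b c (by omega)]; simp
    · rw [H1 a b (by omega)]; simp
  let ε := Homotopy.nullHomotopicMap H
  have hε : ∀ a, ε.f a = K.d a (a + 1) ≫ H (a + 1) a + H a (a - 1) ≫ K.d (a - 1) a := fun a =>
    Homotopy.nullHomotopicMap_f (c := ComplexShape.up ℤ) (by simp) (by simp) H
  refine ⟨ε, ?_, ?_, ?_⟩
  · ext1 a
    have h2 := HdH (a + 1)
    rw [show a + 1 - 1 = a by ring] at h2
    rw [HomologicalComplex.comp_f, hε]
    simp only [Preadditive.add_comp, Preadditive.comp_add, Category.assoc, h2,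
      reassoc_of% (HdH a)]
    simp [reassoc_of% (HH (a + 1) a (a - 1))]
  · have := HomotopyCategory.eq_of_homotopy _ _ (Homotopy.nullHomotopy H
      fun a b hab => H1 a b fun h => hab (by simp [h.1, h.2]))
    simpa using this
  · intro h3
    have h4 : (ε.f (i + 1)) (K.d i (i + 1) v) = K.d i (i + 1) v := by
      have e : ε.f (i + 1) = K.d (i + 1) (i + 1 + 1) ≫ H (i + 1 + 1) (i + 1) +
          H (i + 1) i ≫ K.d i (i + 1) :=
        Homotopy.nullHomotopicMap_f (c := ComplexShape.up ℤ) (by simp) (by simp) H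
      rw [e, H1 (i + 1 + 1) (i + 1) (by omega), H0]
      simp [h0, h]
    rw [h3] at h4
    have h5 : K.d i (i + 1) v = 0 := h4.symm
    rw [h5, map_zero] at h
    exact zero_ne_one h

/-- A minimal complex has an interval complex as a retract. -/
lemma exists_interval {K : CochainComplex (ModuleCat.{u} (Lam k)) ℤ}
    (hfin : ∀ i, Module.Finite (Lam k) (K.X i)) (hproj : ∀ i, Module.Projective (Lam k) (K.X i))
    {m b : ℤ} (hm : ¬Limits.IsZero (K.X m)) (hm' : Limits.IsZero (K.X (m - 1)))
    (hb : ∀ i, b < i → Limits.IsZero (K.X i))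
    (hmin : ∀ i (v : K.X i), ∃ w, K.d i (i + 1) v = (DualNumber.eps : Lam k) • w) :
    ∃ (n : ℤ) (p : K ⟶ interval k m n) (j : interval k m n ⟶ K),
      m ≤ n ∧ j ≫ p = 𝟙 _ := by
  have hfree : ∀ i, Module.Free (Lam k) (K.X i) := fun i => free_of_projective
  -- Minimality means that d takes values in the multiples of x; projectivity lifts it through
  -- multiplication by x. The maps D need not compose to zero.
  have hD : ∀ i j, ∃ D : K.X i →ₗ[Lam k] K.X j, ∀ v, K.d i j v = (DualNumber.eps : Lam k) • D v := by
    intro i j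
    by_cases hij : i + 1 = j
    · subst hij
      let f : K.X (i + 1) →ₗ[Lam k] K.X (i + 1) := LinearMap.lsmul (Lam k) _ (DualNumber.eps : Lam k)
      let g : K.X i →ₗ[Lam k] LinearMap.range f :=
        LinearMap.codRestrict _ (K.d i (i + 1)).hom fun v => by
          obtain ⟨w, hw⟩ := hmin i v
          exact ⟨w, hw.symm⟩
      obtain ⟨D, hD⟩ := Module.projective_lifting_property f.rangeRestrict g
        f.surjective_rangeRestrict
      refine ⟨D, fun v => ?_⟩
      have := congrArg Subtype.val (LinearMap.congr_fun hD v)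
      exact this.symm
    · refine ⟨0, fun v => ?_⟩
      rw [K.shape _ _ hij]
      simp
  choose D hD using hD
  let E : ∀ a, K.X m →ₗ[Lam k] K.X a := fun a =>
    Int.inductionOn' (motive := fun a => K.X m →ₗ[Lam k] K.X a) a m LinearMap.id
      (fun a _ f => D a (a + 1) ∘ₗ f) (fun _ _ _ => 0)
  have hE0 : E m = LinearMap.id := Int.inductionOn'_self
  have hE1 : ∀ a, m ≤ a → E (a + 1) = D a (a + 1) ∘ₗ E a := fun a ha =>
    Int.inductionOn'_add_one ha
  -- The string starting at v survives up to degree a: x E_a(v) ≠ 0 says that E_a(v) is not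
  -- divisible by x. A largest such a is the end of the interval.
  let P : ℤ → Prop := fun a => m ≤ a ∧ ∃ v, (DualNumber.eps : Lam k) • E a v ≠ 0
  have hP : ∃ a, P a := by
    refine ⟨m, le_rfl, ?_⟩
    by_contra! h
    apply hm
    rw [ModuleCat.isZero_iff_subsingleton]
    refine ⟨fun v w => ?_⟩
    have key : ∀ v : K.X m, v = 0 := by
      intro v
      have h1 : ∀ v : K.X m, (DualNumber.eps : Lam k) • v = 0 := fun v => by
        have := h v
        rwa [hE0] at this
      obtain ⟨φ, hφ⟩ | ⟨w, hw⟩ := exists_dual_eq_one_or (k := k) v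
      · have h2 := congrArg φ (h1 v)
        rw [map_smul, hφ, map_zero] at h2
        have h3 := congrArg TrivSqZeroExt.snd h2
        simp at h3
      · rw [hw, h1]
    rw [key v, key w]
  have hPb : ∀ a, P a → a ≤ b := by
    rintro a ⟨-, v, hv⟩
    by_contra! h
    have := hb a h
    rw [ModuleCat.isZero_iff_subsingleton] at this
    exact hv (Subsingleton.elim _ _)
  obtain ⟨n, ⟨hmn, v, hv⟩, hn⟩ := Int.exists_greatest_of_bdd ⟨b, hPb⟩ hP
  -- By maximality of n the next multiple x E_{n+1}(v) is zero, so the string ends in a cycle.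
  have hv' : K.d n (n + 1) (E n v) = 0 := by
    rw [hD, ← LinearMap.comp_apply, ← hE1 n hmn]
    by_contra h
    have := hn (n + 1) ⟨by omega, v, h⟩
    omega
  obtain ⟨φ, hφ⟩ | ⟨w, hw⟩ := exists_dual_eq_one_or (k := k) (E n v)
  swap
  · exact absurd (by rw [hw, smul_smul]; simp) hv
  -- The form φ pulled back along D. It takes the value 1 on every member E_a(v) of the string, so F
  -- is a retraction onto the interval spanned by the string.
  let F : ∀ a, K.X a →ₗ[Lam k] Lam k := fun a =>
    Int.inductionOn' (motive := fun a => K.X a →ₗ[Lam k] Lam k) a n φ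
      (fun _ _ _ => 0) (fun a _ f => f ∘ₗ D (a - 1) a)
  have hF0 : F n = φ := Int.inductionOn'_self
  have hF1 : ∀ a, a ≤ n → F (a - 1) = F a ∘ₗ D (a - 1) a := fun a ha =>
    Int.inductionOn'_sub_one ha
  have hF1' : ∀ a, a + 1 ≤ n → F a = F (a + 1) ∘ₗ D a (a + 1) := fun a ha => by
    have := hF1 (a + 1) ha
    have e : a + 1 - 1 = a := by ring
    rw [e] at this
    exact this
  have hFE : ∀ a, a ≤ n → m ≤ a → F a (E a v) = 1 := by
    intro a ha
    refine Int.leInductionDown (motive := fun a _ => m ≤ a → F a (E a v) = 1) (fun _ => ?_)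
      (fun a ha ih h => ?_) a ha
    · rw [hF0, hφ]
    · have := ih (by omega)
      rw [hF1 a ha, LinearMap.comp_apply]
      have h2 := hE1 (a - 1) h
      have e : a - 1 + 1 = a := by ring
      rw [e] at h2
      rw [← LinearMap.comp_apply (D (a - 1) a), ← h2, this]
  let jT : ∀ a, intervalTerm k m n a →ₗ[Lam k] K.X a := fun a =>
    LinearMap.toSpanSingleton (Lam k) (K.X a) (E a v) ∘ₗ (intervalTerm k m n a).subtype
  have hjT : ∀ a w, jT a w = (w : Lam k) • E a v := fun _ _ => rfl
  let pT : ∀ a, K.X a →ₗ[Lam k] intervalTerm k m n a := fun a =>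
    if h : m ≤ a ∧ a ≤ n then LinearMap.codRestrict _ (F a) (fun _ => by simp [intervalTerm, h])
    else 0
  have hpT : ∀ a w, (pT a w : Lam k) = if m ≤ a ∧ a ≤ n then F a w else 0 := by
    intro a w
    by_cases h : m ≤ a ∧ a ≤ n
    · simp only [pT, dif_pos h, if_pos h]; rfl
    · simp only [pT, dif_neg h, if_neg h]; rfl
  have hd : ∀ a, (interval k m n).d a (a + 1) = ModuleCat.ofHom (mulX k m n a (a + 1)) :=
    fun a => if_pos rfl
  let j : interval k m n ⟶ K :=
    { f := fun a => ModuleCat.ofHom (jT a)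
      comm' := by
        intro a c hac
        have hac' : a + 1 = c := hac
        subst hac'
        rw [hd]
        apply ModuleCat.hom_ext
        apply LinearMap.ext
        intro (w : intervalTerm k m n a)
        change K.d a (a + 1) (jT a w) = jT (a + 1) (mulX k m n a (a + 1) w)
        rw [hjT, hjT, mulX_coe, map_smul]
        by_cases h : m ≤ a ∧ a ≤ n
        · by_cases h' : a = n
          · subst h'
            rw [hv', if_neg (by omega)]; simp
          · rw [if_pos (by omega), hD, smul_smul, hE1 a h.1, mul_comm]; rfl
        · rw [intervalTerm_eq_zero h w]; simp }
  let p : K ⟶ interval k m n :=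
    { f := fun a => ModuleCat.ofHom (pT a)
      comm' := by
        intro a c hac
        have hac' : a + 1 = c := hac
        subst hac'
        rw [hd]
        apply ModuleCat.hom_ext
        apply LinearMap.ext
        intro w
        apply Subtype.ext
        change (mulX k m n a (a + 1) (pT a w) : Lam k) = pT (a + 1) (K.d a (a + 1) w)
        rw [mulX_coe, hpT, hpT]
        by_cases h : m ≤ a + 1 ∧ a + 1 ≤ n
        · rw [if_pos h, if_pos h]
          by_cases h' : m ≤ a
          · rw [if_pos (by omega), hD, map_smul, hF1' a h.2]; rfl
          -- Here a = m - 1, where K vanishes because m is its lowest degree.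
          · rw [if_neg (by omega)]
            have e : m - 1 = a := by omega
            rw [e, ModuleCat.isZero_iff_subsingleton] at hm'
            rw [Subsingleton.elim w 0]
            simp
        · rw [if_neg h, if_neg h] }
  refine ⟨n, p, j, hmn, ?_⟩
  ext1 a
  apply ModuleCat.hom_ext
  apply LinearMap.ext
  intro (w : intervalTerm k m n a)
  apply Subtype.ext
  change (pT a (jT a w) : Lam k) = w
  rw [hpT, hjT]
  by_cases h : m ≤ a ∧ a ≤ n
  · rw [if_pos h, map_smul, hFE a h.2 h.1]; simp
  · rw [intervalTerm_eq_zero h w, if_neg h]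

/-- Every bounded complex of finitely generated projective modules over the dual numbers is a
direct sum of interval complexes in the homotopy category. -/
theorem exists_decomposition (X : PerfectComplex (Lam k)) :
    Nonempty (Decomposition (perf (Lam k)) (fun I : ℤ × ℤ => intervalPerf k I.1 I.2) X) := by
  obtain ⟨a, b, hab⟩ := X.bounded
  suffices h : ∀ N : ℕ, ∀ X : PerfectComplex (Lam k),
      (∀ i, (i < a ∨ b < i) → Limits.IsZero (X.cx.X i)) →
      ∑ i ∈ Finset.Icc a b, Module.finrank (Lam k) (X.cx.X i) ≤ N →
      Nonempty (Decomposition (perf (Lam k)) (fun I : ℤ × ℤ => intervalPerf k I.1 I.2) X) from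
    h _ X hab le_rfl
  clear hab X
  intro N
  induction N using Nat.strong_induction_on with
  | _ N ih =>
  intro X hX hN
  have hfin := X.finite
  have hproj := X.projective
  have hfree : ∀ i, Module.Free (Lam k) (X.cx.X i) := fun i => free_of_projective
  by_cases h0 : ∀ i, Limits.IsZero (X.cx.X i)
  · have hid : 𝟙 (perf (Lam k) X) = 0 := by
      have h1 : 𝟙 X.cx = 0 := by
        ext1 i
        exact (h0 i).eq_of_src _ _
      change 𝟙 ((toHo (Lam k)).obj X.cx) = 0
      rw [← (toHo (Lam k)).map_id, h1, Functor.map_zero]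
    exact ⟨{ size := 0, idx := Fin.elim0, inj := fun a => Fin.elim0 a, proj := fun a => Fin.elim0 a
             sum_eq := by rw [hid]; simp }⟩
  push Not at h0
  -- A nonzero idempotent that agrees in the homotopy category with a map through an interval can be
  -- split off; the complement has smaller total rank, so the induction applies to it.
  have step : ∀ (m n : ℤ) (p : X.cx ⟶ interval k m n) (j : interval k m n ⟶ X.cx)
      (ε : X.cx ⟶ X.cx), ε ≫ ε = ε → (toHo (Lam k)).map ε = (toHo (Lam k)).map (p ≫ j) →
      (∃ i, ε.f i ≠ 0) →
      Nonempty (Decomposition (perf (Lam k)) (fun I : ℤ × ℤ => intervalPerf k I.1 I.2) X) := by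
    rintro m n p j ε hε hpj ⟨i, hi⟩
    obtain ⟨Y, q, l, h1, h2, h3, h4⟩ := exists_complement X ε hε
    have hlt : ∑ i ∈ Finset.Icc a b, Module.finrank (Lam k) (Y.cx.X i) <
        ∑ i ∈ Finset.Icc a b, Module.finrank (Lam k) (X.cx.X i) := by
      refine Finset.sum_lt_sum (fun i _ => h3 i) ⟨i, ?_, h4 i hi⟩
      by_contra hi'
      exact hi ((hX i (by simp at hi'; omega)).eq_of_src _ _)
    obtain ⟨d⟩ := ih _ (hlt.trans_le hN) Y (fun i hi => h2 i (hX i hi)) le_rfl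
    refine homotopic_sum d q l p j ?_
    rw [← hpj, ← Functor.map_add, h1, CategoryTheory.Functor.map_id]
  by_cases hmin : ∀ i (v : X.cx.X i), ∃ w, X.cx.d i (i + 1) v = (DualNumber.eps : Lam k) • w
  · obtain ⟨m, hm, hm'⟩ := Int.exists_least_of_bdd (P := fun i => ¬Limits.IsZero (X.cx.X i))
      ⟨a, fun i hi => by
        by_contra! h
        exact hi (hX i (Or.inl h))⟩ h0
    have hm1 : Limits.IsZero (X.cx.X (m - 1)) := by
      by_contra h
      have := hm' _ h
      omega
    obtain ⟨n, p, j, hmn, hjp⟩ := exists_interval hfin hproj hm hm1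
      (fun i hi => hX i (Or.inr hi)) hmin
    refine step m n p j (p ≫ j) ?_ rfl ⟨m, fun h => ?_⟩
    · rw [Category.assoc, reassoc_of% hjp]
    · have h1 : j ≫ (p ≫ j) ≫ p = 𝟙 _ := by simp [hjp]
      have h2 := congrArg (fun f : interval k m n ⟶ interval k m n =>
        HomologicalComplex.Hom.f f m) h1
      simp only [HomologicalComplex.comp_f] at h2 h
      rw [h] at h2
      have h3 := congrArg coef h2
      rw [Limits.zero_comp, Limits.comp_zero, coef_zero] at h3
      have h4 := coef_id (k := k) m n m
      rw [if_pos (by omega)] at h4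
      exact zero_ne_one (h3.trans h4)
  · push Not at hmin
    obtain ⟨i, v, hv⟩ := hmin
    obtain ⟨φ, hφ⟩ | ⟨w, hw⟩ := exists_dual_eq_one_or (k := k) (X.cx.d i (i + 1) v)
    · obtain ⟨ε, h1, h2, h3⟩ := exists_contractible v φ hφ
      -- A contractible summand is zero in the homotopy category, so zero maps through Λ^{[0,0]}
      -- account for it.
      exact step 0 0 0 0 ε h1 (by rw [h2]; simp) ⟨_, h3⟩
    · exact absurd hw (hv w)

end Decompose

/-! ### Calculus in the orbit category of the interval complexes -/

section IntervalCalculus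

variable {k : Type u} [Field k] {m n m' n' m'' n'' t : ℤ}

/-- The degree `t` morphisms between two interval complexes in the homotopy category. -/
abbrev IvHom (k : Type u) [Field k] (m n m' n' t : ℤ) : Type _ :=
  ShiftedHom (perf (Lam k) (intervalPerf k m n)) (perf (Lam k) (intervalPerf k m' n')) t

variable (k m n m' n' t) in
/-- `cls` as an additive map. -/
def clsHom : cocycles k m n m' n' t →+ IvHom k m n m' n' t := AddMonoidHom.mk' cls cls_add

lemma cls_eq_iff (c d : cocycles k m n m' n' t) : cls c = cls d ↔ cls (c - d) = 0 := by
  have : cls (c - d) = cls c - cls d := map_sub (clsHom k m n m' n' t) c d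
  rw [this, sub_eq_zero]

lemma cls_zero : cls (0 : cocycles k m n m' n' t) = 0 := map_zero (clsHom k m n m' n' t)

lemma fst_eq_of_cls_eq {c d : cocycles k m n m' n' t} (h : cls c = cls d) (i : ℤ) :
    (c.1 i).fst = (d.1 i).fst := by
  have := ((cls_eq_zero_iff _).1 ((cls_eq_iff c d).1 h)).1 i
  exact sub_eq_zero.1 this

lemma neg_one_zpow_mul_self (t : ℤ) : (-1 : k) ^ t * (-1 : k) ^ t = 1 := by
  rw [← mul_zpow]; simp

lemma neg_one_zpow_eq_or (t : ℤ) : (-1 : k) ^ t = 1 ∨ (-1 : k) ^ t = -1 := by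
  obtain h | h := Int.even_or_odd t
  · exact Or.inl h.neg_one_zpow
  · exact Or.inr h.neg_one_zpow

lemma units_smul_cls (u : ℤ) (c : cocycles k m n m' n' t) : ∃ d : cocycles k m n m' n' t,
    u.negOnePow • cls c = cls d ∧ ∀ i, d.1 i = (-1 : k) ^ u • c.1 i := by
  obtain h | h := Int.even_or_odd u
  · exact ⟨c, by rw [Int.negOnePow_even _ h, one_smul], fun i => by rw [h.neg_one_zpow, one_smul]⟩
  · refine ⟨-c, ?_, fun i => by rw [h.neg_one_zpow, neg_one_smul]; rfl⟩
    rw [Int.negOnePow_odd _ h]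
    have : cls (-c) = -cls c := map_neg (clsHom k m n m' n' t) c
    rw [this]; simp

/-- The leading coefficients of a morphism. -/
def scal (f : IvHom k m n m' n' t) (i : ℤ) : k :=
  ((Function.surjInv cls_surjective f).1 i).fst

lemma scal_cls (c : cocycles k m n m' n' t) (i : ℤ) : scal (cls c) i = (c.1 i).fst :=
  fst_eq_of_cls_eq (Function.surjInv_eq _ _) i

lemma scal_add (f g : IvHom k m n m' n' t) (i : ℤ) : scal (f + g) i = scal f i + scal g i := by
  obtain ⟨c, rfl⟩ := cls_surjective f
  obtain ⟨d, rfl⟩ := cls_surjective g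
  rw [← cls_add, scal_cls, scal_cls, scal_cls]
  rfl

lemma scal_comp {t' t'' : ℤ} (f : IvHom k m n m' n' t) (g : IvHom k m' n' m'' n'' t')
    (h : t' + t = t'') (i : ℤ) : scal (f.comp g h) i = scal g (i + t) * scal f i := by
  obtain ⟨c, rfl⟩ := cls_surjective f
  obtain ⟨d, rfl⟩ := cls_surjective g
  rw [cls_comp, scal_cls, scal_cls, scal_cls]
  simp

lemma scal_units_smul (u : ℤ) (f : IvHom k m n m' n' t) (i : ℤ) :
    scal (u.negOnePow • f) i = (-1) ^ u * scal f i := by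
  obtain ⟨c, rfl⟩ := cls_surjective f
  obtain ⟨d, hd, hd'⟩ := units_smul_cls u c
  rw [hd, scal_cls, scal_cls, hd']
  simp

lemma scal_zero (i : ℤ) : scal (0 : IvHom k m n m' n' t) i = 0 := by
  rw [← cls_zero, scal_cls]; rfl

lemma scal_eq_zero (f : IvHom k m n m' n' t) {i : ℤ}
    (h : ¬(m ≤ i ∧ i ≤ n ∧ m' ≤ i + t ∧ i + t ≤ n')) : scal f i = 0 := by
  obtain ⟨c, rfl⟩ := cls_surjective f
  rw [scal_cls, c.2.1 i h]
  rfl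

lemma fst_shift (c : cocycles k m n m' n' t) (l : ℕ) {i : ℤ} (h : m ≤ i) (h' : i + l + t ≤ n') :
    (c.1 (i + l)).fst = ((-1) ^ t) ^ l * (c.1 i).fst := by
  induction l with
  | zero => simp
  | succ l ih =>
    have h1 := c.2.2 (i + l) (by omega) (by push_cast at h'; omega)
    push_cast
    rw [← add_assoc, h1, ih (by push_cast at h'; omega), pow_succ]
    ring

lemma scal_shift (f : IvHom k m n m' n' t) (l : ℕ) {i : ℤ} (h : m ≤ i) (h' : i + l + t ≤ n') :
    scal f (i + l) = ((-1) ^ t) ^ l * scal f i := by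
  obtain ⟨c, rfl⟩ := cls_surjective f
  rw [scal_cls, scal_cls, fst_shift c l h h']

/-- The solution of a first order recursion. -/
lemma exists_recursion (g : ℤ → k) (v : k) (a : ℤ) :
    ∃ h : ℤ → k, h a = 0 ∧ ∀ i, a ≤ i → h (i + 1) = g i - v * h i :=
  ⟨fun i => Int.inductionOn' (motive := fun _ => k) i a 0 (fun i _ y => g i - v * y)
    (fun _ _ _ => 0), Int.inductionOn'_self, fun _ hi => Int.inductionOn'_add_one hi⟩

variable (k) in
lemma ξ_mem (m n m' n' t : ℤ) (i₀ : ℤ) (a : k) :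
    (fun i => if i = i₀ ∧ m ≤ i ∧ i ≤ n ∧ m' ≤ i + t ∧ i + t ≤ n' then
      (TrivSqZeroExt.inr a : Lam k) else 0) ∈ cocycles k m n m' n' t := by
  refine ⟨fun i hi => if_neg (by tauto), fun i _ _ => ?_⟩
  simp only
  split_ifs <;> simp

/-- Multiplication by `a x` in degree `i₀`, as a morphism of degree `t`. -/
def ξ (m n m' n' t : ℤ) (i₀ : ℤ) (a : k) : cocycles k m n m' n' t := ⟨_, ξ_mem k m n m' n' t i₀ a⟩

lemma ξ_apply (m n m' n' t : ℤ) (i₀ : ℤ) (a : k) (i : ℤ) : (ξ m n m' n' t i₀ a).1 i =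
    if i = i₀ ∧ m ≤ i ∧ i ≤ n ∧ m' ≤ i + t ∧ i + t ≤ n' then TrivSqZeroExt.inr a else 0 := rfl

lemma xClass_eq (m n : ℤ) (a : k) : xClass k m n a = cls (ξ m n m n 0 n a) := by
  rw [← cls_x]
  congr 1
  ext1
  funext i
  rw [ξ_apply]
  have : (m ≤ i ∧ i = n) ↔ (i = n ∧ m ≤ i ∧ i ≤ n ∧ m ≤ i + 0 ∧ i + 0 ≤ n) := by omega
  simp only [this]
  split_ifs
  · ext <;> simp
  · rfl

/-- Morphisms of degree `t > 0` of an interval complex are determined by the leading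
coefficients. -/
lemma cls_eq_zero_of_pos (ht : 0 < t) (c : cocycles k m n m n t) (hc : ∀ i, (c.1 i).fst = 0) :
    cls c = 0 := by
  rw [cls_eq_zero_iff]
  refine ⟨hc, ?_⟩
  -- The coefficients live in m ≤ i ≤ n - t, and the recursion produces h up to degree n - t + 1.
  -- Since t > 0, this is at most n, so all these values are allowed in a homotopy and no end
  -- condition remains.
  obtain ⟨h, h0, h1⟩ := exists_recursion (fun i => (c.1 i).snd) ((-1) ^ t) m
  refine ⟨fun i => if m ≤ i ∧ i ≤ n ∧ m ≤ i + t - 1 ∧ i + t - 1 ≤ n then h i else 0,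
    fun i hi => if_neg hi, fun i h2 h3 h4 h5 => ?_⟩
  simp only
  rw [if_pos (by omega), if_pos (by omega), h1 i h2]
  ring

/-- For t ≤ 0 a homotopy lives in m - t < i ≤ n, one degree fewer than the coefficients. The
recursion removes all coefficients of x but the last one, in degree n. -/
lemma cls_eq_ξ_of_nonpos (ht : t ≤ 0) (c : cocycles k m n m n t) (hc : ∀ i, (c.1 i).fst = 0) :
    ∃ a, cls c = cls (ξ m n m n t n a) := by
  obtain ⟨h, h0, h1⟩ := exists_recursion (fun i => (c.1 i).snd) ((-1) ^ t) (m - t)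
  by_cases hmn : m - t ≤ n
  · refine ⟨(c.1 n).snd - (-1) ^ t * h n, ?_⟩
    rw [cls_eq_iff, cls_eq_zero_iff]
    refine ⟨fun i => ?_, fun i => if m - t < i ∧ i ≤ n then h i else 0,
      fun i hi => if_neg (by omega), fun i h2 h3 h4 h5 => ?_⟩
    · change (c.1 i - (ξ m n m n t n _).1 i).fst = 0
      rw [TrivSqZeroExt.fst_sub, hc, ξ_apply]
      split_ifs <;> simp
    · change (c.1 i - (ξ m n m n t n _).1 i).snd = _
      rw [TrivSqZeroExt.snd_sub, ξ_apply]
      have h6 : (if m - t < i ∧ i ≤ n then h i else 0) = h i := by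
        split_ifs with h7
        · rfl
        · rw [show i = m - t by omega, h0]
      simp only [h6]
      by_cases hi : i = n
      · subst hi
        rw [if_pos (by omega), if_neg (by omega)]
        simp
      · rw [if_neg (by omega), if_pos (by omega), h1 i (by omega)]
        simp
  · refine ⟨0, congrArg cls ?_⟩
    ext1
    funext i
    rw [c.2.1 i (by omega), ξ_apply]
    split_ifs <;> simp

/-- The coefficient in degree m - t - 1 vanishes because its target degree is m - 1. As m - t - 1 ≥
m, the geometric relation already holds from there and carries the zero to all higher degrees. -/
lemma fst_eq_zero_of_neg (ht : t < 0) (c : cocycles k m n m n t) (i : ℤ) : (c.1 i).fst = 0 := by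
  by_cases h : m - t ≤ i ∧ i ≤ n
  · obtain ⟨l, hl⟩ := Int.eq_ofNat_of_zero_le (show 0 ≤ i - (m - t - 1) by omega)
    have h1 := fst_shift c l (i := m - t - 1) (by omega) (by omega)
    rw [c.2.1 (m - t - 1) (by omega), ← hl, add_sub_cancel] at h1
    simpa using h1
  · rw [c.2.1 i (by omega)]; rfl

/-- Endomorphisms of negative degree of an interval complex. -/
lemma exists_eq_ξ_of_neg (ht : t < 0) (f : IvHom k m n m n t) :
    ∃ a, f = cls (ξ m n m n t n a) := by
  obtain ⟨c, rfl⟩ := cls_surjective f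
  exact cls_eq_ξ_of_nonpos ht.le c (fst_eq_zero_of_neg ht c)

/-- Endomorphisms of degree `0` of an interval complex. -/
lemma exists_eq_xClass (f : IvHom k m n m n 0) (h : scal f m = 0) : ∃ a, f = xClass k m n a := by
  obtain ⟨c, rfl⟩ := cls_surjective f
  rw [scal_cls] at h
  simp only [xClass_eq]
  refine cls_eq_ξ_of_nonpos le_rfl c fun i => ?_
  by_cases hi : m ≤ i ∧ i ≤ n
  · obtain ⟨l, hl⟩ := Int.eq_ofNat_of_zero_le (show 0 ≤ i - m by omega)
    have h1 := fst_shift c l (i := m) le_rfl (by omega)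
    rw [h, ← hl, add_sub_cancel] at h1
    simpa using h1
  · rw [c.2.1 i (by omega)]; rfl

lemma eq_zero_of_pos (ht : 0 < t) (f : IvHom k m n m n t) (h : scal f m = 0) : f = 0 := by
  obtain ⟨c, rfl⟩ := cls_surjective f
  rw [scal_cls] at h
  refine cls_eq_zero_of_pos ht c fun i => ?_
  by_cases hi : m ≤ i ∧ i + t ≤ n
  · obtain ⟨l, hl⟩ := Int.eq_ofNat_of_zero_le (show 0 ≤ i - m by omega)
    have h1 := fst_shift c l (i := m) le_rfl (by omega)
    rw [h, ← hl, add_sub_cancel] at h1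
    simpa using h1
  · rw [c.2.1 i (by omega)]; rfl

lemma ivHom_eq_zero_of_lt (h : n < m) (f : IvHom k m n m' n' t) : f = 0 := by
  obtain ⟨c, rfl⟩ := cls_surjective f
  rw [← cls_zero]
  congr 1
  ext1
  funext i
  exact c.2.1 i (by omega)

/-! ### Linear forms -/

lemma sum_Icc_telescope (g : ℤ → k) (h : m ≤ n + 1) :
    ∑ i ∈ Finset.Icc m n, (g (i + 1) - g i) = g (n + 1) - g m := by
  obtain ⟨l, hl⟩ := Int.eq_ofNat_of_zero_le (show 0 ≤ n + 1 - m by omega)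
  induction l generalizing n with
  | zero =>
    rw [Finset.Icc_eq_empty (by push_cast at hl; omega), show n + 1 = m by push_cast at hl; omega]
    simp
  | succ l ih =>
    have h1 := ih (n := n - 1) (by push_cast at hl; omega) (by push_cast at hl; omega)
    have h2 : Finset.Icc m n = insert n (Finset.Icc m (n - 1)) := by
      ext i
      simp only [Finset.mem_Icc, Finset.mem_insert]
      push_cast at hl
      omega
    rw [h2, Finset.sum_insert (by simp), h1]
    ring_nf

/-- The alternating sum of the coefficients of `x`. -/
def altSum (m n t : ℤ) (c : ℤ → Lam k) : k :=
  ∑ i ∈ Finset.Icc m n, ((-1) ^ (t + 1)) ^ i * (c i).snd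

lemma altSum_add (c d : ℤ → Lam k) : altSum m n t (c + d) = altSum m n t c + altSum m n t d := by
  simp [altSum, mul_add, Finset.sum_add_distrib]

/-- The sign turns h(i + 1) + (-1)^t h(i) into a telescoping difference. The boundary terms vanish:
h(m) because m + t - 1 < m', and h(n + 1) because n + 1 lies outside the source. -/
lemma altSum_eq_zero (hm : m + t ≤ m') (hn : n + t ≤ n') (c : cocycles k m n m' n' t)
    (h : cls c = 0) : altSum m n t c.1 = 0 := by
  obtain ⟨h0, h, h1, h2⟩ := (cls_eq_zero_iff c).1 h
  by_cases hmn : m ≤ n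
  · have key : ∀ i ∈ Finset.Icc m n, ((-1 : k) ^ (t + 1)) ^ i * (c.1 i).snd =
        ((-1) ^ (t + 1)) ^ (i + 1 - 1) * h (i + 1) - ((-1) ^ (t + 1)) ^ (i - 1) * h i := by
      intro i hi
      rw [Finset.mem_Icc] at hi
      have h3 : (c.1 i).snd = h (i + 1) + (-1) ^ t * h i := by
        by_cases hi' : m' ≤ i + t
        · exact h2 i hi.1 hi.2 hi' (by omega)
        · rw [c.2.1 i (by omega), h1 i (by omega), h1 (i + 1) (by omega)]; simp
      have h4 : ((-1 : k) ^ (t + 1)) ^ (i - 1) = -(((-1) ^ (t + 1)) ^ i * (-1) ^ t) := by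
        have h5 : (-1 : k) ^ (t + 1) ≠ 0 := zpow_ne_zero _ (by simp)
        rw [zpow_sub_one₀ h5, zpow_add_one₀ (by simp)]
        obtain h6 | h6 := neg_one_zpow_eq_or (k := k) t <;> rw [h6] <;> simp
      rw [h3, h4, add_sub_cancel_right]
      ring
    rw [altSum, Finset.sum_congr rfl key,
      sum_Icc_telescope (fun i => ((-1 : k) ^ (t + 1)) ^ (i - 1) * h i) (by omega),
      h1 m (by omega), h1 (n + 1) (by omega)]
    simp
  · rw [altSum, Finset.Icc_eq_empty hmn]; simp

lemma altSum_ξ (hm : m ≤ n) (h1 : m' ≤ n + t) (h2 : n + t ≤ n') (a : k) :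
    altSum m n t (ξ m n m' n' t n a).1 = ((-1) ^ (t + 1)) ^ n * a := by
  rw [altSum, Finset.sum_eq_single_of_mem n (by simp [hm])]
  · rw [ξ_apply, if_pos ⟨rfl, hm, le_rfl, h1, h2⟩]; simp
  · intro i _ hi
    rw [ξ_apply, if_neg (by tauto)]; simp

/-! ### The graded center -/

lemma center_block {η : ∀ X, ShiftedHom (perf (Lam k) X) (perf (Lam k) X) t}
    (hη : η ∈ gradedCenter (perf (Lam k)) t) {j q : ℤ} (f : IvHom k m n m' n' j) (hq : t + j = q) :
    (η (intervalPerf k m n)).comp f ((add_comm j t).trans hq) =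
      (t * j).negOnePow • f.comp (η (intervalPerf k m' n')) hq :=
  comp_center_comm hη f hq

lemma one_mem_truncate (m n n' : ℤ) (h : n' ≤ n) :
    (fun i => if m ≤ i ∧ i ≤ n' then (1 : Lam k) else 0) ∈ cocycles k m n m n' 0 := by
  refine ⟨fun i hi => if_neg (by omega), fun i h h' => ?_⟩
  simp only
  rw [if_pos (by omega), if_pos (by omega)]
  simp

lemma one_mem_extend (m m' n : ℤ) (h : m' ≤ m) :
    (fun i => if m ≤ i ∧ i ≤ n then (1 : Lam k) else 0) ∈ cocycles k m n m' n 0 := by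
  refine ⟨fun i hi => if_neg (by omega), fun i h h' => ?_⟩
  simp only
  rw [if_pos (by omega), if_pos (by omega)]
  simp

/-- The projection `Λ^{[m,n]} ⟶ Λ^{[m,n']}`, for `n' ≤ n`. -/
def truncate (m n n' : ℤ) (h : n' ≤ n) : cocycles k m n m n' 0 := ⟨_, one_mem_truncate m n n' h⟩

lemma truncate_apply (m n n' : ℤ) (h : n' ≤ n) (i : ℤ) :
    (truncate (k := k) m n n' h).1 i = if m ≤ i ∧ i ≤ n' then 1 else 0 := rfl

/-- The inclusion `Λ^{[m,n]} ⟶ Λ^{[m',n]}`, for `m' ≤ m`. -/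
def extend (m m' n : ℤ) (h : m' ≤ m) : cocycles k m n m' n 0 := ⟨_, one_mem_extend m m' n h⟩

lemma extend_apply (m m' n : ℤ) (h : m' ≤ m) (i : ℤ) :
    (extend (k := k) m m' n h).1 i = if m ≤ i ∧ i ≤ n then 1 else 0 := rfl

/-- The graded center vanishes in negative degrees. -/
lemma center_neg (ht : t < 0) {η : ∀ X, ShiftedHom (perf (Lam k) X) (perf (Lam k) X) t}
    (hη : η ∈ gradedCenter (perf (Lam k)) t) : η = 0 := by
  refine center_eq_zero exists_decomposition hη fun I => ?_
  obtain ⟨m, n⟩ := I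
  change η (intervalPerf k m n) = 0
  by_cases hmn : m - 1 ≤ n
  swap
  · exact ivHom_eq_zero_of_lt (by omega) _
  induction n, hmn using Int.leInduction with
  | base => exact ivHom_eq_zero_of_lt (by omega) _
  | succ n hmn ih =>
    obtain ⟨a, ha⟩ := exists_eq_ξ_of_neg ht (η (intervalPerf k m (n + 1)))
    -- By induction η vanishes on [m,n], so η on [m,n+1] followed by the truncation is
    -- null-homotopic. As t < 0, the truncation keeps the target degree n + 1 + t of the multiple of
    -- x, and the alternating sum reads off a = 0.
    have h1 := center_block hη (cls (truncate m (n + 1) n (by omega))) (add_zero t)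
    rw [ih, ShiftedHom.comp_zero, smul_zero, ha, cls_comp] at h1
    by_cases hn : m ≤ n + 1 + t
    · have h2 := altSum_eq_zero (by omega) (by omega) _ h1
      have h3 := altSum_ξ (k := k) (m := m) (n := n + 1) (m' := m) (n' := n) (t := t)
        (by omega) hn (by omega) a
      have h4 : (fun i => (if m ≤ i + t ∧ i + t ≤ n then (1 : Lam k) else 0) *
          (ξ m (n + 1) m (n + 1) t (n + 1) a).1 i) = (ξ m (n + 1) m n t (n + 1) a).1 := by
        funext i
        rw [ξ_apply, ξ_apply]
        split_ifs <;> first | omega | simp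
      change altSum m (n + 1) t (fun i => (if m ≤ i + t ∧ i + t ≤ n then (1 : Lam k) else 0) *
          (ξ m (n + 1) m (n + 1) t (n + 1) a).1 i) = 0 at h2
      rw [h4, h3] at h2
      have h5 : a = 0 := by
        refine (mul_eq_zero.1 h2).resolve_left ?_
        exact zpow_ne_zero _ (zpow_ne_zero _ (by simp))
      rw [ha, h5, ← cls_zero]
      congr 1
      ext1
      funext i
      rw [ξ_apply]
      split_ifs <;> simp
    · rw [ha, ← cls_zero]
      congr 1
      ext1
      funext i
      rw [ξ_apply, if_neg (by omega)]
      rfl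

/-- The leading coefficients of a central element on an interval complex and on a longer one. -/
lemma center_scal_extend {η : ∀ X, ShiftedHom (perf (Lam k) X) (perf (Lam k) X) t}
    (hη : η ∈ gradedCenter (perf (Lam k)) t) (h : m' ≤ m) (ht : 0 ≤ t) (hn : m + t ≤ n) :
    scal (η (intervalPerf k m' n)) m = scal (η (intervalPerf k m n)) m := by
  have h1 := center_block hη (cls (extend m m' n h)) (add_zero t)
  have h2 := congrArg (fun f => scal f m) h1
  simp only [mul_zero, Int.negOnePow_zero, one_smul] at h2
  rw [scal_comp, scal_comp, scal_cls, scal_cls, extend_apply, extend_apply, if_pos (by omega),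
    if_pos (by omega)] at h2
  simpa using h2.symm

/-- The coefficient at m is unchanged when the interval is prolonged to the left, and in the longer
interval it is up to sign the coefficient at m'. -/
lemma center_scal_eq_zero {η : ∀ X, ShiftedHom (perf (Lam k) X) (perf (Lam k) X) t}
    (hη : η ∈ gradedCenter (perf (Lam k)) t) (ht : 0 ≤ t) (h : m' ≤ m) (hn : m + t ≤ n)
    (h0 : scal (η (intervalPerf k m' n)) m' = 0) : scal (η (intervalPerf k m n)) m = 0 := by
  rw [← center_scal_extend hη h ht hn]
  obtain ⟨l, hl⟩ := Int.eq_ofNat_of_zero_le (show 0 ≤ m - m' by omega)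
  have h1 := scal_shift (η (intervalPerf k m' n)) l (i := m') le_rfl (by omega)
  rw [h0, ← hl, add_sub_cancel] at h1
  simpa using h1

/-- A central element of positive degree vanishes once its leading coefficients vanish on all
sufficiently long interval complexes. -/
lemma center_eq_zero_of_long {η : ∀ X, ShiftedHom (perf (Lam k) X) (perf (Lam k) X) t}
    (hη : η ∈ gradedCenter (perf (Lam k)) t) (ht : 0 < t) (N : ℤ)
    (h : ∀ m n, m + N ≤ n → scal (η (intervalPerf k m n)) m = 0) : η = 0 := by
  refine center_eq_zero exists_decomposition hη fun I => ?_
  obtain ⟨m, n⟩ := I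
  refine eq_zero_of_pos ht (η (intervalPerf k m n)) ?_
  by_cases hn : m + t ≤ n
  -- The interval is prolonged to the left until it has length at least N.
  · exact center_scal_eq_zero hη ht.le (m' := min m (n - N)) (min_le_left _ _) hn
      (h _ _ (by have := min_le_right m (n - N); omega))
  · exact scal_eq_zero _ (by omega)

variable (k) in
lemma Y_mem (m n : ℤ) {t : ℤ} (ht : 0 ≤ t) (a : k) : (fun i => if m ≤ i ∧ i + t ≤ n then
    (TrivSqZeroExt.inl (((-1) ^ t) ^ i * a) : Lam k) else 0) ∈ cocycles k m n m n t := by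
  refine ⟨fun i hi => if_neg (by omega), fun i h h' => ?_⟩
  simp only
  rw [if_pos (by omega), if_pos (by omega), TrivSqZeroExt.fst_inl, TrivSqZeroExt.fst_inl,
    zpow_add_one₀ (zpow_ne_zero _ (by simp))]
  ring

/-- The endomorphism of degree `t` of an interval complex with the leading coefficient `a`. -/
def Y (m n : ℤ) {t : ℤ} (ht : 0 ≤ t) (a : k) : cocycles k m n m n t := ⟨_, Y_mem k m n ht a⟩

lemma Y_apply (m n : ℤ) {t : ℤ} (ht : 0 ≤ t) (a : k) (i : ℤ) : (Y m n ht a).1 i =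
    if m ≤ i ∧ i + t ≤ n then TrivSqZeroExt.inl (((-1) ^ t) ^ i * a) else 0 := rfl

/-- The graded center vanishes in odd degrees, for `char k ≠ 2`. -/
lemma center_odd (h2 : (2 : k) ≠ 0) (ht : Odd t)
    {η : ∀ X, ShiftedHom (perf (Lam k) X) (perf (Lam k) X) t}
    (hη : η ∈ gradedCenter (perf (Lam k)) t) : η = 0 := by
  obtain ht' | ht' := lt_or_ge t 0
  · exact center_neg ht' hη
  have ht0 : 0 < t := by
    obtain ⟨a, ha⟩ := ht
    omega
  refine center_eq_zero_of_long hη ht0 (t + 1) fun m n hn => ?_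
  -- Commutation with a map of degree 1, compared at the leading coefficient in degree m: for odd t
  -- the two sides differ by a sign. The bound t + 1 makes room for a composite of this degree.
  have h1 := center_block hη (cls (Y m n zero_le_one 1)) rfl
  have h3 := congrArg (fun f => scal f m) h1
  rw [scal_units_smul, scal_comp, scal_comp, scal_cls, scal_cls, Y_apply, Y_apply, if_pos (by omega), if_pos (by omega), mul_one] at h3
  have h4 := scal_shift (η (intervalPerf k m n)) 1 (i := m) le_rfl (by push_cast; omega)
  rw [Nat.cast_one] at h4
  rw [h4, ht.neg_one_zpow] at h3
  simp only [TrivSqZeroExt.fst_inl, mul_one, zpow_one, pow_one] at h3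
  rw [zpow_add₀ (by simp), ht.neg_one_zpow] at h3
  have h5 : (2 : k) * (-1) ^ m * scal (η (intervalPerf k m n)) m = 0 := by
    linear_combination -h3
  refine (mul_eq_zero.1 h5).resolve_left (mul_ne_zero h2 (zpow_ne_zero _ (by simp)))

end IntervalCalculus

/-! ### Traces of powers of matrices in positive characteristic -/

section MatrixTrace

open Polynomial Matrix

variable {k : Type*} [Field k] (p : ℕ) [Fact p.Prime] [CharP k p] {n : Type*} [DecidableEq n]
  [Fintype n]

/-- Since X and M commute, X^{p^r} - M^{p^r} = (X - M)^{p^r} in characteristic p; take determinants.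
-/
lemma expand_charpoly_pow (M : Matrix n n k) (r : ℕ) [Nonempty n] :
    expand k (p ^ r) (M ^ p ^ r).charpoly = M.charpoly ^ p ^ r := by
  unfold Matrix.charpoly
  rw [AlgHom.map_det, ← coe_detMonoidHom, ← (detMonoidHom : Matrix n n k[X] →* k[X]).map_pow]
  apply congr_arg det
  refine matPolyEquiv.injective ?_
  rw [map_pow, matPolyEquiv_charmatrix, sub_pow_char_pow_of_commute, ← C_pow]
  · exact (id (matPolyEquiv_eq_X_pow_sub_C (p ^ r) M) :)
  · exact (C M).commute_X

/-- The trace is minus the coefficient of the characteristic polynomial in degree one less than the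
top. Compare this coefficient in `expand_charpoly_pow`, where the p^r-th power of a polynomial
raises its coefficients to the p^r-th power and expands. -/
lemma trace_pow_char_pow (M : Matrix n n k) (r : ℕ) :
    trace (M ^ p ^ r) = trace M ^ p ^ r := by
  have hp : 0 < p ^ r := pow_pos (Fact.out : p.Prime).pos r
  cases isEmpty_or_nonempty n
  · simp [Matrix.trace, zero_pow hp.ne']
  rw [Matrix.trace_eq_neg_charpoly_coeff, Matrix.trace_eq_neg_charpoly_coeff, neg_pow,
    neg_one_pow_expChar_pow k p r, neg_one_mul]
  congr 1
  have h := congrArg (fun P => coeff P ((Fintype.card n - 1) * p ^ r)) (expand_charpoly_pow p M r)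
  rw [coeff_expand_mul hp, ← map_iterateFrobenius_expand, coeff_map, coeff_expand_mul hp,
    iterateFrobenius_def] at h
  exact h

end MatrixTrace

/-! ### Degrees in which all endomorphisms are sums of commutators. -/

section Commutators

variable {k : Type u} [Field k] {m n m' n' m'' n'' t : ℤ}

open Classical in
/-- An endomorphism of an interval complex, as an element of `⊕ End`. -/
def blk (f : IvHom k m n m n t) : EndSum (perf (Lam k)) t := DFinsupp.single (intervalPerf k m n) f

open Classical in
lemma blk_add (f g : IvHom k m n m n t) : blk (f + g) = blk f + blk g := DFinsupp.single_add _ _ _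

open Classical in
lemma blk_zero : blk (0 : IvHom k m n m n t) = 0 := DFinsupp.single_zero _

open Classical in
lemma blk_units_smul (u : ℤˣ) (f : IvHom k m n m n t) : blk (u • f) = u • blk f := by
  obtain rfl | rfl := Int.units_eq_one_or u
  · simp
  · simp only [Units.neg_smul, one_smul]
    exact DFinsupp.single_neg _ _

lemma blk_commutator {i j : ℤ} (hij : i + j = t) (f : IvHom k m n m' n' i)
    (g : IvHom k m' n' m n j) :
    blk (f.comp g ((add_comm j i).trans hij)) - (i * j).negOnePow • blk (g.comp f hij) ∈
      commutators (perf (Lam k)) t := commutator_mem hij f g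

lemma blk_mem_of_comm {i j : ℤ} (hij : i + j = t) (f : IvHom k m n m' n' i)
    (g : IvHom k m' n' m n j) (h : blk (g.comp f hij) ∈ commutators (perf (Lam k)) t) :
    blk (f.comp g ((add_comm j i).trans hij)) ∈ commutators (perf (Lam k)) t := by
  have := add_mem (blk_commutator hij f g) (units_smul_mem (i * j).negOnePow h)
  rwa [sub_add_cancel] at this

lemma commutators_eq_top_of_intervals
    (h : ∀ m n (f : IvHom k m n m n t), blk f ∈ commutators (perf (Lam k)) t) :
    commutators (perf (Lam k)) t = ⊤ :=
  commutators_eq_top exists_decomposition fun j f => h j.1 j.2 f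

/-- Endomorphisms of positive degree of an interval complex. -/
lemma exists_eq_Y (ht : 0 < t) (f : IvHom k m n m n t) : ∃ a, f = cls (Y m n ht.le a) := by
  refine ⟨((-1) ^ t) ^ m * scal f m, ?_⟩
  rw [← sub_eq_zero]
  apply eq_zero_of_pos ht
  have h1 := scal_add (f - cls (Y m n ht.le (((-1) ^ t) ^ m * scal f m)))
    (cls (Y m n ht.le (((-1) ^ t) ^ m * scal f m))) m
  rw [sub_add_cancel, scal_cls, Y_apply] at h1
  by_cases h : m + t ≤ n
  · rw [if_pos ⟨le_rfl, h⟩, TrivSqZeroExt.fst_inl, ← mul_assoc, ← mul_zpow,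
      neg_one_zpow_mul_self, one_zpow, one_mul] at h1
    linear_combination -h1
  · exact scal_eq_zero _ (by omega)

/-- In positive degrees every endomorphism is a sum of commutators. -/
lemma commutators_eq_top_of_pos (ht : 0 < t) : commutators (perf (Lam k)) t = ⊤ := by
  refine commutators_eq_top_of_intervals fun m n => ?_
  by_cases hmn : m - 1 ≤ n
  swap
  · intro f
    rw [ivHom_eq_zero_of_lt (by omega) f, blk_zero]
    exact zero_mem _
  induction n, hmn using Int.leInduction with
  | base =>
    intro f
    rw [ivHom_eq_zero_of_lt (by omega) f, blk_zero]
    exact zero_mem _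
  | succ n hmn ih =>
    intro f
    obtain ⟨a, rfl⟩ := exists_eq_Y ht f
    -- As t > 0, an endomorphism of [m,n+1] does not involve the source degree n + 1, so it factors
    -- through the truncation to [m,n]. Turning the factors around gives an endomorphism of [m,n].
    have hg : (fun i => if m ≤ i ∧ i + t ≤ n + 1 then
        (TrivSqZeroExt.inl (((-1) ^ t) ^ i * a) : Lam k) else 0) ∈ cocycles k m n m (n + 1) t := by
      refine ⟨fun i hi => if_neg (by omega), fun i h h' => ?_⟩
      simp only
      rw [if_pos (by omega), if_pos (by omega), TrivSqZeroExt.fst_inl, TrivSqZeroExt.fst_inl,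
        zpow_add_one₀ (zpow_ne_zero _ (by simp))]
      ring
    have h1 := blk_mem_of_comm (zero_add t) (cls (truncate m (n + 1) n (by omega))) (cls ⟨_, hg⟩)
      (ih _)
    rw [cls_comp] at h1
    convert h1 using 3
    ext1
    funext i
    change _ = (if m ≤ i + 0 ∧ i + 0 + t ≤ n + 1 then
      (TrivSqZeroExt.inl (((-1) ^ t) ^ (i + 0) * a) : Lam k) else 0) * (truncate _ _ _ _).1 i
    rw [Y_apply, truncate_apply, add_zero]
    split_ifs <;> first | omega | simp

lemma cls_ξ_add (i : ℤ) (a b : k) :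
    cls (ξ m n m' n' t i (a + b)) = cls (ξ m n m' n' t i a) + cls (ξ m n m' n' t i b) := by
  rw [← cls_add]
  congr 1
  ext1
  funext j
  change _ = (ξ m n m' n' t i a).1 j + (ξ m n m' n' t i b).1 j
  rw [ξ_apply, ξ_apply, ξ_apply]
  split_ifs <;> simp [add_smul]

lemma cls_ξ_eq_zero_of_lt (h : n + t < m') (a : k) : cls (ξ m n m' n' t n a) = 0 := by
  rw [← cls_zero]
  congr 1
  ext1
  funext i
  rw [ξ_apply, if_neg (by omega)]
  rfl

/-- The map factors through the inclusion of [m,n] in [m-1,n]; turning the factors around gives the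
same multiple of x on the longer interval. -/
lemma blk_ξ_extend (a : k) (h : m ≤ n + t)
    (h1 : blk (cls (ξ (m - 1) n (m - 1) n t n a)) ∈ commutators (perf (Lam k)) t) :
    blk (cls (ξ m n m n t n a)) ∈ commutators (perf (Lam k)) t := by
  have h2 := blk_mem_of_comm (zero_add t) (cls (extend m (m - 1) n (by omega)))
    (cls (ξ (m - 1) n m n t n a))
  rw [cls_comp, cls_comp] at h2
  convert h2 ?_ using 3
  · ext1
    funext i
    change _ = (ξ (m - 1) n m n t n a).1 (i + 0) * (extend _ _ _ _).1 i
    rw [ξ_apply, ξ_apply, extend_apply, add_zero]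
    split_ifs <;> first | omega | simp
  · convert h1 using 3
    ext1
    funext i
    change (extend _ _ _ _).1 (i + t) * (ξ (m - 1) n m n t n a).1 i = _
    rw [ξ_apply, ξ_apply, extend_apply]
    split_ifs <;> first | omega | simp

/-- In odd degrees every endomorphism is a sum of commutators, for `char k ≠ 2`. -/
lemma commutators_eq_top_of_odd (h2 : (2 : k) ≠ 0) (ht : Odd t) :
    commutators (perf (Lam k)) t = ⊤ := by
  obtain ht' | ht' := lt_or_ge 0 t
  · exact commutators_eq_top_of_pos ht'
  have ht0 : t < 0 := by
    obtain ⟨a, ha⟩ := ht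
    omega
  refine commutators_eq_top_of_intervals fun m n f => ?_
  obtain ⟨a, rfl⟩ := exists_eq_ξ_of_neg ht0 f
  by_cases hm : n + t < m
  · rw [cls_ξ_eq_zero_of_lt hm, blk_zero]
    exact zero_mem _
  refine blk_ξ_extend a (by omega) ?_
  -- One extra degree on the left ensures that both n - 1 and n are admissible for a map of degree
  -- t.
  generalize hm' : m - 1 = l
  have hl : l + 1 ≤ n + t := by omega
  -- The commutator of Y, of degree 1, with the multiple μ x in degree n, of degree t - 1, is x with
  -- the coefficient (-1)^{n-1} μ - (-1)^n μ = -2 (-1)^n μ. The choice of μ makes this equal to a.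
  let μ : k := -((-1) ^ n) * a / 2
  have h1 := blk_commutator (t := t) (i := 1) (j := t - 1) (by ring)
    (cls (Y l n zero_le_one (1 : k))) (cls (ξ l n l n (t - 1) n μ))
  have ht1 : Even (t - 1) := ht.sub_odd odd_one
  rw [one_mul, Int.negOnePow_even _ ht1, one_smul, cls_comp, cls_comp, sub_eq_add_neg,
    ← one_smul ℤˣ (blk _), ← sub_eq_add_neg] at h1
  -- The composite is a multiple of x in degree n - 1. For odd t it is homotopic to the same
  -- multiple in degree n, by a homotopy concentrated in degree n.
  have e1 : cls ⟨_, cocycles_comp (Y l n zero_le_one (1 : k)) (ξ l n l n (t - 1) n μ)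
      ((add_comm (t - 1) 1).trans (by ring))⟩ = cls (ξ l n l n t n ((-1) ^ (n - 1) * μ)) := by
    rw [cls_eq_iff, cls_eq_zero_iff]
    have e2 : ∀ i, (((⟨_, cocycles_comp (Y l n zero_le_one (1 : k)) (ξ l n l n (t - 1) n μ)
        ((add_comm (t - 1) 1).trans (by ring))⟩ : cocycles k l n l n t) -
        ξ l n l n t n ((-1) ^ (n - 1) * μ)).1 i) =
        (ξ l n l n t (n - 1) ((-1) ^ (n - 1) * μ)).1 i -
        (ξ l n l n t n ((-1) ^ (n - 1) * μ)).1 i := by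
      intro i
      change (ξ l n l n (t - 1) n μ).1 (i + 1) * (Y l n zero_le_one (1 : k)).1 i - _ = _
      congr 1
      rw [ξ_apply, ξ_apply, Y_apply]
      by_cases hi : i = n - 1
      · subst hi
        rw [if_pos (by omega), if_pos (by omega), if_pos (by omega)]
        ext <;> simp [mul_comm]
      · split_ifs <;> first | omega | simp
    simp only [e2]
    refine ⟨fun i => ?_, fun i => if i = n then (-1) ^ (n - 1) * μ else 0,
      fun i hi => if_neg (by omega), fun i h3 h4 h5 h6 => ?_⟩
    · rw [ξ_apply, ξ_apply]
      split_ifs <;> simp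
    · simp only
      rw [ξ_apply, ξ_apply, ht.neg_one_zpow]
      split_ifs <;> first | omega | simp
  have e3 : cls ⟨_, cocycles_comp (ξ l n l n (t - 1) n μ) (Y l n zero_le_one (1 : k))
      (show 1 + (t - 1) = t by ring)⟩ = cls (ξ l n l n t n ((-1) ^ n * μ)) := by
    congr 1
    ext1
    funext i
    change (Y l n zero_le_one (1 : k)).1 (i + (t - 1)) * (ξ l n l n (t - 1) n μ).1 i = _
    rw [ξ_apply, ξ_apply, Y_apply]
    by_cases hi : i = n
    · subst hi
      rw [if_pos (by omega), if_pos (by omega), if_pos (by omega)]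
      have h3 : ((-1 : k) ^ (1 : ℤ)) ^ (i + (t - 1)) = (-1) ^ i := by
        rw [zpow_one, zpow_add₀ (by simp), ht1.neg_one_zpow, mul_one]
      rw [h3]
      ext <;> simp [mul_comm]
    · split_ifs <;> first | omega | simp
  rw [e1, e3] at h1
  have e4 : cls (ξ l n l n t n ((-1) ^ (n - 1) * μ)) =
      cls (ξ l n l n t n a) + cls (ξ l n l n t n ((-1) ^ n * μ)) := by
    rw [← cls_ξ_add]
    congr 2
    have h3 := neg_one_zpow_mul_self (k := k) n
    rw [zpow_sub_one₀ (by simp)]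
    simp only [μ]
    field_simp
    linear_combination 2 * a * h3
  rw [e4, blk_add] at h1
  simpa using h1

end Commutators

/-! ### Two traces on the blocks: alternating sums of the coefficients of x, and leading
coefficients by length. -/

section Traces

variable {k : Type u} [Field k] {m n m' n' m'' n'' t : ℤ}

lemma negOnePow_smul (u : ℤ) (a : k) : u.negOnePow • a = (-1 : k) ^ u * a := by
  obtain h | h := Int.even_or_odd u
  · rw [Int.negOnePow_even _ h, h.neg_one_zpow, one_smul, one_mul]
  · rw [Int.negOnePow_odd _ h, h.neg_one_zpow, Units.neg_smul, one_smul, neg_one_mul]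

/-! ### The trace in non-positive degrees -/

/-- A cocycle representing a given class. -/
def rep (f : IvHom k m n m' n' t) : cocycles k m n m' n' t := Function.surjInv cls_surjective f

lemma cls_rep (f : IvHom k m n m' n' t) : cls (rep f) = f := Function.surjInv_eq _ _

/-- The alternating sum of the coefficients of `x` of an endomorphism of degree `t ≤ 0`. -/
def altTrace (ht : t ≤ 0) (m n : ℤ) : IvHom k m n m n t →+ k where
  toFun f := altSum m n t (rep f).1
  map_zero' := altSum_eq_zero (by omega) (by omega) _ (cls_rep _)
  map_add' f g := by
    rw [← altSum_add, ← sub_eq_zero]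
    have h1 : ∀ c d : ℤ → Lam k, altSum m n t c - altSum m n t d = altSum m n t (c - d) := by
      intro c d
      rw [sub_eq_iff_eq_add, ← altSum_add, sub_add_cancel]
    rw [h1]
    refine altSum_eq_zero (by omega) (by omega) (rep (f + g) - (rep f + rep g)) ?_
    rw [← cls_eq_iff, cls_add, cls_rep, cls_rep, cls_rep]

lemma altTrace_cls (ht : t ≤ 0) (c : cocycles k m n m n t) :
    altTrace ht m n (cls c) = altSum m n t c.1 := by
  change altSum m n t _ = _
  rw [← sub_eq_zero]
  have h1 : ∀ c d : ℤ → Lam k, altSum m n t c - altSum m n t d = altSum m n t (c - d) := by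
    intro c d
    rw [sub_eq_iff_eq_add, ← altSum_add, sub_add_cancel]
  rw [h1]
  refine altSum_eq_zero (by omega) (by omega) (rep (cls c) - c) ?_
  rw [← cls_eq_iff, cls_rep]

lemma altSum_eq_finsum (h1 : (-1 : k) ^ t = 1) (c : ℤ → Lam k)
    (hc : ∀ i, ¬(m ≤ i ∧ i ≤ n) → c i = 0) :
    altSum m n t c = ∑ᶠ i, (-1) ^ i * (c i).snd := by
  rw [altSum, finsum_eq_sum_of_support_subset (s := Finset.Icc m n)]
  · refine Finset.sum_congr rfl fun i _ => ?_
    rw [zpow_add₀ (by simp), h1, one_mul, zpow_one]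
  · intro i hi
    rw [Finset.coe_Icc, Set.mem_Icc]
    by_contra h
    refine hi ?_
    simp [hc i h]

/-- The coefficient of x in a product has two terms, each a constant term times a coefficient of x.
After an index shift by a, one kind of terms agrees directly and the other after a translation by t:
if (-1)^t = 1, constant terms have period t wherever the other factor is nonzero. -/
lemma altSum_comm (ht : t ≤ 0) (h1 : (-1 : k) ^ t = 1) {a b : ℤ} (hab : a + b = t)
    (c : cocycles k m n m' n' a) (d : cocycles k m' n' m n b) :
    altSum m n t (fun i => d.1 (i + a) * c.1 i) =
      (-1) ^ (a * b) * altSum m' n' t (fun i => c.1 (i + b) * d.1 i) := by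
  have hc : ∀ i, ¬(m ≤ i ∧ i ≤ n) → c.1 i = 0 := fun i hi => c.2.1 i (by tauto)
  have hd : ∀ i, ¬(m' ≤ i ∧ i ≤ n') → d.1 i = 0 := fun i hi => d.2.1 i (by tauto)
  rw [altSum_eq_finsum h1 _ (fun i hi => by rw [hc i hi, mul_zero]),
    altSum_eq_finsum h1 _ (fun i hi => by rw [hd i hi, mul_zero])]
  obtain ⟨l, hl⟩ := Int.eq_ofNat_of_zero_le (show 0 ≤ -t by omega)
  have hl1 : (-1 : k) ^ l = 1 := by
    rw [← zpow_natCast, ← hl, zpow_neg, h1, inv_one]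
  have hv : ∀ v : ℤ, ((-1 : k) ^ v) ^ l = 1 := by
    intro v
    rw [← zpow_natCast, ← zpow_mul, mul_comm, zpow_mul, zpow_natCast, hl1, one_zpow]
  let F : ℤ → k := fun i => (-1) ^ i * ((d.1 (i + a)).fst * (c.1 i).snd)
  let G : ℤ → k := fun i => (-1) ^ i * ((c.1 i).fst * (d.1 (i + a)).snd)
  have hF : (Function.support F).Finite := (Set.finite_Icc m n).subset fun i hi => by
    rw [Set.mem_Icc]
    by_contra h
    exact hi (by simp [F, hc i h])
  have hG : (Function.support G).Finite := (Set.finite_Icc m n).subset fun i hi => by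
    rw [Set.mem_Icc]
    by_contra h
    exact hi (by simp [G, hc i h])
  have e1 : ∑ᶠ i, (-1 : k) ^ i * (d.1 (i + a) * c.1 i).snd = ∑ᶠ i, (F i + G i) := by
    refine finsum_congr fun i => ?_
    simp only [F, G, TrivSqZeroExt.snd_mul, smul_eq_mul, MulOpposite.smul_eq_mul_unop,
      MulOpposite.unop_op]
    ring
  -- Only F is translated by t. As the sums run over all integers, this does not change their value.
  have e2 : ∑ᶠ i, (-1 : k) ^ i * (c.1 (i + b) * d.1 i).snd =
      ∑ᶠ i, (-1) ^ a * (F (i + t) + G i) := by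
    rw [← finsum_comp_equiv (Equiv.addRight a)]
    refine finsum_congr fun i => ?_
    simp only [Equiv.coe_addRight, F, G, TrivSqZeroExt.snd_mul, smul_eq_mul,
      MulOpposite.smul_eq_mul_unop, MulOpposite.unop_op]
    have e3 : (c.1 (i + a + b)).fst * (d.1 (i + a)).snd = (c.1 i).fst * (d.1 (i + a)).snd := by
      by_cases h2 : m' ≤ i + a ∧ i + a ≤ n' ∧ m ≤ i + a + b ∧ i + a + b ≤ n
      · have h3 := fst_shift c l (i := i + a + b) (by omega) (by omega)
        rw [hv, one_mul, show i + a + b + l = i by omega] at h3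
        rw [h3]
      · rw [d.2.1 _ h2]; simp
    have e4 : (d.1 (i + a)).fst * (c.1 (i + a + b)).snd =
        (d.1 (i + t + a)).fst * (c.1 (i + t)).snd := by
      rw [show i + a + b = i + t by omega]
      by_cases h2 : m ≤ i + t ∧ i + t ≤ n ∧ m' ≤ i + t + a ∧ i + t + a ≤ n'
      · have h3 := fst_shift d l (i := i + t + a) (by omega) (by omega)
        rw [hv, one_mul, show i + t + a + l = i + a by omega] at h3
        rw [h3]
      · rw [c.2.1 _ h2]; simp
    have e5 : (-1 : k) ^ (i + t) = (-1) ^ i := by rw [zpow_add₀ (by simp), h1, mul_one]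
    rw [e5, zpow_add₀ (by simp), ← e4, ← e3]
    ring
  have hFt : (Function.support fun i => F (i + t)).Finite :=
    (Set.finite_Icc (m - t) (n - t)).subset fun i hi => by
      rw [Set.mem_Icc]
      by_contra h
      refine hi ?_
      change F (i + t) = 0
      simp [F, hc (i + t) (by omega)]
  have e6 : (-1 : k) ^ (a * b) * (-1) ^ a = 1 := by
    obtain h2 | h2 := Int.even_or_odd a
    · rw [(h2.mul_right b).neg_one_zpow, h2.neg_one_zpow, one_mul]
    · have h3 := h1
      rw [← hab, zpow_add₀ (by simp), h2.neg_one_zpow] at h3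
      rw [zpow_mul, h2.neg_one_zpow, mul_comm, h3]
  rw [e1, e2, finsum_add_distrib hF hG, ← mul_finsum, finsum_add_distrib hFt hG, ← mul_assoc, e6,
    one_mul]
  congr 1
  exact (finsum_comp_equiv (Equiv.addRight t) (f := F)).symm

/-- The trace on endomorphisms of degree `t ≤ 0`. -/
def altBlockTrace (ht : t ≤ 0) (h1 : (-1 : k) ^ t = 1) : BlockTrace (perf (Lam k))
    (fun I : ℤ × ℤ => intervalPerf k I.1 I.2) t k where
  toFun I := altTrace ht I.1 I.2
  comm I J a b hab f g := by
    obtain ⟨m, n⟩ := I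
    obtain ⟨m', n'⟩ := J
    obtain ⟨c, rfl⟩ := cls_surjective (m := m) (n := n) (m' := m') (n' := n') f
    obtain ⟨d, rfl⟩ := cls_surjective (m := m') (n := n') (m' := m) (n' := n) g
    have h2 := altSum_comm ht h1 hab c d
    have h3 : (cls c).comp (cls d) ((add_comm b a).trans hab) = _ := cls_comp c d _
    have h4 : (cls d).comp (cls c) hab = _ := cls_comp d c _
    change altTrace ht m n ((cls c).comp (cls d) ((add_comm b a).trans hab)) =
      _ • altTrace ht m' n' ((cls d).comp (cls c) hab)
    rw [h3, h4, altTrace_cls, altTrace_cls, negOnePow_smul, h2]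

lemma altSum_eq_zero_of_blk_mem (ht : t ≤ 0) (h1 : (-1 : k) ^ t = 1) (c : cocycles k m n m n t)
    (h : blk (cls c) ∈ commutators (perf (Lam k)) t) : altSum m n t c.1 = 0 := by
  classical
  rw [← altTrace_cls ht]
  have h2 := (altBlockTrace ht h1).total_commutator exists_decomposition h
  have h3 := (altBlockTrace ht h1).total_block exists_decomposition (m, n) (cls c)
  rw [← h2]
  exact h3.symm

/-! ### The trace by length in degree `0` -/

/-- Constant terms propagate along the intervals by the geometric relation, so a nonzero one cannot
meet an end of one interval before that of the other. A nonzero product therefore forces both ends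
to match after the translation by a. -/
lemma scal_comp_ne_zero {a b : ℤ} (hab : a + b = 0) (f : IvHom k m n m' n' a)
    (g : IvHom k m' n' m n b) (h : scal g (n + a) * scal f n ≠ 0) : n' = n + a ∧ m' = m + a := by
  have hf : scal f n ≠ 0 := right_ne_zero_of_mul h
  have hg : scal g (n + a) ≠ 0 := left_ne_zero_of_mul h
  have h1 : m ≤ n ∧ n ≤ n ∧ m' ≤ n + a ∧ n + a ≤ n' := by
    by_contra h'
    exact hf (scal_eq_zero f h')
  have h2 : n' = n + a := by
    by_contra h'
    have h3 := scal_shift f 1 (i := n) (by omega) (by push_cast; omega)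
    rw [scal_eq_zero f (by push_cast; omega)] at h3
    exact mul_ne_zero (pow_ne_zero _ (zpow_ne_zero _ (by simp))) hf h3.symm
  refine ⟨h2, le_antisymm ?_ ?_⟩
  · by_contra h'
    obtain ⟨l, hl⟩ := Int.eq_ofNat_of_zero_le (show 0 ≤ n - m by omega)
    have h3 := scal_shift f l (i := m) (by omega) (by omega)
    rw [scal_eq_zero f (i := m) (by omega), show m + l = n by omega] at h3
    simp [hf] at h3
  · by_contra h'
    obtain ⟨l, hl⟩ := Int.eq_ofNat_of_zero_le (show 0 ≤ n + a - m' by omega)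
    have h3 := scal_shift g l (i := m') (by omega) (by omega)
    rw [scal_eq_zero g (i := m') (by omega), show m' + l = n + a by omega] at h3
    simp [hg] at h3

/-- The leading coefficient of an endomorphism of degree `0`, with sign, in the component given by
the length. -/
def lengthBlockTrace (k : Type u) [Field k] (ht : t = 0) : BlockTrace (perf (Lam k))
    (fun I : ℤ × ℤ => intervalPerf k I.1 I.2) t (ℤ →₀ k) where
  toFun I :=
    { toFun := fun f => Finsupp.single (I.2 - I.1)
        ((-1) ^ I.2 * scal (m := I.1) (n := I.2) (m' := I.1) (n' := I.2) f I.2)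
      map_zero' := by
        have h := scal_zero (k := k) (m := I.1) (n := I.2) (m' := I.1) (n' := I.2) (t := t) I.2
        rw [h, mul_zero, Finsupp.single_zero]
      map_add' := fun f g => by
        have h := scal_add (k := k) (m := I.1) (n := I.2) (m' := I.1) (n' := I.2) f g I.2
        rw [h, mul_add, Finsupp.single_add] }
  comm I J a b hab f g := by
    obtain ⟨m, n⟩ := I
    obtain ⟨m', n'⟩ := J
    subst ht
    have h1 : scal (m := m) (n := n) (m' := m) (n' := n)
        (f.comp g ((add_comm b a).trans hab)) n = _ := scal_comp f g _ _
    have h2 : scal (m := m') (n := n') (m' := m') (n' := n') (g.comp f hab) n' = _ :=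
      scal_comp g f _ _
    change Finsupp.single (n - m) ((-1) ^ n * scal (f.comp g _) n) =
      (a * b).negOnePow • Finsupp.single (n' - m') ((-1) ^ n' * scal (g.comp f _) n')
    rw [h1, h2]
    -- Either the intervals are translates of each other, so that they have the same length and
    -- (-1)^{n'} compensates the Koszul sign, or both leading coefficients vanish.
    by_cases h : n' = n + a ∧ m' = m + a
    · obtain ⟨rfl, rfl⟩ := h
      obtain rfl : b = -a := by omega
      have h3 : (a * -a).negOnePow = a.negOnePow := by
        rw [mul_neg, Int.negOnePow_neg]
        obtain h4 | h4 := Int.even_or_odd a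
        · rw [Int.negOnePow_even _ h4, Int.negOnePow_even _ (h4.mul_right a)]
        · rw [Int.negOnePow_odd _ h4, Int.negOnePow_odd _ (h4.mul h4)]
      have h5 : ∀ (u : ℤˣ) (i : ℤ) (x : k), u • Finsupp.single i x = Finsupp.single i (u • x) := by
        intro u i x
        obtain rfl | rfl := Int.units_eq_one_or u <;> simp
      rw [h5, h3, negOnePow_smul, zpow_add₀ (by simp), show n + a - (m + a) = n - m by ring,
        show n + a + -a = n by ring]
      congr 1
      linear_combination -(-1) ^ n * scal g (n + a) * scal f n * neg_one_zpow_mul_self (k := k) a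
    · have h3 : scal (m := m') (n := n') g (n + a) * scal (m := m) (n := n) f n = 0 := by
        by_contra h'
        exact h (scal_comp_ne_zero hab f g h')
      have h4 : scal (m := m) (n := n) f (n' + b) * scal (m := m') (n := n') g n' = 0 := by
        by_contra h'
        have := scal_comp_ne_zero (by omega) g f h'
        exact h (by omega)
      rw [h3, h4]
      simp

end Traces

/-! ### Powers and the trace by length -/

section Powers

variable {k : Type u} [Field k] {m n m' n' m'' n'' t : ℤ}

/-- The decompositions of perfect complexes into interval complexes. -/
abbrev IvDecomposition (X : PerfectComplex (Lam k)) : Type _ :=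
  Decomposition (perf (Lam k)) (fun I : ℤ × ℤ => intervalPerf k I.1 I.2) X

/-- The leading coefficient of an entry. -/
def entryScal {X Y : PerfectComplex (Lam k)} (d : IvDecomposition X) (d' : IvDecomposition Y)
    (f : ShiftedHom (perf (Lam k) X) (perf (Lam k) Y) t) (a : Fin d.size) (b : Fin d'.size) : k :=
  scal (m := (d.idx a).1) (n := (d.idx a).2) (m' := (d'.idx b).1) (n' := (d'.idx b).2)
    (d.entry d' f a b) (d.idx a).2

/-- The matrix of the leading coefficients of the entries between interval complexes
`Λ^{[m,n]}` with `n - m = len`. -/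
def lengthMatrix {X : PerfectComplex (Lam k)} (d : IvDecomposition X) (len : ℤ)
    (f : ShiftedHom (perf (Lam k) X) (perf (Lam k) X) t) : Matrix (Fin d.size) (Fin d.size) k :=
  Matrix.of fun a b =>
    if d.idx a = d.idx b ∧ (d.idx a).2 - (d.idx a).1 = len then entryScal d d f a b else 0

/-- A composite of degree 0 through a different interval has no leading coefficient, by
`scal_comp_ne_zero`. So discarding the entries between different intervals is compatible with
products. -/
lemma lengthMatrix_comp {X : PerfectComplex (Lam k)} (d : IvDecomposition X) (len : ℤ)
    {t' t'' : ℤ} (ht : t = 0) (ht' : t' = 0) (f : ShiftedHom (perf (Lam k) X) (perf (Lam k) X) t)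
    (g : ShiftedHom (perf (Lam k) X) (perf (Lam k) X) t') (h : t' + t = t'') :
    lengthMatrix d len (f.comp g h) = lengthMatrix d len f * lengthMatrix d len g := by
  subst ht ht'
  ext a c
  rw [Matrix.mul_apply]
  simp only [lengthMatrix, Matrix.of_apply]
  by_cases h1 : d.idx a = d.idx c ∧ (d.idx a).2 - (d.idx a).1 = len
  · rw [if_pos h1]
    have h2 : entryScal d d (f.comp g h) a c =
        ∑ b, entryScal d d f a b * scal (m := (d.idx b).1) (n := (d.idx b).2)
          (m' := (d.idx c).1) (n' := (d.idx c).2) (d.entry d g b c) (d.idx a).2 := by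
      rw [entryScal, d.entry_comp d d f g h]
      have h3 : ∀ (s : Finset (Fin d.size)) (F : Fin d.size → IvHom k (d.idx a).1 (d.idx a).2
          (d.idx c).1 (d.idx c).2 t''), scal (∑ b ∈ s, F b) (d.idx a).2 =
          ∑ b ∈ s, scal (F b) (d.idx a).2 := fun s F =>
        map_sum (AddMonoidHom.mk' (fun f : IvHom k (d.idx a).1 (d.idx a).2
          (d.idx c).1 (d.idx c).2 t'' => scal f (d.idx a).2) fun f g => scal_add f g _) F s
      refine (h3 _ _).trans (Finset.sum_congr rfl fun b _ => ?_)
      refine (scal_comp (m := (d.idx a).1) (n := (d.idx a).2) (m' := (d.idx b).1)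
        (n' := (d.idx b).2) _ _ h _).trans ?_
      rw [add_zero, mul_comm]
      rfl
    rw [h2]
    refine Finset.sum_congr rfl fun b _ => ?_
    by_cases h3 : d.idx a = d.idx b
    · rw [if_pos ⟨h3, h1.2⟩, if_pos ⟨h3 ▸ h1.1, h3 ▸ h1.2⟩]
      exact congrArg (fun i => entryScal d d f a b * scal (m := (d.idx b).1) (n := (d.idx b).2)
        (m' := (d.idx c).1) (n' := (d.idx c).2) (d.entry d g b c) i) (congrArg Prod.snd h3)
    · rw [if_neg (fun h4 => h3 h4.1), zero_mul]
      by_contra h4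
      -- The index of c is replaced by a variable, so that its equality with the index of a can be
      -- eliminated.
      have h5 : ∀ J : ℤ × ℤ, d.idx a = J → ∀ F : IvHom k (d.idx b).1 (d.idx b).2 J.1 J.2 0,
          scal F (d.idx a).2 * entryScal d d f a b ≠ 0 → False := by
        rintro _ rfl F hF
        have h6 := scal_comp_ne_zero (add_zero 0) (d.entry d f a b) F
          (by rwa [add_zero])
        exact h3 (Prod.ext (by omega) (by omega))
      exact h5 _ h1.1 _ (by rwa [mul_comm])
  · rw [if_neg h1]
    refine (Finset.sum_eq_zero fun b _ => ?_).symm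
    split_ifs with h2 h3
    · exact absurd ⟨h2.1.trans h3.1, h2.2⟩ h1
    all_goals simp

lemma lengthMatrix_shiftedPow {X : PerfectComplex (Lam k)} (d : IvDecomposition X) (len : ℤ)
    (ht : t = 0) (f : ShiftedHom (perf (Lam k) X) (perf (Lam k) X) t) (q : ℕ) :
    lengthMatrix d len (shiftedPow f (q + 1)) = lengthMatrix d len f ^ (q + 1) := by
  induction q with
  | zero =>
    rw [pow_one, shiftedPow, shiftedPow]
    have h : ∀ (a b : ℤ) (ha : a = 0) (hb : a + t = b),
        lengthMatrix d len (f.comp (ShiftedHom.mk₀ a ha (𝟙 _)) hb) = lengthMatrix d len f := by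
      intro a b ha hb
      obtain rfl : t = b := by omega
      rw [ShiftedHom.comp_mk₀_id]
    exact h _ _ _ _
  | succ q ih =>
    rw [shiftedPow, lengthMatrix_comp d len ht (by rw [ht, mul_zero]), ih, pow_succ' _ (q + 1)]

variable (k) in
/-- The trace by length on `⊕ End`. -/
def lengthTrace (ht : t = 0) : EndSum (perf (Lam k)) t →+ (ℤ →₀ k) :=
  (lengthBlockTrace k ht).total exists_decomposition

/-- The signs of the blocks of a decomposition. -/
def signVec {X : PerfectComplex (Lam k)} (d : IvDecomposition X) (a : Fin d.size) : k :=
  (-1) ^ (d.idx a).2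

open Classical in
lemma lengthTrace_single {X : PerfectComplex (Lam k)} (d : IvDecomposition X) (len : ℤ)
    (ht : t = 0) (f : ShiftedHom (perf (Lam k) X) (perf (Lam k) X) t) :
    lengthTrace k ht (DFinsupp.single X f) len =
      (Matrix.diagonal (signVec d) * lengthMatrix d len f).trace := by
  rw [lengthTrace, (lengthBlockTrace k ht).total_single_eq exists_decomposition d]
  change (∑ a, Finsupp.single ((d.idx a).2 - (d.idx a).1) ((-1 : k) ^ (d.idx a).2 *
    entryScal d d f a a)) len = _
  rw [Finsupp.finsetSum_apply, Matrix.trace]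
  refine Finset.sum_congr rfl fun a _ => ?_
  rw [Matrix.diag_apply, Matrix.diagonal_mul, Finsupp.single_apply]
  simp [lengthMatrix, signVec]

variable (p : ℕ) [Fact p.Prime] [CharP k p]

lemma neg_one_zpow_pow_char (r : ℕ) (i : ℤ) : ((-1 : k) ^ i) ^ p ^ r = (-1) ^ i := by
  obtain h | h := neg_one_zpow_eq_or (k := k) i
  · rw [h, one_pow]
  · rw [h, neg_one_pow_expChar_pow k p r]

open Classical in
-- The sign matrix commutes with the length matrix, which relates equal indices only, and it is its
-- own p^r-th power. So the trace formula for powers applies to the product of the two.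
lemma lengthTrace_single_pow {X : PerfectComplex (Lam k)} (len : ℤ)
    (ht : t = 0) (f : ShiftedHom (perf (Lam k) X) (perf (Lam k) X) t) (r : ℕ) :
    lengthTrace k (show ((p ^ r : ℕ) : ℤ) * t = 0 by rw [ht, mul_zero])
      (DFinsupp.single X (shiftedPow f (p ^ r))) len =
      lengthTrace k ht (DFinsupp.single X f) len ^ p ^ r := by
  obtain ⟨d⟩ := exists_decomposition X
  rw [lengthTrace_single d, lengthTrace_single d, ← trace_pow_char_pow]
  have hc : Commute (Matrix.diagonal (signVec d)) (lengthMatrix d len f) := by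
    ext a b
    rw [Matrix.diagonal_mul, Matrix.mul_diagonal]
    simp only [lengthMatrix, Matrix.of_apply, signVec]
    split_ifs with h
    · rw [h.1, mul_comm]
    · simp
  rw [hc.mul_pow, Matrix.diagonal_pow]
  have h1 : signVec d ^ p ^ r = signVec d := by
    funext a
    exact neg_one_zpow_pow_char p r _
  obtain ⟨q, hq⟩ := Nat.exists_eq_succ_of_ne_zero (pow_pos (Fact.out : p.Prime).pos r).ne'
  rw [h1]
  have h2 := lengthMatrix_shiftedPow d len ht f q
  congr 2
  rw [hq]
  exact h2

/-- The trace by length of a power. -/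
lemma lengthTrace_powMap (len : ℤ) (ht : t = 0) (w : EndSum (perf (Lam k)) t) (r : ℕ) :
    lengthTrace k (show ((p ^ r : ℕ) : ℤ) * t = 0 by rw [ht, mul_zero])
      (powMap (perf (Lam k)) t (p ^ r) w) len = lengthTrace k ht w len ^ p ^ r := by
  classical
  induction w using DFinsupp.induction with
  | h0 =>
    have h : powMap (perf (Lam k)) t (p ^ r) 0 = 0 := DFinsupp.mapRange_zero _ _
    rw [h, map_zero, map_zero, Finsupp.coe_zero, Pi.zero_apply,
      zero_pow (pow_pos (Fact.out : p.Prime).pos r).ne']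
  | ha X f w hX hf ih =>
    have h : powMap (perf (Lam k)) t (p ^ r) (DFinsupp.single X f + w) =
        DFinsupp.single X (shiftedPow f (p ^ r)) + powMap (perf (Lam k)) t (p ^ r) w := by
      ext Y
      rw [DFinsupp.add_apply, powMap, powMap, DFinsupp.mapRange_apply, DFinsupp.mapRange_apply,
        DFinsupp.add_apply]
      by_cases hY : X = Y
      · subst hY
        rw [hX, shiftedPow_zero, add_zero, add_zero, DFinsupp.single_eq_same,
          DFinsupp.single_eq_same]
      · rw [DFinsupp.single_eq_of_ne (Ne.symm hY), DFinsupp.single_eq_of_ne (Ne.symm hY), zero_add,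
          zero_add]
    rw [h, map_add, map_add, Finsupp.add_apply, Finsupp.add_apply, ih, add_pow_expChar_pow]
    congr 1
    convert lengthTrace_single_pow p len ht f r

/-- Elements of `T_r` of degree `0` have trace `0`. -/
lemma lengthTrace_eq_zero (ht : t = 0) {w : EndSum (perf (Lam k)) t} {r : ℕ}
    (hw : IsInT (perf (Lam k)) p r w) : lengthTrace k ht w = 0 := by
  ext len
  have h1 := lengthTrace_powMap p len ht w r
  rw [lengthTrace, (lengthBlockTrace k _).total_commutator exists_decomposition hw] at h1
  exact (pow_eq_zero_iff (pow_pos (Fact.out : p.Prime).pos r).ne').1 h1.symm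

end Powers

/-! ### The Külshammer ideals of the perfect complexes -/

section Kulshammer

variable {k : Type u} [Field k] {m n m' n' m'' n'' t : ℤ}

open Classical in
lemma leftAct_blk {s : ℤ} (η : ∀ X, ShiftedHom (perf (Lam k) X) (perf (Lam k) X) t)
    (f : IvHom k m n m n (s - t)) :
    leftAct (perf (Lam k)) s t η (blk f) =
      blk (f.comp (η (intervalPerf k m n)) (by ring)) := leftAct_single η _ f

/-- Multiplication by `x` of an interval complex, in terms of the one of `Λ`. -/
lemma blk_xClass_sub_mem (h : m ≤ n) (b : k) :
    blk (xClass k m n b) - blk (xClass k 0 0 ((-1) ^ n * b)) ∈ commutators (perf (Lam k)) 0 := by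
  -- The map b x_n factors through Λ by maps of degrees -n and n; the opposite composite is b x on
  -- Λ. The Koszul sign is (-1)^{n·n} = (-1)^n.
  have hg : (fun i => if i = 0 then (1 : Lam k) else 0) ∈ cocycles k 0 0 m n n := by
    refine ⟨fun i hi => if_neg (by omega), fun i h1 h2 => ?_⟩
    simp only
    rw [if_neg (by omega), if_neg (by omega)]
    simp
  have h1 := blk_commutator (t := 0) (i := -n) (j := n) (by ring) (cls (ξ m n 0 0 (-n) n b))
    (cls ⟨_, hg⟩)
  have e1 : (cls (ξ m n 0 0 (-n) n b)).comp (cls ⟨_, hg⟩) (by ring) = xClass k m n b := by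
    rw [cls_comp, xClass_eq]
    congr 1
    ext1
    funext i
    change (if i + -n = 0 then (1 : Lam k) else 0) * (ξ m n 0 0 (-n) n b).1 i = _
    rw [ξ_apply, ξ_apply]
    split_ifs <;> first | omega | simp
  have e2 : (cls ⟨_, hg⟩).comp (cls (ξ m n 0 0 (-n) n b)) (by ring) = xClass k 0 0 b := by
    rw [cls_comp, xClass_eq]
    congr 1
    ext1
    funext i
    change (ξ m n 0 0 (-n) n b).1 (i + n) * (if i = 0 then (1 : Lam k) else 0) = _
    rw [ξ_apply, ξ_apply]
    split_ifs <;> first | omega | simp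
  have e3 : (-n * n).negOnePow • blk (xClass k 0 0 b) = blk (xClass k 0 0 ((-1) ^ n * b)) := by
    have e4 : (-n * n).negOnePow = n.negOnePow := by
      rw [neg_mul, Int.negOnePow_neg]
      obtain h4 | h4 := Int.even_or_odd n
      · rw [Int.negOnePow_even _ h4, Int.negOnePow_even _ (h4.mul_right n)]
      · rw [Int.negOnePow_odd _ h4, Int.negOnePow_odd _ (h4.mul h4)]
    rw [e4]
    obtain h4 | h4 := Int.even_or_odd n
    · rw [Int.negOnePow_even _ h4, one_smul, h4.neg_one_zpow, one_mul]
    · rw [Int.negOnePow_odd _ h4, h4.neg_one_zpow, neg_one_mul, xClass_neg, ← blk_units_smul]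
      simp
  rw [e1, e2, e3] at h1
  exact h1

lemma xClass_injective (h : m ≤ n) {a b : k} (hab : xClass k m n a = xClass k m n b) : a = b := by
  rw [xClass_eq, xClass_eq, cls_eq_iff] at hab
  have h1 := altSum_eq_zero (by omega) (by omega) _ hab
  have h2 : ∀ a : k, altSum m n 0 (ξ m n m n 0 n a).1 = ((-1) ^ (0 + 1 : ℤ)) ^ n * a := fun a =>
    altSum_ξ h (by omega) (by omega) a
  have h3 : altSum m n 0 ((ξ m n m n 0 n a).1) = altSum m n 0 ((ξ m n m n 0 n b).1) := by
    have h4 := altSum_add (m := m) (n := n) (t := 0) ((ξ m n m n 0 n a - ξ m n m n 0 n b).1)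
      ((ξ m n m n 0 n b).1)
    rw [h1, zero_add] at h4
    rw [← h4]
    congr 1
    change _ = (ξ m n m n 0 n a).1 - (ξ m n m n 0 n b).1 + (ξ m n m n 0 n b).1
    rw [sub_add_cancel]
  rw [h2, h2] at h3
  exact mul_left_cancel₀ (zpow_ne_zero _ (zpow_ne_zero _ (by simp))) h3

/-- The coefficient of an element of `Z̃⁰` on an interval complex depends only on the length. -/
lemma tildeZ_coeff_shift {η : ∀ X, ShiftedHom (perf (Lam k) X) (perf (Lam k) X) 0}
    (hη : η ∈ gradedCenter (perf (Lam k)) 0) (h : m ≤ n) {c c' : k}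
    (hc : η (intervalPerf k m n) = xClass k m n c)
    (hc' : η (intervalPerf k 0 (n - m)) = xClass k 0 (n - m) c') : c = c' := by
  -- Translation by m identifies [m,n] with [0,n-m] through inverse maps of degrees -m and m.
  -- Conjugation with them takes η on one complex to η on the other and preserves the coefficient of
  -- x.
  have hf : (fun i => if m ≤ i ∧ i ≤ n then
      (TrivSqZeroExt.inl (((-1) ^ (-m)) ^ i) : Lam k) else 0) ∈ cocycles k m n 0 (n - m) (-m) := by
    refine ⟨fun i hi => if_neg (by omega), fun i h1 h2 => ?_⟩
    simp only
    rw [if_pos (by omega), if_pos (by omega), TrivSqZeroExt.fst_inl, TrivSqZeroExt.fst_inl,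
      zpow_add_one₀ (zpow_ne_zero _ (by simp)), mul_comm]
  have hg : (fun i => if 0 ≤ i ∧ i ≤ n - m then
      (TrivSqZeroExt.inl (((-1) ^ m) ^ (i + m)) : Lam k) else 0) ∈
      cocycles k 0 (n - m) m n m := by
    refine ⟨fun i hi => if_neg (by omega), fun i h1 h2 => ?_⟩
    simp only
    rw [if_pos (by omega), if_pos (by omega), TrivSqZeroExt.fst_inl, TrivSqZeroExt.fst_inl,
      show i + 1 + m = i + m + 1 by ring, zpow_add_one₀ (zpow_ne_zero _ (by simp)), mul_comm]
  have h1 := center_block hη (cls ⟨_, hf⟩) (zero_add _)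
  rw [zero_mul, Int.negOnePow_zero, one_smul, hc, hc'] at h1
  have h2 := congrArg (fun z => ShiftedHom.comp z (cls ⟨_, hg⟩) (add_neg_cancel m)) h1
  have hone : ∀ i : ℤ, ((-1 : k) ^ m) ^ i * (((-1) ^ m) ^ i) = 1 := by
    intro i
    rw [← mul_zpow, neg_one_zpow_mul_self, one_zpow]
  have hneg : ((-1 : k) ^ (-m)) = (-1) ^ m := by
    rw [zpow_neg, inv_eq_of_mul_eq_one_left (neg_one_zpow_mul_self m)]
  simp only [xClass_eq, cls_comp] at h2
  refine xClass_injective h ?_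
  rw [xClass_eq, xClass_eq]
  convert h2 using 2
  · ext1
    funext i
    change _ = (if 0 ≤ i + -m ∧ i + -m ≤ n - m then
      (TrivSqZeroExt.inl (((-1) ^ m) ^ (i + -m + m)) : Lam k) else 0) *
      ((if m ≤ i + 0 ∧ i + 0 ≤ n then
      (TrivSqZeroExt.inl (((-1) ^ (-m)) ^ (i + 0)) : Lam k) else 0) * (ξ m n m n 0 n c).1 i)
    rw [ξ_apply, neg_add_cancel_right, add_zero, hneg]
    split_ifs <;> first | omega | (rw [← mul_assoc, ← TrivSqZeroExt.inl_mul, hone]; simp) | simp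
  · ext1
    funext i
    change _ = (if 0 ≤ i + -m ∧ i + -m ≤ n - m then
      (TrivSqZeroExt.inl (((-1) ^ m) ^ (i + -m + m)) : Lam k) else 0) *
      ((ξ 0 (n - m) 0 (n - m) 0 (n - m) c').1 (i + -m) * (if m ≤ i ∧ i ≤ n then
      (TrivSqZeroExt.inl (((-1) ^ (-m)) ^ i) : Lam k) else 0))
    rw [ξ_apply, ξ_apply, neg_add_cancel_right, hneg, mul_left_comm]
    split_ifs <;> first | omega | (rw [← TrivSqZeroExt.inl_mul, hone]; simp) | simp

lemma cls_comp_xClass (c : cocycles k m n m n 0) (a : k) :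
    (cls c).comp (xClass k m n a) (zero_add 0) = xClass k m n (a * scal (cls c) n) := by
  rw [scal_cls, xClass_eq, xClass_eq, cls_comp]
  congr 1
  ext1
  funext i
  change (ξ m n m n 0 n a).1 (i + 0) * c.1 i = _
  rw [ξ_apply, ξ_apply, add_zero]
  by_cases h : i = n ∧ m ≤ i ∧ i ≤ n ∧ m ≤ i ∧ i ≤ n
  · rw [if_pos h, if_pos (by omega), h.1]
    ext <;> simp [mul_comm]
  · rw [if_neg h, if_neg (by omega), zero_mul]

variable (p : ℕ) [Fact p.Prime] [CharP k p]

lemma kulshammer_le_center (r : ℕ) (s : ℤ) :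
    kulshammer (perf (Lam k)) p r s t ≤ gradedCenter (perf (Lam k)) t := fun _ h => h.1

lemma kulshammer_eq_bot_of_neg (r : ℕ) (s : ℤ) (ht : t < 0) :
    kulshammer (perf (Lam k)) p r s t = ⊥ :=
  eq_bot_iff.2 fun _ h => center_neg ht h.1

lemma kulshammer_eq_center {s : ℤ} (h : commutators (perf (Lam k)) s = ⊤) (r : ℕ) :
    kulshammer (perf (Lam k)) p r s t = gradedCenter (perf (Lam k)) t :=
  le_antisymm (kulshammer_le_center p r s) fun _ hη => (mem_kulshammer_iff p r).2
    ⟨hη, fun _ _ => h ▸ AddSubgroup.mem_top _⟩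

/-- For s < 0 each endomorphism of a block is a multiple of x, and x² = 0. For s = 0, η takes an
endomorphism of a block to x times its leading coefficient; modulo commutators the total is x on Λ
times a linear function of `lengthTrace`, which vanishes on T_r. -/
lemma tildeZ_le_kulshammer (r : ℕ) {s : ℤ} (hs : s ≤ 0) :
    tildeZ k ≤ kulshammer (perf (Lam k)) p r s 0 := by
  intro η hη
  refine (mem_kulshammer_iff p r).2 ⟨hη.1, fun w hw => ?_⟩
  obtain hs' | rfl := hs.lt_or_eq
  · refine endSum_mem_of_blocks (e := fun I : ℤ × ℤ => intervalPerf k I.1 I.2)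
      exists_decomposition ((commutators (perf (Lam k)) s).comap
      (leftActHom s 0 η)) (fun w hw => leftAct_mem_commutators hη.1 hw) (fun I f => ?_) w
    obtain ⟨m, n⟩ := I
    change leftAct (perf (Lam k)) s 0 η (blk (m := m) (n := n) f) ∈
      commutators (perf (Lam k)) s
    rw [leftAct_blk]
    obtain ⟨a, rfl⟩ := exists_eq_ξ_of_neg (m := m) (n := n) (by omega) f
    by_cases hmn : m ≤ n
    · obtain ⟨c, hc⟩ := hη.2 m n hmn
      have h1 : (cls (ξ m n m n (s - 0) n a)).comp (xClass k m n c) (by ring) =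
          (0 : IvHom k m n m n s) := by
        rw [xClass_eq, cls_comp, ← cls_zero]
        congr 1
        ext1
        funext i
        change (ξ m n m n 0 n c).1 (i + (s - 0)) * (ξ m n m n (s - 0) n a).1 i = 0
        rw [ξ_apply, ξ_apply]
        split_ifs <;> simp
      rw [hc, h1, blk_zero]
      exact zero_mem _
    · rw [ivHom_eq_zero_of_lt (by omega) (ShiftedHom.comp _ _ _), blk_zero]
      exact zero_mem _
  · choose! c hc using hη.2
    -- The coefficient of η on [m,n] depends only on the length (`tildeZ_coeff_shift`), so it can be
    -- read off on [0,len].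
    let L : (ℤ →₀ k) →+ k := Finsupp.liftAddHom fun len => AddMonoidHom.mulLeft (c 0 len)
    have hL : ∀ len a, L (Finsupp.single len a) = c 0 len * a := fun len a => by simp [L]
    let Ψ : EndSum (perf (Lam k)) (0 - 0) →+ EndSum (perf (Lam k)) 0 :=
      AddMonoidHom.mk' (fun w => blk (xClass k 0 0 (L (lengthTrace k (sub_zero 0) w))))
        (fun a b => by rw [map_add, map_add, xClass_add, blk_add])
    have key : ∀ w : EndSum (perf (Lam k)) (0 - 0), leftActHom 0 0 η w - Ψ w ∈
        commutators (perf (Lam k)) 0 := by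
      refine endSum_mem_of_blocks (e := fun I : ℤ × ℤ => intervalPerf k I.1 I.2)
        exists_decomposition ((commutators (perf (Lam k)) 0).comap
        (leftActHom 0 0 η - Ψ)) (fun w hw => ?_) (fun I f => ?_)
      · have h1 : Ψ w = 0 := by
          change blk (xClass k 0 0 (L (lengthTrace k _ w))) = 0
          rw [lengthTrace, (lengthBlockTrace k _).total_commutator exists_decomposition hw, map_zero,
            xClass_zero, blk_zero]
        change leftActHom 0 0 η w - Ψ w ∈ commutators (perf (Lam k)) 0
        rw [h1, sub_zero]
        exact leftAct_mem_commutators hη.1 hw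
      · obtain ⟨m, n⟩ := I
        change leftAct (perf (Lam k)) 0 0 η (blk (m := m) (n := n) f) -
          blk (xClass k 0 0 (L (lengthTrace k _ (blk (m := m) (n := n) f)))) ∈
          commutators (perf (Lam k)) 0
        by_cases hmn : m ≤ n
        · have h1 : lengthTrace k (sub_zero 0) (blk (m := m) (n := n) f) =
              Finsupp.single (n - m) ((-1) ^ n * scal (m := m) (n := n) f n) :=
            (lengthBlockTrace k _).total_block exists_decomposition (m, n) f
          rw [h1, hL, leftAct_blk, hc m n hmn]
          rw [tildeZ_coeff_shift hη.1 hmn (hc m n hmn) (hc 0 (n - m) (by omega))]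
          obtain ⟨f, rfl⟩ := cls_surjective (m := m) (n := n) f
          -- The endomorphism has degree 0 - 0; a variable degree allows the passage to 0.
          have h2 : ∀ (z : ℤ) (hz : 0 = z) (hz' : 0 + z = 0) (f : cocycles k m n m n z),
              (cls f).comp (xClass k m n (c 0 (n - m))) hz' =
              xClass k m n (c 0 (n - m) * scal (cls f) n) := by
            rintro _ rfl _ f
            exact cls_comp_xClass f _
          rw [h2 _ (sub_zero 0).symm, mul_left_comm]
          exact blk_xClass_sub_mem hmn _
        · rw [ivHom_eq_zero_of_lt (by omega) f, blk_zero, map_zero, map_zero, xClass_zero, blk_zero,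
            sub_zero]
          exact leftAct_mem_commutators hη.1 (zero_mem _)
    have h1 := key w
    have h2 : Ψ w = 0 := by
      change blk (xClass k 0 0 (L (lengthTrace k _ w))) = 0
      rw [lengthTrace_eq_zero p _ hw, map_zero, xClass_zero, blk_zero]
    rwa [h2, sub_zero] at h1

open Classical in
-- As r > 0, the exponent p^r is at least 2, so the power contains the square f ∘ f.
lemma blk_isInT {r : ℕ} (hr : 0 < r) (f : IvHom k m n m n t)
    (hf : ∀ q (h : t + t = q), f.comp f h = 0) : IsInT (perf (Lam k)) p r (blk f) := by
  have h1 : shiftedPow f (p ^ r) = 0 := by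
    obtain ⟨q, hq⟩ : ∃ q, p ^ r = q + 2 := by
      have h2 : 2 ^ 1 ≤ p ^ r := (Nat.pow_le_pow_left (Fact.out : p.Prime).two_le 1).trans
        (Nat.pow_le_pow_right (Fact.out : p.Prime).pos hr)
      exact ⟨p ^ r - 2, by omega⟩
    rw [hq, shiftedPow, shiftedPow, ← ShiftedHom.comp_assoc _ _ _ rfl (by push_cast; ring)
      (by push_cast; ring), hf _ rfl, ShiftedHom.zero_comp]
  have h2 : powMap (perf (Lam k)) t (p ^ r) (blk f) =
      blk (t := (p ^ r : ℕ) * t) (shiftedPow f (p ^ r)) :=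
    DFinsupp.mapRange_single
  rw [IsInT, h2, h1, blk_zero]
  exact zero_mem _

/-- Test η on multiplication by x in degree n, as a map of degree s - t. Its square is zero, so it
represents an element of T_r, and its product with η is x times a leading coefficient of η. The
alternating trace in degree s shows that this coefficient vanishes. -/
lemma scal_eq_zero_of_mem_kulshammer {r : ℕ} (hr : 0 < r) {s : ℤ} (hs : s ≤ 0) (ht : 0 ≤ t)
    (h1 : (-1 : k) ^ s = 1) {η : ∀ X, ShiftedHom (perf (Lam k) X) (perf (Lam k) X) t}
    (hη : η ∈ kulshammer (perf (Lam k)) p r s t) (h : m ≤ n + s - t) :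
    scal (η (intervalPerf k m n)) m = 0 := by
  have h2 := ((mem_kulshammer_iff p r).1 hη).2 (blk (cls (ξ m n m n (s - t) n 1)))
    (blk_isInT p hr _ fun q hq => by
      rw [cls_comp, ← cls_zero]
      congr 1
      ext1
      funext i
      change (ξ m n m n (s - t) n 1).1 _ * (ξ m n m n (s - t) n 1).1 i = 0
      rw [ξ_apply, ξ_apply]
      split_ifs <;> simp)
  rw [leftAct_blk] at h2
  obtain ⟨c, hc⟩ := cls_surjective (η (intervalPerf k m n))
  rw [← hc, cls_comp] at h2
  have h3 := altSum_eq_zero_of_blk_mem hs h1 _ h2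
  have h4 : (fun i => c.1 (i + (s - t)) * (ξ m n m n (s - t) n 1).1 i) =
      (ξ m n m n s n (c.1 (n + (s - t))).fst).1 := by
    funext i
    rw [ξ_apply, ξ_apply]
    by_cases hi : i = n
    · subst hi
      rw [if_pos (by omega), if_pos (by omega)]
      ext <;> simp
    · rw [if_neg (by tauto), if_neg (by tauto), mul_zero]
  change altSum m n s (fun i => c.1 (i + (s - t)) * (ξ m n m n (s - t) n 1).1 i) = 0 at h3
  rw [h4, altSum_ξ (by omega) (by omega) (by omega)] at h3
  have h5 := (mul_eq_zero.1 h3).resolve_left (zpow_ne_zero _ (zpow_ne_zero _ (by simp)))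
  -- The vanishing coefficient sits in degree n + s - t; the geometric relation moves it down to m.
  obtain ⟨l, hl⟩ := Int.eq_ofNat_of_zero_le (show 0 ≤ n + s - t - m by omega)
  have h6 := fst_shift c l (i := m) le_rfl (by omega)
  rw [show m + l = n + (s - t) by omega, h5] at h6
  rw [← hc, scal_cls]
  exact (mul_eq_zero.1 h6.symm).resolve_left (pow_ne_zero _ (zpow_ne_zero _ (by simp)))

lemma kulshammer_zero {r : ℕ} (hr : 0 < r) {s : ℤ} (hs : s ≤ 0) (h1 : (-1 : k) ^ s = 1) :
    kulshammer (perf (Lam k)) p r s 0 = tildeZ k := by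
  refine le_antisymm (fun η hη => ⟨hη.1, fun m n hmn => exists_eq_xClass _ ?_⟩)
    (tildeZ_le_kulshammer p r hs)
  -- The test element needs an interval of length at least -s, so the interval is prolonged to the
  -- left.
  refine center_scal_eq_zero hη.1 le_rfl (m' := min m (n + s)) (min_le_left _ _) (by omega) ?_
  have h2 := min_le_right m (n + s)
  exact scal_eq_zero_of_mem_kulshammer p hr hs le_rfl h1 hη (by omega)

lemma kulshammer_pos {r : ℕ} (hr : 0 < r) {s : ℤ} (hs : s ≤ 0) (h1 : (-1 : k) ^ s = 1)
    (ht : 0 < t) : kulshammer (perf (Lam k)) p r s t = ⊥ :=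
  eq_bot_iff.2 fun _ hη => center_eq_zero_of_long hη.1 ht (t - s) fun _ _ h =>
    scal_eq_zero_of_mem_kulshammer p hr hs ht.le h1 hη (by omega)

/-- The power with exponent p⁰ is the identity up to the equality of the degrees p⁰(s - t) and s -
t. So representatives of T₀ are commutators, and the center preserves these. Heterogeneous equality
handles the change of degree. -/
lemma kulshammer_zero_iterate (s : ℤ) :
    kulshammer (perf (Lam k)) p 0 s t = gradedCenter (perf (Lam k)) t := by
  refine le_antisymm (kulshammer_le_center p 0 s) fun η hη => (mem_kulshammer_iff p 0).2
    ⟨hη, fun w hw => leftAct_mem_commutators hη ?_⟩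
  have h1 : ∀ (q : ℤ) (hq : s - t = q) (v : EndSum (perf (Lam k)) q), HEq w v →
      v ∈ commutators (perf (Lam k)) q → w ∈ commutators (perf (Lam k)) (s - t) := by
    rintro _ rfl v hv h
    rwa [eq_of_heq hv]
  refine h1 _ (by simp) _ ?_ hw
  have h2 : ∀ X, HEq (w X) (shiftedPow (w X) (p ^ 0)) := by
    intro X
    have h3 : ∀ (b a c : ℤ) (ha : a = 0) (hc : a + b = c)
        (f : ShiftedHom (perf (Lam k) X) (perf (Lam k) X) b),
        HEq f (f.comp (ShiftedHom.mk₀ a ha (𝟙 _)) hc) := by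
      intro b a c ha hc f
      obtain rfl : b = c := by omega
      rw [ShiftedHom.comp_mk₀_id]
    exact h3 _ _ _ _ _ _
  have h4 : ∀ (q : ℤ) (hq : s - t = q) (v : EndSum (perf (Lam k)) q), (∀ X, HEq (w X) (v X)) →
      HEq w v := by
    rintro _ rfl v hv
    exact heq_of_eq (DFinsupp.ext fun X => eq_of_heq (hv X))
  exact h4 _ (by simp) _ h2

end Kulshammer

/-! ### Assembly of the Külshammer and Reynolds ideals of the perfect complexes. -/

section Main

variable {k : Type u} [Field k] {t : ℤ} (p : ℕ) [Fact p.Prime] [CharP k p]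

lemma two_ne_zero_of_char (hp : p ≠ 2) : (2 : k) ≠ 0 := by
  have h := (CharP.cast_eq_zero_iff k p 2).not.2 fun h =>
    hp ((Nat.prime_dvd_prime_iff_eq (Fact.out : p.Prime) Nat.prime_two).1 h)
  exact_mod_cast h

lemma neg_one_zpow_of_char_two (hp : p = 2) (s : ℤ) : (-1 : k) ^ s = 1 := by
  subst hp
  rw [CharTwo.neg_eq, one_zpow]

/-- The Külshammer ideals for `char k ≠ 2`. -/
theorem kulshammer_of_char_ne_two (hp : p ≠ 2) (r : ℕ) (hr : 0 < r) (s : ℤ) :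
    (∀ t : ℤ, t < 0 → kulshammer (perf (Lam k)) p r s t = ⊥) ∧
    (0 < s → ∀ t : ℤ, 0 ≤ t →
      kulshammer (perf (Lam k)) p r s t = gradedCenter (perf (Lam k)) t) ∧
    (s ≤ 0 → ∀ t : ℤ, 0 ≤ t → Odd (s - t) →
      kulshammer (perf (Lam k)) p r s t = gradedCenter (perf (Lam k)) t) ∧
    (s ≤ 0 → Even s → kulshammer (perf (Lam k)) p r s 0 = tildeZ k) ∧
    (s ≤ 0 → ∀ t : ℤ, 0 < t → Even (s - t) → kulshammer (perf (Lam k)) p r s t = ⊥) := by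
  have h2 := two_ne_zero_of_char (k := k) p hp
  refine ⟨fun t ht => kulshammer_eq_bot_of_neg p r s ht, fun hs t _ =>
    kulshammer_eq_center p (commutators_eq_top_of_pos hs) r, fun hs t ht hst => ?_,
    fun hs he => kulshammer_zero p hr hs he.neg_one_zpow, fun hs t ht hst => ?_⟩
  -- For even t the degree s is odd, where everything is a commutator; for odd t the center is
  -- already zero.
  · obtain ht' | ht' := Int.even_or_odd t
    · have hs' : Odd s := by
        have := hst.add_even ht'
        rwa [sub_add_cancel] at this
      exact kulshammer_eq_center p (commutators_eq_top_of_odd h2 hs') r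
    · have h3 : gradedCenter (perf (Lam k)) t = ⊥ := eq_bot_iff.2 fun _ h => center_odd h2 ht' h
      exact le_antisymm (kulshammer_le_center p r s) (h3 ▸ bot_le)
  · obtain ht' | ht' := Int.even_or_odd t
    · have hs' : Even s := by
        have := hst.add ht'
        rwa [sub_add_cancel] at this
      exact kulshammer_pos p hr hs hs'.neg_one_zpow ht
    · exact eq_bot_iff.2 fun _ h => center_odd h2 ht' h.1

/-- The Külshammer ideals for `char k = 2`. -/
theorem kulshammer_of_char_eq_two (hp : p = 2) (r : ℕ) (hr : 0 < r) (s : ℤ) :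
    (∀ t : ℤ, t < 0 → kulshammer (perf (Lam k)) p r s t = ⊥) ∧
    (0 < s → ∀ t : ℤ, 0 ≤ t →
      kulshammer (perf (Lam k)) p r s t = gradedCenter (perf (Lam k)) t) ∧
    (s ≤ 0 → kulshammer (perf (Lam k)) p r s 0 = tildeZ k) ∧
    (s ≤ 0 → ∀ t : ℤ, 0 < t → kulshammer (perf (Lam k)) p r s t = ⊥) :=
  ⟨fun _ ht => kulshammer_eq_bot_of_neg p r s ht, fun hs _ _ =>
    kulshammer_eq_center p (commutators_eq_top_of_pos hs) r,
    fun hs => kulshammer_zero p hr hs (neg_one_zpow_of_char_two p hp s),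
    fun hs _ ht => kulshammer_pos p hr hs (neg_one_zpow_of_char_two p hp s) ht⟩

lemma kulshammer_eq_of_pos {r r' : ℕ} (hr : 0 < r) (hr' : 0 < r') (s t : ℤ) :
    kulshammer (perf (Lam k)) p r s t = kulshammer (perf (Lam k)) p r' s t := by
  obtain ht | ht := lt_or_ge t 0
  · rw [kulshammer_eq_bot_of_neg p r s ht, kulshammer_eq_bot_of_neg p r' s ht]
  obtain hs | hs := lt_or_ge 0 s
  · rw [kulshammer_eq_center p (commutators_eq_top_of_pos hs) r,
      kulshammer_eq_center p (commutators_eq_top_of_pos hs) r']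
  by_cases hp : p = 2
  · obtain ht' | rfl := ht.lt_or_eq
    · rw [(kulshammer_of_char_eq_two p hp r hr s).2.2.2 hs t ht',
        (kulshammer_of_char_eq_two p hp r' hr' s).2.2.2 hs t ht']
    · rw [(kulshammer_of_char_eq_two p hp r hr s).2.2.1 hs,
        (kulshammer_of_char_eq_two p hp r' hr' s).2.2.1 hs]
  · have h := kulshammer_of_char_ne_two (k := k) p hp r hr s
    have h' := kulshammer_of_char_ne_two (k := k) p hp r' hr' s
    obtain hst | hst := Int.even_or_odd (s - t)
    · obtain ht' | rfl := ht.lt_or_eq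
      · rw [h.2.2.2.2 hs t ht' hst, h'.2.2.2.2 hs t ht' hst]
      · rw [sub_zero] at hst
        rw [h.2.2.2.1 hs hst, h'.2.2.2.1 hs hst]
    · rw [h.2.2.1 hs t ht hst, h'.2.2.1 hs t ht hst]

/-- The intersections of the Külshammer ideals. -/
theorem kulshammer_inf (r : ℕ) (hr : 0 < r) :
    kulshammerInf (perf (Lam k)) p r 0 = tildeZ k ∧
    (∀ t : ℤ, t ≠ 0 → kulshammerInf (perf (Lam k)) p r t = ⊥) ∧
    (∀ t : ℤ, reynoldsInf (perf (Lam k)) p t = kulshammerInf (perf (Lam k)) p r t) ∧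
    (∀ s t : ℤ, reynolds (perf (Lam k)) p s t = kulshammer (perf (Lam k)) p r s t) := by
  -- All ideals with positive index r agree and the one for r = 0 is the whole center, so
  -- intersections over r are attained at any r > 0.
  have h0 : ∀ r' s t, kulshammer (perf (Lam k)) p r s t ≤ kulshammer (perf (Lam k)) p r' s t := by
    intro r' s t
    obtain rfl | hr' := Nat.eq_zero_or_pos r'
    · rw [kulshammer_zero_iterate]
      exact kulshammer_le_center p r s
    · exact (kulshammer_eq_of_pos p hr hr' s t).le
  -- The index s = 0 is decisive in every characteristic, since (-1)^0 = 1: the intersection over s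
  -- is already attained there.
  have h00 : kulshammer (perf (Lam k)) p r 0 0 = tildeZ k :=
    kulshammer_zero p hr le_rfl (zpow_zero _)
  refine ⟨le_antisymm ((iInf_le _ 0).trans h00.le) (le_iInf fun s => ?_), fun t ht => ?_,
    fun t => ?_, fun s t => ?_⟩
  · obtain hs | hs := lt_or_ge 0 s
    · rw [kulshammer_eq_center p (commutators_eq_top_of_pos hs) r]
      exact fun _ h => h.1
    · exact tildeZ_le_kulshammer p r hs
  · refine eq_bot_iff.2 ((iInf_le _ 0).trans ?_)
    obtain ht' | ht' := lt_or_gt_of_ne ht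
    · rw [kulshammer_eq_bot_of_neg p r 0 ht']
    · rw [kulshammer_pos p hr le_rfl (zpow_zero _) ht']
  · refine le_antisymm (iInf_le _ r) (le_iInf fun r' => ?_)
    exact iInf_mono fun s => h0 r' s t
  · exact le_antisymm (iInf_le _ r) (le_iInf fun r' => h0 r' s t)

end Main

/-! ### The characteristic homomorphism on the level of complexes -/

section Twist

open HomologicalComplex

variable {C D : Type*} [Category C] [Category D] [Preadditive C] [Preadditive D]
  [Limits.HasZeroObject D] (F : C ⥤ D ⥤ C) [F.Additive] [∀ X, (F.obj X).Additive]
  [∀ (K₁ : CochainComplex C ℤ) (K₂ : CochainComplex D ℤ), CochainComplex.HasMapBifunctor K₁ K₂ F]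
  (Y : D) (e : F.flip.obj Y ⟶ 𝟭 C)

/-- The chain map `F(X, P) ⟶ X` induced by a chain map `P ⟶ Y[0]`. -/
def augComplex {P : CochainComplex D ℤ} (s : P ⟶ (single D (ComplexShape.up ℤ) 0).obj Y)
    (X : CochainComplex C ℤ) : mapBifunctor X P F (ComplexShape.up ℤ) ⟶ X :=
  (F.map₂CochainComplex.obj X).map s ≫ unitComplex F Y e X

/-- The chain map `F(X, P) ⟶ X[l]` induced by a chain map `P ⟶ Y[l]`. -/
def twistComplex {P : CochainComplex D ℤ} {l : ℤ}
    (g : ShiftedHom P ((single D (ComplexShape.up ℤ) 0).obj Y) l) (X : CochainComplex C ℤ) :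
    mapBifunctor X P F (ComplexShape.up ℤ) ⟶ X⟦l⟧ :=
  g.map (F.map₂CochainComplex.obj X) ≫ (unitComplex F Y e X)⟦l⟧'

lemma ι_augComplex {P : CochainComplex D ℤ} (s : P ⟶ (single D (ComplexShape.up ℤ) 0).obj Y)
    (X : CochainComplex C ℤ) (p q j : ℤ) (h : p + q = j) :
    ιMapBifunctor X P F (ComplexShape.up ℤ) p q j h ≫ (augComplex F Y e s X).f j =
      if hq : q = 0 then (F.obj (X.X p)).map (s.f q ≫
        (singleObjXIsoOfEq (ComplexShape.up ℤ) 0 Y q hq).hom) ≫ e.app (X.X p) ≫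
        (X.XIsoOfEq (show p = j by omega)).hom else 0 := by
  have h1 : (augComplex F Y e s X).f j =
    (mapBifunctorMap (𝟙 X) s F (ComplexShape.up ℤ)).f j ≫ (unitComplex F Y e X).f j := rfl
  rw [h1, ι_mapBifunctorMap_assoc]
  rw [unitComplex, ι_mapBifunctorDesc]
  split_ifs with hq
  · simp
  · simp

/-- The component of a chain map `P ⟶ Y[l]` in the degree `-l`. -/
def twistComponent {P : CochainComplex D ℤ} {l : ℤ}
    (g : ShiftedHom P ((single D (ComplexShape.up ℤ) 0).obj Y) l) (q : ℤ) (hq : q + l = 0) :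
    P.X q ⟶ Y :=
  g.f q ≫ (singleObjXIsoOfEq (ComplexShape.up ℤ) 0 Y (q + l) hq).hom

lemma comp_comp_eq_smul {a a' b c d e' : C} (i₁ : a ⟶ b) (m : b ⟶ c) (i : c ⟶ d) (v : d ⟶ e')
    (f : a ⟶ a') (i₂ : a' ⟶ c) (i₃ : a' ⟶ d) {w : a' ⟶ e'} (u : ℤˣ) (h₁ : i₁ ≫ m = f ≫ i₂)
    (h₂ : i₂ ≫ i = u • i₃) (h₃ : i₃ ≫ v = w) : i₁ ≫ ((m ≫ i) ≫ v) = u • (f ≫ w) := by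
  subst h₃
  rw [Category.assoc, reassoc_of% h₁, reassoc_of% h₂, Linear.units_smul_comp,
    Linear.comp_units_smul]

/-- The sign (-1)^{pl} comes from moving the shift [l] out of the second argument, past the degree p
of the first. -/
lemma ι_twistComplex {P : CochainComplex D ℤ} {l : ℤ}
    (g : ShiftedHom P ((single D (ComplexShape.up ℤ) 0).obj Y) l)
    (X : CochainComplex C ℤ) (p q j : ℤ) (h : p + q = j) :
    ιMapBifunctor X P F (ComplexShape.up ℤ) p q j h ≫ (twistComplex F Y e g X).f j =
      if hq : q + l = 0 then (p * l).negOnePow • (F.obj (X.X p)).map (twistComponent Y g q hq) ≫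
        e.app (X.X p) ≫ (X.XIsoOfEq (show p = j + l by omega)).hom else 0 := by
  have h1 : ιMapBifunctor X P F (ComplexShape.up ℤ) p q j h ≫
      (mapBifunctorMap (𝟙 X) g F (ComplexShape.up ℤ)).f j =
      (F.obj (X.X p)).map (g.f q) ≫ ιMapBifunctor X _ F (ComplexShape.up ℤ) p q j h := by
    rw [ι_mapBifunctorMap]
    simp
  let i : (mapBifunctor X (((single D (ComplexShape.up ℤ) 0).obj Y)⟦l⟧) F (ComplexShape.up ℤ)).X j ⟶
      (mapBifunctor X ((single D (ComplexShape.up ℤ) 0).obj Y) F (ComplexShape.up ℤ)).X (j + l) :=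
    (CochainComplex.mapBifunctorShift₂Iso X _ F l).hom.f j
  have h2 : ιMapBifunctor X (((single D (ComplexShape.up ℤ) 0).obj Y)⟦l⟧) F (ComplexShape.up ℤ)
      p q j h ≫ i = (p * l).negOnePow • ιMapBifunctor X ((single D (ComplexShape.up ℤ) 0).obj Y) F
        (ComplexShape.up ℤ) p (q + l) (j + l) (show p + (q + l) = j + l by omega) := by
    refine (CochainComplex.ι_mapBifunctorShift₂Iso_hom_f X
      ((single D (ComplexShape.up ℤ) 0).obj Y) F l p q j h (q + l) (j + l) rfl rfl).trans ?_
    congr 1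
    have h5 : (CochainComplex.shiftFunctorObjXIso ((single D (ComplexShape.up ℤ) 0).obj Y) l q
      (q + l) rfl).hom = 𝟙 (((single D (ComplexShape.up ℤ) 0).obj Y).X (q + l)) := rfl
    have h6 : (CochainComplex.shiftFunctorObjXIso (mapBifunctor X
      ((single D (ComplexShape.up ℤ) 0).obj Y) F (ComplexShape.up ℤ)) l j (j + l) rfl).inv =
      𝟙 ((mapBifunctor X ((single D (ComplexShape.up ℤ) 0).obj Y) F (ComplexShape.up ℤ)).X (j + l)) :=
      rfl
    refine (congrArg₂ (fun a b => (F.obj (X.X p)).map a ≫ ιMapBifunctor X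
      ((single D (ComplexShape.up ℤ) 0).obj Y) F
        (ComplexShape.up ℤ) p (q + l) (j + l) (show p + (q + l) = j + l by omega) ≫ b) h5 h6).trans ?_
    exact (congrArg (fun a => a ≫ _ ≫ 𝟙 _) (CategoryTheory.Functor.map_id (F.obj (X.X p)) _)).trans
      ((Category.id_comp _).trans (Category.comp_id _))
  have h3 : ιMapBifunctor X ((single D (ComplexShape.up ℤ) 0).obj Y) F (ComplexShape.up ℤ)
      p (q + l) (j + l) (show p + (q + l) = j + l by omega) ≫ (unitComplex F Y e X).f (j + l) =
      if hq : q + l = 0 then (F.obj (X.X p)).map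
        (singleObjXIsoOfEq (ComplexShape.up ℤ) 0 Y (q + l) hq).hom ≫ e.app (X.X p) ≫
        (X.XIsoOfEq (show p = j + l by omega)).hom else 0 := by
    rw [unitComplex, ι_mapBifunctorDesc]
  refine (comp_comp_eq_smul _ _ i _ _ _ _ (p * l).negOnePow h1 h2 h3).trans ?_
  split_ifs with hq
  · congr 1
    exact (Category.assoc _ _ _).symm.trans (congrArg (· ≫ _) (Functor.map_comp _ _ _).symm)
  · exact (congrArg _ Limits.comp_zero).trans (smul_zero _)

lemma unitComplex_naturality {X X' : CochainComplex C ℤ} (v : X ⟶ X') :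
    (F.map₂CochainComplex.map v).app ((single D (ComplexShape.up ℤ) 0).obj Y) ≫
      unitComplex F Y e X' = unitComplex F Y e X ≫ v := by
  ext j : 1
  apply mapBifunctor.hom_ext
  intro p q h
  have hpq : p + q = j := h
  subst hpq
  have h1 : ((F.map₂CochainComplex.map v).app ((single D (ComplexShape.up ℤ) 0).obj Y) ≫
      unitComplex F Y e X').f (p + q) = (mapBifunctorMap v (𝟙 _) F (ComplexShape.up ℤ)).f (p + q) ≫
        (unitComplex F Y e X').f (p + q) := rfl
  rw [h1, HomologicalComplex.comp_f, ι_mapBifunctorMap_assoc, unitComplex, unitComplex,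
    ι_mapBifunctorDesc, ι_mapBifunctorDesc_assoc]
  by_cases hq : q = 0
  · subst hq
    simp only [↓reduceDIte, Category.assoc, HomologicalComplex.id_f,
      CategoryTheory.Functor.map_id, Category.id_comp]
    have h2 := e.naturality (v.f p)
    dsimp at h2
    have h3 := (F.map (v.f p)).naturality (singleObjXIsoOfEq (ComplexShape.up ℤ) 0 Y 0 rfl).hom
    have h4 : v.f p ≫ (X'.XIsoOfEq (show p = p + 0 by omega)).hom =
        (X.XIsoOfEq (show p = p + 0 by omega)).hom ≫ v.f (p + 0) :=
      XIsoOfEq_hom_naturality v (show p = p + 0 by omega)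
    rw [← reassoc_of% h3, reassoc_of% h2]
    congr 2
  · simp [hq]

lemma augComplex_naturality {P : CochainComplex D ℤ}
    (s : P ⟶ (single D (ComplexShape.up ℤ) 0).obj Y) {X X' : CochainComplex C ℤ} (v : X ⟶ X') :
    (F.map₂CochainComplex.map v).app P ≫ augComplex F Y e s X' = augComplex F Y e s X ≫ v := by
  have h := (F.map₂CochainComplex.map v).naturality s
  refine (Category.assoc _ _ _).symm.trans ((congrArg (· ≫ _) h.symm).trans ?_)
  refine (Category.assoc _ _ _).trans ((congrArg (_ ≫ ·) (unitComplex_naturality F Y e v)).trans ?_)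
  exact (Category.assoc _ _ _).symm

lemma square_comp {K : Type*} [Category K] {a b c d a' b' c' d' : K} {m : a ⟶ a'} {f : a ⟶ b}
    {f' : a' ⟶ b'} {m₁ : b ⟶ b'} {i : b ⟶ c} {i' : b' ⟶ c'} {m₂ : c ⟶ c'} {u : c ⟶ d}
    {u' : c' ⟶ d'} {m₃ : d ⟶ d'} (h₁ : f ≫ m₁ = m ≫ f') (h₂ : m₁ ≫ i' = i ≫ m₂)
    (h₃ : m₂ ≫ u' = u ≫ m₃) : m ≫ ((f' ≫ i') ≫ u') = ((f ≫ i) ≫ u) ≫ m₃ := by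
  rw [Category.assoc, Category.assoc, Category.assoc, ← h₃, ← reassoc_of% h₁, reassoc_of% h₂]

lemma twistComplex_naturality {P : CochainComplex D ℤ} {l : ℤ}
    (g : ShiftedHom P ((single D (ComplexShape.up ℤ) 0).obj Y) l) {X X' : CochainComplex C ℤ}
    (v : X ⟶ X') : (F.map₂CochainComplex.map v).app P ≫ twistComplex F Y e g X' =
      twistComplex F Y e g X ≫ v⟦l⟧' := by
  have h := (F.map₂CochainComplex.map v).naturality g
  have h' : (F.map₂CochainComplex.map v).app _ ≫
      ((F.map₂CochainComplex.obj X').commShiftIso l).hom.app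
        ((single D (ComplexShape.up ℤ) 0).obj Y) =
      ((F.map₂CochainComplex.obj X).commShiftIso l).hom.app
        ((single D (ComplexShape.up ℤ) 0).obj Y) ≫
      ((F.map₂CochainComplex.map v).app ((single D (ComplexShape.up ℤ) 0).obj Y))⟦l⟧' :=
    (NatTrans.shift_app_comm (F.map₂CochainComplex.map v) l _).symm
  have h'' := congrArg (fun w => w⟦l⟧') (unitComplex_naturality F Y e v)
  exact square_comp h h' (((shiftFunctor _ l).map_comp _ _).symm.trans
    (h''.trans ((shiftFunctor _ l).map_comp _ _)))

end Twist

/-! ### Additivity of the total tensor product in the first complex. -/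

section TensorAdditive

open HomologicalComplex

variable {C D : Type*} [Category C] [Category D] [Preadditive C] [Preadditive D]
  (F : C ⥤ D ⥤ C) [F.Additive] [∀ X, (F.obj X).Additive]
  [∀ (K₁ : CochainComplex C ℤ) (K₂ : CochainComplex D ℤ), CochainComplex.HasMapBifunctor K₁ K₂ F]

lemma map₂CochainComplex_map_add {X X' : CochainComplex C ℤ} (v w : X ⟶ X')
    (P : CochainComplex D ℤ) : (F.map₂CochainComplex.map (v + w)).app P =
      (F.map₂CochainComplex.map v).app P + (F.map₂CochainComplex.map w).app P := by
  ext j : 1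
  apply mapBifunctor.hom_ext
  intro p q h
  change _ ≫ (mapBifunctorMap (v + w) (𝟙 P) F (ComplexShape.up ℤ)).f j =
    _ ≫ ((mapBifunctorMap v (𝟙 P) F (ComplexShape.up ℤ)).f j +
      (mapBifunctorMap w (𝟙 P) F (ComplexShape.up ℤ)).f j)
  rw [Preadditive.comp_add, ι_mapBifunctorMap, ι_mapBifunctorMap, ι_mapBifunctorMap, add_f_apply,
    Functor.map_add, NatTrans.app_add, Preadditive.add_comp]

lemma map₂CochainComplex_map_sum {σ : Type*} (S : Finset σ) {X X' : CochainComplex C ℤ}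
    (v : σ → (X ⟶ X')) (P : CochainComplex D ℤ) :
    (F.map₂CochainComplex.map (∑ i ∈ S, v i)).app P =
      ∑ i ∈ S, (F.map₂CochainComplex.map (v i)).app P :=
  map_sum (AddMonoidHom.mk' (fun v : X ⟶ X' => (F.map₂CochainComplex.map v).app P)
    fun v w => map₂CochainComplex_map_add F v w P) v S

end TensorAdditive

lemma shiftedHom_map_comp_map {C₁ C₂ C₃ : Type*} [Category C₁] [Category C₂] [Category C₃]
    [HasShift C₁ ℤ] [HasShift C₂ ℤ] [HasShift C₃ ℤ] (F : C₁ ⥤ C₂) (G : C₂ ⥤ C₃)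
    [F.CommShift ℤ] [G.CommShift ℤ] {X Y : C₁} {l : ℤ} (f : ShiftedHom X Y l) {Z : C₂}
    (u : F.obj Y ⟶ Z) : f.map (F ⋙ G) ≫ (G.map u)⟦l⟧' =
      G.map (f.map F ≫ u⟦l⟧') ≫ (G.commShiftIso l).hom.app Z := by
  rw [ShiftedHom.map, ShiftedHom.map, Functor.map_comp, Functor.map_comp,
    Functor.commShiftIso_comp_hom_app, Category.assoc, Category.assoc, Category.assoc,
    Category.assoc, Functor.comp_map]
  congr 2
  exact ((G.commShiftIso l).hom.naturality u).symm

/-! ### The equation of the characteristic homomorphism as a homotopy of chain maps. -/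

section CharEquation

variable (k : Type u) [Field k] (A : Type u) [CommRing A] [Algebra k A]

/-- The equation of `IsCharValue`, for given chain maps on a resolution. -/
def CharEquation {P : CochainComplex (ModuleCat.{u} (A ⊗[k] A)) ℤ} {l : ℤ}
    (s : P ⟶ regComplex k A) (g : ShiftedHom P (regComplex k A) l)
    (X : CochainComplex (ModuleCat.{u} A) ℤ)
    (φ : ShiftedHom ((toHo A).obj X) ((toHo A).obj X) l) : Prop :=
  ((tensorHo k A X).map s ≫ unitHo k A X) ≫ φ = g.map (tensorHo k A X) ≫ (unitHo k A X)⟦l⟧'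

variable {P : CochainComplex (ModuleCat.{u} (A ⊗[k] A)) ℤ} {l : ℤ}
    (s : P ⟶ regComplex k A) (g : ShiftedHom P (regComplex k A) l)

/-- The chain map `X ⊗ P ⟶ X` induced by `s`. -/
abbrev aug (X : CochainComplex (ModuleCat.{u} A) ℤ) :=
  augComplex (tensorBimod k A) (regBimod k A) (unitBimod k A) s X

/-- The chain map `X ⊗ P ⟶ X[l]` induced by `g`. -/
abbrev twist (X : CochainComplex (ModuleCat.{u} A) ℤ) :=
  twistComplex (tensorBimod k A) (regBimod k A) (unitBimod k A) g X

lemma charEquation_iff (X : CochainComplex (ModuleCat.{u} A) ℤ)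
    (φ : ShiftedHom ((toHo A).obj X) ((toHo A).obj X) l) : CharEquation k A s g X φ ↔
      (toHo A).map (aug k A s X) ≫ φ =
        (toHo A).map (twist k A g X) ≫ ((toHo A).commShiftIso l).hom.app X := by
  have h1 : (tensorHo k A X).map s ≫ unitHo k A X = (toHo A).map (aug k A s X) :=
    ((toHo A).map_comp _ _).symm
  have h2 : g.map (tensorHo k A X) ≫ (unitHo k A X)⟦l⟧' =
      (toHo A).map (twist k A g X) ≫ ((toHo A).commShiftIso l).hom.app X := by
    exact shiftedHom_map_comp_map ((tensorBimod k A).map₂CochainComplex.obj X) (toHo A) g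
      (unitComplex (tensorBimod k A) (regBimod k A) (unitBimod k A) X)
  rw [CharEquation, h1, h2]
  rfl

/-- In this form a value of χ can be verified by writing down a homotopy. -/
lemma charEquation_hoClass_iff (X : CochainComplex (ModuleCat.{u} A) ℤ)
    (φ : ShiftedHom X X l) : CharEquation k A s g X (hoClass φ) ↔
      Nonempty (Homotopy (aug k A s X ≫ φ) (twist k A g X)) := by
  rw [charEquation_iff, hoClass, ShiftedHom.map, ← Category.assoc, ← Functor.map_comp]
  constructor
  · intro h
    exact ⟨HomotopyCategory.homotopyOfEq _ _ ((cancel_mono _).1 h)⟩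
  · rintro ⟨h⟩
    rw [HomotopyCategory.eq_of_homotopy _ _ h]

lemma toHo_map_tensor_eq {X X' : CochainComplex (ModuleCat.{u} A) ℤ} {v w : X ⟶ X'}
    (h : (toHo A).map v = (toHo A).map w) (P : CochainComplex (ModuleCat.{u} (A ⊗[k] A)) ℤ) :
    (toHo A).map (((tensorBimod k A).map₂CochainComplex.map v).app P) =
      (toHo A).map (((tensorBimod k A).map₂CochainComplex.map w).app P) :=
  HomotopyCategory.eq_of_homotopy _ _ (HomologicalComplex.mapBifunctorMapHomotopy₁
    (HomotopyCategory.homotopyOfEq _ _ h) (𝟙 P) (tensorBimod k A) (ComplexShape.up ℤ))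

lemma toHo_aug_naturality {X X' : CochainComplex (ModuleCat.{u} A) ℤ} (v : X ⟶ X') :
    (toHo A).map (((tensorBimod k A).map₂CochainComplex.map v).app P) ≫
      (toHo A).map (aug k A s X') = (toHo A).map (aug k A s X) ≫ (toHo A).map v :=
  ((toHo A).map_comp _ _).symm.trans ((congrArg _ (augComplex_naturality _ _ _ s v)).trans
    ((toHo A).map_comp _ _))

lemma toHo_twist_naturality {X X' : CochainComplex (ModuleCat.{u} A) ℤ} (v : X ⟶ X') :
    (toHo A).map (((tensorBimod k A).map₂CochainComplex.map v).app P) ≫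
      ((toHo A).map (twist k A g X') ≫ ((toHo A).commShiftIso l).hom.app X') =
    ((toHo A).map (twist k A g X) ≫ ((toHo A).commShiftIso l).hom.app X) ≫
      ((toHo A).map v)⟦l⟧' := by
  have h := congrArg (toHo A).map (twistComplex_naturality _ _ (unitBimod k A) g v)
  have h' := ((toHo A).commShiftIso l).hom.naturality v
  refine (Category.assoc _ _ _).symm.trans ((congrArg (· ≫ _) (((toHo A).map_comp _ _).symm.trans
    (h.trans ((toHo A).map_comp _ _)))).trans ?_)
  exact (Category.assoc _ _ _).trans ((congrArg (_ ≫ ·) h').trans (Category.assoc _ _ _).symm)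

end CharEquation

/-- The morphism of `K^b_p A` given by a chain map. -/
def hoMap {A : Type u} [CommRing A] {X Y : PerfectComplex A} (v : X.cx ⟶ Y.cx) :
    perf A X ⟶ perf A Y := (toHo A).map v

lemma exists_eq_mk₀ {A : Type u} [CommRing A] {X Y : PerfectComplex A}
    (f : ShiftedHom (perf A X) (perf A Y) (0 : ℤ)) : ∃ v : X.cx ⟶ Y.cx,
      f = ShiftedHom.mk₀ 0 rfl (hoMap v) := by
  obtain ⟨v, hv⟩ := (toHo A).map_surjective ((ShiftedHom.homEquiv (0 : ℤ) rfl).symm f)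
  exact ⟨v, ((ShiftedHom.homEquiv (0 : ℤ) rfl).apply_symm_apply f).symm.trans
    (congrArg (ShiftedHom.mk₀ (0 : ℤ) rfl) hv.symm)⟩

lemma gradedCenter_naturality {A : Type u} [CommRing A] {l : ℤ}
    {η : ∀ X, ShiftedHom (perf A X) (perf A X) l} (hη : η ∈ gradedCenter (perf A) l)
    {X Y : PerfectComplex A} (v : X.cx ⟶ Y.cx) : hoMap v ≫ η Y = η X ≫ (hoMap v)⟦l⟧' := by
  have h := comp_center_comm hη (ShiftedHom.mk₀ 0 rfl (hoMap v)) (add_zero l)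
  rw [mul_zero, Int.negOnePow_zero, one_smul] at h
  exact (ShiftedHom.mk₀_comp (0 : ℤ) rfl (hoMap v) (η Y)).symm.trans
    (h.symm.trans (ShiftedHom.comp_mk₀ (η X) (0 : ℤ) rfl (hoMap v)))

lemma ShiftedHom_mk₀_sum {C : Type*} [Category C] [Preadditive C] [HasShift C ℤ]
    [∀ n : ℤ, (shiftFunctor C n).Additive] {X Y : C} {σ : Type*} (S : Finset σ) (f : σ → (X ⟶ Y)) :
    ShiftedHom.mk₀ (0 : ℤ) rfl (∑ a ∈ S, f a) = ∑ a ∈ S, ShiftedHom.mk₀ (0 : ℤ) rfl (f a) :=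
  map_sum (AddMonoidHom.mk' (fun f : X ⟶ Y => ShiftedHom.mk₀ (0 : ℤ) rfl f)
    (fun f g => ShiftedHom.mk₀_add (0 : ℤ) rfl f g)) f S

/-- The formal part of the reduction to intervals: the identity of T (which will be X ⊗ P) is a sum
of maps through the objects TI a, and U, η and G' are natural along each summand, so the equation
for the blocks implies the one for X. -/
lemma sum_comp_eq_of_factorization {C : Type*} [Category C] [Preadditive C] {σ : Type*}
    (S : Finset σ) {T X Z : C} {TI I ZI : σ → C} {U : T ⟶ X} {η : X ⟶ Z} {G' : T ⟶ Z}
    {Tw : ∀ a, T ⟶ TI a} {Tv : ∀ a, TI a ⟶ T} {v : ∀ a, I a ⟶ X} {vZ : ∀ a, ZI a ⟶ Z}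
    {UI : ∀ a, TI a ⟶ I a} {ηI : ∀ a, I a ⟶ ZI a} {GI : ∀ a, TI a ⟶ ZI a}
    (h₁ : ∑ a ∈ S, Tw a ≫ Tv a = 𝟙 T) (h₂ : ∀ a, Tv a ≫ U = UI a ≫ v a)
    (h₃ : ∀ a, v a ≫ η = ηI a ≫ vZ a) (h₄ : ∀ a, UI a ≫ ηI a = GI a)
    (h₅ : ∀ a, Tv a ≫ G' = GI a ≫ vZ a) : U ≫ η = G' := by
  rw [← Category.id_comp U, ← Category.id_comp G', ← h₁, Preadditive.sum_comp,
    Preadditive.sum_comp, Preadditive.sum_comp]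
  refine Finset.sum_congr rfl fun a _ => ?_
  have h₆ : Tv a ≫ U ≫ η = GI a ≫ vZ a := by
    rw [← Category.assoc, h₂, Category.assoc, h₃, ← Category.assoc, h₄]
  rw [Category.assoc (Tw a) (Tv a) G', h₅, Category.assoc, Category.assoc, h₆]

/-! ### Reduction of the characteristic equation to interval complexes. -/

section CharEquationPerfect

variable (k : Type u) [Field k] {P : CochainComplex (ModuleCat.{u} (Lam k ⊗[k] Lam k)) ℤ} {l : ℤ}
  (s : P ⟶ regComplex k (Lam k)) (g : ShiftedHom P (regComplex k (Lam k)) l)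

/-- A central family satisfies the equation of the characteristic homomorphism once it
does on the interval complexes. -/
lemma charEquation_of_intervals {η : ∀ X, ShiftedHom (perf (Lam k) X) (perf (Lam k) X) l}
    (hη : η ∈ gradedCenter (perf (Lam k)) l)
    (h : ∀ m n, CharEquation k (Lam k) s g (interval k m n) (η (intervalPerf k m n)))
    (X : PerfectComplex (Lam k)) : CharEquation k (Lam k) s g X.cx (η X) := by
  obtain ⟨d⟩ := exists_decomposition X
  choose v hv using fun a => exists_eq_mk₀ (d.inj a)
  choose w hw using fun a => exists_eq_mk₀ (d.proj a)
  have h1 : (toHo (Lam k)).map (∑ a, w a ≫ v a) = (toHo (Lam k)).map (𝟙 X.cx) := by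
    have h2 := d.sum_eq
    have h3 : ∀ a, (d.proj a).comp (d.inj a) (zero_add 0) =
        ShiftedHom.mk₀ 0 rfl (hoMap (w a ≫ v a)) := by
      intro a
      rw [hv, hw, ShiftedHom.mk₀_comp_mk₀]
      exact congrArg (ShiftedHom.mk₀ (0 : ℤ) rfl) ((toHo (Lam k)).map_comp (w a) (v a)).symm
    rw [Finset.sum_congr rfl fun a _ => h3 a, ← ShiftedHom_mk₀_sum] at h2
    have h5 : ∑ a, hoMap (w a ≫ v a) = 𝟙 (perf (Lam k) X) :=
      (ShiftedHom.homEquiv (0 : ℤ) rfl).injective h2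
    exact ((toHo (Lam k)).map_sum _ _).trans (h5.trans ((toHo (Lam k)).map_id _).symm)
  -- Tensoring with P preserves homotopies, so the decomposition of the identity of X yields one of
  -- the identity of X ⊗ P.
  have h2 := toHo_map_tensor_eq k (Lam k) h1 P
  have h3 : ∑ a, (toHo (Lam k)).map (((tensorBimod k (Lam k)).map₂CochainComplex.map (w a)).app P) ≫
      (toHo (Lam k)).map (((tensorBimod k (Lam k)).map₂CochainComplex.map (v a)).app P) = 𝟙 _ := by
    rw [map₂CochainComplex_map_sum, Functor.map_sum] at h2
    refine Eq.trans (Finset.sum_congr rfl fun a _ => ?_) (h2.trans ?_)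
    · exact ((toHo (Lam k)).map_comp _ _).symm.trans (congrArg _
        (congrArg (fun (u : _ ⟶ _) => NatTrans.app u P) ((tensorBimod k (Lam k)).map₂CochainComplex.map_comp _ _)).symm)
    · exact (congrArg (fun (u : _ ⟶ _) => (toHo (Lam k)).map (NatTrans.app u P))
        ((tensorBimod k (Lam k)).map₂CochainComplex.map_id _)).trans ((toHo (Lam k)).map_id _)
  refine (charEquation_iff k (Lam k) s g X.cx (η X)).2 ?_
  refine sum_comp_eq_of_factorization Finset.univ
    (Tw := fun a => (toHo (Lam k)).map (((tensorBimod k (Lam k)).map₂CochainComplex.map (w a)).app P))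
    (Tv := fun a => (toHo (Lam k)).map (((tensorBimod k (Lam k)).map₂CochainComplex.map (v a)).app P))
    (v := fun a => (toHo (Lam k)).map (v a)) (vZ := fun a => ((toHo (Lam k)).map (v a))⟦l⟧')
    (UI := fun a => (toHo (Lam k)).map (aug k (Lam k) s _))
    (ηI := fun a => η _)
    (GI := fun a => (toHo (Lam k)).map (twist k (Lam k) g _) ≫ ((toHo (Lam k)).commShiftIso l).hom.app _)
    ?_ ?_ ?_ ?_ ?_
  · exact h3
  · intro a
    exact toHo_aug_naturality k (Lam k) s (v a)
  · intro a
    exact gradedCenter_naturality hη (v a)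
  · intro a
    exact (charEquation_iff k (Lam k) s g _ _).1 (h _ _)
  · intro a
    exact toHo_twist_naturality k (Lam k) g (v a)

end CharEquationPerfect

/-! ### The periodic resolution of the dual numbers as a bimodule over themselves -/

section PeriodicComplex

variable {E : Type u} [CommRing E] (ρ : ℤ → E)

/-- The module `E` in the degrees `q ≤ 0`, and zero in the other degrees. -/
def resTerm (E : Type u) [CommRing E] (q : ℤ) : Submodule E E := if q ≤ 0 then ⊤ else ⊥

/-- Multiplication by `ρ q` from the degree `q` to the degree `q'`. -/
def resD (q q' : ℤ) : resTerm E q →ₗ[E] resTerm E q' :=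
  if h : q' ≤ 0 then LinearMap.codRestrict _ (ρ q • (resTerm E q).subtype)
    (fun _ => by simp [resTerm, h])
  else 0

lemma resD_coe (q q' : ℤ) (v : resTerm E q) : (resD ρ q q' v : E) =
    if q' ≤ 0 then ρ q * (v : E) else 0 := by
  by_cases h : q' ≤ 0
  · rw [resD, dif_pos h, if_pos h]; rfl
  · rw [resD, dif_neg h, if_neg h]; rfl

variable {ρ} in
lemma resD_resD (hρ : ∀ q, ρ (q + 1) * ρ q = 0) (i : ℤ) :
    resD ρ (i + 1) (i + 1 + 1) ∘ₗ resD ρ i (i + 1) = 0 := by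
  ext1 v
  apply Subtype.ext
  rw [LinearMap.comp_apply, resD_coe, resD_coe]
  split_ifs
  · rw [← mul_assoc, hρ, zero_mul]; rfl
  · simp
  · rfl

/-- The complex with the module `E` in the degrees `q ≤ 0`, and with the multiplications by `ρ q` as
differentials. -/
def freeComplex (hρ : ∀ q, ρ (q + 1) * ρ q = 0) : CochainComplex (ModuleCat.{u} E) ℤ where
  X q := ModuleCat.of _ (resTerm E q)
  d q q' := if q + 1 = q' then ModuleCat.ofHom (resD ρ q q') else 0
  shape q q' h := if_neg h
  d_comp_d' i j l hij hjl := by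
    have hij' : i + 1 = j := hij
    have hjl' : j + 1 = l := hjl
    subst hij'
    subst hjl'
    rw [if_pos rfl, if_pos rfl, ← ModuleCat.ofHom_comp, resD_resD hρ]
    rfl

variable {ρ} (hρ : ∀ q, ρ (q + 1) * ρ q = 0)

/-- The inclusion of the terms of `freeComplex ρ` in `E`. -/
def freeIncl (q : ℤ) : (freeComplex ρ hρ).X q ⟶ ModuleCat.of E E :=
  ModuleCat.ofHom (resTerm E q).subtype

lemma freeIncl_injective (q : ℤ) : Function.Injective (freeIncl hρ q) := Subtype.val_injective

lemma freeIncl_surjective {q : ℤ} (hq : q ≤ 0) : Function.Surjective (freeIncl hρ q) := fun v =>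
  ⟨(⟨v, by rw [resTerm, if_pos hq]; trivial⟩ : resTerm E q), rfl⟩

lemma freeComplex_subsingleton {q : ℤ} (hq : 0 < q) : Subsingleton ((freeComplex ρ hρ).X q) := by
  have h : resTerm E q = ⊥ := if_neg (by omega)
  change Subsingleton (resTerm E q)
  rw [h]
  infer_instance

lemma freeIncl_d {q q' : ℤ} (h : q + 1 = q') (hq : q' ≤ 0) (v : (freeComplex ρ hρ).X q) :
    freeIncl hρ q' ((freeComplex ρ hρ).d q q' v) = (show E from ρ q * (freeIncl hρ q v : E)) := by
  subst h
  have h1 : (freeComplex ρ hρ).d q (q + 1) = ModuleCat.ofHom (resD ρ q (q + 1)) := if_pos rfl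
  rw [h1]
  exact (resD_coe ρ q (q + 1) v).trans (if_pos hq)

lemma freeComplex_d_incl {q q' : ℤ} (h : q + 1 = q') (hq : q' ≤ 0) :
    (freeComplex ρ hρ).d q q' ≫ freeIncl hρ q' =
      freeIncl hρ q ≫ ModuleCat.ofHom (LinearMap.lsmul E E (ρ q)) := by
  ext v
  exact freeIncl_d hρ h hq v

instance (q : ℤ) : Projective ((freeComplex ρ hρ).X q) := by
  rw [← IsProjective.iff_projective]
  change Module.Projective E (resTerm E q)
  by_cases h : q ≤ 0
  · rw [resTerm, if_pos h]
    exact Module.Projective.of_equiv Submodule.topEquiv.symm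
  · rw [resTerm, if_neg h]
    infer_instance

instance : (freeComplex ρ hρ).IsStrictlyLE 0 := by
  rw [CochainComplex.isStrictlyLE_iff]
  intro i hi
  have := freeComplex_subsingleton hρ hi
  exact ModuleCat.isZero_of_subsingleton _

instance : (freeComplex ρ hρ).IsKProjective := CochainComplex.isKProjective_of_projective _ 0

lemma freeComplex_exactAt (h : ∀ (q : ℤ) (v : E), ρ (q + 1) * v = 0 → ∃ w, ρ q * w = v) {q : ℤ}
    (hq : q ≠ 0) : (freeComplex ρ hρ).ExactAt q := by
  rw [HomologicalComplex.exactAt_iff' _ (q - 1) q (q + 1) (by simp) (by simp),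
    ShortComplex.moduleCat_exact_iff]
  intro v hv
  change (freeComplex ρ hρ).d q (q + 1) v = 0 at hv
  change ∃ w, (freeComplex ρ hρ).d (q - 1) q w = v
  rcases lt_or_gt_of_ne hq with hq | hq
  · have h1 := freeIncl_d hρ rfl (show q + 1 ≤ 0 by omega) v
    rw [hv, map_zero] at h1
    have h2 : ρ (q - 1 + 1) * (freeIncl hρ q v : E) = 0 := by
      rw [show q - 1 + 1 = q by omega]
      exact h1.symm
    obtain ⟨w, hw⟩ := h _ _ h2
    obtain ⟨w', hw'⟩ := freeIncl_surjective hρ (show q - 1 ≤ 0 by omega) w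
    refine ⟨w', freeIncl_injective hρ q ?_⟩
    refine (freeIncl_d hρ (by omega) (by omega) w').trans ?_
    rw [hw']
    exact hw
  · have := freeComplex_subsingleton hρ hq
    exact ⟨0, Subsingleton.elim _ _⟩

end PeriodicComplex

/-! ### Augmentations of free complexes and chain maps to a shifted module. -/

section AugmentedPeriodicComplex

variable {E : Type u} [CommRing E] {ρ : ℤ → E} (hρ : ∀ q, ρ (q + 1) * ρ q = 0)
  {Y : ModuleCat.{u} E} (π : ModuleCat.of E E ⟶ Y)

/-- The augmentation of `freeComplex ρ` given by a map `E ⟶ Y` annihilated by `ρ (-1)`. -/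
def freeAug (hπ : ∀ v : E, π (show E from ρ (-1) * v) = 0) : freeComplex ρ hρ ⟶
    (HomologicalComplex.single (ModuleCat.{u} E) (ComplexShape.up ℤ) 0).obj Y :=
  HomologicalComplex.mkHomToSingle (freeIncl hρ 0 ≫ π) (by
    intro i hi
    have hi' : i + 1 = 0 := hi
    obtain rfl : i = -1 := by omega
    ext v
    exact (congrArg π (freeIncl_d hρ hi' le_rfl v)).trans (hπ _))

variable (hπ : ∀ v : E, π (show E from ρ (-1) * v) = 0)

lemma freeAug_f_zero : (freeAug hρ π hπ).f 0 ≫ (HomologicalComplex.singleObjXSelf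
    (ComplexShape.up ℤ) 0 Y).hom = freeIncl hρ 0 ≫ π := by
  simp [freeAug]

lemma freeAug_quasiIso (h : ∀ (q : ℤ) (v : E), ρ (q + 1) * v = 0 → ∃ w, ρ q * w = v)
    (h' : ∀ v : E, π v = 0 → ∃ w, ρ (-1) * w = v) (hs : Function.Surjective π) :
    QuasiIso (freeAug hρ π hπ) where
  quasiIsoAt q := by
    by_cases hq : q = 0
    · subst hq
      rw [quasiIsoAt_iff' _ (-1) 0 1 (by simp) (by simp),
        ShortComplex.quasiIso_iff_of_zeros']
      · have h1 : ∀ v, (HomologicalComplex.singleObjXSelf (ComplexShape.up ℤ) 0 Y).hom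
            ((freeAug hρ π hπ).f 0 v) = π (freeIncl hρ 0 v) := fun v =>
          congrArg (fun f : (freeComplex ρ hρ).X 0 ⟶ Y => f v) (freeAug_f_zero hρ π hπ)
        refine ⟨?_, ?_⟩
        · rw [ShortComplex.moduleCat_exact_iff]
          intro v hv
          change (freeAug hρ π hπ).f 0 v = 0 at hv
          change ∃ w, (freeComplex ρ hρ).d (-1) 0 w = v
          have h2 := h1 v
          rw [hv, map_zero] at h2
          obtain ⟨w, hw⟩ := h' _ h2.symm
          obtain ⟨w', hw'⟩ := freeIncl_surjective hρ (show (-1 : ℤ) ≤ 0 by norm_num) w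
          refine ⟨w', freeIncl_injective hρ 0 ((freeIncl_d hρ (by norm_num) le_rfl w').trans ?_)⟩
          rw [hw']
          exact hw
        · have : Epi (freeIncl hρ 0) :=
            (ModuleCat.epi_iff_surjective _).2 (freeIncl_surjective hρ le_rfl)
          have : Epi π := (ModuleCat.epi_iff_surjective _).2 hs
          have h3 : (freeAug hρ π hπ).f 0 = (freeIncl hρ 0 ≫ π) ≫ (HomologicalComplex.singleObjXSelf
              (ComplexShape.up ℤ) 0 Y).inv :=
            (Iso.eq_comp_inv _).2 (freeAug_f_zero hρ π hπ)
          change Epi ((freeAug hρ π hπ).f 0)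
          rw [h3]
          infer_instance
      · have := freeComplex_subsingleton hρ (show (0 : ℤ) < 1 by norm_num)
        exact (ModuleCat.isZero_of_subsingleton ((freeComplex ρ hρ).X 1)).eq_of_tgt _ _
      · exact HomologicalComplex.single_obj_d (ComplexShape.up ℤ) 0 Y _ _
      · exact HomologicalComplex.single_obj_d (ComplexShape.up ℤ) 0 Y _ _
    · rw [quasiIsoAt_iff_exactAt _ _ (freeComplex_exactAt hρ h hq)]
      exact HomologicalComplex.exactAt_single_obj _ _ _ _ hq

lemma single_shift_d {D : Type*} [Category D] [Preadditive D] [Limits.HasZeroObject D]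
    (Y : D) (l i j : ℤ) :
    (((HomologicalComplex.single D (ComplexShape.up ℤ) 0).obj Y)⟦l⟧).d i j = 0 := by
  by_cases hij : i + 1 = j
  · by_cases hi : i + l = 0
    · exact (HomologicalComplex.isZero_single_obj_X (ComplexShape.up ℤ) 0 Y (j + l)
        (by omega)).eq_of_tgt _ _
    · exact (HomologicalComplex.isZero_single_obj_X (ComplexShape.up ℤ) 0 Y (i + l) hi).eq_of_src _ _
  · exact HomologicalComplex.shape _ _ _ hij

/-- The chain map from `freeComplex ρ` to `Y[l]` given by a map `E ⟶ Y` which is annihilated by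
`ρ (-l - 1)`. -/
def freeTwist (l : ℤ) (m : ModuleCat.of E E ⟶ Y)
    (hm : ∀ v : E, m (show E from ρ (-l - 1) * v) = 0) : ShiftedHom (freeComplex ρ hρ)
      ((HomologicalComplex.single (ModuleCat.{u} E) (ComplexShape.up ℤ) 0).obj Y) l where
  f q := if hq : q + l = 0 then freeIncl hρ q ≫ m ≫
    (HomologicalComplex.singleObjXIsoOfEq (ComplexShape.up ℤ) 0 Y (q + l) hq).inv else 0
  comm' i j hij := by
    have hij' : i + 1 = j := hij
    subst hij'
    have h : (((HomologicalComplex.single (ModuleCat.{u} E) (ComplexShape.up ℤ) 0).obj Y)⟦l⟧).d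
      i (i + 1) = 0 := single_shift_d _ _ _ _
    rw [h, Limits.comp_zero]
    split_ifs with hq
    · obtain rfl : i = -l - 1 := by omega
      by_cases hl : -l - 1 + 1 ≤ 0
      · refine (((Category.assoc _ _ _).symm.trans (Category.assoc _ _ _).symm).trans
          ((congrArg (· ≫ _) ?_).trans Limits.zero_comp)).symm
        ext v
        exact (congrArg m (freeIncl_d hρ rfl hl v)).trans (hm _)
      · have := freeComplex_subsingleton hρ (show 0 < -l - 1 + 1 by omega)
        refine (Limits.IsZero.eq_of_tgt (ModuleCat.isZero_of_subsingleton
          ((freeComplex ρ hρ).X (-l - 1 + 1))) ((freeComplex ρ hρ).d (-l - 1) (-l - 1 + 1)) 0 ▸ ?_)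
        exact Limits.zero_comp.symm
    · exact Limits.comp_zero.symm

lemma twistComponent_freeTwist (l : ℤ) (m : ModuleCat.of E E ⟶ Y)
    (hm : ∀ v : E, m (show E from ρ (-l - 1) * v) = 0) (q : ℤ) (hq : q + l = 0) :
    twistComponent Y (freeTwist hρ l m hm) q hq = freeIncl hρ q ≫ m := by
  have h : (freeTwist hρ l m hm).f q = freeIncl hρ q ≫ m ≫
    (HomologicalComplex.singleObjXIsoOfEq (ComplexShape.up ℤ) 0 Y (q + l) hq).inv := dif_pos hq
  rw [twistComponent, h]
  simp

lemma shiftedHom_single_ext {D : Type*} [Category D] [Preadditive D] [Limits.HasZeroObject D]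
    {P : CochainComplex D ℤ} {Y : D} {l : ℤ}
    {g g' : ShiftedHom P ((HomologicalComplex.single D (ComplexShape.up ℤ) 0).obj Y) l}
    (h : ∀ q hq, twistComponent Y g q hq = twistComponent Y g' q hq) : g = g' := by
  apply HomologicalComplex.Hom.ext
  funext q
  by_cases hq : q + l = 0
  · exact (Iso.cancel_iso_hom_right _ _
      (HomologicalComplex.singleObjXIsoOfEq (ComplexShape.up ℤ) 0 Y (q + l) hq)).1 (h q hq)
  · exact (HomologicalComplex.isZero_single_obj_X (ComplexShape.up ℤ) 0 Y (q + l) hq).eq_of_tgt _ _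

/-- A chain map to a complex concentrated in one degree is its component there, in the source degree
-l ≤ 0 where the complex is E; compatibility with the differential says that ρ(-l-1) is annihilated.
-/
lemma exists_eq_freeTwist (l : ℕ) (g : ShiftedHom (freeComplex ρ hρ)
      ((HomologicalComplex.single (ModuleCat.{u} E) (ComplexShape.up ℤ) 0).obj Y) (l : ℤ)) :
    ∃ m hm, g = freeTwist hρ l m hm := by
  let i : ModuleCat.of E E ⟶ (freeComplex ρ hρ).X (-l) := ModuleCat.ofHom
    (LinearMap.codRestrict (resTerm E (-l)) LinearMap.id (fun v => by
      rw [resTerm, if_pos (by omega)]; trivial))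
  have hi : ∀ v, freeIncl hρ (-l) (i v) = v := fun _ => rfl
  have hi' : freeIncl hρ (-l) ≫ i = 𝟙 _ := rfl
  have hm : ∀ v : E, (i ≫ twistComponent Y g (-l) (by omega)) (show E from ρ (-l - 1) * v) = 0 := by
    intro v
    obtain ⟨w, hw⟩ := freeIncl_surjective hρ (show (-l - 1 : ℤ) ≤ 0 by omega) v
    have h1 : (freeComplex ρ hρ).d (-l - 1) (-l) w = i (show E from ρ (-l - 1) * v) := by
      apply freeIncl_injective
      rw [freeIncl_d hρ (by omega) (by omega), hw, hi]
    have h2 := g.comm (-l - 1) (-l)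
    have h3 : (((HomologicalComplex.single (ModuleCat.{u} E) (ComplexShape.up ℤ) 0).obj Y)⟦(l : ℤ)⟧).d
      (-l - 1) (-l) = 0 := single_shift_d _ _ _ _
    rw [h3, Limits.comp_zero] at h2
    have h4 : (freeComplex ρ hρ).d (-l - 1) (-l) ≫ twistComponent Y g (-l) (by omega) = 0 :=
      (Category.assoc _ _ _).symm.trans ((congrArg (· ≫ _) h2.symm).trans Limits.zero_comp)
    have h5 := congrArg (fun f : _ ⟶ Y => f w) h4
    exact (congrArg (twistComponent Y g (-l) (by omega)) h1).symm.trans h5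
  refine ⟨_, hm, ?_⟩
  apply shiftedHom_single_ext
  intro q hq
  obtain rfl : q = -l := by omega
  rw [twistComponent_freeTwist, ← Category.assoc, hi', Category.id_comp]

end AugmentedPeriodicComplex

/-! ### Morphisms from a K-projective complex in the derived category are homotopy classes. -/

section DerivedHom

open DerivedCategory

variable {C : Type*} [Category C] [Abelian C] [HasDerivedCategory C] {K L : CochainComplex C ℤ}
  [K.IsKProjective]

lemma Q_map_eq_iff (f g : K ⟶ L) : Q.map f = Q.map g ↔
    (HomotopyCategory.quotient C (ComplexShape.up ℤ)).map f =
      (HomotopyCategory.quotient C (ComplexShape.up ℤ)).map g := by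
  rw [← (CochainComplex.IsKProjective.Qh_map_bijective K _).injective.eq_iff,
    ← cancel_mono ((quotientCompQhIso C).hom.app L), quotientCompQhIso_hom_naturality,
    quotientCompQhIso_hom_naturality, cancel_epi]

lemma exists_Q_map_eq (φ : Q.obj K ⟶ Q.obj L) : ∃ f : K ⟶ L, Q.map f = φ := by
  obtain ⟨g, hg⟩ := (CochainComplex.IsKProjective.Qh_map_bijective K
    ((HomotopyCategory.quotient C (ComplexShape.up ℤ)).obj L)).surjective
    ((quotientCompQhIso C).hom.app K ≫ φ ≫ (quotientCompQhIso C).inv.app L)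
  obtain ⟨f, rfl⟩ := (HomotopyCategory.quotient C (ComplexShape.up ℤ)).map_surjective g
  refine ⟨f, ?_⟩
  rw [← cancel_mono ((quotientCompQhIso C).inv.app L), quotientCompQhIso_inv_naturality, hg]
  simp

lemma shiftedHom_map_Q_eq_iff {l : ℤ} (f g : ShiftedHom K L l) : f.map Q = g.map Q ↔
    (HomotopyCategory.quotient C (ComplexShape.up ℤ)).map f =
      (HomotopyCategory.quotient C (ComplexShape.up ℤ)).map g := by
  rw [ShiftedHom.map, ShiftedHom.map, cancel_mono, Q_map_eq_iff]

lemma exists_shiftedHom_map_Q_eq {l : ℤ} (φ : ShiftedHom (Q.obj K) (Q.obj L) l) :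
    ∃ f : ShiftedHom K L l, f.map Q = φ := by
  obtain ⟨f, hf⟩ := exists_Q_map_eq (K := K) (φ ≫ (Q.commShiftIso l).inv.app L)
  refine ⟨f, ?_⟩
  rw [ShiftedHom.map, hf]
  simp

end DerivedHom

/-! ### Multiplication in coordinates for two elements of square zero. -/

section TwoNilpotents

variable {k E : Type*} [Field k] [CommRing E] [Algebra k E] {x y : E}

lemma neg_add_mul_coordinates (hx : x * x = 0) (hy : y * y = 0) (τ a b c d : k) : -(y + τ • x) *
    (a • 1 + b • x + c • y + d • (x * y)) =
      (0 : k) • 1 + (-τ * a) • x + (-a) • y + (-b - τ * c) • (x * y) := by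
  simp only [Algebra.smul_def, map_neg, map_sub, map_mul, map_zero]
  linear_combination (-(algebraMap k E τ) * (algebraMap k E b + algebraMap k E d * y)) * hx -
      (algebraMap k E c + algebraMap k E d * x) * hy

lemma neg_add_mul_neg_add (hx : x * x = 0) (hy : y * y = 0) (τ : k) : -(y + (-τ) • x) * -(y + τ • x) = 0 := by
  simp only [Algebra.smul_def, map_neg]
  linear_combination hy - (algebraMap k E τ) ^ 2 * hx

end TwoNilpotents

/-! ### The enveloping algebra of the dual numbers and exactness of the periodic resolution. -/

section Resolution

variable (k : Type u) [Field k]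

/-- The element `x ⊗ 1`. -/
def epsLeft : Lam k ⊗[k] Lam k := (DualNumber.eps : Lam k) ⊗ₜ[k] (1 : Lam k)

/-- The element `1 ⊗ x`. -/
def epsRight : Lam k ⊗[k] Lam k := (1 : Lam k) ⊗ₜ[k] (DualNumber.eps : Lam k)

lemma epsLeft_mul_self : epsLeft k * epsLeft k = 0 := by
  simp [epsLeft, Algebra.TensorProduct.tmul_mul_tmul]

lemma epsRight_mul_self : epsRight k * epsRight k = 0 := by
  simp [epsRight, Algebra.TensorProduct.tmul_mul_tmul]

lemma inLeft_eps : inLeft k (Lam k) DualNumber.eps = epsLeft k := rfl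

lemma inRight_eps : inRight k (Lam k) DualNumber.eps = epsRight k := rfl

lemma mulHom_epsLeft : mulHom k (Lam k) (epsLeft k) = DualNumber.eps := by
  simp [mulHom, epsLeft]

lemma mulHom_epsRight : mulHom k (Lam k) (epsRight k) = DualNumber.eps := by
  simp [mulHom, epsRight]

variable {k}

lemma mulHom_smul (c : k) (e : Lam k ⊗[k] Lam k) :
    mulHom k (Lam k) (c • e) = c • mulHom k (Lam k) e :=
  map_smul (Algebra.TensorProduct.lmul' k : Lam k ⊗[k] Lam k →ₐ[k] Lam k) c e

lemma lam_eq (a : Lam k) : a = a.fst • (1 : Lam k) + a.snd • DualNumber.eps := by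
  ext <;> simp

lemma exists_coordinates (e : Lam k ⊗[k] Lam k) : ∃ a b c d : k,
    e = a • 1 + b • epsLeft k + c • epsRight k + d • (epsLeft k * epsRight k) := by
  induction e using TensorProduct.induction_on with
  | zero => exact ⟨0, 0, 0, 0, by simp⟩
  | tmul v w =>
    refine ⟨v.fst * w.fst, v.snd * w.fst, v.fst * w.snd, v.snd * w.snd, ?_⟩
    conv_lhs => rw [lam_eq v, lam_eq w]
    simp only [TensorProduct.add_tmul, TensorProduct.tmul_add, TensorProduct.smul_tmul_smul,
      epsLeft, epsRight, Algebra.TensorProduct.tmul_mul_tmul, one_mul, mul_one,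
      Algebra.TensorProduct.one_def]
    abel
  | add v w hv hw =>
    obtain ⟨a, b, c, d, rfl⟩ := hv
    obtain ⟨a', b', c', d', rfl⟩ := hw
    exact ⟨a + a', b + b', c + c', d + d', by simp only [add_smul]; abel⟩

lemma mulHom_coordinates (a b c d : k) : mulHom k (Lam k)
    (a • 1 + b • epsLeft k + c • epsRight k + d • (epsLeft k * epsRight k)) =
      a • 1 + (b + c) • DualNumber.eps := by
  simp only [map_add, mulHom_smul, map_mul, mulHom_epsLeft, mulHom_epsRight, map_one,
    DualNumber.eps_mul_eps, smul_zero, add_zero, add_smul, add_assoc]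

/-- The product of coordinates `e ↦ (f ⊗ g) e`. -/
def tensorCoordinate (f g : Lam k →ₗ[k] k) : Lam k ⊗[k] Lam k →ₗ[k] k :=
  LinearMap.mul' k k ∘ₗ TensorProduct.map f g

/-- The products of the two coordinate forms of Λ are dual to the four elements. -/
lemma coordinates_eq_zero {a b c d : k}
    (h : a • 1 + b • epsLeft k + c • epsRight k + d • (epsLeft k * epsRight k) = 0) :
    a = 0 ∧ b = 0 ∧ c = 0 ∧ d = 0 := by
  have h' : ∀ f g : Lam k →ₗ[k] k, a * (f 1 * g 1) + b * (f DualNumber.eps * g 1) +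
      c * (f 1 * g DualNumber.eps) + d * (f DualNumber.eps * g DualNumber.eps) = 0 := by
    intro f g
    have h2 := congrArg (tensorCoordinate f g) h
    simpa [tensorCoordinate, epsLeft, epsRight, Algebra.TensorProduct.tmul_mul_tmul,
      Algebra.TensorProduct.one_def] using h2
  have h1 : (TrivSqZeroExt.fstHom k k k).toLinearMap (1 : Lam k) = 1 := rfl
  have h2 : (TrivSqZeroExt.fstHom k k k).toLinearMap (DualNumber.eps : Lam k) = 0 := rfl
  have h3 : TrivSqZeroExt.sndHom k k (1 : Lam k) = 0 := rfl
  have h4 : TrivSqZeroExt.sndHom k k (DualNumber.eps : Lam k) = 1 := rfl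
  refine ⟨?_, ?_, ?_, ?_⟩
  · simpa [h1, h2, h3, h4] using
      h' (TrivSqZeroExt.fstHom k k k).toLinearMap (TrivSqZeroExt.fstHom k k k).toLinearMap
  · simpa [h1, h2, h3, h4] using
      h' (TrivSqZeroExt.sndHom k k) (TrivSqZeroExt.fstHom k k k).toLinearMap
  · simpa [h1, h2, h3, h4] using
      h' (TrivSqZeroExt.fstHom k k k).toLinearMap (TrivSqZeroExt.sndHom k k)
  · simpa [h1, h2, h3, h4] using h' (TrivSqZeroExt.sndHom k k) (TrivSqZeroExt.sndHom k k)

variable (k)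

/-- The element defining the differential of the resolution from the degree `q` to `q + 1`. -/
def resCoef (q : ℤ) : Lam k ⊗[k] Lam k := -(epsRight k + (-1 : k) ^ q • epsLeft k)

variable {k}

lemma resCoef_mul_coordinates (q : ℤ) (a b c d : k) : resCoef k q *
    (a • 1 + b • epsLeft k + c • epsRight k + d • (epsLeft k * epsRight k)) =
      (0 : k) • 1 + (-(-1) ^ q * a) • epsLeft k + (-a) • epsRight k +
        (-b - (-1) ^ q * c) • (epsLeft k * epsRight k) :=
  neg_add_mul_coordinates (E := Lam k ⊗[k] Lam k) (epsLeft_mul_self k) (epsRight_mul_self k) _ a b c d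

lemma resCoef_mul_resCoef (q : ℤ) : resCoef k (q + 1) * resCoef k q = 0 := by
  rw [resCoef, resCoef, zpow_add_one₀ (by simp), mul_neg_one]
  exact neg_add_mul_neg_add (k := k) (E := Lam k ⊗[k] Lam k) (epsLeft_mul_self k) (epsRight_mul_self k) _

/-- In coordinates (a, b, c, d) the hypothesis says a = 0 and b = (-1)^q c, and then -c - d (x ⊗ 1)
is a preimage. -/
lemma exists_of_resCoef_mul_eq_zero {q : ℤ} {e : Lam k ⊗[k] Lam k}
    (h : resCoef k (q + 1) * e = 0) : ∃ v, resCoef k q * v = e := by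
  obtain ⟨a, b, c, d, rfl⟩ := exists_coordinates e
  rw [resCoef_mul_coordinates] at h
  obtain ⟨-, -, h1, h2⟩ := coordinates_eq_zero h
  have h1' : a = 0 := by simpa using h1
  have h2' : b = (-1) ^ q * c := by
    rw [zpow_add_one₀ (by simp)] at h2
    linear_combination -h2
  refine ⟨(-c) • 1 + (-d) • epsLeft k + (0 : k) • epsRight k +
    (0 : k) • (epsLeft k * epsRight k), ?_⟩
  rw [resCoef_mul_coordinates, h1', h2']
  congr 3 <;> simp

/-- The kernel of the multiplication is annihilated by `resCoef k 0`, so exactness one step further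
applies. -/
lemma exists_of_mulHom_eq_zero {e : Lam k ⊗[k] Lam k}
    (h : mulHom k (Lam k) e = 0) : ∃ v, resCoef k (-1) * v = e := by
  apply exists_of_resCoef_mul_eq_zero
  obtain ⟨a, b, c, d, rfl⟩ := exists_coordinates e
  rw [mulHom_coordinates] at h
  have h1 : a = 0 := by simpa using congrArg TrivSqZeroExt.fst h
  have h2 : b + c = 0 := by simpa using congrArg TrivSqZeroExt.snd h
  rw [resCoef_mul_coordinates, h1]
  have h3 : (-b - (-1) ^ (-1 + 1 : ℤ) * c) = 0 := by
    simp
    linear_combination -h2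
  rw [h3]
  simp

/-- The value alternates between -2x and 0; this is the source of the dependence on parity and
characteristic. -/
lemma mulHom_resCoef (q : ℤ) :
    mulHom k (Lam k) (resCoef k q) = -((1 + (-1 : k) ^ q) • DualNumber.eps) := by
  rw [resCoef, map_neg, map_add, mulHom_smul, mulHom_epsLeft, mulHom_epsRight, add_smul, one_smul]

variable (k)

/-- The periodic resolution of `Λ` by free bimodules. -/
abbrev resComplex : CochainComplex (ModuleCat.{u} (Lam k ⊗[k] Lam k)) ℤ :=
  freeComplex (resCoef k) resCoef_mul_resCoef

/-- The multiplication map `Λ ⊗ Λ ⟶ Λ`. -/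
def mulBimod : ModuleCat.of _ (Lam k ⊗[k] Lam k) ⟶ regBimod k (Lam k) :=
  ModuleCat.ofHom (Y := regBimod k (Lam k))
    { toFun := fun e => mulHom k (Lam k) e
      map_add' := map_add _
      map_smul' := fun a e => map_mul (mulHom k (Lam k)) a e }

/-- The augmentation of the resolution. -/
def resAug : resComplex k ⟶ regComplex k (Lam k) := freeAug resCoef_mul_resCoef (mulBimod k) (by
  intro v
  refine (map_mul (mulHom k (Lam k)) _ _).trans ?_
  rw [mulHom_resCoef, zpow_neg_one, inv_neg_one, add_neg_cancel, zero_smul, neg_zero, zero_mul]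
  rfl)

instance : QuasiIso (resAug k) := freeAug_quasiIso _ _ _
  (fun _ _ h => exists_of_resCoef_mul_eq_zero h) (fun _ h => exists_of_mulHom_eq_zero h)
  (fun a => ⟨inLeft k (Lam k) a, RingHom.congr_fun (mulHom_inLeft k (Lam k)) a⟩)

end Resolution

/-! ### Coboundaries on the free complex. -/

section FreeTwist

variable {E : Type u} [CommRing E] {ρ : ℤ → E} (hρ : ∀ q, ρ (q + 1) * ρ q = 0) {Y : ModuleCat.{u} E}

/-- The chain map `freeTwist` given by a multiple of `ρ (-l)` is homotopic to zero. -/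
def freeTwistHomotopy (l : ℤ) (hl : 0 < l) (m : ModuleCat.of E E ⟶ Y)
    (hm : ∀ v : E, m (show E from ρ (-l - 1) * v) = 0) (m' : ModuleCat.of E E ⟶ Y)
    (h : m = ModuleCat.ofHom (LinearMap.lsmul E E (ρ (-l))) ≫ m') :
    Homotopy (freeTwist hρ l m hm) 0 :=
  (Homotopy.ofEq (by
    ext q : 1
    have hr : (ComplexShape.up ℤ).Rel q (q + 1) := rfl
    rw [Homotopy.nullHomotopicMap'_f (show (ComplexShape.up ℤ).Rel (q - 1) q from
      by simp) hr, single_shift_d, Limits.comp_zero, add_zero]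
    by_cases hq : q + l = 0
    · obtain rfl : q = -l := by omega
      refine (dif_pos (show -l + l = 0 by omega)).trans (Eq.symm ((congrArg (_ ≫ ·)
        (dif_pos (show -l + l = 0 by omega))).trans ?_))
      rw [h]
      refine (Category.assoc _ _ _).symm.trans ((congrArg (· ≫ _)
        (freeComplex_d_incl hρ rfl (by omega))).trans ?_)
      exact (Category.assoc _ _ _).trans (congrArg (freeIncl hρ (-l) ≫ ·) (Category.assoc _ _ _).symm)
    · exact (HomologicalComplex.isZero_single_obj_X (ComplexShape.up ℤ) 0 Y (q + l) hq).eq_of_tgt _ _)).trans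
    (Homotopy.nullHomotopy' (fun i j _ => if hj : j + l = 0 then freeIncl hρ i ≫ m' ≫
      (HomologicalComplex.singleObjXIsoOfEq (ComplexShape.up ℤ) 0 Y (j + l) hj).inv else 0))

end FreeTwist

/-! ### Hochschild cocycles of the dual numbers -/

section Representatives

open DerivedCategory

variable {k : Type u} [Field k]

/-- The multiplication takes `resCoef k (-l - 1)` to -(1 - (-1)^l) x, so only the constant term of a
enters the cocycle condition. -/
lemma mul_resCoef_eq_zero_iff (l : ℤ) (a : Lam k) :
    a * mulHom k (Lam k) (resCoef k (-l - 1)) = 0 ↔ (-1 : k) ^ l * a.fst = a.fst := by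
  have h : (-1 : k) ^ (-l - 1) = -(-1) ^ l := by
    rw [zpow_sub_one₀ (by simp), zpow_neg, ← inv_zpow]
    simp
  rw [mulHom_resCoef, h]
  constructor
  · intro h1
    have h2 := congrArg TrivSqZeroExt.snd h1
    simp only [mul_neg, TrivSqZeroExt.snd_neg, TrivSqZeroExt.snd_mul, TrivSqZeroExt.snd_smul,
      DualNumber.snd_eps, TrivSqZeroExt.fst_smul, DualNumber.fst_eps, smul_eq_mul,
      TrivSqZeroExt.snd_zero] at h2
    simp at h2
    rcases h2 with h2 | h2
    · rw [h2, mul_zero]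
    · linear_combination -a.fst * h2
  · intro h1
    ext
    · simp
    · simp
      by_cases h2 : a.fst = 0
      · exact Or.inr h2
      · left
        have h3 : (-1 : k) ^ l = 1 := mul_right_cancel₀ h2 (h1.trans (one_mul _).symm)
        rw [h3, add_neg_cancel]

lemma resTwist_aux {l : ℤ} {a : Lam k} (ha : (-1 : k) ^ l * a.fst = a.fst)
    (v : Lam k ⊗[k] Lam k) : (mulBimod k ≫ mulReg k (Lam k) a)
      (show Lam k ⊗[k] Lam k from resCoef k (-l - 1) * v) = 0 := by
  have h := (mul_resCoef_eq_zero_iff l a).2 ha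
  have h1 : a * mulHom k (Lam k) (resCoef k (-l - 1) * v) = 0 := by
    rw [map_mul, ← mul_assoc, h, zero_mul]
  exact h1

/-- The chain map `P ⟶ Λ[l]` on the periodic resolution which maps the generator in the degree
`-l` to `a`. -/
def resTwist (l : ℤ) (a : Lam k) (ha : (-1 : k) ^ l * a.fst = a.fst) :
    ShiftedHom (resComplex k) (regComplex k (Lam k)) l :=
  freeTwist resCoef_mul_resCoef l (mulBimod k ≫ mulReg k (Lam k) a) (resTwist_aux ha)

lemma exists_eq_resTwist {l : ℕ} (g : ShiftedHom (resComplex k) (regComplex k (Lam k)) (l : ℤ)) :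
    ∃ a ha, g = resTwist l a ha := by
  obtain ⟨m, hm, rfl⟩ := exists_eq_freeTwist resCoef_mul_resCoef l g
  obtain ⟨a, h1⟩ : ∃ a : Lam k, ∀ e : Lam k ⊗[k] Lam k,
      m e = (show regBimod k (Lam k) from a * mulHom k (Lam k) e) := by
    refine ⟨show Lam k from m (1 : Lam k ⊗[k] Lam k), fun e => ?_⟩
    have h2 : e = e • (1 : Lam k ⊗[k] Lam k) := (mul_one e).symm
    refine (congrArg m h2).trans ((map_smul m.hom e (1 : Lam k ⊗[k] Lam k)).trans ?_)
    exact mul_comm (mulHom k (Lam k) e) _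
  have h3 : m = mulBimod k ≫ mulReg k (Lam k) a := by
    exact ModuleCat.hom_ext (LinearMap.ext h1)
  have h4 : (-1 : k) ^ (l : ℤ) * a.fst = a.fst := by
    rw [← mul_resCoef_eq_zero_iff]
    exact (h1 _).symm.trans ((congrArg m (mul_one (resCoef k (-l - 1))).symm).trans (hm 1))
  refine ⟨a, h4, ?_⟩
  subst h3
  rfl

variable (k) in
/-- The class `f` is represented by the chain map on the periodic resolution which maps the
generator in the degree `-l` to `a`. -/
def IsRep {l : ℕ} (f : HH k (Lam k) l) (a : Lam k) : Prop :=
  ∃ ha, Q.map (resAug k) ≫ f = (resTwist l a ha).map Q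

instance : IsIso (Q.map (resAug k)) := by
  rw [isIso_Q_map_iff_quasiIso]
  infer_instance

lemma exists_isRep {l : ℕ} (f : HH k (Lam k) l) : ∃ a, IsRep k f a := by
  obtain ⟨g, hg⟩ := exists_shiftedHom_map_Q_eq (K := resComplex k)
    (show ShiftedHom (Q.obj (resComplex k)) (Q.obj (regComplex k (Lam k))) (l : ℤ) from
      Q.map (resAug k) ≫ f)
  obtain ⟨a, ha, rfl⟩ := exists_eq_resTwist g
  exact ⟨a, ha, hg.symm⟩

lemma exists_isRep' {l : ℕ} {a : Lam k} (ha : (-1 : k) ^ (l : ℤ) * a.fst = a.fst) :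
    ∃ f : HH k (Lam k) l, IsRep k f a :=
  ⟨inv (Q.map (resAug k)) ≫ (resTwist l a ha).map Q, ha, IsIso.hom_inv_id_assoc _ _⟩

lemma IsRep.unique {l : ℕ} {f f' : HH k (Lam k) l} {a : Lam k} (h : IsRep k f a)
    (h' : IsRep k f' a) : f = f' := by
  obtain ⟨_, h⟩ := h
  obtain ⟨_, h'⟩ := h'
  exact (cancel_epi (Q.map (resAug k))).1 (h.trans h'.symm)

lemma single_map_f {D : Type*} [Category D] [Preadditive D] [Limits.HasZeroObject D]
    {Y Y' : D} (u : Y ⟶ Y') (q : ℤ) (hq : q = 0) :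
    ((HomologicalComplex.single D (ComplexShape.up ℤ) 0).map u).f q ≫
      (HomologicalComplex.singleObjXIsoOfEq (ComplexShape.up ℤ) 0 Y' q hq).hom =
    (HomologicalComplex.singleObjXIsoOfEq (ComplexShape.up ℤ) 0 Y q hq).hom ≫ u := by
  subst hq
  rw [HomologicalComplex.single_map_f_self]
  simp [HomologicalComplex.singleObjXSelf]

lemma twistComponent_comp {D : Type*} [Category D] [Preadditive D] [Limits.HasZeroObject D]
    {P : CochainComplex D ℤ} {Y Y' : D} {l : ℤ}
    (g : ShiftedHom P ((HomologicalComplex.single D (ComplexShape.up ℤ) 0).obj Y) l) (u : Y ⟶ Y')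
    (q : ℤ) (hq : q + l = 0) :
    twistComponent Y' (g ≫ ((HomologicalComplex.single D (ComplexShape.up ℤ) 0).map u)⟦l⟧') q hq =
      twistComponent Y g q hq ≫ u :=
  (Category.assoc _ _ _).trans ((congrArg (g.f q ≫ ·) (single_map_f u (q + l) hq)).trans
    (Category.assoc _ _ _).symm)

lemma resTwist_comp {l : ℤ} {a : Lam k} (ha : (-1 : k) ^ l * a.fst = a.fst) (c : Lam k)
    (hca : (-1 : k) ^ l * (c * a).fst = (c * a).fst) : resTwist l a ha ≫
      ((HomologicalComplex.single _ (ComplexShape.up ℤ) 0).map (mulReg k (Lam k) c))⟦l⟧' =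
    resTwist l (c * a) hca := by
  apply shiftedHom_single_ext
  intro q hq
  rw [twistComponent_comp, resTwist, resTwist, twistComponent_freeTwist, twistComponent_freeTwist]
  ext v
  exact (mul_assoc c a _).symm

lemma map_comp_shift {C₁ C₂ : Type*} [Category C₁] [Category C₂] [HasShift C₁ ℤ] [HasShift C₂ ℤ]
    (F : C₁ ⥤ C₂) [F.CommShift ℤ] {X Y Z : C₁} {l : ℤ} (g : ShiftedHom X Y l) (u : Y ⟶ Z) :
    ShiftedHom.map (show ShiftedHom X Z l from g ≫ u⟦l⟧') F = g.map F ≫ (F.map u)⟦l⟧' := by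
  rw [ShiftedHom.map, ShiftedHom.map, Functor.map_comp, Category.assoc, Category.assoc]
  congr 1
  exact (F.commShiftIso l).hom.naturality u

lemma twistComponent_mk₀ {D : Type*} [Category D] [Preadditive D] [Limits.HasZeroObject D]
    {P : CochainComplex D ℤ} {Y : D} {l : ℤ} (hl : l = 0)
    (u : P ⟶ (HomologicalComplex.single D (ComplexShape.up ℤ) 0).obj Y)
    (q : ℤ) (hq : q = 0) (hq' : q + l = 0) :
    twistComponent Y (ShiftedHom.mk₀ l hl u) q hq' =
      u.f q ≫ (HomologicalComplex.singleObjXIsoOfEq (ComplexShape.up ℤ) 0 Y q hq).hom := by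
  subst hl
  subst hq
  simp [twistComponent, ShiftedHom.mk₀, shiftFunctorZero', CochainComplex.shiftFunctorZero_inv_app_f,
    HomologicalComplex.XIsoOfEq]

lemma isRep_hhMul {l : ℕ} {f : HH k (Lam k) l} {a : Lam k} (h : IsRep k f a) (c : Lam k) :
    IsRep k (hhMul k (Lam k) (zero_add l) (hhZero k (Lam k) c) f) (c * a) := by
  obtain ⟨ha, h⟩ := h
  have hca : (-1 : k) ^ (l : ℤ) * (c * a).fst = (c * a).fst := by
    rw [TrivSqZeroExt.fst_mul, mul_left_comm, ha]
  refine ⟨hca, ?_⟩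
  have h1 := ShiftedHom.comp_mk₀ f ((0 : ℕ) : ℤ) (by simp)
    (Q.map ((HomologicalComplex.single _ (ComplexShape.up ℤ) 0).map (mulReg k (Lam k) c)))
  refine (congrArg (Q.map (resAug k) ≫ ·) h1).trans ((Category.assoc _ _ _).symm.trans
    ((congrArg (· ≫ _) h).trans ?_))
  rw [← resTwist_comp ha]
  exact (map_comp_shift Q _ _).symm

variable (k) in
lemma resAug_f_zero : (resAug k).f 0 ≫ (HomologicalComplex.singleObjXIsoOfEq
    (ComplexShape.up ℤ) 0 (regBimod k (Lam k)) 0 rfl).hom =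
      freeIncl resCoef_mul_resCoef 0 ≫ mulBimod k :=
  freeAug_f_zero resCoef_mul_resCoef (mulBimod k) _

lemma isRep_hhZero (c : Lam k) : IsRep k (hhZero k (Lam k) c) c := by
  refine ⟨by simp, ?_⟩
  have h1 : resTwist ((0 : ℕ) : ℤ) c (by simp) = ShiftedHom.mk₀ _ (by simp) (resAug k ≫
      (HomologicalComplex.single _ (ComplexShape.up ℤ) 0).map (mulReg k (Lam k) c)) := by
    apply shiftedHom_single_ext
    intro q hq
    obtain rfl : q = 0 := by simpa using hq
    rw [twistComponent_mk₀ _ _ _ rfl, resTwist, twistComponent_freeTwist]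
    refine ((Category.assoc _ _ _).symm.trans ((congrArg (· ≫ mulReg k (Lam k) c)
      (resAug_f_zero k).symm).trans ?_)).trans (Category.assoc _ _ _).symm
    exact (Category.assoc _ _ _).trans (congrArg ((resAug k).f 0 ≫ ·)
      (single_map_f (mulReg k (Lam k) c) 0 rfl).symm)
  rw [h1, ShiftedHom.map_mk₀, Functor.map_comp]
  exact (Category.assoc _ _ _).symm

/-- For even l > 0 the multiplication takes `resCoef k (-l)` to -2x. So every multiple of x is a
coboundary once 2 is invertible. -/
lemma eq_zero_of_isRep (h2 : (2 : k) ≠ 0) {l : ℕ} (hl : 0 < l) (hl' : Even l)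
    {f : HH k (Lam k) l} {a : Lam k} (h : IsRep k f a) (ha : a.fst = 0) : f = 0 := by
  obtain ⟨ha', h⟩ := h
  have h1 : mulBimod k ≫ mulReg k (Lam k) a = ModuleCat.ofHom (LinearMap.lsmul _ _ (resCoef k (-l))) ≫
      mulBimod k ≫ mulReg k (Lam k) ((-a.snd / 2) • 1) := by
    refine ModuleCat.hom_ext (LinearMap.ext fun e => ?_)
    have h3 : (-1 : k) ^ (-l : ℤ) = 1 := by
      rw [zpow_neg, zpow_natCast, hl'.neg_one_pow, inv_one]
    have h2 : a = (-a.snd / 2) • 1 * mulHom k (Lam k) (resCoef k (-l)) := by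
      rw [mulHom_resCoef, h3]
      ext
      · simp [ha]
      · simp
        field_simp
        norm_num
    have h4 : a * mulHom k (Lam k) e = (-a.snd / 2) • 1 * mulHom k (Lam k) (resCoef k (-l) * e) := by
      rw [map_mul, ← mul_assoc, ← h2]
    exact h4
  have h2 : (resTwist l a ha').map Q = (0 : ShiftedHom (resComplex k) (regComplex k (Lam k)) _).map Q :=
    (shiftedHom_map_Q_eq_iff _ _).2 (HomotopyCategory.eq_of_homotopy _ _
      (freeTwistHomotopy resCoef_mul_resCoef (l : ℤ) (by exact_mod_cast hl)
        (mulBimod k ≫ mulReg k (Lam k) a) (resTwist_aux ha') _ h1))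
  rw [ShiftedHom.map_zero] at h2
  exact (cancel_epi (Q.map (resAug k))).1 ((h.trans h2).trans Limits.comp_zero.symm)

lemma tensorHo_map_eq {A : Type u} [CommRing A] [Algebra k A] 
    {P P' : CochainComplex (ModuleCat.{u} (A ⊗[k] A)) ℤ}
    (X : CochainComplex (ModuleCat.{u} A) ℤ) {g g' : P ⟶ P'} 
    (h : (HomotopyCategory.quotient _ (ComplexShape.up ℤ)).map g =
      (HomotopyCategory.quotient _ (ComplexShape.up ℤ)).map g') :
    (tensorHo k A X).map g = (tensorHo k A X).map g' :=
  HomotopyCategory.eq_of_homotopy _ _ (HomologicalComplex.mapBifunctorMapHomotopy₂ (𝟙 X)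
    (HomotopyCategory.homotopyOfEq _ _ h) (tensorBimod k A) (ComplexShape.up ℤ))

lemma comp_eq_comp_of_precomp {C : Type*} [Category C] {T T' R X S W Z : C} {v : T' ⟶ T} {s : T ⟶ R}
    {s' : T' ⟶ R} {g : T ⟶ S} {g' : T' ⟶ S} {c : S ⟶ W} {u : R ⟶ X} {φ : X ⟶ Z} {w : W ⟶ Z}
    (h₁ : v ≫ s = s') (h₂ : v ≫ g = g') (h : (s ≫ u) ≫ φ = (g ≫ c) ≫ w) :
    (s' ≫ u) ≫ φ = (g' ≫ c) ≫ w := by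
  subst h₁ h₂
  simpa only [Category.assoc] using congrArg (v ≫ ·) h

/-- Independence of the resolution: the periodic resolution maps to any other one compatibly, up to
homotopy, with the augmentations and with the chain maps representing f. The equation is pulled back
along this map. -/
lemma isCharValue_iff {l : ℕ} {f : HH k (Lam k) l} 
    {g : ShiftedHom (resComplex k) (regComplex k (Lam k)) (l : ℤ)}
    (hg : Q.map (resAug k) ≫ f = g.map Q) (X : PerfectComplex (Lam k))
    (φ : ShiftedHom (perf (Lam k) X) (perf (Lam k) X) (l : ℤ)) :
    IsCharValue k (Lam k) f X φ ↔ CharEquation k (Lam k) (resAug k) g X.cx φ := by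
  constructor
  · rintro ⟨P, s, g', hP, hs, h1, h2⟩
    have : IsIso (Q.map s) := by
      rw [isIso_Q_map_iff_quasiIso]
      infer_instance
    obtain ⟨v, hv⟩ := exists_Q_map_eq (K := resComplex k) (Q.map (resAug k) ≫ inv (Q.map s))
    have h3 := (Q_map_eq_iff (K := resComplex k) (v ≫ s) (resAug k)).1 (by
      rw [Functor.map_comp, hv, Category.assoc, IsIso.inv_hom_id, Category.comp_id])
    have h4 := (shiftedHom_map_Q_eq_iff (K := resComplex k)
      (show ShiftedHom (resComplex k) (regComplex k (Lam k)) (l : ℤ) from v ≫ g') g).1 (by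
      rw [← hg]
      have h5 : ShiftedHom.map (show ShiftedHom (resComplex k) (regComplex k (Lam k)) (l : ℤ) from
          v ≫ g') Q = Q.map v ≫ g'.map Q := by
        rw [ShiftedHom.map, ShiftedHom.map, Functor.map_comp, Category.assoc]
      rw [h5, ← h1, hv, Category.assoc, IsIso.inv_hom_id_assoc])
    have h6 := tensorHo_map_eq X.cx h3
    have h7 := tensorHo_map_eq X.cx h4
    exact comp_eq_comp_of_precomp (((tensorHo k (Lam k) X.cx).map_comp v s).symm.trans h6)
      (((tensorHo k (Lam k) X.cx).map_comp v g').symm.trans h7) h2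
  · intro h
    exact ⟨resComplex k, resAug k, g, inferInstance, inferInstance, hg, h⟩

end Representatives

/-! ### Tensor products with bimodules by elements -/

section TensorElements

variable (k : Type u) [Field k] (A : Type u) [CommRing A] [Algebra k A]

/-- The element `m ⊗ n` of `M ⊗_A N`. -/
def tens (M : ModuleCat.{u} A) (N : ModuleCat.{u} (A ⊗[k] A)) (m : M) (n : N) :
    ((tensorBimod k A).obj M).obj N :=
  letI : Module A (A ⊗[k] A) := Module.compHom _ (inLeft k A)
  (show (ModuleCat.extendScalars (inLeft k A)).obj M from (1 : A ⊗[k] A) ⊗ₜ[A] m) ⊗ₜ[A ⊗[k] A] n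

variable {k A} {M M' : ModuleCat.{u} A} {N N' : ModuleCat.{u} (A ⊗[k] A)}

lemma tens_add_left (m m' : M) (n : N) :
    tens k A M N (m + m') n = tens k A M N m n + tens k A M N m' n :=
  (congrArg (fun v : (ModuleCat.extendScalars (inLeft k A)).obj M => v ⊗ₜ[A ⊗[k] A] n)
    (TensorProduct.tmul_add _ m m')).trans (TensorProduct.add_tmul _ _ n)

lemma tens_add_right (m : M) (n n' : N) :
    tens k A M N m (n + n') = tens k A M N m n + tens k A M N m n' :=
  TensorProduct.tmul_add _ n n'

lemma tens_zero_left (n : N) : tens k A M N 0 n = 0 := by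
  have h := tens_add_left (0 : M) 0 n
  rwa [add_zero, left_eq_add] at h

lemma tens_zero_right (m : M) : tens k A M N m 0 = 0 := by
  have h := tens_add_right m (0 : N) 0
  rwa [add_zero, left_eq_add] at h

lemma tens_smul_left (a : A) (m : M) (n : N) :
    tens k A M N (a • m) n = tens k A M N m (inLeft k A a • n) := by
  let : Module A (A ⊗[k] A) := Module.compHom _ (inLeft k A)
  have h : (show (ModuleCat.extendScalars (inLeft k A)).obj M from (1 : A ⊗[k] A) ⊗ₜ[A] (a • m)) =
      inLeft k A a • (show (ModuleCat.extendScalars (inLeft k A)).obj M from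
        (1 : A ⊗[k] A) ⊗ₜ[A] m) := by
    refine (TensorProduct.tmul_smul a _ m).trans ?_
    exact (TensorProduct.smul_tmul' a _ m).trans ((congrArg (· ⊗ₜ[A] m) (by rfl)).trans
      (ModuleCat.ExtendScalars.smul_tmul (inLeft k A) _ _ _).symm)
  exact (congrArg (· ⊗ₜ[A ⊗[k] A] n) h).trans (TensorProduct.smul_tmul _ _ n)

lemma smul_tens (a : A) (m : M) (n : N) :
    a • tens k A M N m n = tens k A M N m (inRight k A a • n) :=
  (TensorProduct.tmul_smul (inRight k A a) _ n).symm

lemma tens_induction {p : ((tensorBimod k A).obj M).obj N → Prop} (z)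
    (h0 : p 0) (h : ∀ m n, p (tens k A M N m n)) (hadd : ∀ v w, p v → p w → p (v + w)) : p z := by
  let : Module A (A ⊗[k] A) := Module.compHom _ (inLeft k A)
  refine TensorProduct.induction_on (R := A ⊗[k] A)
    (motive := fun z => p (show ((tensorBimod k A).obj M).obj N from z)) z h0 ?_ hadd
  intro v n
  refine TensorProduct.induction_on (R := A)
    (motive := fun (v : (A ⊗[k] A) ⊗[A] M) => p (show ((tensorBimod k A).obj M).obj N from
      (show (ModuleCat.extendScalars (inLeft k A)).obj M from v) ⊗ₜ[A ⊗[k] A] n)) v ?_ ?_ ?_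
  · refine Eq.subst (motive := p) ?_ h0
    exact (TensorProduct.zero_tmul _ n).symm
  · intro e m
    refine Eq.subst (motive := p) ?_ (h m (e • n))
    refine (TensorProduct.smul_tmul e _ n).symm.trans (congrArg (· ⊗ₜ[A ⊗[k] A] n) ?_)
    exact (ModuleCat.ExtendScalars.smul_tmul (inLeft k A) _ _ _).trans
      (congrArg (· ⊗ₜ[A] m) (mul_one e))
  · intro v w hv hw
    refine Eq.subst (motive := p) ?_ (hadd _ _ hv hw)
    exact (TensorProduct.add_tmul _ _ n).symm

lemma tens_hom_ext {Z : ModuleCat.{u} A} {f g : ((tensorBimod k A).obj M).obj N ⟶ Z}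
    (h : ∀ m n, f (tens k A M N m n) = g (tens k A M N m n)) : f = g := by
  ext z
  induction z using tens_induction with
  | h0 => exact (map_zero f.hom).trans (map_zero g.hom).symm
  | h m n => exact h m n
  | hadd v w hv hw => exact (map_add f.hom v w).trans ((congrArg₂ (· + ·) hv hw).trans
      (map_add g.hom v w).symm)

lemma tens_unit (m : M) (a : regBimod k A) :
    (unitBimod k A).app M (tens k A M (regBimod k A) m a) = (show A from a) • m := by
  refine (unitBimod_tensorElement k A M 1 m (show A from a)).trans ?_
  rw [map_one, mul_one]

end TensorElements

/-! ### Morphisms out of M ⊗ (A ⊗ A) from k-linear maps. -/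

section TensorMaps

variable {k : Type u} [Field k] {A : Type u} [CommRing A] [Algebra k A]
  {M Z : Type u} [AddCommGroup M] [Module A M] [Module k M] [IsScalarTower k A M]
  [AddCommGroup Z] [Module A Z] [Module k Z] [IsScalarTower k A Z] (ψ : M →ₗ[k] Z)

/-- The biadditive map `(a ⊗ b, m) ↦ b ψ(a m)`. -/
def bimodEval : A ⊗[k] A →+ M →+ Z :=
  TensorProduct.liftAddHom
    (AddMonoidHom.mk' (fun a => AddMonoidHom.mk' (fun b => AddMonoidHom.mk'
        (fun m => b • ψ (a • m)) (fun m m' => by rw [smul_add, map_add, smul_add]))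
        (fun b b' => by ext m; exact add_smul b b' _))
      (fun a a' => by ext b m; change b • ψ ((a + a') • m) = b • ψ (a • m) + b • ψ (a' • m)
                      rw [add_smul, map_add, smul_add]))
    (fun c a b => by
      ext m
      change b • ψ ((c • a) • m) = (c • b) • ψ (a • m)
      rw [smul_assoc, map_smul, smul_assoc, smul_comm])

lemma bimodEval_tmul (a b : A) (m : M) : bimodEval ψ (a ⊗ₜ[k] b) m = b • ψ (a • m) := rfl

lemma bimodEval_inLeft_mul (a : A) (e : A ⊗[k] A) (m : M) :
    bimodEval ψ (inLeft k A a * e) m = bimodEval ψ e (a • m) := by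
  induction e using TensorProduct.induction_on with
  | zero => rw [mul_zero, map_zero]; rfl
  | tmul b c =>
    have h : inLeft k A a * (b ⊗ₜ[k] c) = (a * b) ⊗ₜ[k] c := by
      simp [inLeft, Algebra.TensorProduct.tmul_mul_tmul]
    rw [h, bimodEval_tmul, bimodEval_tmul, smul_smul, mul_comm]
  | add v w hv hw =>
    rw [mul_add, map_add, map_add, AddMonoidHom.add_apply, AddMonoidHom.add_apply, hv, hw]

lemma bimodEval_inRight_mul (a : A) (e : A ⊗[k] A) (m : M) :
    bimodEval ψ (inRight k A a * e) m = a • bimodEval ψ e m := by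
  induction e using TensorProduct.induction_on with
  | zero => rw [mul_zero, map_zero]; exact (smul_zero a).symm
  | tmul b c =>
    have h : inRight k A a * (b ⊗ₜ[k] c) = b ⊗ₜ[k] (a * c) := by
      simp [inRight, Algebra.TensorProduct.tmul_mul_tmul]
    rw [h, bimodEval_tmul, bimodEval_tmul, smul_smul]
  | add v w hv hw =>
    rw [mul_add, map_add, map_add, AddMonoidHom.add_apply, AddMonoidHom.add_apply, hv, hw, smul_add]

/-- The map `(A ⊗ A) ⊗_A M ⟶ Z`, `e ⊗ m ↦ bimodEval ψ e m`. -/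
def extendEval : (ModuleCat.extendScalars (inLeft k A)).obj (ModuleCat.of A M) →+ Z :=
  letI : Module A (A ⊗[k] A) := Module.compHom _ (inLeft k A)
  TensorProduct.liftAddHom (R := A) (M := A ⊗[k] A) (N := M) (bimodEval ψ)
    (fun a e m => bimodEval_inLeft_mul ψ a e m)

/-- The map `M ⊗_A (A ⊗ A) ⟶ Z`, `m ⊗ (a ⊗ b) ↦ b ψ(a m)`. -/
def tensorEvalHom : ((tensorBimod k A).obj (ModuleCat.of A M)).obj
    (ModuleCat.of (A ⊗[k] A) (A ⊗[k] A)) →+ Z :=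
  TensorProduct.liftAddHom (R := A ⊗[k] A)
    (M := (ModuleCat.extendScalars (inLeft k A)).obj (ModuleCat.of A M)) (N := A ⊗[k] A)
    (AddMonoidHom.mk' (fun v => AddMonoidHom.mk' (fun e => extendEval ψ (e • v))
        (fun e e' => by rw [add_smul, map_add]))
      (fun v v' => by ext e; change extendEval ψ (e • (v + v')) = _; rw [smul_add, map_add]; rfl))
    (fun r v e => by
      change extendEval ψ (e • r • v) = extendEval ψ ((r * e) • v)
      rw [smul_smul, mul_comm])

lemma tensorEvalHom_tens (m : M) (e : A ⊗[k] A) : tensorEvalHom ψ (tens k A (ModuleCat.of A M)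
    (ModuleCat.of (A ⊗[k] A) (A ⊗[k] A)) m e) = bimodEval ψ e m := by
  let : Module A (A ⊗[k] A) := Module.compHom _ (inLeft k A)
  refine (congrArg (extendEval ψ) (ModuleCat.ExtendScalars.smul_tmul (inLeft k A)
    (M := ModuleCat.of A M) e 1 m)).trans ?_
  change bimodEval ψ (e * 1) m = _
  rw [mul_one]

/-- The morphism `M ⊗_A (A ⊗ A) ⟶ Z`, `m ⊗ (a ⊗ b) ↦ b ψ(a m)`. -/
def tensorEval : ((tensorBimod k A).obj (ModuleCat.of A M)).obj
    (ModuleCat.of (A ⊗[k] A) (A ⊗[k] A)) ⟶ ModuleCat.of A Z :=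
  ModuleCat.ofHom (X := ((tensorBimod k A).obj (ModuleCat.of A M)).obj
    (ModuleCat.of (A ⊗[k] A) (A ⊗[k] A)))
  { tensorEvalHom ψ with
    map_smul' := fun a z => by
      induction z using tens_induction with
      | h0 =>
        refine (congrArg (tensorEvalHom ψ) (smul_zero a)).trans ?_
        exact (map_zero (tensorEvalHom ψ)).trans
          ((congrArg (a • ·) (map_zero (tensorEvalHom ψ))).trans (smul_zero a)).symm
      | h m n =>
        refine (congrArg (tensorEvalHom ψ) (smul_tens a m n)).trans
          ((tensorEvalHom_tens ψ m _).trans ?_)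
        exact (bimodEval_inRight_mul ψ a n m).trans
          (congrArg (a • ·) (tensorEvalHom_tens ψ m n)).symm
      | hadd v w hv hw =>
        refine (congrArg (tensorEvalHom ψ) (smul_add a v w)).trans
          ((map_add (tensorEvalHom ψ) _ _).trans ((congrArg₂ (· + ·) hv hw).trans ?_))
        exact (smul_add a _ _).symm.trans
          (congrArg (a • ·) (map_add (tensorEvalHom ψ) v w).symm) }

lemma tensorEval_tens (m : M) (e : A ⊗[k] A) : tensorEval ψ (tens k A (ModuleCat.of A M)
    (ModuleCat.of (A ⊗[k] A) (A ⊗[k] A)) m e) = bimodEval ψ e m := tensorEvalHom_tens ψ m e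

end TensorMaps

/-! ### Homotopies on total complexes by components -/

section TotalHomotopy

open HomologicalComplex

variable {C D : Type*} [Category C] [Category D] [Preadditive C] [Preadditive D]
  {F : C ⥤ D ⥤ C} [F.Additive] [∀ X, (F.obj X).Additive]
  [∀ (K₁ : CochainComplex C ℤ) (K₂ : CochainComplex D ℤ), CochainComplex.HasMapBifunctor K₁ K₂ F]
  {X Z : CochainComplex C ℤ} {P : CochainComplex D ℤ}

lemma ι_mapBifunctor_d (p q j j' : ℤ) (hj : p + q = j) (hj' : j + 1 = j') :
    ιMapBifunctor X P F (ComplexShape.up ℤ) p q j hj ≫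
      (mapBifunctor X P F (ComplexShape.up ℤ)).d j j' =
    (F.map (X.d p (p + 1))).app (P.X q) ≫
        ιMapBifunctor X P F (ComplexShape.up ℤ) (p + 1) q j' (show p + 1 + q = j' by omega) +
      p.negOnePow • (F.obj (X.X p)).map (P.d q (q + 1)) ≫
        ιMapBifunctor X P F (ComplexShape.up ℤ) p (q + 1) j' (show p + (q + 1) = j' by omega) := by
  rw [mapBifunctor.d_eq, Preadditive.comp_add, mapBifunctor.ι_D₁, mapBifunctor.ι_D₂,
    mapBifunctor.d₁_eq _ _ _ _ (show (ComplexShape.up ℤ).Rel p (p + 1) from rfl) q _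
      (show p + 1 + q = j' by omega),
    mapBifunctor.d₂_eq _ _ _ _ p (show (ComplexShape.up ℤ).Rel q (q + 1) from rfl) _
      (show p + (q + 1) = j' by omega)]
  simp only [ComplexShape.ε₁_def, ComplexShape.ε₂_def, one_smul]
  rfl

/-- A homotopy between morphisms from a total complex, given by components. -/
def totalHomotopy {f g : mapBifunctor X P F (ComplexShape.up ℤ) ⟶ Z}
    (H : ∀ p q j, (F.obj (X.X p)).obj (P.X q) ⟶ Z.X j)
    (h : ∀ p q j (hj : p + q = j), ιMapBifunctor X P F (ComplexShape.up ℤ) p q j hj ≫ f.f j =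
      (F.map (X.d p (p + 1))).app (P.X q) ≫ H (p + 1) q j +
        p.negOnePow • ((F.obj (X.X p)).map (P.d q (q + 1)) ≫ H p (q + 1) j) +
        H p q (j - 1) ≫ Z.d (j - 1) j +
        ιMapBifunctor X P F (ComplexShape.up ℤ) p q j hj ≫ g.f j) : Homotopy f g where
  hom i j := if j + 1 = i then mapBifunctorDesc (fun p q _ => H p q j) else 0
  zero i j hij := if_neg hij
  comm j := by
    apply mapBifunctor.hom_ext
    intro p q hj
    have hj' : p + q = j := hj
    rw [h p q j hj', dNext_eq _ (show (ComplexShape.up ℤ).Rel j (j + 1) from rfl),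
      prevD_eq _ (show (ComplexShape.up ℤ).Rel (j - 1) j by simp), if_pos rfl, if_pos (by omega),
      Preadditive.comp_add, Preadditive.comp_add, reassoc_of% (ι_mapBifunctor_d (F := F) (X := X) (P := P) p q j (j + 1) hj' rfl),
      Preadditive.add_comp]
    congr 2
    · congr 1
      · rw [Category.assoc, ι_mapBifunctorDesc]
      · rw [Linear.units_smul_comp, Category.assoc, ι_mapBifunctorDesc]
    · rw [ι_mapBifunctorDesc_assoc]

end TotalHomotopy

/-! ### Tensor products with a free complex are generated by the generators of its terms. -/

section FreeTensor

variable {k : Type u} [Field k] {A : Type u} [CommRing A] [Algebra k A] {ρ : ℤ → A ⊗[k] A}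
  (hρ : ∀ q, ρ (q + 1) * ρ q = 0)

/-- The generator of `freeComplex ρ` in the degree `q`. -/
def freeGen (q : ℤ) : (freeComplex ρ hρ).X q :=
  if h : q ≤ 0 then (freeIncl_surjective hρ h (1 : A ⊗[k] A)).choose else 0

lemma freeIncl_freeGen {q : ℤ} (h : q ≤ 0) :
    freeIncl hρ q (freeGen hρ q) = (1 : A ⊗[k] A) := by
  rw [freeGen, dif_pos h]
  exact (freeIncl_surjective hρ h (1 : A ⊗[k] A)).choose_spec

lemma freeGen_eq_zero {q : ℤ} (h : 0 < q) : freeGen hρ q = 0 := dif_neg (by omega)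

lemma eq_smul_freeGen {q : ℤ} (h : q ≤ 0) (v : (freeComplex ρ hρ).X q) :
    v = (show A ⊗[k] A from freeIncl hρ q v) • freeGen hρ q := by
  apply freeIncl_injective
  have h1 := (map_smul (freeIncl hρ q).hom (show A ⊗[k] A from freeIncl hρ q v) (freeGen hρ q))
  refine Eq.trans ?_ h1.symm
  have h2 := freeIncl_freeGen hρ h
  exact (mul_one _).symm.trans (congrArg ((show A ⊗[k] A from freeIncl hρ q v) * ·) h2.symm)

lemma freeComplex_d_freeGen {q q' : ℤ} (h : q + 1 = q') :
    (freeComplex ρ hρ).d q q' (freeGen hρ q) = ρ q • freeGen hρ q' := by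
  by_cases hq : q' ≤ 0
  · apply freeIncl_injective
    refine (freeIncl_d hρ h hq _).trans ?_
    refine Eq.trans ?_ (map_smul (freeIncl hρ q').hom (ρ q) (freeGen hρ q')).symm
    have h1 := freeIncl_freeGen hρ hq
    have h2 := freeIncl_freeGen hρ (show q ≤ 0 by omega)
    exact (congrArg (ρ q * ·) h2).trans (congrArg (ρ q * ·) h1).symm
  · have := freeComplex_subsingleton hρ (show 0 < q' by omega)
    exact Subsingleton.elim _ _

/-- In m ⊗ (a ⊗ b)·e, with e the generator, a can be absorbed in m and b acts on the whole tensor.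
So a linear map is determined by the elements m ⊗ e. -/
lemma tens_freeGen_hom_ext {M Z : ModuleCat.{u} A} {q : ℤ}
    {f g : ((tensorBimod k A).obj M).obj ((freeComplex ρ hρ).X q) ⟶ Z}
    (h : q ≤ 0 → ∀ m, f (tens k A M _ m (freeGen hρ q)) = g (tens k A M _ m (freeGen hρ q))) :
    f = g := by
  apply tens_hom_ext
  intro m n
  by_cases hq : q ≤ 0
  · rw [eq_smul_freeGen hρ hq n]
    generalize (show A ⊗[k] A from freeIncl hρ q n) = e
    induction e using TensorProduct.induction_on generalizing m with
    | zero => rw [zero_smul, tens_zero_right, map_zero, map_zero]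
    | tmul a b =>
      have h1 : (a ⊗ₜ[k] b : A ⊗[k] A) = inRight k A b * inLeft k A a := by
        simp [inLeft, inRight, Algebra.TensorProduct.tmul_mul_tmul]
      rw [h1, mul_smul, ← smul_tens, ← tens_smul_left, map_smul, map_smul, h hq]
    | add v w hv hw => rw [add_smul, tens_add_right, map_add, map_add, hv, hw]
  · have := freeComplex_subsingleton hρ (show 0 < q by omega)
    rw [Subsingleton.elim n 0, tens_zero_right, map_zero, map_zero]

end FreeTensor

/-! ### Values of the characteristic homomorphism on the interval complexes -/

section IntervalValues

variable {k : Type u} [Field k] {m n m' n' i j : ℤ}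

/-- An element of a term of an interval complex, as an element of `Λ`. -/
def intVal (z : (interval k m n).X i) : Lam k := (show intervalTerm k m n i from z : intervalTerm k m n i).1

lemma intVal_injective : Function.Injective (intVal : (interval k m n).X i → Lam k) :=
  Subtype.val_injective

lemma intVal_add (z w : (interval k m n).X i) : intVal (z + w) = intVal z + intVal w := rfl

lemma intVal_zero : intVal (0 : (interval k m n).X i) = 0 := rfl

lemma intVal_smul (a : Lam k) (z : (interval k m n).X i) : intVal (a • z) = a * intVal z := rfl

lemma intVal_eq_zero (h : ¬(m ≤ i ∧ i ≤ n)) (z : (interval k m n).X i) : intVal z = 0 :=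
  intervalTerm_eq_zero h z

lemma intVal_units_smul (t : ℤ) (z : (interval k m n).X i) :
    intVal (t.negOnePow • z) = (-1 : k) ^ t • intVal z := by
  obtain h | h := Int.even_or_odd t
  · rw [Int.negOnePow_even t h, h.neg_one_zpow, one_smul, one_smul]
  · rw [Int.negOnePow_odd t h, h.neg_one_zpow, neg_one_smul, Units.neg_smul, one_smul]
    rfl

lemma intVal_ofCoef (c : Lam k) (z : (interval k m n).X i) :
    intVal ((ofCoef c : (interval k m n).X i ⟶ (interval k m' n').X j) z) =
      if m' ≤ j ∧ j ≤ n' then c * intVal z else 0 := ofCoef_apply c z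

lemma intVal_d (z : (interval k m n).X i) (h : i + 1 = j) : intVal ((interval k m n).d i j z) =
    if m ≤ j ∧ j ≤ n then DualNumber.eps * intVal z else 0 := by
  have h1 : (interval k m n).d i j = ModuleCat.ofHom (mulX k m n i j) := if_pos h
  rw [h1]
  exact mulX_coe k m n i j z

lemma intVal_XIsoOfEq (h : i = j) (z : (interval k m n).X i) :
    intVal (((interval k m n).XIsoOfEq h).hom z) = intVal z := by
  subst h
  simp

variable (m n i j) in
/-- The `k`-linear map `v₀ + v₁ x ↦ v₁ c` between terms of an interval complex. -/
def sndTerm (c : Lam k) : intervalTerm k m n i →ₗ[k] intervalTerm k m n j :=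
  if h : m ≤ j ∧ j ≤ n then
    { toFun := fun v => ⟨TrivSqZeroExt.snd (v : Lam k) • c, by simp [intervalTerm, h]⟩
      map_add' := fun v w => Subtype.ext (by simp [add_smul])
      map_smul' := fun b v => Subtype.ext (by simp [mul_smul]) }
  else 0

lemma sndTerm_coe (c : Lam k) (v : intervalTerm k m n i) : (sndTerm m n i j c v : Lam k) =
    if m ≤ j ∧ j ≤ n then TrivSqZeroExt.snd (v : Lam k) • c else 0 := by
  by_cases h : m ≤ j ∧ j ≤ n
  · rw [sndTerm, dif_pos h, if_pos h]; rfl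
  · rw [sndTerm, dif_neg h, if_neg h]; rfl

variable (m n) in
/-- The map `M ⊗_Λ P^q ⟶ N` given by `sndTerm`, for terms `M` and `N` of an interval complex. -/
def sndTensor (c : Lam k) (p q j : ℤ) :
    ((tensorBimod k (Lam k)).obj ((interval k m n).X p)).obj ((resComplex k).X q) ⟶
      (interval k m n).X j :=
  ((tensorBimod k (Lam k)).obj ((interval k m n).X p)).map (freeIncl resCoef_mul_resCoef q) ≫
    tensorEval (M := intervalTerm k m n p) (Z := intervalTerm k m n j) (sndTerm m n p j c)

/-- The generator of the resolution in the degree `q`. -/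
abbrev resGen (q : ℤ) : (resComplex k).X q := freeGen resCoef_mul_resCoef q

variable {p q : ℤ}

/-- The coefficient of an element of the resolution with respect to the generator. -/
def resVal (w : (resComplex k).X q) : Lam k ⊗[k] Lam k :=
  show Lam k ⊗[k] Lam k from freeIncl (E := Lam k ⊗[k] Lam k) (ρ := resCoef k) resCoef_mul_resCoef q w

lemma resVal_resGen (hq : q ≤ 0) : resVal (resGen (k := k) q) = (1 : Lam k) ⊗ₜ[k] (1 : Lam k) :=
  freeIncl_freeGen (k := k) (A := Lam k) (ρ := resCoef k) resCoef_mul_resCoef hq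

lemma resVal_d (hq : q + 1 ≤ 0) (w : (resComplex k).X q) :
    resVal ((resComplex k).d q (q + 1) w) = resCoef k q * resVal w :=
  freeIncl_d (E := Lam k ⊗[k] Lam k) (ρ := resCoef k) resCoef_mul_resCoef rfl hq w

lemma sndTensor_tens (c : Lam k) (v : (interval k m n).X p) (w : (resComplex k).X q) :
    sndTensor m n c p q j (tens k (Lam k) _ _ v w) =
      (show intervalTerm k m n j from bimodEval (M := intervalTerm k m n p)
        (Z := intervalTerm k m n j) (sndTerm m n p j c) (resVal w) v) :=
  tensorEval_tens (M := intervalTerm k m n p) (Z := intervalTerm k m n j) _ v _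

lemma bimodEval_sndTerm (c a b : Lam k) (v : intervalTerm k m n p) :
    (bimodEval (sndTerm m n p j c) (a ⊗ₜ[k] b) v : Lam k) =
      if m ≤ j ∧ j ≤ n then b * TrivSqZeroExt.snd (a * (v : Lam k)) • c else 0 := by
  rw [bimodEval_tmul]
  change b * (sndTerm m n p j c (a • v) : Lam k) = _
  rw [sndTerm_coe, mul_ite, mul_zero]
  rfl

/-- The resolution has no generator in the degrees q > 0, so c must vanish there for the formula to
hold for all q. -/
lemma intVal_sndTensor (c : Lam k) (hc : 0 < q → c = 0) (v : (interval k m n).X p) :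
    intVal (sndTensor m n c p q j (tens k (Lam k) _ _ v (resGen q))) =
      if m ≤ j ∧ j ≤ n then TrivSqZeroExt.snd (intVal v) • c else 0 := by
  by_cases hq : q ≤ 0
  · rw [sndTensor_tens, resVal_resGen hq]
    refine (bimodEval_sndTerm c 1 1 v).trans ?_
    rw [one_mul, one_mul]
    rfl
  · rw [resGen, freeGen_eq_zero _ (by omega), tens_zero_right, map_zero, hc (by omega), smul_zero,
      ite_self, intVal_zero]

lemma resCoef_eq (q : ℤ) : resCoef k q = -((1 : Lam k) ⊗ₜ[k] (DualNumber.eps : Lam k) +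
    ((-1 : k) ^ q • (DualNumber.eps : Lam k)) ⊗ₜ[k] (1 : Lam k)) := by
  rfl

/-- The generator has the differential -(1 ⊗ x + (-1)^q x ⊗ 1) times the next one: 1 ⊗ x multiplies
the value by x, and x ⊗ 1 multiplies the argument. -/
lemma intVal_sndTensor_d (c : Lam k) (hc : 0 < q + 1 → c = 0) (v : (interval k m n).X p) :
    intVal (sndTensor m n c p (q + 1) j (tens k (Lam k) _ _ v
      ((resComplex k).d q (q + 1) (resGen q)))) =
    -(if m ≤ j ∧ j ≤ n then TrivSqZeroExt.snd (intVal v) • (DualNumber.eps * c) +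
      ((-1 : k) ^ q * TrivSqZeroExt.snd (DualNumber.eps * intVal v)) • c else 0) := by
  by_cases hq : q + 1 ≤ 0
  · rw [sndTensor_tens, resVal_d hq, resVal_resGen (by omega)]
    have h1 : resCoef k q * ((1 : Lam k) ⊗ₜ[k] (1 : Lam k)) = resCoef k q := mul_one (M := Lam k ⊗[k] Lam k) (resCoef k q)
    rw [h1, resCoef_eq, map_neg, map_add]
    refine (congrArg Neg.neg (congrArg₂ (· + ·)
      (bimodEval_sndTerm (j := j) c 1 DualNumber.eps v)
      (bimodEval_sndTerm (j := j) c ((-1 : k) ^ q • DualNumber.eps) 1 v))).trans ?_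
    change -((if m ≤ j ∧ j ≤ n then DualNumber.eps * TrivSqZeroExt.snd (1 * intVal v) • c else 0) +
      (if m ≤ j ∧ j ≤ n then 1 * TrivSqZeroExt.snd
        (((-1 : k) ^ q • DualNumber.eps : Lam k) * intVal v) • c else 0)) = _
    split_ifs
    · rw [one_mul, one_mul, smul_mul_assoc, TrivSqZeroExt.snd_smul, mul_smul_comm, smul_eq_mul]
    · rw [add_zero]
  · rw [resGen, freeComplex_d_freeGen _ rfl, freeGen_eq_zero _ (by omega), smul_zero,
      tens_zero_right, map_zero, hc (by omega), mul_zero, smul_zero, smul_zero, add_zero,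
      ite_self, intVal_zero, neg_zero]

lemma units_smul_apply {R : Type*} [Ring R] {M N : ModuleCat R} (t : ℤ) (f : M ⟶ N) (z : M) :
    (t.negOnePow • f) z = t.negOnePow • f z := by
  obtain h | h := Int.even_or_odd t
  · rw [Int.negOnePow_even t h, one_smul, one_smul]
  · rw [Int.negOnePow_odd t h, Units.neg_smul, one_smul, Units.neg_smul, one_smul]
    rfl

end IntervalValues

/-! ### The explicit homotopy between augmentation and twist on an interval. -/

section IntervalCharacteristic

open HomologicalComplex

variable {k : Type u} [Field k] {m n p q j : ℤ}

/-- The element `v ⊗ w` of the total complex of `X ⊗ P`, for the periodic resolution `P`. -/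
def totTens {X : CochainComplex (ModuleCat.{u} (Lam k)) ℤ} (hj : p + q = j) (v : X.X p)
    (w : (resComplex k).X q) :
    (mapBifunctor X (resComplex k) (tensorBimod k (Lam k)) (ComplexShape.up ℤ)).X j :=
  ιMapBifunctor X (resComplex k) (tensorBimod k (Lam k)) (ComplexShape.up ℤ) p q j hj
    (tens k (Lam k) (X.X p) ((resComplex k).X q) v w)

lemma mulHom_resVal_resGen (hq : q ≤ 0) : mulHom k (Lam k) (resVal (resGen q)) = 1 := by
  rw [resVal_resGen hq]
  exact map_one (mulHom k (Lam k))

lemma intVal_aug_totTens (hj : p + q = j) (v : (interval k m n).X p) :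
    intVal ((aug k (Lam k) (resAug k) (interval k m n)).f j (totTens hj v (resGen q))) =
      if q = 0 then intVal v else 0 := by
  have h := congrArg (fun f => f.hom (tens k (Lam k) ((interval k m n).X p) ((resComplex k).X q) v
    (resGen q))) (ι_augComplex (tensorBimod k (Lam k)) (regBimod k (Lam k)) (unitBimod k (Lam k))
      (resAug k) (interval k m n) p q j hj)
  refine (congrArg intVal h).trans ?_
  split_ifs with hq
  · subst hq
    rw [resAug_f_zero]
    refine (intVal_XIsoOfEq _ _).trans ((congrArg intVal (tens_unit v _)).trans ?_)
    refine (congrArg (· * intVal v) (mulHom_resVal_resGen (k := k) le_rfl)).trans (one_mul _)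
  · rfl

lemma intVal_twist_totTens (l : ℤ) (hl : 0 ≤ l) (a : Lam k) (ha : (-1 : k) ^ l * a.fst = a.fst)
    (hj : p + q = j) (v : (interval k m n).X p) :
    intVal (show (interval k m n).X (j + l) from
      (twist k (Lam k) (resTwist l a ha) (interval k m n)).f j (totTens hj v (resGen q))) =
      if q + l = 0 then (-1 : k) ^ (p * l) • (a * intVal v) else 0 := by
  have h := congrArg (fun f => f.hom (tens k (Lam k) ((interval k m n).X p) ((resComplex k).X q) v
    (resGen q))) (ι_twistComplex (tensorBimod k (Lam k)) (regBimod k (Lam k)) (unitBimod k (Lam k))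
      (resTwist l a ha) (interval k m n) p q j hj)
  refine (congrArg (intVal (i := j + l)) h).trans ?_
  split_ifs with hq
  · refine (congrArg (intVal (i := j + l)) (units_smul_apply (p * l) _ _)).trans
      ((intVal_units_smul (p * l) _).trans (congrArg ((-1 : k) ^ (p * l) • ·) ?_))
    refine (intVal_XIsoOfEq _ _).trans ?_
    rw [resTwist, twistComponent_freeTwist]
    refine (congrArg intVal (tens_unit v _)).trans ?_
    refine congrArg (· * intVal v) ?_
    exact (congrArg (a * ·) (mulHom_resVal_resGen (k := k) (by omega))).trans (mul_one a)
  · rfl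

lemma twistCocycle_mem (m n : ℤ) (l : ℕ) {a : Lam k} (ha : (-1 : k) ^ (l : ℤ) * a.fst = a.fst) :
    (fun i => if m ≤ i ∧ i + l ≤ n then (-1 : k) ^ (l : ℤ) • a else 0) ∈ cocycles k m n m n l := by
  refine ⟨fun i hi => if_neg (by omega), fun i h h' => ?_⟩
  simp only
  rw [if_pos (by omega), if_pos (by omega), TrivSqZeroExt.fst_smul, smul_eq_mul, ha, ha]

/-- The value of the characteristic homomorphism on an interval complex. -/
def twistCocycle (m n : ℤ) (l : ℕ) {a : Lam k} (ha : (-1 : k) ^ (l : ℤ) * a.fst = a.fst) :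
    cocycles k m n m n l := ⟨_, twistCocycle_mem m n l ha⟩

/-- The coefficients of the homotopy which computes the characteristic homomorphism. -/
def twistCoef (l : ℕ) (a : Lam k) (p q : ℤ) : Lam k :=
  if -l < q ∧ q ≤ 0 then ((-1 : k) ^ (p * q) * (-1 : k) ^ (l : ℤ)) • a else 0

/-- The homotopy equation at v ⊗ generator, where v has the value V. For -l < q < 0 the terms of the
homotopy cancel each other. If l > 0, the uncancelled term at q = 0 is the augmentation followed by
the candidate value, and the one at q = -l is the twist. For l = 0 the homotopy is zero. -/
lemma twistCoef_identity (l : ℕ) {a : Lam k} (ha : (-1 : k) ^ (l : ℤ) * a.fst = a.fst)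
    (hj : p + q = j) (hp : m ≤ p ∧ p ≤ n) (hl : m ≤ j + l ∧ j + l ≤ n) (V : Lam k) :
    (if q = 0 then (-1 : k) ^ (l : ℤ) • a * V else 0) =
      (if p + 1 ≤ n then V.fst • twistCoef l a (p + 1) q else 0) +
      (-1 : k) ^ p • (-(V.snd • (DualNumber.eps * twistCoef l a p (q + 1)) +
        ((-1 : k) ^ q * V.fst) • twistCoef l a p (q + 1))) +
      (-1 : k) ^ (l : ℤ) • (if m ≤ j - 1 + l then DualNumber.eps * V.snd • twistCoef l a p q else 0) +
      (if q + l = 0 then (-1 : k) ^ (p * l) • (a * V) else 0) := by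
  subst hj
  have e1 : (-1 : k) ^ ((p + 1) * q) = (-1) ^ (p * q) * (-1) ^ q := by
    rw [add_mul, one_mul, zpow_add₀ (by simp)]
  have e2 : (-1 : k) ^ (p * (q + 1)) = (-1) ^ (p * q) * (-1) ^ p := by
    rw [mul_add, mul_one, zpow_add₀ (by simp)]
  have hP : (-1 : k) ^ p * (-1 : k) ^ p = 1 := neg_one_zpow_mul_self p
  have hQ : (-1 : k) ^ q * (-1 : k) ^ q = 1 := neg_one_zpow_mul_self q
  have hL : (-1 : k) ^ (l : ℤ) * (-1 : k) ^ (l : ℤ) = 1 := neg_one_zpow_mul_self l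
  by_cases h1 : -l < q ∧ q ≤ 0
  · have c1 : twistCoef l a (p + 1) q = ((-1) ^ (p * q) * (-1) ^ q * (-1 : k) ^ (l : ℤ)) • a := by
      rw [twistCoef, if_pos h1, e1]
    have c2 : twistCoef l a p q = ((-1) ^ (p * q) * (-1 : k) ^ (l : ℤ)) • a := by
      rw [twistCoef, if_pos h1]
    rw [if_pos (show p + 1 ≤ n by omega), if_pos (show m ≤ p + q - 1 + l by omega),
      if_neg (show ¬ q + l = 0 by omega), c1, c2]
    by_cases h2 : q = 0
    · subst h2
      rw [if_pos rfl, twistCoef, if_neg (by omega), mul_zero, zpow_zero]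
      generalize (-1 : k) ^ (l : ℤ) = L at *
      ext
      · simp [mul_assoc, mul_comm]
      · simp
        linear_combination -V.snd * (L * ha)
    · have c3 : twistCoef l a p (q + 1) = ((-1) ^ (p * q) * (-1) ^ p * (-1 : k) ^ (l : ℤ)) • a := by
        rw [twistCoef, if_pos (by omega), e2]
      rw [if_neg h2, c3]
      generalize (-1 : k) ^ (l : ℤ) = L at *
      generalize (-1 : k) ^ q = Q at *
      generalize (-1 : k) ^ p = P at *
      generalize (-1 : k) ^ (p * q) = A at *
      ext
      · simp
        linear_combination (A * Q * L * V.fst * a.fst) * hP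
      · simp
        linear_combination (A * Q * L * V.fst * a.snd) * hP + A * V.snd * L * a.fst * hP
          + A * V.snd * (ha - a.fst * hL)
  · have c1 : twistCoef l a (p + 1) q = 0 := if_neg h1
    have c2 : twistCoef l a p q = 0 := if_neg h1
    rw [c1, c2]
    by_cases h2 : q + l = 0
    · by_cases h3 : q = 0
      · subst h3
        obtain rfl : l = 0 := by omega
        have c3 : twistCoef 0 a p (0 + 1) = 0 := if_neg (by omega)
        rw [c3]
        simp
      · have c3 : twistCoef l a p (q + 1) = ((-1) ^ (p * q) * (-1) ^ p * (-1 : k) ^ (l : ℤ)) • a := by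
          rw [twistCoef, if_pos (by omega), e2]
        rw [if_neg h3, if_pos h2, c3]
        obtain rfl : q = -l := by omega
        have e3 : (-1 : k) ^ (p * (-l : ℤ)) = (-1 : k) ^ (p * l) := by
          rw [mul_neg, zpow_neg, ← inv_zpow]; simp
        have e4 : (-1 : k) ^ (-l : ℤ) = (-1 : k) ^ (l : ℤ) := by
          rw [zpow_neg, ← inv_zpow]; simp
        rw [e3, e4]
        clear hQ e1 e2 e3 e4 c3
        generalize (-1 : k) ^ (l : ℤ) = L at *
        generalize (-1 : k) ^ p = P at *
        generalize (-1 : k) ^ (p * l) = A at *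
        ext
        · simp
          linear_combination A * V.fst * a.fst * (L * L * hP + hL)
        · simp
          linear_combination A * V.fst * a.snd * (L * L * hP + hL)
            + A * V.snd * (a.fst * L * hP + ha)
    · have c3 : twistCoef l a p (q + 1) = 0 := if_neg (by omega)
      rw [c3, if_neg h2, if_neg (show ¬ q = 0 by omega)]
      simp

/-- The components of the homotopy which computes the characteristic homomorphism. -/
def twistHomotopy (m n : ℤ) (l : ℕ) (a : Lam k) (p q j : ℤ) :
    ((tensorBimod k (Lam k)).obj ((interval k m n).X p)).obj ((resComplex k).X q) ⟶
      ((interval k m n)⟦(l : ℤ)⟧).X j :=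
  sndTensor m n (twistCoef l a p q) p q (j + l)

lemma twistCoef_of_pos (l : ℕ) (a : Lam k) (p : ℤ) (h : 0 < q) : twistCoef l a p q = 0 :=
  if_neg (by omega)

lemma hom_apply_eq_of_values {R : Type*} [Ring R] {S : Type*} [Add S] {M N : ModuleCat R}
    (e : N → S) (he : Function.Injective e) (h : ∀ v w, e (v + w) = e v + e w)
    {f f₁ f₂ f₃ f₄ : M ⟶ N} {z : M} {a a₁ a₂ a₃ a₄ : S} (h₀ : e (f z) = a) (h₁ : e (f₁ z) = a₁)
    (h₂ : e (f₂ z) = a₂) (h₃ : e (f₃ z) = a₃) (h₄ : e (f₄ z) = a₄) (ha : a = a₁ + a₂ + a₃ + a₄) :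
    f z = (f₁ + f₂ + f₃ + f₄) z := by
  apply he
  rw [h₀, ha, ← h₁, ← h₂, ← h₃, ← h₄, ← h, ← h, ← h]
  rfl

lemma intVal_units_smul_apply {i : ℤ} (t : ℤ) {M : ModuleCat (Lam k)} (f : M ⟶ (interval k m n).X i)
    (z : M) : intVal ((t.negOnePow • f) z) = (-1 : k) ^ t • intVal (f z) := by
  rw [units_smul_apply, intVal_units_smul]

lemma twistHomotopy_comm (m n : ℤ) (l : ℕ) {a : Lam k}
    (ha : (-1 : k) ^ (l : ℤ) * a.fst = a.fst) (p q j : ℤ) (hj : p + q = j) :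
    ιMapBifunctor (interval k m n) (resComplex k) (tensorBimod k (Lam k)) (ComplexShape.up ℤ)
      p q j hj ≫ (aug k (Lam k) (resAug k) (interval k m n) ≫ chainOf (twistCocycle m n l ha)).f j =
    ((tensorBimod k (Lam k)).map ((interval k m n).d p (p + 1))).app ((resComplex k).X q) ≫
        twistHomotopy m n l a (p + 1) q j +
      p.negOnePow • (((tensorBimod k (Lam k)).obj ((interval k m n).X p)).map
        ((resComplex k).d q (q + 1)) ≫ twistHomotopy m n l a p (q + 1) j) +
      twistHomotopy m n l a p q (j - 1) ≫ ((interval k m n)⟦(l : ℤ)⟧).d (j - 1) j +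
      ιMapBifunctor (interval k m n) (resComplex k) (tensorBimod k (Lam k)) (ComplexShape.up ℤ)
        p q j hj ≫ (twist k (Lam k) (resTwist l a ha) (interval k m n)).f j := by
  -- All maps are Λ-linear, so it suffices to evaluate the five terms on v ⊗ generator.
  apply tens_freeGen_hom_ext
  intro _ v
  have t0 : intVal (i := j + l) ((ιMapBifunctor (interval k m n) (resComplex k)
      (tensorBimod k (Lam k)) (ComplexShape.up ℤ) p q j hj ≫
        (aug k (Lam k) (resAug k) (interval k m n) ≫ chainOf (twistCocycle m n l ha)).f j)
      (tens k (Lam k) _ _ v (resGen q))) = if m ≤ j + l ∧ j + l ≤ n then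
        (twistCocycle m n l ha).1 j * (if q = 0 then intVal v else 0) else 0 := by
    refine (intVal_ofCoef (j := j + l) _ _).trans ?_
    rw [← intVal_aug_totTens hj v]
    rfl
  have t1 : intVal (i := j + l) ((((tensorBimod k (Lam k)).map ((interval k m n).d p (p + 1))).app
      ((resComplex k).X q) ≫ twistHomotopy m n l a (p + 1) q j)
      (tens k (Lam k) _ _ v (resGen q))) = if m ≤ j + l ∧ j + l ≤ n then
        TrivSqZeroExt.snd (if m ≤ p + 1 ∧ p + 1 ≤ n then DualNumber.eps * intVal v else 0) •
          twistCoef l a (p + 1) q else 0 := by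
    refine (intVal_sndTensor (j := j + l) (twistCoef l a (p + 1) q) (twistCoef_of_pos l a _)
      ((interval k m n).d p (p + 1) v)).trans ?_
    rw [intVal_d v rfl]
  have t2 : intVal (i := j + l) ((p.negOnePow • (((tensorBimod k (Lam k)).obj
      ((interval k m n).X p)).map ((resComplex k).d q (q + 1)) ≫ twistHomotopy m n l a p (q + 1) j))
      (tens k (Lam k) _ _ v (resGen q))) = (-1 : k) ^ p • -(if m ≤ j + l ∧ j + l ≤ n then
        TrivSqZeroExt.snd (intVal v) • (DualNumber.eps * twistCoef l a p (q + 1)) +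
        ((-1 : k) ^ q * TrivSqZeroExt.snd (DualNumber.eps * intVal v)) •
          twistCoef l a p (q + 1) else 0) := by
    rw [← intVal_sndTensor_d (j := j + l) (twistCoef l a p (q + 1)) (twistCoef_of_pos l a p) v]
    exact intVal_units_smul_apply (i := j + l) p (((tensorBimod k (Lam k)).obj
      ((interval k m n).X p)).map ((resComplex k).d q (q + 1)) ≫ twistHomotopy m n l a p (q + 1) j)
      (tens k (Lam k) ((interval k m n).X p) ((resComplex k).X q) v (resGen q))
  have t3 : intVal (i := j + l) ((twistHomotopy m n l a p q (j - 1) ≫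
      ((interval k m n)⟦(l : ℤ)⟧).d (j - 1) j) (tens k (Lam k) _ _ v (resGen q))) =
      (-1 : k) ^ (l : ℤ) • if m ≤ j + l ∧ j + l ≤ n then DualNumber.eps *
        (if m ≤ j - 1 + l ∧ j - 1 + l ≤ n then TrivSqZeroExt.snd (intVal v) • twistCoef l a p q
        else 0) else 0 := by
    refine (congrArg (intVal (i := j + l)) (units_smul_apply (l : ℤ)
      ((interval k m n).d (j - 1 + l) (j + l)) _)).trans
      ((intVal_units_smul (l : ℤ) _).trans (congrArg ((-1 : k) ^ (l : ℤ) • ·) ?_))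
    refine (intVal_d _ (by omega)).trans ?_
    rw [← intVal_sndTensor (j := j - 1 + l) (twistCoef l a p q) (twistCoef_of_pos l a _) v]
    rfl
  have t4 := intVal_twist_totTens (l : ℤ) (by omega) a ha hj v
  refine hom_apply_eq_of_values (N := ((interval k m n)⟦(l : ℤ)⟧).X j) (intVal (i := j + l))
    (intVal_injective (i := j + l)) (intVal_add (i := j + l)) t0 t1 t2 t3 t4 ?_
  clear t0 t1 t2 t3 t4
  by_cases hp : m ≤ p ∧ p ≤ n
  · by_cases hl : m ≤ j + l ∧ j + l ≤ n
    · have h := twistCoef_identity l ha hj hp hl (intVal v)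
      have e : TrivSqZeroExt.snd (DualNumber.eps * intVal v) = (intVal v).fst := by simp
      have h1 : TrivSqZeroExt.snd (if m ≤ p + 1 ∧ p + 1 ≤ n then DualNumber.eps * intVal v else 0) •
          twistCoef l a (p + 1) q =
          if p + 1 ≤ n then (intVal v).fst • twistCoef l a (p + 1) q else 0 := by
        by_cases hp' : p + 1 ≤ n
        · rw [if_pos hp', if_pos (by omega), e]
        · rw [if_neg hp', if_neg (by omega), TrivSqZeroExt.snd_zero, zero_smul]
      have h2 : DualNumber.eps * (if m ≤ j - 1 + l ∧ j - 1 + l ≤ n then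
            TrivSqZeroExt.snd (intVal v) • twistCoef l a p q else 0) =
          if m ≤ j - 1 + l then DualNumber.eps * (intVal v).snd • twistCoef l a p q else 0 := by
        by_cases hl' : m ≤ j - 1 + l
        · rw [if_pos hl', if_pos (by omega)]
        · rw [if_neg hl', if_neg (by omega), mul_zero]
      rw [if_pos hl, if_pos hl, if_pos hl, if_pos hl, h1, h2, e, ← h]
      change (if m ≤ j ∧ j + l ≤ n then (-1 : k) ^ (l : ℤ) • a else 0) * _ = _
      by_cases hq : q = 0
      · rw [if_pos hq, if_pos hq, if_pos (by omega)]
      · rw [if_neg hq, if_neg hq, mul_zero]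
    · rw [if_neg hl, if_neg hl, if_neg hl, if_neg hl, if_neg (show ¬ q + l = 0 by omega)]
      simp
  · rw [intVal_eq_zero hp]
    simp

lemma charEquation_interval (m n : ℤ) (l : ℕ) {a : Lam k}
    (ha : (-1 : k) ^ (l : ℤ) * a.fst = a.fst) : CharEquation k (Lam k) (resAug k) (resTwist l a ha)
      (interval k m n) (cls (twistCocycle m n l ha)) :=
  (charEquation_hoClass_iff k (Lam k) (resAug k) (resTwist l a ha) (interval k m n) _).2
    ⟨totalHomotopy (twistHomotopy m n l a) (twistHomotopy_comm m n l ha)⟩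

end IntervalCharacteristic

/-! ### The characteristic homomorphism of the dual numbers -/

section CentralTwist

variable {k : Type u} [Field k] {m n m' n' : ℤ}

/-- An explicit solution h of h(i + 1) - τ h(i) = f(i + l) - τ^l f(i). It supplies the homotopy that
makes multiplication by a central. -/
lemma pow_sum_shift (l : ℕ) (τ : k) (f : ℤ → k) (i : ℤ) :
    (∑ u ∈ Finset.range l, τ ^ (l - 1 - u) * f (i + 1 + u)) -
      τ * ∑ u ∈ Finset.range l, τ ^ (l - 1 - u) * f (i + u) = f (i + l) - τ ^ l * f i := by
  induction l with
  | zero => simp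
  | succ l ih =>
    have h : ∀ g : ℕ → k, ∑ u ∈ Finset.range (l + 1), τ ^ (l + 1 - 1 - u) * g u =
        τ * ∑ u ∈ Finset.range l, τ ^ (l - 1 - u) * g u + g l := by
      intro g
      rw [Finset.sum_range_succ, Finset.mul_sum]
      congr 1
      · refine Finset.sum_congr rfl fun u hu => ?_
        rw [← mul_assoc, ← pow_succ']
        congr 2
        have := Finset.mem_range.1 hu
        omega
      · simp
    rw [h fun u => f (i + 1 + u), h fun u => f (i + u), pow_succ]
    have e : i + 1 + (l : ℤ) = i + ((l + 1 : ℕ) : ℤ) := by push_cast; ring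
    rw [e]
    linear_combination τ * ih

/-- The composites differ by a (c_{i+l} - c_i). Its constant term vanishes because ((-1)^j)^l = 1;
its coefficient of x is a coboundary by `pow_sum_shift` with τ = -(-1)^j, where τ^l = 1. -/
lemma cls_twistCocycle_comm {l : ℕ} {a : Lam k} (ha : (-1 : k) ^ (l : ℤ) * a.fst = a.fst)
    (hl : (-1 : k) ^ l = 1) {j q : ℤ} (c : cocycles k m n m' n' j) (h : j + l = q)
    (h' : l + j = q) : (cls (twistCocycle m n l ha)).comp (cls c) h =
      (cls c).comp (cls (twistCocycle m' n' l ha)) h' := by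
  rw [cls_comp, cls_comp, cls_eq_iff, cls_eq_zero_iff]
  have hj : ((-1 : k) ^ j) ^ l = 1 := by
    rw [← zpow_natCast, ← zpow_mul, mul_comm, zpow_mul, zpow_natCast, hl, one_zpow]
  have hq : (-1 : k) ^ q = (-1) ^ j := by
    rw [← h, zpow_add₀ (by simp), zpow_natCast, hl, mul_one]
  have key : ∀ i, (c.1 (i + l) * (twistCocycle m n l ha).1 i -
      (twistCocycle m' n' l ha).1 (i + j) * c.1 i) = if m ≤ i ∧ i + j + l ≤ n' then
        a * (c.1 (i + l) - c.1 i) else 0 := by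
    intro i
    change c.1 (i + l) * (if m ≤ i ∧ i + l ≤ n then (-1 : k) ^ (l : ℤ) • a else 0) -
      (if m' ≤ i + j ∧ i + j + l ≤ n' then (-1 : k) ^ (l : ℤ) • a else 0) * c.1 i = _
    rw [zpow_natCast, hl, one_smul]
    by_cases h1 : m ≤ i ∧ i + j + l ≤ n'
    · rw [if_pos h1]
      have e1 : c.1 (i + l) * (if m ≤ i ∧ i + l ≤ n then a else 0) = c.1 (i + l) * a := by
        split_ifs with h2
        · rfl
        · rw [c.2.1 _ (by omega), zero_mul, zero_mul]
      have e2 : (if m' ≤ i + j ∧ i + j + l ≤ n' then a else 0) * c.1 i = a * c.1 i := by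
        split_ifs with h2
        · rfl
        · rw [c.2.1 i (by omega), mul_zero, mul_zero]
      rw [e1, e2]
      ring
    · rw [if_neg h1]
      have e1 : c.1 (i + l) * (if m ≤ i ∧ i + l ≤ n then a else 0) = 0 := by
        split_ifs with h2
        · rw [c.2.1 _ (by omega), zero_mul]
        · rw [mul_zero]
      have e2 : (if m' ≤ i + j ∧ i + j + l ≤ n' then a else 0) * c.1 i = 0 := by
        split_ifs with h2
        · rw [c.2.1 i (by omega), mul_zero]
        · rw [zero_mul]
      rw [e1, e2, sub_zero]
  have fst_eq : ∀ i, m ≤ i ∧ i + j + l ≤ n' → (c.1 (i + l)).fst = (c.1 i).fst := fun i hi => by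
    rw [fst_shift c l hi.1 (by omega), hj, one_mul]
  have τl : (-(-1 : k) ^ j) ^ l = 1 := by rw [neg_pow, hl, hj, one_mul]
  let g : ℤ → k := fun i =>
    ∑ u ∈ Finset.range l, (-(-1 : k) ^ j) ^ (l - 1 - u) * (c.1 (i + u)).snd
  have g0 : ∀ i, ¬(i ≤ n ∧ m' ≤ i + q - 1) → g i = 0 := fun i hi =>
    Finset.sum_eq_zero fun u hu => by
      have := Finset.mem_range.1 hu
      rw [c.2.1 _ (by omega), TrivSqZeroExt.snd_zero, mul_zero]
  constructor
  · intro i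
    refine (congrArg TrivSqZeroExt.fst (key i)).trans ?_
    split_ifs with h1
    · rw [TrivSqZeroExt.fst_mul, TrivSqZeroExt.fst_sub, fst_eq i h1, sub_self, mul_zero]
    · rfl
  · refine ⟨fun i => if m ≤ i ∧ i ≤ n ∧ m' ≤ i + q - 1 ∧ i + q - 1 ≤ n' then a.fst * g i else 0,
      fun i hi => if_neg hi, fun i h1 h2 h3 h4 => ?_⟩
    refine (congrArg TrivSqZeroExt.snd (key i)).trans ?_
    have e1 : (if m ≤ i + 1 ∧ i + 1 ≤ n ∧ m' ≤ i + 1 + q - 1 ∧ i + 1 + q - 1 ≤ n' then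
        a.fst * g (i + 1) else 0) = a.fst * g (i + 1) := by
      split_ifs with h5
      · rfl
      · rw [g0 _ (by omega), mul_zero]
    have e2 : (if m ≤ i ∧ i ≤ n ∧ m' ≤ i + q - 1 ∧ i + q - 1 ≤ n' then
        a.fst * g i else 0) = a.fst * g i := by
      split_ifs with h5
      · rfl
      · rw [g0 _ (by omega), mul_zero]
    have h5 := pow_sum_shift l (-(-1 : k) ^ j) (fun i => (c.1 i).snd) i
    rw [τl, one_mul] at h5
    simp only
    rw [e1, e2, if_pos (by omega), hq]
    have h6 := fst_eq i (by omega)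
    simp only [TrivSqZeroExt.snd_mul, TrivSqZeroExt.fst_sub, TrivSqZeroExt.snd_sub, smul_eq_mul,
      MulOpposite.smul_eq_mul_unop, MulOpposite.unop_op, h6, sub_self]
    rw [← h5]
    change a.fst * (g (i + 1) - -(-1) ^ j * g i) + a.snd * 0 = _
    ring

/-- The characteristic homomorphism has a value at every class. -/
lemma exists_charValue {l : ℕ} {f : HH k (Lam k) l} {a : Lam k} (h : IsRep k f a)
    (ha : (-1 : k) ^ (l : ℤ) * a.fst = a.fst) : ∃ η ∈ gradedCenter (perf (Lam k)) (l : ℤ),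
      (∀ X, IsCharValue k (Lam k) f X (η X)) ∧
      ∀ m n, η (intervalPerf k m n) = cls (twistCocycle m n l ha) := by
  suffices H : ∃ η ∈ gradedCenter (perf (Lam k)) (l : ℤ),
      ∀ m n, η (intervalPerf k m n) = cls (twistCocycle m n l ha) by
    obtain ⟨η, hη, h1⟩ := H
    obtain ⟨_, h⟩ := h
    refine ⟨η, hη, fun X => (isCharValue_iff h X _).2 ?_, h1⟩
    refine charEquation_of_intervals k _ _ hη (fun m n => ?_) X
    rw [h1]
    exact charEquation_interval m n l ha
  -- In the first case the explicit values form a central family. Otherwise a has no constant term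
  -- and l > 0, so all of them are null-homotopic and η = 0.
  by_cases hl : (-1 : k) ^ l = 1
  · obtain ⟨η, hη, h1, -⟩ := exists_center exists_decomposition
      (fun I : ℤ × ℤ => cls (twistCocycle I.1 I.2 l ha)) (by
        intro I J j c
        obtain ⟨c, rfl⟩ := cls_surjective c
        have h1 := cls_twistCocycle_comm ha hl c (add_comm j (l : ℤ)) rfl
        refine h1.trans ?_
        rw [cls_comp]
        obtain ⟨d, hd, hd'⟩ := units_smul_cls ((l : ℤ) * j)
          ⟨_, cocycles_comp c (twistCocycle J.1 J.2 l ha) (rfl : (l : ℤ) + j = l + j)⟩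
        refine Eq.trans (congrArg cls (Subtype.ext (funext fun i => ?_))) hd.symm
        rw [hd', zpow_mul, zpow_natCast, hl, one_zpow, one_smul])
    exact ⟨η, hη, fun m n => h1 (m, n)⟩
  · have h0 : a.fst = 0 := by
      by_contra h0
      rw [zpow_natCast] at ha
      exact hl (mul_right_cancel₀ h0 (ha.trans (one_mul _).symm))
    have h1 : 0 < l := by
      obtain rfl | h1 := Nat.eq_zero_or_pos l
      · exact absurd (pow_zero _) hl
      · exact h1
    refine ⟨0, zero_mem _, fun m n => (cls_eq_zero_of_pos (by exact_mod_cast h1) _ fun i => ?_).symm⟩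
    change (if m ≤ i ∧ i + l ≤ n then (-1 : k) ^ (l : ℤ) • a else 0).fst = 0
    split_ifs
    · rw [TrivSqZeroExt.fst_smul, h0, smul_zero]
    · rfl

end CentralTwist

/-! ### Faithfulness of the characteristic homomorphism on leading coefficients -/

section LeadingCoefficient

open HomologicalComplex

variable {k : Type u} [Field k] {m n p p' q j : ℤ}

section

variable {X : CochainComplex (ModuleCat.{u} (Lam k)) ℤ}

lemma totTens_neg_right (hj : p + q = j) (v : X.X p) (w : (resComplex k).X q) :
    totTens hj v (-w) = -totTens hj v w := by
  have h : tens k (Lam k) (X.X p) ((resComplex k).X q) v (-w) = -tens k (Lam k) _ _ v w := by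
    rw [eq_neg_iff_add_eq_zero, ← tens_add_right, neg_add_cancel, tens_zero_right]
  rw [totTens, h, map_neg]
  rfl

lemma totTens_zero_left (hj : p + q = j) (w : (resComplex k).X q) :
    totTens hj (0 : X.X p) w = 0 := by
  rw [totTens, tens_zero_left, map_zero]

lemma totTens_zero_right (hj : p + q = j) (v : X.X p) :
    totTens hj v (0 : (resComplex k).X q) = 0 := by
  rw [totTens, tens_zero_right, map_zero]

lemma totTens_add_right (hj : p + q = j) (v : X.X p) (w w' : (resComplex k).X q) :
    totTens hj v (w + w') = totTens hj v w + totTens hj v w' := by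
  rw [totTens, tens_add_right, map_add]
  rfl

lemma totTens_epsRight (hj : p + q = j) (v : X.X p) (w : (resComplex k).X q) :
    totTens hj v (epsRight k • w) = (DualNumber.eps : Lam k) • totTens hj v w := by
  rw [totTens, ← inRight_eps, ← smul_tens, map_smul]
  rfl

lemma totTens_epsLeft (hj : p + q = j) (v : X.X p) (w : (resComplex k).X q) :
    totTens hj v (epsLeft k • w) = totTens hj ((DualNumber.eps : Lam k) • v) w := by
  rw [totTens, totTens, ← inLeft_eps, ← tens_smul_left]

lemma add_units_smul_apply {R : Type*} [Ring R] {M N : ModuleCat R} (t : ℤ) (f g : M ⟶ N) (z : M) :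
    (f + t.negOnePow • g).hom z = f z + t.negOnePow • g z :=
  congrArg (f z + ·) (units_smul_apply t g z)

lemma units_smul_neg_add {T : Type*} [AddCommGroup T] (x y z : T) (h : Even p → z = y)
    (h' : Odd p → z = -y) : p.negOnePow • (-(x + z)) = -(p.negOnePow • x + y) := by
  obtain hp | hp := Int.even_or_odd p
  · rw [Int.negOnePow_even p hp, h hp, one_smul, one_smul]
  · rw [Int.negOnePow_odd p hp, h' hp, Units.neg_smul, Units.neg_smul, one_smul, one_smul]
    abel

lemma totTens_d (hj : p + q = j) (v : X.X p) (w : (resComplex k).X q) :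
    (mapBifunctor X (resComplex k) (tensorBimod k (Lam k)) (ComplexShape.up ℤ)).d j (j + 1)
      (totTens hj v w) =
    totTens (show p + 1 + q = j + 1 by omega) (X.d p (p + 1) v) w +
      p.negOnePow • totTens (show p + (q + 1) = j + 1 by omega) v ((resComplex k).d q (q + 1) w) := by
  have h := congrArg (fun f => f.hom (tens k (Lam k) (X.X p) ((resComplex k).X q) v w))
    (ι_mapBifunctor_d (F := tensorBimod k (Lam k)) (X := X) (P := resComplex k) p q j (j + 1) hj rfl)
  exact h.trans (add_units_smul_apply p _ _ _)

variable (k) in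
/-- The element `(-1)^q x ⊗ 1`. -/
def signEpsLeft (q : ℤ) : Lam k ⊗[k] Lam k := (-1 : k) ^ q • epsLeft k

lemma totTens_signEpsLeft_even {r : ℤ} (hr : Even r) (hj : p + q = j) (v : X.X p)
    (w : (resComplex k).X q) : totTens hj v (signEpsLeft k r • w) =
      totTens hj ((DualNumber.eps : Lam k) • v) w := by
  rw [signEpsLeft, hr.neg_one_zpow, one_smul k (epsLeft k)]
  exact totTens_epsLeft hj v w

lemma totTens_signEpsLeft_odd {r : ℤ} (hr : Odd r) (hj : p + q = j) (v : X.X p)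
    (w : (resComplex k).X q) : totTens hj v (signEpsLeft k r • w) =
      -totTens hj ((DualNumber.eps : Lam k) • v) w := by
  rw [signEpsLeft, hr.neg_one_zpow, neg_one_smul k (epsLeft k)]
  refine (congrArg (totTens hj v) (neg_smul (epsLeft k) w)).trans ?_
  exact (totTens_neg_right hj v _).trans (congrArg Neg.neg (totTens_epsLeft hj v w))

lemma resCoef_smul (q : ℤ) (w : (resComplex k).X p) :
    resCoef k q • w = -(epsRight k • w + signEpsLeft k q • w) :=
  (neg_smul (epsRight k + signEpsLeft k q) w).trans (congrArg Neg.neg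
    (add_smul (R := Lam k ⊗[k] Lam k) (M := (resComplex k).X p) (epsRight k) (signEpsLeft k q) w))

lemma totTens_d_resGen (hq : q + 1 = p) (hj : p' + p = j) (v : X.X p') :
    totTens hj v ((resComplex k).d q p (resGen q)) =
      -((DualNumber.eps : Lam k) • totTens hj v (resGen p) +
        totTens hj v (signEpsLeft k q • resGen p)) := by
  have h1 := freeComplex_d_freeGen (k := k) (A := Lam k) (ρ := resCoef k) resCoef_mul_resCoef hq
  refine (congrArg (totTens hj v) (h1.trans (resCoef_smul q _))).trans ?_
  refine (totTens_neg_right hj v _).trans (congrArg Neg.neg ?_)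
  exact (totTens_add_right hj v _ _).trans (congrArg (· + _) (totTens_epsRight hj v _))

/-- For p + q = 0 the sign (-1)^p of the total complex cancels the sign (-1)^q of x ⊗ 1. A sign
remains only in the term that is a multiple of x. -/
lemma negOnePow_totTens_d_resGen (hq : p + q = 0) (hj : p + (q + 1) = j) (v : X.X p) :
    p.negOnePow • totTens hj v ((resComplex k).d q (q + 1) (resGen q)) =
      -(p.negOnePow • (DualNumber.eps : Lam k) • totTens hj v (resGen (q + 1)) +
        totTens hj ((DualNumber.eps : Lam k) • v) (resGen (q + 1))) := by
  obtain rfl : q = -p := by omega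
  rw [totTens_d_resGen rfl]
  exact units_smul_neg_add _ _ _ (fun h => totTens_signEpsLeft_even h.neg hj v _)
    (fun h => totTens_signEpsLeft_odd h.neg hj v _)

end

variable (k m n p) in
/-- The unit in a term of an interval complex. -/
def intOne : (interval k m n).X p :=
  (⟨if m ≤ p ∧ p ≤ n then 1 else 0, by
    rw [intervalTerm]; split_ifs <;> simp⟩ : intervalTerm k m n p)

lemma intVal_intOne : intVal (intOne k m n p) = if m ≤ p ∧ p ≤ n then 1 else 0 := rfl

lemma intOne_d (hp : m ≤ p) : (interval k m n).d p (p + 1) (intOne k m n p) =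
    (DualNumber.eps : Lam k) • intOne k m n (p + 1) := by
  apply intVal_injective
  rw [intVal_d _ rfl, intVal_smul, intVal_intOne, intVal_intOne]
  split_ifs <;> first | omega | simp

lemma fst_hom_apply_eq {R : Type*} [Ring R] {S : Type*} [Add S] {M N N₁ N₂ : ModuleCat R}
    (e : N → S) (he : ∀ v w, e (v + w) = e v + e w) {f g : M ⟶ N} {d : M ⟶ N₁} {h : N₁ ⟶ N}
    {h' : M ⟶ N₂} {d' : N₂ ⟶ N} (hf : f = d ≫ h + h' ≫ d' + g) (z : M) :
    e (f z) = e (h (d z)) + e (d' (h' z)) + e (g z) := by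
  rw [hf, ← he, ← he]
  rfl

/-- A chain map of degree `l` of an interval complex with null-homotopic composite with
the augmentation has no leading coefficient. -/
lemma fst_eq_zero_of_homotopy (l : ℕ) (c : cocycles k 0 l 0 l l)
    (H : Homotopy (aug k (Lam k) (resAug k) (interval k 0 l) ≫ chainOf c) 0) :
    (c.1 0).fst = 0 := by
  -- The constant term of the homotopy on total degree 1. It is additive and vanishes on multiples
  -- of x.
  let Φ : (mapBifunctor (interval k 0 l) (resComplex k) (tensorBimod k (Lam k))
      (ComplexShape.up ℤ)).X (0 + 1) → k := fun z => (intVal (i := 0 + l) (H.hom (0 + 1) 0 z)).fst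
  have hadd : ∀ z w, Φ (z + w) = Φ z + Φ w := fun z w => by
    have h1 : H.hom (0 + 1) 0 (z + w) = H.hom (0 + 1) 0 z + H.hom (0 + 1) 0 w := map_add _ _ _
    simp only [Φ, h1]
    rfl
  have heps : ∀ z, Φ ((DualNumber.eps : Lam k) • z) = 0 := fun z => by
    have h1 : H.hom (0 + 1) 0 ((DualNumber.eps : Lam k) • z) =
      (DualNumber.eps : Lam k) • H.hom (0 + 1) 0 z := map_smul _ _ _
    simp only [Φ, h1]
    refine (congrArg TrivSqZeroExt.fst (intVal_smul (i := 0 + l) _ _)).trans ?_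
    simp
  have key : ∀ p : ℕ, ((c.1 0 * if (-p : ℤ) = 0 then intVal (intOne k 0 l p) else 0).fst) =
      Φ ((mapBifunctor (interval k 0 l) (resComplex k) (tensorBimod k (Lam k))
      (ComplexShape.up ℤ)).d 0 (0 + 1) (totTens (show (p : ℤ) + -p = 0 by omega) (intOne k 0 l p) (resGen (-p)))) := by
    intro p
    have h1 := H.comm 0
    rw [dNext_eq _ (show (ComplexShape.up ℤ).Rel 0 (0 + 1) from rfl),
      prevD_eq _ (show (ComplexShape.up ℤ).Rel (-1) 0 by simp)] at h1
    have h2 := fst_hom_apply_eq (fun z => (intVal (m := 0) (n := l) (i := 0 + l) z).fst)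
      (fun _ _ => rfl) h1 (totTens (show (p : ℤ) + -p = 0 by omega) (intOne k 0 l p)
        (resGen (-p)))
    -- The part of the homotopy followed by the differential is a multiple of x, so it does not
    -- affect constant terms.
    have h3 : ∀ x : (interval k 0 l).X (-1 + l), (intVal (m := 0) (n := l) (i := 0 + l)
        ((((interval k 0 l)⟦(l : ℤ)⟧).d (-1) 0) x)).fst = 0 := by
      intro x
      have h4 := intVal_units_smul_apply (l : ℤ) ((interval k 0 l).d (-1 + l) (0 + l)) x
      refine (congrArg TrivSqZeroExt.fst h4).trans ?_
      rw [intVal_d _ (by omega)]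
      split_ifs <;> simp
    have h5 : (intVal (m := 0) (n := l) (i := 0 + l) ((aug k (Lam k) (resAug k) (interval k 0 l) ≫
        chainOf c).f 0 (totTens (show (p : ℤ) + -p = 0 by omega) (intOne k 0 l p)
        (resGen (-p))))).fst = (c.1 0 * if (-p : ℤ) = 0 then intVal (intOne k 0 l p) else 0).fst := by
      refine (congrArg TrivSqZeroExt.fst ((intVal_ofCoef (j := 0 + (l : ℤ)) (c.1 0) _).trans
        ((if_pos (by omega)).trans ?_)))
      rw [← intVal_aug_totTens (m := 0) (n := l) (show (p : ℤ) + -p = 0 by omega)]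
      rfl
    refine h5.symm.trans (h2.trans ?_)
    refine (congrArg₂ (· + ·) (congrArg₂ (· + ·) rfl (h3 _)) rfl).trans ?_
    exact (add_zero _).trans (add_zero _)
  have h0 : Φ 0 = 0 := by
    have h1 := hadd 0 0
    rwa [add_zero, left_eq_add] at h1
  have hneg : ∀ z, Φ (-z) = -Φ z := fun z => by
    rw [eq_neg_iff_add_eq_zero, ← hadd, neg_add_cancel, h0]
  have hsign : ∀ (p : ℤ) z, Φ (p.negOnePow • (DualNumber.eps : Lam k) • z) = 0 := fun p z => by
    obtain hp | hp := Int.even_or_odd p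
    · rw [Int.negOnePow_even p hp, one_smul, heps]
    · rw [Int.negOnePow_odd p hp, Units.neg_smul, one_smul, hneg, heps, neg_zero]
  -- Modulo multiples of x, the differential of 1_p ⊗ e_{-p} consists of x·1_{p+1} ⊗ e_{-p} and
  -- -x·1_p ⊗ e_{1-p}. The augmentation is nonzero only for p = 0. So consecutive values of G differ
  -- by the leading coefficient of c at p = 0 and agree for p > 0.
  let G : ∀ (p q : ℤ) (_ : p + q = 0 + 1), k := fun p q h =>
    Φ (totTens h ((DualNumber.eps : Lam k) • intOne k 0 l p) (resGen q))
  have step : ∀ p : ℕ, ((c.1 0 * if (-p : ℤ) = 0 then intVal (intOne k 0 l p) else 0).fst) =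
      G (p + 1) (-p) (by omega) - G p (-p + 1) (by omega) := by
    intro p
    rw [key, totTens_d, hadd, negOnePow_totTens_d_resGen (by omega), hneg, hadd, hsign, zero_add (Φ _),
      intOne_d (by omega), ← sub_eq_add_neg]
  -- The zigzag starts with G = 0, because the resolution has no generator in degree 1. After the
  -- first step all values equal the leading coefficient.
  have claim : ∀ (p : ℕ) (q : ℤ) (h : (p : ℤ) + 1 + q = 0 + 1), G (p + 1) q h = (c.1 0).fst := by
    intro p
    induction p with
    | zero =>
      intro q h
      obtain rfl : q = -(0 : ℕ) := by push_cast at h ⊢; omega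
      have h1 := step 0
      have h2 : G ((0 : ℕ) : ℤ) (-((0 : ℕ) : ℤ) + 1) (by omega) = 0 := by
        have h3 : resGen (k := k) (-((0 : ℕ) : ℤ) + 1) = 0 := freeGen_eq_zero _ (by simp)
        exact (congrArg Φ ((congrArg (totTens _ _) h3).trans (totTens_zero_right _ _))).trans h0
      rw [h2, sub_zero] at h1
      rw [← h1, if_pos (by simp), intVal_intOne, if_pos (by simp), mul_one]
    | succ p ih =>
      intro q h
      obtain rfl : q = -((p + 1 : ℕ) : ℤ) := by push_cast at h ⊢; omega
      have h1 := step (p + 1)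
      rw [if_neg (by push_cast; omega), mul_zero, TrivSqZeroExt.fst_zero] at h1
      exact (sub_eq_zero.1 h1.symm).trans (ih _ _)
  rw [← claim l (-l) (by omega)]
  -- At the other end of the zigzag the interval [0,l] stops, so the common value is zero.
  have h3 : (DualNumber.eps : Lam k) • intOne k 0 l (l + 1) = 0 := by
    apply intVal_injective
    rw [intVal_smul, intVal_intOne, if_neg (by omega), mul_zero, intVal_zero]
  exact (congrArg Φ ((congrArg (fun v => totTens _ v _) h3).trans (totTens_zero_left _ _))).trans h0

end LeadingCoefficient

/-! ### Preimages under the characteristic homomorphism -/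

section Preimages

open DerivedCategory

variable {k : Type u} [Field k] {m n m' n' t : ℤ} {l : ℕ}

lemma chainOf_sub (c d : cocycles k m n m' n' t) : chainOf (c - d) = chainOf c - chainOf d := by
  rw [eq_sub_iff_add_eq]
  refine chain_ext fun i => ?_
  rw [coefAt_add, coefAt_chainOf, coefAt_chainOf, coefAt_chainOf]
  exact sub_add_cancel (c.1 i) (d.1 i)

/-- Two morphisms with homotopic composites differ by a morphism with null-homotopic composite. -/
def homotopyCompSub {C : Type*} [Category C] [Preadditive C] {K L M : CochainComplex C ℤ}
    (u : K ⟶ L) (f g : L ⟶ M) {w : K ⟶ M} (H : Homotopy (u ≫ f) w) (H' : Homotopy (u ≫ g) w) :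
    Homotopy (u ≫ (f - g)) 0 :=
  (Homotopy.ofEq (Preadditive.comp_sub u f g)).trans (Homotopy.equivSubZero (H.trans H'.symm))

/-- Any value and the explicit one solve the same equation, so by `fst_eq_zero_of_homotopy` they
have equal leading coefficients; that of the explicit value is the constant term of a. The interval
[0,l] is the shortest one from 0 on which a leading coefficient of degree l exists. -/
lemma fst_eq_zero_of_isCharValue {f : HH k (Lam k) l} {a : Lam k} (h : IsRep k f a)
    (φ : IvHom k 0 l 0 l l) (hφ : IsCharValue k (Lam k) f (intervalPerf k 0 l) φ)
    (h0 : scal φ 0 = 0) : a.fst = 0 := by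
  obtain ⟨ha, h⟩ := h
  obtain ⟨c, rfl⟩ := cls_surjective φ
  have h1 : CharEquation k (Lam k) (resAug k) (resTwist l a ha) (interval k 0 l) (cls c) :=
    (isCharValue_iff h (intervalPerf k 0 l) (cls c)).1 hφ
  obtain ⟨H⟩ := (charEquation_hoClass_iff k (Lam k) (resAug k) (resTwist l a ha)
    (interval k 0 l) (chainOf c)).1 h1
  obtain ⟨H'⟩ := (charEquation_hoClass_iff k (Lam k) (resAug k) (resTwist l a ha)
    (interval k 0 l) _).1 (charEquation_interval 0 l l ha)
  have h1 := fst_eq_zero_of_homotopy l (c - twistCocycle 0 l l ha) (by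
    rw [chainOf_sub]
    exact homotopyCompSub _ _ _ H H')
  rw [scal_cls] at h0
  have h2 : (c.1 0).fst - ((if (0 : ℤ) ≤ 0 ∧ 0 + (l : ℤ) ≤ l then (-1 : k) ^ (l : ℤ) • a else 0) :
    Lam k).fst = 0 := h1
  rw [h0, if_pos (by omega), TrivSqZeroExt.fst_smul, smul_eq_mul, ha, zero_sub, neg_eq_zero] at h2
  exact h2

variable (k l) in
/-- The classes in `HHˡ(Λ)` represented by multiples of `x`. -/
def hhNilpotent : Set (HH k (Lam k) l) := {f | ∃ a, IsRep k f a ∧ a.fst = 0}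

lemma charPreimage_center :
    charPreimage k (Lam k) (gradedCenter (perf (Lam k)) (l : ℤ)) = Set.univ := by
  refine Set.eq_univ_of_forall fun f => ?_
  obtain ⟨a, h⟩ := exists_isRep f
  obtain ⟨ha, _⟩ := id h
  obtain ⟨η, hη, h1, -⟩ := exists_charValue h ha
  exact ⟨η, hη, h1⟩

/-- In positive degree a family without constant terms is null-homotopic on every interval, so the
explicit value is zero. -/
lemma isCharValue_zero (hl : 0 < l) {f : HH k (Lam k) l} {a : Lam k} (h : IsRep k f a)
    (h0 : a.fst = 0) (X : PerfectComplex (Lam k)) : IsCharValue k (Lam k) f X 0 := by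
  obtain ⟨ha, h⟩ := h
  refine (isCharValue_iff h X _).2 (charEquation_of_intervals k _ _ (η := 0) (zero_mem _)
    (fun m n => ?_) X)
  have h2 : cls (twistCocycle m n l ha) = 0 :=
    cls_eq_zero_of_pos (by exact_mod_cast hl) _ fun i => by
      change (if m ≤ i ∧ i + l ≤ n then (-1 : k) ^ (l : ℤ) • a else 0).fst = 0
      split_ifs
      · rw [TrivSqZeroExt.fst_smul, h0, smul_zero]
      · rfl
  have h3 := charEquation_interval m n l ha
  rw [h2] at h3
  exact h3

lemma charPreimage_bot (hl : 0 < l) :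
    charPreimage k (Lam k) (⊥ : AddSubgroup (∀ X, ShiftedHom (perf (Lam k) X) (perf (Lam k) X)
      (l : ℤ))) = hhNilpotent k l := by
  ext f
  constructor
  · rintro ⟨η, hη, h⟩
    obtain rfl := AddSubgroup.mem_bot.1 hη
    obtain ⟨a, ha⟩ := exists_isRep f
    refine ⟨a, ha, fst_eq_zero_of_isCharValue ha 0 (h _) ?_⟩
    rw [← cls_zero, scal_cls]
    rfl
  · rintro ⟨a, ha, h0⟩
    exact ⟨0, zero_mem _, isCharValue_zero hl ha h0⟩

lemma charPreimage_tildeZ : charPreimage k (Lam k) (n := 0) (tildeZ k) = hhNilpotent k 0 := by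
  ext f
  constructor
  · rintro ⟨η, hη, h⟩
    obtain ⟨a, ha⟩ := exists_isRep f
    refine ⟨a, ha, fst_eq_zero_of_isCharValue ha _ (h (intervalPerf k 0 0)) ?_⟩
    obtain ⟨c, hc⟩ := hη.2 0 0 le_rfl
    refine (congrArg (fun φ => scal φ 0) hc).trans ?_
    rw [xClass_eq, scal_cls, ξ_apply]
    split_ifs <;> rfl
  · rintro ⟨a, h, h0⟩
    obtain ⟨ha, _⟩ := id h
    obtain ⟨η, hη, h1, h2⟩ := exists_charValue h ha
    refine ⟨η, ⟨hη, fun m n _ => exists_eq_xClass _ ?_⟩, h1⟩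
    refine (congrArg (fun φ => scal φ m) (h2 m n)).trans ?_
    rw [scal_cls]
    change (if m ≤ m ∧ m + ((0 : ℕ) : ℤ) ≤ n then (-1 : k) ^ ((0 : ℕ) : ℤ) • a else 0).fst = 0
    split_ifs
    · rw [TrivSqZeroExt.fst_smul, h0, smul_zero]
    · rfl

lemma hhNilpotent_of_odd (h2 : (2 : k) ≠ 0) (hl : Odd l) : hhNilpotent k l = Set.univ := by
  refine Set.eq_univ_of_forall fun f => ?_
  obtain ⟨a, h⟩ := exists_isRep f
  refine ⟨a, h, ?_⟩
  obtain ⟨ha, _⟩ := h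
  rw [zpow_natCast, hl.neg_one_pow] at ha
  have h3 : (2 : k) * a.fst = 0 := by linear_combination -ha
  exact (mul_eq_zero.1 h3).resolve_left h2

lemma hhNilpotent_of_even (h2 : (2 : k) ≠ 0) (hl : 0 < l) (hl' : Even l) :
    hhNilpotent k l = {0} := by
  ext f
  refine ⟨fun ⟨a, h, h0⟩ => eq_zero_of_isRep h2 hl hl' h h0, ?_⟩
  rintro rfl
  obtain ⟨f, hf⟩ := exists_isRep' (k := k) (l := l) (a := 0) (by simp)
  have h3 := eq_zero_of_isRep h2 hl hl' hf rfl
  exact ⟨0, h3 ▸ hf, rfl⟩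

lemma eq_snd_smul_eps {a : Lam k} (h : a.fst = 0) : a = a.snd • DualNumber.eps := by
  ext <;> simp [h]

lemma hhNilpotent_zero : hhNilpotent k 0 = hhLineX k := by
  ext f
  constructor
  · rintro ⟨a, h, h0⟩
    refine ⟨a.snd, h.unique ?_⟩
    rw [← eq_snd_smul_eps h0]
    exact isRep_hhZero a
  · rintro ⟨c, rfl⟩
    exact ⟨_, isRep_hhZero _, by simp⟩

lemma hhNilpotent_of_char_two (h2 : (2 : k) = 0) : hhNilpotent k l = hhLineXMul k l := by
  ext f
  constructor
  · rintro ⟨a, h, h0⟩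
    -- In characteristic 2 every element of Λ is a cocycle, so the coefficient of x in a itself
    -- represents a class g, and a = x · a.snd.
    obtain ⟨g, hg⟩ := exists_isRep' (k := k) (l := l) (a := TrivSqZeroExt.inl a.snd) (by
      have : (-1 : k) = 1 := by linear_combination -h2
      rw [this, one_zpow, one_mul])
    refine ⟨g, h.unique ?_⟩
    have h3 := isRep_hhMul hg DualNumber.eps
    have h4 : (DualNumber.eps : Lam k) * TrivSqZeroExt.inl a.snd = a := by
      ext <;> simp [h0]
    rwa [h4] at h3
  · rintro ⟨b, rfl⟩
    obtain ⟨a, h⟩ := exists_isRep b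
    exact ⟨_, isRep_hhMul h _, by simp⟩

/-- Multiplication by c is the action of c ⊗ 1 on the identity. Since composition in the derived
category is linear over the enveloping algebra, such classes are central. -/
lemma hhZero_eq (c : Lam k) : hhZero k (Lam k) c = ShiftedHom.mk₀ _ (by simp)
    (inLeft k (Lam k) c • 𝟙 (Q.obj (regComplex k (Lam k)))) := by
  have h : mulReg k (Lam k) c = inLeft k (Lam k) c • 𝟙 (regBimod k (Lam k)) := by
    refine ModuleCat.hom_ext (LinearMap.ext fun b => ?_)
    refine congrArg (fun e : Lam k => e * (show Lam k from b)) ?_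
    exact (RingHom.congr_fun (mulHom_inLeft k (Lam k)) c).symm
  have h' : (HomologicalComplex.single _ (ComplexShape.up ℤ) 0).map (mulReg k (Lam k) c) =
      inLeft k (Lam k) c • 𝟙 (regComplex k (Lam k)) := by
    apply HomologicalComplex.to_single_hom_ext
    rw [h, HomologicalComplex.single_map_f_self]
    simp
  rw [hhZero, h', Functor.map_smul, CategoryTheory.Functor.map_id]

lemma hhMul_hhZero (c : Lam k) (f : HH k (Lam k) l) :
    hhMul k (Lam k) (add_zero l) f (hhZero k (Lam k) c) =
      hhMul k (Lam k) (zero_add l) (hhZero k (Lam k) c) f := by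
  rw [hhMul, hhMul, hhZero_eq]
  refine (ShiftedHom.mk₀_comp _ _ _ f).trans (Eq.trans ?_ (ShiftedHom.comp_mk₀ f _ _ _).symm)
  rw [Functor.map_smul, CategoryTheory.Functor.map_id, Linear.smul_comp, Linear.comp_smul, Category.id_comp]
  exact congrArg _ (Category.comp_id _).symm

lemma hhMul_assoc {A : Type u} [CommRing A] [Algebra k A] {l₁ l₂ l₃ l₁₂ l₂₃ l : ℕ}
    (f₁ : HH k A l₁) (f₂ : HH k A l₂) (f₃ : HH k A l₃)
    (h₁₂ : l₁ + l₂ = l₁₂) (h₂₃ : l₂ + l₃ = l₂₃) (h : l₁₂ + l₃ = l) (h' : l₁ + l₂₃ = l) :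
    hhMul k A h (hhMul k A h₁₂ f₁ f₂) f₃ = hhMul k A h' f₁ (hhMul k A h₂₃ f₂ f₃) :=
  (ShiftedHom.comp_assoc _ _ _ _ _ (by subst h h₁₂; push_cast; ring)).symm

/-- The multiples of `x` in Hochschild cohomology. -/
def hhMultiples (l : ℕ) : AddSubgroup (HH k (Lam k) l) :=
  AddMonoidHom.range (AddMonoidHom.mk'
    (fun b : HH k (Lam k) l => hhMul k (Lam k) (zero_add l) (hhZero k (Lam k) DualNumber.eps) b)
    (fun _ _ => ShiftedHom.add_comp _ _ _ _))

lemma hhMultiples_isHHIdeal : IsHHIdeal k (Lam k) hhMultiples where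
  mul_left := by
    rintro l m n h a - ⟨b, rfl⟩
    refine ⟨hhMul k (Lam k) h a b, ?_⟩
    change hhMul k (Lam k) (zero_add n) _ (hhMul k (Lam k) h a b) =
      hhMul k (Lam k) h a (hhMul k (Lam k) (zero_add m) _ b)
    rw [← hhMul_assoc _ _ _ (zero_add l) h h, ← hhMul_assoc _ _ _ (add_zero l) _ h, hhMul_hhZero]
  mul_right := by
    rintro l m n h - b ⟨a, rfl⟩
    exact ⟨hhMul k (Lam k) h a b,
      (hhMul_assoc (hhZero k (Lam k) DualNumber.eps) a b (zero_add l) h h (zero_add n)).symm⟩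

/-- As x is central, its multiples already form a two-sided ideal. -/
lemma hhSpan_eps : hhSpan k (Lam k) (hhZero k (Lam k) DualNumber.eps) l = hhLineXMul k l := by
  ext f
  constructor
  · intro hf
    obtain ⟨b, hb⟩ := hf hhMultiples hhMultiples_isHHIdeal ⟨hhZero k (Lam k) 1, by
      have h := (isRep_hhMul (isRep_hhZero (1 : Lam k)) DualNumber.eps)
      rw [mul_one] at h
      exact h.unique (isRep_hhZero _)⟩
    exact ⟨b, hb.symm⟩
  · rintro ⟨b, rfl⟩ I hI hx
    exact hI.mul_right _ _ _ hx

end Preimages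

/-! ### The ideals in Hochschild cohomology. -/

section HochschildIdeals

variable {k : Type u} [Field k] (p : ℕ) [Fact p.Prime] [CharP k p]

/-- The zero family is a value of χ at every such class and lies in every subgroup. So in odd
degrees, with 2 invertible, no knowledge of the ideal is needed. -/
lemma charPreimage_eq_univ {l : ℕ} (h : hhNilpotent k l = Set.univ) (hl : 0 < l)
    (I : AddSubgroup (∀ X, ShiftedHom (perf (Lam k) X) (perf (Lam k) X) (l : ℤ))) :
    charPreimage k (Lam k) I = Set.univ := by
  refine Set.eq_univ_of_forall fun f => ?_
  obtain ⟨a, ha, h0⟩ : f ∈ hhNilpotent k l := h ▸ Set.mem_univ f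
  exact ⟨0, zero_mem _, isCharValue_zero hl ha h0⟩

/-- The ideals `HK_{r,s}` of the dual numbers in characteristic different from `2`. -/
theorem HK_of_char_ne_two (hp : p ≠ 2) (r : ℕ) (hr : 0 < r) (s : ℤ) :
    (s ≤ 0 → Even s →
      HK k (Lam k) p r s 0 = hhLineX k ∧
      (∀ l : ℕ, Odd l → HK k (Lam k) p r s l = Set.univ) ∧
      (∀ l : ℕ, 0 < l → Even l → HK k (Lam k) p r s l = {0})) ∧
    ((s ≤ 0 ∧ Odd s) ∨ 0 < s → ∀ l : ℕ, HK k (Lam k) p r s l = Set.univ) := by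
  have h2 := two_ne_zero_of_char (k := k) p hp
  obtain ⟨-, h₁, h₂, h₃, h₄⟩ := kulshammer_of_char_ne_two (k := k) p hp r hr s
  have hodd : ∀ l : ℕ, Odd l → HK k (Lam k) p r s l = Set.univ := fun l hl =>
    charPreimage_eq_univ (hhNilpotent_of_odd h2 hl) hl.pos _
  refine ⟨fun hs he => ⟨?_, hodd, fun l hl hl' => ?_⟩, fun hs l => ?_⟩
  · refine (congrArg (charPreimage k (Lam k) (n := 0)) (h₃ hs he)).trans ?_
    rw [charPreimage_tildeZ, hhNilpotent_zero]
  · have h := h₄ hs l (by exact_mod_cast hl) (he.sub ((Int.even_coe_nat l).2 hl'))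
    rw [HK, h, charPreimage_bot hl, hhNilpotent_of_even h2 hl hl']
  · obtain ⟨hs, ho⟩ | hs := hs
    · obtain hl | hl := Nat.even_or_odd l
      · rw [HK, h₂ hs l (by omega) (ho.sub_even ((Int.even_coe_nat l).2 hl)), charPreimage_center]
      · exact hodd l hl
    · rw [HK, h₁ hs l (by omega), charPreimage_center]

/-- The ideals `HK_{r,s}` of the dual numbers in characteristic `2`. -/
theorem HK_of_char_eq_two (hp : p = 2) (r : ℕ) (hr : 0 < r) (s : ℤ) (l : ℕ) :
    (s ≤ 0 → HK k (Lam k) p r s l = hhLineXMul k l) ∧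
    (0 < s → HK k (Lam k) p r s l = Set.univ) := by
  have h2 : (2 : k) = 0 := by
    subst hp
    exact_mod_cast CharP.cast_eq_zero k 2
  obtain ⟨-, h₁, h₂, h₃⟩ := kulshammer_of_char_eq_two (k := k) p hp r hr s
  refine ⟨fun hs => ?_, fun hs => ?_⟩
  · rw [← hhNilpotent_of_char_two h2]
    obtain rfl | hl := Nat.eq_zero_or_pos l
    · exact (congrArg (charPreimage k (Lam k) (n := 0)) (h₂ hs)).trans charPreimage_tildeZ
    · rw [HK, h₃ hs l (by exact_mod_cast hl), charPreimage_bot hl]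
  · rw [HK, h₁ hs l (by omega), charPreimage_center]

lemma HKInf_zero (r : ℕ) (hr : 0 < r) : HKInf k (Lam k) p r 0 = hhNilpotent k 0 :=
  (congrArg (charPreimage k (Lam k) (n := 0)) (kulshammer_inf p r hr).1).trans charPreimage_tildeZ

lemma HKInf_of_pos (r : ℕ) (hr : 0 < r) {l : ℕ} (hl : 0 < l) :
    HKInf k (Lam k) p r l = hhNilpotent k l := by
  rw [HKInf, (kulshammer_inf p r hr).2.1 l (by omega), charPreimage_bot hl]

lemma HKInf_eq (r : ℕ) (hr : 0 < r) (l : ℕ) : HKInf k (Lam k) p r l = hhNilpotent k l := by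
  obtain rfl | hl := Nat.eq_zero_or_pos l
  · exact HKInf_zero p r hr
  · exact HKInf_of_pos p r hr hl

end HochschildIdeals

end KulshammerIdeals

end

open KulshammerIdeals

theorem mainTheorem12 (k : Type u) [Field k] (p : ℕ) [Fact p.Prime] [CharP k p] :
    -- the ideals `K_{r,s}(K^b_p Λ/[1])`, `r > 0`, for `char k ≠ 2`
    (p ≠ 2 → ∀ r : ℕ, 0 < r → ∀ s : ℤ,
      (∀ t : ℤ, t < 0 → kulshammer (perf (Lam k)) p r s t = ⊥) ∧
      (0 < s → ∀ t : ℤ, 0 ≤ t →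
        kulshammer (perf (Lam k)) p r s t = gradedCenter (perf (Lam k)) t) ∧
      (s ≤ 0 → ∀ t : ℤ, 0 ≤ t → Odd (s - t) →
        kulshammer (perf (Lam k)) p r s t = gradedCenter (perf (Lam k)) t) ∧
      (s ≤ 0 → Even s → kulshammer (perf (Lam k)) p r s 0 = tildeZ k) ∧
      (s ≤ 0 → ∀ t : ℤ, 0 < t → Even (s - t) → kulshammer (perf (Lam k)) p r s t = ⊥)) ∧
    -- the ideals `K_{r,s}(K^b_p Λ/[1])`, `r > 0`, for `char k = 2`
    (p = 2 → ∀ r : ℕ, 0 < r → ∀ s : ℤ,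
      (∀ t : ℤ, t < 0 → kulshammer (perf (Lam k)) p r s t = ⊥) ∧
      (0 < s → ∀ t : ℤ, 0 ≤ t →
        kulshammer (perf (Lam k)) p r s t = gradedCenter (perf (Lam k)) t) ∧
      (s ≤ 0 → kulshammer (perf (Lam k)) p r s 0 = tildeZ k) ∧
      (s ≤ 0 → ∀ t : ℤ, 0 < t → kulshammer (perf (Lam k)) p r s t = ⊥)) ∧
    -- `R = K_r = Z̃⁰` and `R_s = K_{r,s}` for `r > 0`
    (∀ r : ℕ, 0 < r →
      kulshammerInf (perf (Lam k)) p r 0 = tildeZ k ∧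
      (∀ t : ℤ, t ≠ 0 → kulshammerInf (perf (Lam k)) p r t = ⊥) ∧
      (∀ t : ℤ, reynoldsInf (perf (Lam k)) p t = kulshammerInf (perf (Lam k)) p r t) ∧
      (∀ s t : ℤ, reynolds (perf (Lam k)) p s t = kulshammer (perf (Lam k)) p r s t)) ∧
    -- the ideals in the Hochschild cohomology, `r > 0`, for `char k ≠ 2`
    (p ≠ 2 → ∀ r : ℕ, 0 < r →
      (∀ s : ℤ, s ≤ 0 → Even s →
        HK k (Lam k) p r s 0 = hhLineX k ∧
        (∀ l : ℕ, Odd l → HK k (Lam k) p r s l = Set.univ) ∧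
        (∀ l : ℕ, 0 < l → Even l → HK k (Lam k) p r s l = {0})) ∧
      (∀ s : ℤ, (s ≤ 0 ∧ Odd s) ∨ 0 < s → ∀ l : ℕ, HK k (Lam k) p r s l = Set.univ) ∧
      HKInf k (Lam k) p r 0 = hhLineX k ∧
      (∀ l : ℕ, Odd l → HKInf k (Lam k) p r l = Set.univ) ∧
      (∀ l : ℕ, 0 < l → Even l → HKInf k (Lam k) p r l = {0})) ∧
    -- the ideals in the Hochschild cohomology, `r > 0`, for `char k = 2`
    (p = 2 → ∀ r : ℕ, 0 < r →
      (∀ s : ℤ, s ≤ 0 → ∀ l : ℕ,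
        HK k (Lam k) p r s l = hhSpan k (Lam k) (hhZero k (Lam k) DualNumber.eps) l ∧
        HK k (Lam k) p r s l = hhLineXMul k l) ∧
      (∀ s : ℤ, 0 < s → ∀ l : ℕ, HK k (Lam k) p r s l = Set.univ) ∧
      (∀ l : ℕ,
        HKInf k (Lam k) p r l = hhSpan k (Lam k) (hhZero k (Lam k) DualNumber.eps) l ∧
        HKInf k (Lam k) p r l = hhLineXMul k l)) ∧
    -- the higher Reynolds ideals: `HR = HK_r` and `HR_s = HK_{r,s}` for `r > 0`
    (∀ r : ℕ, 0 < r → ∀ l : ℕ,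
      HRInf k (Lam k) p l = HKInf k (Lam k) p r l ∧
      (∀ s : ℤ, HR k (Lam k) p s l = HK k (Lam k) p r s l)) := by
  have h2 : p ≠ 2 → (2 : k) ≠ 0 := two_ne_zero_of_char p
  have h2' : p = 2 → (2 : k) = 0 := by
    rintro rfl
    exact_mod_cast CharP.cast_eq_zero k 2
  refine ⟨fun hp r hr s => kulshammer_of_char_ne_two p hp r hr s,
    fun hp r hr s => kulshammer_of_char_eq_two p hp r hr s, fun r hr => kulshammer_inf p r hr,
    fun hp r hr => ⟨fun s => (HK_of_char_ne_two p hp r hr s).1,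
      fun s => (HK_of_char_ne_two p hp r hr s).2, ?_, fun l hl => ?_, fun l hl hl' => ?_⟩,
    fun hp r hr => ⟨fun s hs l => ?_, fun s hs l => (HK_of_char_eq_two p hp r hr s l).2 hs,
      fun l => ?_⟩, fun r hr l => ⟨?_, fun s => ?_⟩⟩
  · rw [HKInf_eq p r hr, hhNilpotent_zero]
  · rw [HKInf_eq p r hr, hhNilpotent_of_odd (h2 hp) hl]
  · rw [HKInf_eq p r hr, hhNilpotent_of_even (h2 hp) hl hl']
  · rw [hhSpan_eps]
    exact ⟨(HK_of_char_eq_two p hp r hr s l).1 hs, (HK_of_char_eq_two p hp r hr s l).1 hs⟩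
  · rw [hhSpan_eps, HKInf_eq p r hr, hhNilpotent_of_char_two (h2' hp)]
    exact ⟨rfl, rfl⟩
  · rw [HRInf, (kulshammer_inf p r hr).2.2.1 l, HKInf]
  · rw [HR, (kulshammer_inf p r hr).2.2.2 s l, HK]
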